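/- **Setting.** Let $M$ be a smooth 4-manifold with a smooth para-Kähler–Einstein (pKE) structure $(g,K)$: $g$ is a pseudo-Riemannian metric of signature $(2,2)$, $K$ is an endomorphism field of $TM$ with $K^2=\mathrm{id}$ and $g(KX,KY)=-g(X,Y)$, both eigendistributions of $K$ (of rank 2) are integrable, the 2-form $\rho(X,Y)=g(KX,Y)$ is closed, and the trace-free Ricci tensor of $g$ vanishes. Assume that the scalar curvature $R$ is non-zero. A local coframe $(\theta^1,\dots,\theta^4)$ with dual frame $(\partial_{\theta^1},\dots,\partial_{\theta^4})$ is *adapted* if $g=2\theta^1\theta^3+2\theta^2\theta^4$ and $K=\theta^1\otimes\partial_{\theta^1}+\theta^2\otimes\partial_{\theta^2}-\theta^3\otimes\partial_{\theta^3}-\theta^4\otimes\partial_{\theta^4}$. Let $C_{abcd}$ be the components of the Weyl tensor in an adapted coframe. The anti-self-dual Weyl tensor is represented by the quartic $$W(\lambda)=C(X,Y,X,Y)=\Psi_4\lambda^4+4\Psi_3\lambda^3+6\Psi_2\lambda^2+4\Psi_1\lambda+\Psi_0,\qquad X=\partial_{\theta^1}+\lambda\partial_{\theta^2},\quad Y=\partial_{\theta^4}-\lambda\partial_{\theta^3},$$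 where $\Psi_0=C_{1414}$, $\Psi_1=C_{2414}$, $\Psi_2=-C_{1423}$, $\Psi_3=C_{1323}$, $\Psi_4=C_{2323}$; put $\Psi_2'=C_{1234}$. Assume that it has real Petrov type $D$ at every point, i.e. $W$ has two distinct real double roots in $\mathbb R\cup\{\infty\}$. Call an adapted coframe *reduced* if $\Psi_0=\Psi_1=\Psi_3=\Psi_4=0$ and $\Psi_2\ne0$. Let $\Gamma^a{}_b$ be the Levi-Civita connection forms of a coframe ($d\theta^a=-\Gamma^a{}_b\wedge\theta^b$). **Theorem.** (a) Smooth reduced coframes exist near every point, and in each of them $$\Gamma^1{}_2=-J_3\theta^1+J_4\theta^4,\qquad \Gamma^2{}_1=J_1\theta^2+J_2\theta^3$$ for functions $J_1,\dots,J_4$. For two reduced coframes on the same open set, at each point the pairs $(J_2,J_4)$ agree up to non-zero factors and up to order. (b) Say that $p\in M$ belongs to the first, second, third or fourth branch if there is a reduced coframe on a neighbourhood of $p$ with, respectively, $J_2$ and $J_4$ nowhere zero; $J_2$ nowhere zero and $J_4=0$; $J_2=0$ and $J_4$ nowhere zero; $J_2=J_4=0$ on that neighbourhood. The points that belong to one of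 the four branches form a dense open subset of $M$. (c) Each point of a branch has a neighbourhood with coordinates $(y^1,\dots,y^4)$ in which one of the following is a reduced coframe of $(g,K)$. The letters $k_i$ and $\Psi_2'$ denote real constants, $\Psi_2'\neq 0$ is the component $C_{1234}$, and $R=-12\Psi_2'$. *First branch* (five parameters $k_1,\dots,k_4,\Psi_2'$, with $k_4\ne0$; $y^4\neq0$; normalized by $J_2=J_4=1$): $$\begin{aligned}\theta^1&=(y^4)^2(1-y^3)\,dy^1-y^4\,dy^2,\qquad \theta^2=(y^4)^2dy^1-\theta^1,\\ \theta^3&=\Big(-\Psi_2'(y^3)^3+\tfrac{k_1(y^3)^2}{y^4}-\tfrac{k_2y^3}{(y^4)^2}-\tfrac{k_3+\frac12k_4}{(y^4)^3}\Big)\theta^1-dy^3-\tfrac{y^3}{y^4}dy^4,\\ \theta^4&=\Big(\Psi_2'(y^3-1)^3-\tfrac{k_1(y^3-1)^2}{y^4}+\tfrac{k_2(y^3-1)}{(y^4)^2}+\tfrac{k_3}{(y^4)^3}\Big)\theta^2+dy^3+\tfrac{y^3-1}{y^4}dy^4.\end{aligned}$$ *Second branch* (three parameters $k_1,k_2,\Psi_2'$,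 with $k_1\ne0$; $y^4\ne0$; $J_2=1$, $J_4=0$): with $f=k_1(y^4)^3+2k_2y^4+2\Psi_2'$, $$\theta^1=k_2(y^1)^2y^4dy^3+\tfrac{y^1}{y^4}dy^4+dy^1,\quad \theta^2=y^1dy^3+\tfrac1{y^4}dy^2,\quad \theta^3=dy^3,\quad \theta^4=-\tfrac{f}{2y^4}dy^2-\tfrac{f}{2}y^1dy^3+\tfrac1{y^4}dy^4 .$$ *Third branch* ($J_2=0$, $J_4=1$): the coframe of the second branch after switching $\theta^1\leftrightarrow\theta^2$ and $\theta^3\leftrightarrow\theta^4$. *Fourth branch* (one parameter $\Psi_2'$; $J_2=J_4=0$; on the domain where the denominators do not vanish): $$\theta^1=\tfrac{dy^1}{1-\frac32\Psi_2'y^1y^3},\quad \theta^2=\tfrac{dy^2}{1-\frac32\Psi_2'y^2y^4},\quad \theta^3=\tfrac{dy^3}{1-\frac32\Psi_2'y^1y^3},\quad \theta^4=\tfrac{dy^4}{1-\frac32\Psi_2'y^2y^4}.$$ Conversely, for all values of the constants with $\Psi_2'\ne0$ (and $k_4\ne0$ in the first, $k_1\neq0$ in the second and third family), on the whole indicated domain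 of $\mathbb R^4$ each of these coframes is a reduced coframe of a pKE structure of real Petrov type $D$ with $R=-12\Psi_2'$, with $C_{1234}=\Psi_2'$, and with $J_2,J_4$ as indicated. (d) The fourth branch consists of the only homogeneous metrics: if $M$ is connected and all its points belong to the fourth branch, then for all $p,q\in M$ some diffeomorphism between neighbourhoods of $p$ and $q$ that preserves $g$ and $K$ maps $p$ to $q$; and if for all $p,q\in M$ some local isometry of $g$ maps $p$ to $q$, then all points of $M$ belong to the fourth branch. -/

import Mathlib

open scoped Manifold ContDiff

noncomputable section

namespace ParaKaehler

universe u

/-! ### Tensor calculus in coordinates on open subsets of `ℝ⁴` -/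

/-- The coordinate space `ℝ⁴`. -/
abbrev E4 : Type := EuclideanSpace ℝ (Fin 4)

/-- Fields of bilinear forms (covariant 2-tensors) on `ℝ⁴`. -/
abbrev BilinField : Type := E4 → E4 →L[ℝ] E4 →L[ℝ] ℝ

/-- Fields of endomorphisms of the tangent bundle of `ℝ⁴`. -/
abbrev EndoField : Type := E4 → E4 →L[ℝ] E4

/-- Quadruples of 1-forms on `ℝ⁴`; the indices `0, 1, 2, 3` stand for `1, 2, 3, 4`. -/
abbrev FormQuad : Type := E4 → Fin 4 → E4 →L[ℝ] ℝ

/-- The coordinate vector field `∂_i`. -/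
def bvec (i : Fin 4) : E4 := EuclideanSpace.single i (1 : ℝ)

/-- The coordinate differential `d y^i`. -/
def dy (i : Fin 4) : E4 →L[ℝ] ℝ := EuclideanSpace.proj i

/-- The partial derivative `∂_i f`. -/
def pd (i : Fin 4) (f : E4 → ℝ) (x : E4) : ℝ := fderiv ℝ f x (bvec i)

/-- The components `g_{ij}`. -/
def gram (g : BilinField) (x : E4) : Matrix (Fin 4) (Fin 4) ℝ :=
  Matrix.of fun i j => g x (bvec i) (bvec j)

/-- The Christoffel symbols `Γ^k_{ij}` of the Levi-Civita connection. -/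
def christoffel (g : BilinField) (k i j : Fin 4) (x : E4) : ℝ :=
  (1 / 2) * ∑ l, (gram g x)⁻¹ k l *
    (pd i (fun z => gram g z j l) x + pd j (fun z => gram g z i l) x
      - pd l (fun z => gram g z i j) x)

/-- The Riemann tensor `R^a_{bcd}`. -/
def riemannUp (g : BilinField) (a b c d : Fin 4) (x : E4) : ℝ :=
  pd c (christoffel g a d b) x - pd d (christoffel g a c b) x
    + ∑ m, (christoffel g a c m x * christoffel g m d b x
      - christoffel g a d m x * christoffel g m c b x)

/-- `R_{abcd} = g_{ae} R^e_{bcd}`. -/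
def riemannLow (g : BilinField) (a b c d : Fin 4) (x : E4) : ℝ :=
  ∑ e, gram g x a e * riemannUp g e b c d x

/-- The Ricci tensor `R_{ab} = R^c_{acb}`. -/
def ricci (g : BilinField) (a b : Fin 4) (x : E4) : ℝ := ∑ c, riemannUp g c a c b x

/-- The scalar curvature `R = g^{ab} R_{ab}`. -/
def scalarCurv (g : BilinField) (x : E4) : ℝ := ∑ a, ∑ b, (gram g x)⁻¹ a b * ricci g a b x

/-- The Schouten tensor `P_{ab} = R_{ab} / 2 - R g_{ab} / 12`. -/
def schouten (g : BilinField) (a b : Fin 4) (x : E4) : ℝ :=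
  (1 / 2) * ricci g a b x - (1 / 12) * scalarCurv g x * gram g x a b

/-- The Weyl tensor `C_{abcd}`. -/
def weyl (g : BilinField) (a b c d : Fin 4) (x : E4) : ℝ :=
  riemannLow g a b c d x
    + gram g x a d * schouten g c b x - gram g x a c * schouten g d b x
    + gram g x b c * schouten g d a x - gram g x b d * schouten g c a x

/-- The Weyl tensor evaluated on four tangent vectors at `x`. -/
def weylEval (g : BilinField) (x X Y Z W : E4) : ℝ :=
  ∑ a, ∑ b, ∑ c, ∑ d, weyl g a b c d x * X a * Y b * Z c * W d

/-! ### Coframes -/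

/-- The vector `∂/∂θ^b` of the basis dual to a basis `θ` of the cotangent space. -/
def dualVec (θ : Fin 4 → E4 →L[ℝ] ℝ) (b : Fin 4) : E4 :=
  ∑ i, (Matrix.of fun a j => θ a (bvec j))⁻¹ i b • bvec i

/-- The Levi-Civita connection 1-form `Γ^a_b` of the coframe `θ`,
`Γ^a_b (X) = θ^a (∇_X ∂/∂θ^b)`; equivalently `dθ^a + Γ^a_b ∧ θ^b = 0` with `Γ` metric. -/
def connForm (g : BilinField) (θ : FormQuad) (a b : Fin 4) (x X : E4) : ℝ :=
  θ x a (fderiv ℝ (fun z => dualVec (θ z) b) x X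
    + ∑ k, (∑ i, ∑ j, christoffel g k i j x * X i * dualVec (θ x) b j) • bvec k)

/-- `θ` is a coframe at a point at which `(g, K)` takes the values `G` and `k`, and it is adapted:
`g = 2 θ¹ θ³ + 2 θ² θ⁴` and `K = θ¹ ⊗ ∂_{θ¹} + θ² ⊗ ∂_{θ²} - θ³ ⊗ ∂_{θ³} - θ⁴ ⊗ ∂_{θ⁴}`. -/
structure IsAdapted (G : E4 →L[ℝ] E4 →L[ℝ] ℝ) (k : E4 →L[ℝ] E4)
    (θ : Fin 4 → E4 →L[ℝ] ℝ) : Prop where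
  indep : LinearIndependent ℝ θ
  metric : ∀ v w, G v w = θ 0 v * θ 2 w + θ 2 v * θ 0 w + θ 1 v * θ 3 w + θ 3 v * θ 1 w
  endo₀ : ∀ v, θ 0 (k v) = θ 0 v
  endo₁ : ∀ v, θ 1 (k v) = θ 1 v
  endo₂ : ∀ v, θ 2 (k v) = - θ 2 v
  endo₃ : ∀ v, θ 3 (k v) = - θ 3 v

/-- The quartic representing the anti-self-dual Weyl tensor (in homogeneous form, `λ = ξ₁ / ξ₀`):
the Weyl tensor on the anti-self-dual null planes spanned by
`ξ₀ ∂_{θ¹} + ξ₁ ∂_{θ²}` and `ξ₀ ∂_{θ⁴} - ξ₁ ∂_{θ³}`. -/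
def asdQuartic (g : BilinField) (θ : Fin 4 → E4 →L[ℝ] ℝ) (x : E4) (ξ₀ ξ₁ : ℝ) : ℝ :=
  weylEval g x
    (ξ₀ • dualVec θ 0 + ξ₁ • dualVec θ 1) (ξ₀ • dualVec θ 3 - ξ₁ • dualVec θ 2)
    (ξ₀ • dualVec θ 0 + ξ₁ • dualVec θ 1) (ξ₀ • dualVec θ 3 - ξ₁ • dualVec θ 2)

/-- A component of the Weyl tensor in the basis dual to `θ`. -/
def weylComp (g : BilinField) (θ : Fin 4 → E4 →L[ℝ] ℝ) (x : E4) (a b c d : Fin 4) : ℝ :=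
  weylEval g x (dualVec θ a) (dualVec θ b) (dualVec θ c) (dualVec θ d)

/-- `Ψ₀ = C_{1414}`. -/
def psi0 (g : BilinField) (θ : FormQuad) (x : E4) : ℝ := weylComp g (θ x) x 0 3 0 3
/-- `Ψ₁ = C_{2414}`. -/
def psi1 (g : BilinField) (θ : FormQuad) (x : E4) : ℝ := weylComp g (θ x) x 1 3 0 3
/-- `Ψ₂ = - C_{1423}`. -/
def psi2 (g : BilinField) (θ : FormQuad) (x : E4) : ℝ := - weylComp g (θ x) x 0 3 1 2
/-- `Ψ₃ = C_{1323}`. -/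
def psi3 (g : BilinField) (θ : FormQuad) (x : E4) : ℝ := weylComp g (θ x) x 0 2 1 2
/-- `Ψ₄ = C_{2323}`. -/
def psi4 (g : BilinField) (θ : FormQuad) (x : E4) : ℝ := weylComp g (θ x) x 1 2 1 2
/-- The component `Ψ₂' = C_{1234}` of the self-dual Weyl tensor. -/
def psi2' (g : BilinField) (θ : FormQuad) (x : E4) : ℝ := weylComp g (θ x) x 0 1 2 3

/-- `J₁`, the coefficient of `θ²` in `Γ²₁`. -/
def J1 (g : BilinField) (θ : FormQuad) (x : E4) : ℝ := connForm g θ 1 0 x (dualVec (θ x) 1)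
/-- `J₂`, the coefficient of `θ³` in `Γ²₁`. -/
def J2 (g : BilinField) (θ : FormQuad) (x : E4) : ℝ := connForm g θ 1 0 x (dualVec (θ x) 2)
/-- `J₃`, minus the coefficient of `θ¹` in `Γ¹₂`. -/
def J3 (g : BilinField) (θ : FormQuad) (x : E4) : ℝ := - connForm g θ 0 1 x (dualVec (θ x) 0)
/-- `J₄`, the coefficient of `θ⁴` in `Γ¹₂`. -/
def J4 (g : BilinField) (θ : FormQuad) (x : E4) : ℝ := connForm g θ 0 1 x (dualVec (θ x) 3)

/-! ### Para-Kähler-Einstein structures on open subsets of `ℝ⁴` -/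

/-- The para-Kähler form `ρ(X, Y) = g(K X, Y)`. -/
def kaehlerForm (g : BilinField) (K : EndoField) : BilinField := fun x => (g x).comp (K x)

/-- `(g, K)` is a smooth para-Kähler-Einstein structure on the open set `U ⊆ ℝ⁴`.
The eigenspaces of `K` are `g`-null by `compat`; as `g` is nondegenerate, they both have rank 2 and
`g` has signature `(2, 2)`. The fields `integrable_pos` and `integrable_neg` say that the two
eigendistributions of `K` are closed under Lie brackets, `closed` says that `dρ = 0`, and
`einstein` that the trace-free part of the Ricci tensor vanishes. -/
structure IsPKEOn (U : Set E4) (g : BilinField) (K : EndoField) : Prop where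
  smooth_metric : ContDiffOn ℝ ∞ g U
  smooth_endo : ContDiffOn ℝ ∞ K U
  symm : ∀ x ∈ U, ∀ v w, g x v w = g x w v
  nondegenerate : ∀ x ∈ U, ∀ v, (∀ w, g x v w = 0) → v = 0
  paracomplex : ∀ x ∈ U, ∀ v, K x (K x v) = v
  compat : ∀ x ∈ U, ∀ v w, g x (K x v) (K x w) = - g x v w
  integrable_pos : ∀ X Y : E4 → E4, ContDiffOn ℝ ∞ X U → ContDiffOn ℝ ∞ Y U →
    (∀ x ∈ U, K x (X x) = X x) → (∀ x ∈ U, K x (Y x) = Y x) →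
    ∀ x ∈ U, K x (VectorField.lieBracket ℝ X Y x) = VectorField.lieBracket ℝ X Y x
  integrable_neg : ∀ X Y : E4 → E4, ContDiffOn ℝ ∞ X U → ContDiffOn ℝ ∞ Y U →
    (∀ x ∈ U, K x (X x) = - X x) → (∀ x ∈ U, K x (Y x) = - Y x) →
    ∀ x ∈ U, K x (VectorField.lieBracket ℝ X Y x) = - VectorField.lieBracket ℝ X Y x
  closed : ∀ x ∈ U, ∀ u v w,
    fderiv ℝ (kaehlerForm g K) x u v w + fderiv ℝ (kaehlerForm g K) x v w u
      + fderiv ℝ (kaehlerForm g K) x w u v = 0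
  einstein : ∀ x ∈ U, ∀ a b, ricci g a b x - (1 / 4) * scalarCurv g x * gram g x a b = 0

/-- The anti-self-dual Weyl tensor has real Petrov type `D` at every point of `U`: its quartic has
two distinct real double roots in the projective line. -/
def IsRealTypeDOn (U : Set E4) (g : BilinField) (K : EndoField) : Prop :=
  ∀ x ∈ U, ∃ θ : Fin 4 → E4 →L[ℝ] ℝ, IsAdapted (g x) (K x) θ ∧
    ∃ r a b c d : ℝ, r ≠ 0 ∧ a * d - b * c ≠ 0 ∧
      ∀ ξ₀ ξ₁ : ℝ, asdQuartic g θ x ξ₀ ξ₁ = r * (a * ξ₀ + b * ξ₁) ^ 2 * (c * ξ₀ + d * ξ₁) ^ 2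

/-- A smooth coframe on `U`, adapted to `(g, K)`, for which the two double roots of the quartic are
`0` and `∞`, that is `Ψ₀ = Ψ₁ = Ψ₃ = Ψ₄ = 0` and `Ψ₂ ≠ 0`. -/
structure IsReducedCoframeOn (U : Set E4) (g : BilinField) (K : EndoField) (θ : FormQuad) :
    Prop where
  smooth : ∀ a, ContDiffOn ℝ ∞ (fun x => θ x a) U
  adapted : ∀ x ∈ U, IsAdapted (g x) (K x) (θ x)
  psi0_eq : ∀ x ∈ U, psi0 g θ x = 0
  psi1_eq : ∀ x ∈ U, psi1 g θ x = 0
  psi2_ne : ∀ x ∈ U, psi2 g θ x ≠ 0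
  psi3_eq : ∀ x ∈ U, psi3 g θ x = 0
  psi4_eq : ∀ x ∈ U, psi4 g θ x = 0

/-! ### The normal forms -/

/-- The metric `2 θ¹ θ³ + 2 θ² θ⁴`. -/
def metricOf (θ : FormQuad) : BilinField := fun x =>
  (θ x 0).smulRight (θ x 2) + (θ x 2).smulRight (θ x 0)
    + (θ x 1).smulRight (θ x 3) + (θ x 3).smulRight (θ x 1)

/-- The endomorphism `θ¹ ⊗ ∂_{θ¹} + θ² ⊗ ∂_{θ²} - θ³ ⊗ ∂_{θ³} - θ⁴ ⊗ ∂_{θ⁴}`. -/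
def endoOf (θ : FormQuad) : EndoField := fun x =>
  (θ x 0).smulRight (dualVec (θ x) 0) + (θ x 1).smulRight (dualVec (θ x) 1)
    - (θ x 2).smulRight (dualVec (θ x) 2) - (θ x 3).smulRight (dualVec (θ x) 3)

/-- The coframe of the first branch; `s` is the constant `Ψ₂'`. Here `y 0, …, y 3` are the
coordinates `y¹, …, y⁴`. -/
def generic₁ (y : E4) : E4 →L[ℝ] ℝ := ((y 3) ^ 2 * (1 - y 2)) • dy 0 - (y 3) • dy 1

/-- See `generic₁`. -/
def generic₂ (y : E4) : E4 →L[ℝ] ℝ := ((y 3) ^ 2) • dy 0 - generic₁ y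

/-- See `generic₁`. -/
def genericCoframe (k₁ k₂ k₃ k₄ s : ℝ) : FormQuad := fun y =>
  ![generic₁ y,
    generic₂ y,
    (-s * (y 2) ^ 3 + k₁ * (y 2) ^ 2 / (y 3) - k₂ * (y 2) / (y 3) ^ 2
        - (k₃ + (1 / 2) * k₄) / (y 3) ^ 3) • generic₁ y
      - dy 2 - ((y 2) / (y 3)) • dy 3,
    (s * (y 2 - 1) ^ 3 - k₁ * (y 2 - 1) ^ 2 / (y 3) + k₂ * (y 2 - 1) / (y 3) ^ 2
        + k₃ / (y 3) ^ 3) • generic₂ y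
      + dy 2 + ((y 2 - 1) / (y 3)) • dy 3]

/-- The coframe of the second branch. -/
def specialCoframe (k₁ k₂ s : ℝ) : FormQuad := fun y =>
  ![(k₂ * (y 0) ^ 2 * (y 3)) • dy 2 + ((y 0) / (y 3)) • dy 3 + dy 0,
    (y 0) • dy 2 + (1 / (y 3)) • dy 1,
    dy 2,
    - ((k₁ * (y 3) ^ 3 + 2 * k₂ * (y 3) + 2 * s) / (2 * (y 3))) • dy 1
      - ((k₁ * (y 3) ^ 3 + 2 * k₂ * (y 3) + 2 * s) / 2 * (y 0)) • dy 2
      + (1 / (y 3)) • dy 3]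

/-- Switching `θ¹ ↔ θ²` and `θ³ ↔ θ⁴`. -/
def swapCoframe (θ : FormQuad) : FormQuad := fun y => ![θ y 1, θ y 0, θ y 3, θ y 2]

/-- The coframe of the fourth branch. -/
def homogeneousCoframe (s : ℝ) : FormQuad := fun y =>
  ![(1 / (1 - (3 / 2) * s * (y 0) * (y 2))) • dy 0,
    (1 / (1 - (3 / 2) * s * (y 1) * (y 3))) • dy 1,
    (1 / (1 - (3 / 2) * s * (y 0) * (y 2))) • dy 2,
    (1 / (1 - (3 / 2) * s * (y 1) * (y 3))) • dy 3]

/-- The domain of `genericCoframe` and `specialCoframe`. -/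
def domainNe : Set E4 := {y | y 3 ≠ 0}

/-- The domain of `homogeneousCoframe`. -/
def domainHom (s : ℝ) : Set E4 :=
  {y | 1 - (3 / 2) * s * (y 0) * (y 2) ≠ 0 ∧ 1 - (3 / 2) * s * (y 1) * (y 3) ≠ 0}

/-- The coframe `θ` on the open set `D` defines a para-Kähler-Einstein metric with scalar
curvature `-12 s` and of real Petrov type `D`, for which `θ` is reduced,
`Ψ₂' = s`, `J₂ = j₂` and `J₄ = j₄`. -/
structure IsModel (D : Set E4) (θ : FormQuad) (s j₂ j₄ : ℝ) : Prop where
  isOpen : IsOpen D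
  pke : IsPKEOn D (metricOf θ) (endoOf θ)
  scal : ∀ y ∈ D, scalarCurv (metricOf θ) y = -12 * s
  typeD : IsRealTypeDOn D (metricOf θ) (endoOf θ)
  reduced : IsReducedCoframeOn D (metricOf θ) (endoOf θ) θ
  psi2'_eq : ∀ y ∈ D, psi2' (metricOf θ) θ y = s
  J2_eq : ∀ y ∈ D, J2 (metricOf θ) θ y = j₂
  J4_eq : ∀ y ∈ D, J4 (metricOf θ) θ y = j₄

/-! ### Four-manifolds -/

section Manifold

variable {M : Type u} [TopologicalSpace M] [ChartedSpace E4 M]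

/-- The coordinate expression in the chart `e` of a field `g` of bilinear forms. -/
def localMetric (g : ∀ x : M, TangentSpace (𝓡 4) x →L[ℝ] TangentSpace (𝓡 4) x →L[ℝ] ℝ)
    (e : OpenPartialHomeomorph M E4) : BilinField := fun y =>
  let D : E4 →L[ℝ] E4 := mfderiv (𝓡 4) (𝓡 4) e.symm y
  let G : E4 →L[ℝ] E4 →L[ℝ] ℝ := g (e.symm y)
  G.bilinearComp D D

/-- The coordinate expression in the chart `e` of a field `K` of endomorphisms. -/
def localEndo (K : ∀ x : M, TangentSpace (𝓡 4) x →L[ℝ] TangentSpace (𝓡 4) x)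
    (e : OpenPartialHomeomorph M E4) : EndoField := fun y =>
  let D : E4 →L[ℝ] E4 := mfderiv (𝓡 4) (𝓡 4) e.symm y
  let k : E4 →L[ℝ] E4 := K (e.symm y)
  let D' : E4 →L[ℝ] E4 := mfderiv (𝓡 4) (𝓡 4) e (e.symm y)
  D'.comp (k.comp D)

/-- `(g, K)` is a para-Kähler-Einstein structure on `M` (tested in all smooth charts). -/
def IsPKE (g : ∀ x : M, TangentSpace (𝓡 4) x →L[ℝ] TangentSpace (𝓡 4) x →L[ℝ] ℝ)
    (K : ∀ x : M, TangentSpace (𝓡 4) x →L[ℝ] TangentSpace (𝓡 4) x) : Prop :=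
  ∀ e ∈ IsManifold.maximalAtlas (𝓡 4) ∞ M, IsPKEOn e.target (localMetric g e) (localEndo K e)

/-- The scalar curvature of `g` vanishes nowhere. -/
def HasNonzeroScal (g : ∀ x : M, TangentSpace (𝓡 4) x →L[ℝ] TangentSpace (𝓡 4) x →L[ℝ] ℝ) :
    Prop :=
  ∀ e ∈ IsManifold.maximalAtlas (𝓡 4) ∞ M, ∀ y ∈ e.target, scalarCurv (localMetric g e) y ≠ 0

/-- The anti-self-dual Weyl tensor has real Petrov type `D` at every point of `M`. -/
def IsRealTypeD (g : ∀ x : M, TangentSpace (𝓡 4) x →L[ℝ] TangentSpace (𝓡 4) x →L[ℝ] ℝ)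
    (K : ∀ x : M, TangentSpace (𝓡 4) x →L[ℝ] TangentSpace (𝓡 4) x) : Prop :=
  ∀ e ∈ IsManifold.maximalAtlas (𝓡 4) ∞ M,
    IsRealTypeDOn e.target (localMetric g e) (localEndo K e)

/-- The points that have a neighbourhood with a reduced coframe for which
the values `(J₂, J₄)` satisfy `P` everywhere. -/
def branch (g : ∀ x : M, TangentSpace (𝓡 4) x →L[ℝ] TangentSpace (𝓡 4) x →L[ℝ] ℝ)
    (K : ∀ x : M, TangentSpace (𝓡 4) x →L[ℝ] TangentSpace (𝓡 4) x) (P : ℝ → ℝ → Prop) : Set M :=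
  {p | ∃ e ∈ IsManifold.maximalAtlas (𝓡 4) ∞ M, p ∈ e.source ∧ ∃ θ : FormQuad,
    IsReducedCoframeOn e.target (localMetric g e) (localEndo K e) θ ∧
    ∀ y ∈ e.target, P (J2 (localMetric g e) θ y) (J4 (localMetric g e) θ y)}

/-- First branch: `J₂` and `J₄` are nowhere zero. -/
def branch₁ (g : ∀ x : M, TangentSpace (𝓡 4) x →L[ℝ] TangentSpace (𝓡 4) x →L[ℝ] ℝ)
    (K : ∀ x : M, TangentSpace (𝓡 4) x →L[ℝ] TangentSpace (𝓡 4) x) : Set M :=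
  branch g K fun j₂ j₄ => j₂ ≠ 0 ∧ j₄ ≠ 0

/-- Second branch: `J₂` is nowhere zero and `J₄ = 0`. -/
def branch₂ (g : ∀ x : M, TangentSpace (𝓡 4) x →L[ℝ] TangentSpace (𝓡 4) x →L[ℝ] ℝ)
    (K : ∀ x : M, TangentSpace (𝓡 4) x →L[ℝ] TangentSpace (𝓡 4) x) : Set M :=
  branch g K fun j₂ j₄ => j₂ ≠ 0 ∧ j₄ = 0

/-- Third branch: `J₂ = 0` and `J₄` is nowhere zero. -/
def branch₃ (g : ∀ x : M, TangentSpace (𝓡 4) x →L[ℝ] TangentSpace (𝓡 4) x →L[ℝ] ℝ)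
    (K : ∀ x : M, TangentSpace (𝓡 4) x →L[ℝ] TangentSpace (𝓡 4) x) : Set M :=
  branch g K fun j₂ j₄ => j₂ = 0 ∧ j₄ ≠ 0

/-- Fourth branch: `J₂ = J₄ = 0`. -/
def branch₄ (g : ∀ x : M, TangentSpace (𝓡 4) x →L[ℝ] TangentSpace (𝓡 4) x →L[ℝ] ℝ)
    (K : ∀ x : M, TangentSpace (𝓡 4) x →L[ℝ] TangentSpace (𝓡 4) x) : Set M :=
  branch g K fun j₂ j₄ => j₂ = 0 ∧ j₄ = 0

/-- Near `p` there are coordinates, with values in `D`, in which `θ` is a reduced coframe of `(g, K)`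
(in particular `g = 2 θ¹ θ³ + 2 θ² θ⁴`) and `Ψ₂' = s`, `J₂ = j₂`, `J₄ = j₄`. -/
def HasNormalFormAt (g : ∀ x : M, TangentSpace (𝓡 4) x →L[ℝ] TangentSpace (𝓡 4) x →L[ℝ] ℝ)
    (K : ∀ x : M, TangentSpace (𝓡 4) x →L[ℝ] TangentSpace (𝓡 4) x) (p : M)
    (D : Set E4) (θ : FormQuad) (s j₂ j₄ : ℝ) : Prop :=
  ∃ e ∈ IsManifold.maximalAtlas (𝓡 4) ∞ M, p ∈ e.source ∧ e.target ⊆ D ∧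
    IsReducedCoframeOn e.target (localMetric g e) (localEndo K e) θ ∧
    ∀ y ∈ e.target, psi2' (localMetric g e) θ y = s ∧
      J2 (localMetric g e) θ y = j₂ ∧ J4 (localMetric g e) θ y = j₄

/-- `φ` is a diffeomorphism between open subsets of `M` that preserves `g`. -/
def IsLocalIsometry (g : ∀ x : M, TangentSpace (𝓡 4) x →L[ℝ] TangentSpace (𝓡 4) x →L[ℝ] ℝ)
    (φ : OpenPartialHomeomorph M M) : Prop :=
  ContMDiffOn (𝓡 4) (𝓡 4) ∞ φ φ.source ∧ ContMDiffOn (𝓡 4) (𝓡 4) ∞ φ.symm φ.target ∧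
    ∀ x ∈ φ.source, ∀ v w : TangentSpace (𝓡 4) x,
      g (φ x) (mfderiv (𝓡 4) (𝓡 4) φ x v) (mfderiv (𝓡 4) (𝓡 4) φ x w) = g x v w

/-- `φ` preserves `K`. -/
def PreservesEndo (K : ∀ x : M, TangentSpace (𝓡 4) x →L[ℝ] TangentSpace (𝓡 4) x)
    (φ : OpenPartialHomeomorph M M) : Prop :=
  ∀ x ∈ φ.source, ∀ v : TangentSpace (𝓡 4) x,
    mfderiv (𝓡 4) (𝓡 4) φ x (K x v) = K (φ x) (mfderiv (𝓡 4) (𝓡 4) φ x v)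

/-- The metric `g` is (locally) homogeneous: local isometries act transitively. -/
def IsHomogeneousMetric (g : ∀ x : M, TangentSpace (𝓡 4) x →L[ℝ] TangentSpace (𝓡 4) x →L[ℝ] ℝ) :
    Prop :=
  ∀ p q : M, ∃ φ : OpenPartialHomeomorph M M, p ∈ φ.source ∧ φ p = q ∧ IsLocalIsometry g φ

/-- The structure `(g, K)` is (locally) homogeneous: local isometries that preserve `K` act
transitively. -/
def IsHomogeneousPair (g : ∀ x : M, TangentSpace (𝓡 4) x →L[ℝ] TangentSpace (𝓡 4) x →L[ℝ] ℝ)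
    (K : ∀ x : M, TangentSpace (𝓡 4) x →L[ℝ] TangentSpace (𝓡 4) x) : Prop :=
  ∀ p q : M, ∃ φ : OpenPartialHomeomorph M M, p ∈ φ.source ∧ φ p = q ∧
    IsLocalIsometry g φ ∧ PreservesEndo K φ

end Manifold

end ParaKaehler

end

/-!
The proof is the method of moving frames, carried out algebraically. The smooth functions on an open
set `U ⊆ ℝ⁴` form a ring `Sm U`, and a null coframe `θ` supplies four derivations `dF U θ` of it, the
derivatives along the dual frame. The Levi-Civita connection has components `cG U g θ` in this ring, and
curvature, Bianchi identities and closedness of 1-forms are polynomial expressions in these components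
and their derivatives (`frameCurv`, `frame_bianchi`, `IsClosedFrame`). Every integrability condition is
thereby a computation in a commutative ring with derivations.

*Structure equations.* In an adapted coframe the connection takes values in `𝔤𝔩(2, ℝ)`
(`IsAdaptedOn.cG_eq`), and the Einstein equation and the first Bianchi identity leave as curvature
components only `Ψ₀, …, Ψ₄` and `s = -R / 12` (`IsAdaptedOn.ev_rF_eq`). If the quartic has two double
real roots, its square root is smooth, since its coefficients are rational in those of the quartic, and
diagonalizing this quadratic form yields a reduced coframe (`exists_isReducedCoframeOn`). In a reduced
coframe the second Bianchi identity gives the form of `Γ¹₂` and `Γ²₁`, the equation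
`dΨ₂ = 3 Ψ₂ (-J₁ θ¹ + J₃ θ² + J₄ θ³ + J₂ θ⁴)`, and `ds = 0` (`TypeDFrame`). Two reduced coframes differ by
a diagonal or antidiagonal change, under which `J₂` and `J₄` are rescaled or exchanged
(`IsReducedCoframeOn.J_eq`). As `J₂` and `J₄` are continuous, each of them is nowhere zero or identically
zero on suitable smaller open sets, so the branches are dense (`dense_branches`).

*Models.* A metric torsion-free connection is the Levi-Civita connection (`IsNullCoframeOn.cG_unique`),
so a coframe is a model once the components of the `dyⁱ` in it are closed for a proposed connection with
values in `𝔤𝔩(2, ℝ)` and the curvature of this connection has type `D` form (`isModel_of_frame`). This is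
verified for the four families in `isModel_generic`, `isModel_special`, `IsModel.swap` and
`isModel_homogeneous`.

*Normal forms.* In the first branch, rescaled to `J₂ = J₄ = 1`, repeated use of `d² = 0` closes the
structure equations (`TypeDFrame.genericFrame`). They have the first integrals `k₂` and `k₃`, the
functions `y³` and `y⁴` are expressed through the curvature and the connection, and `dy¹`, `dy²` are
found by the Poincaré lemma (`exists_pullsBack_generic`). In the second branch one finds `J₁ = 0`
(`TypeDFrame.special_sq`), in the fourth `J₁ = J₃ = 0` and `Ψ₂ = s` (`TypeDFrame.homogeneous_eqs`). What
is left in these cases are null planes of constant curvature, one or two of them. Their null coordinates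
come from a parallel section of a flat bundle of rank two (`exists_parallel`,
`IsNullCoframeOn.exists_plane`), and this gives `exists_pullsBack_special` and
`exists_pullsBack_homogeneous`. The third branch is the second one with the two planes of the coframe
exchanged. In each case the functions found pull the coframe of a model back to an adapted coframe, and
by the inverse function theorem they are coordinates (`exists_chart_of_pullsBack`).

*Homogeneity.* The coordinates of the fourth branch can be centred at any point, and the parameter `s` is
locally constant. On a connected manifold, the transition maps between centred charts are therefore local
isometries that preserve `K` and move any point to any other. Conversely, the square of the curvature
tensor is `24 Ψ₂² + 48 s²` in a reduced coframe, so a homogeneous metric has constant `Ψ₂`, and the formula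
for `dΨ₂` forces `J₂ = J₄ = 0` (`mem_branch₄_of_isHomogeneousMetric`).
-/

open scoped Manifold ContDiff
open TopologicalSpace (Opens)

set_option maxSynthPendingDepth 3

noncomputable section

namespace ParaKaehler

/-! ### The differential ring of smooth functions on an open set -/

/-- Extension by zero of a function on an open set. -/
def extZero {U : Opens E4} (f : U → ℝ) : E4 → ℝ := Function.extend Subtype.val f 0

theorem extZero_apply {U : Opens E4} (f : U → ℝ) (x : U) : extZero f x = f x :=
  Subtype.val_injective.extend_apply f 0 x

theorem contDiffOn_extZero {U : Opens E4} {f : U → ℝ} {F : E4 → ℝ} (h : ∀ x : U, f x = F x) :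
    ContDiffOn ℝ ∞ (extZero f) U ↔ ContDiffOn ℝ ∞ F U :=
  contDiffOn_congr fun x hx => by rw [← h ⟨x, hx⟩, ← extZero_apply f ⟨x, hx⟩]

theorem extZero_eventuallyEq {U : Opens E4} {f : U → ℝ} {F : E4 → ℝ} (h : ∀ x : U, f x = F x)
    (x : U) : extZero f =ᶠ[nhds (x : E4)] F := by
  filter_upwards [U.isOpen.mem_nhds x.2] with y hy
  rw [← h ⟨y, hy⟩, ← extZero_apply f ⟨y, hy⟩]

/-- The smooth functions on `U`, as a subalgebra of all functions. -/
def smoothSubalgebra (U : Opens E4) : Subalgebra ℝ (U → ℝ) where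
  carrier := {f | ContDiffOn ℝ ∞ (extZero f) U}
  mul_mem' {f g} hf hg := (contDiffOn_extZero (F := extZero f * extZero g) fun x => by
    simp [extZero_apply]).2 (ContDiffOn.mul hf hg)
  add_mem' {f g} hf hg := (contDiffOn_extZero (F := extZero f + extZero g) fun x => by
    simp [extZero_apply]).2 (ContDiffOn.add hf hg)
  algebraMap_mem' r := (contDiffOn_extZero (F := fun _ => r) fun x => rfl).2 contDiffOn_const

/-- The ring `C^∞(U)`. -/
def Sm (U : Opens E4) : Type := smoothSubalgebra U

namespace Sm

variable {U : Opens E4}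

instance : CommRing (Sm U) := inferInstanceAs (CommRing (smoothSubalgebra U))
instance : Algebra ℝ (Sm U) := inferInstanceAs (Algebra ℝ (smoothSubalgebra U))

/-- Evaluation at a point. -/
def ev (x : U) : Sm U →ₐ[ℝ] ℝ := (Pi.evalAlgHom ℝ (fun _ : U => ℝ) x).comp (smoothSubalgebra U).val

/-- The underlying function, extended by zero. -/
def fn (f : Sm U) : E4 → ℝ := extZero f.1

theorem fn_apply (f : Sm U) (x : U) : f.fn x = ev x f := extZero_apply f.1 x

theorem contDiffOn_fn (f : Sm U) : ContDiffOn ℝ ∞ f.fn U := f.2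

theorem ext {f g : Sm U} (h : ∀ x, ev x f = ev x g) : f = g := Subtype.ext (funext h)

theorem differentiableAt_fn (f : Sm U) (x : U) : DifferentiableAt ℝ f.fn x :=
  (f.contDiffOn_fn.contDiffAt (U.isOpen.mem_nhds x.2)).differentiableAt (by simp)

/-- A smooth function as an element of `C^∞(U)`. -/
def mk (F : E4 → ℝ) (h : ContDiffOn ℝ ∞ F U) : Sm U :=
  (⟨fun x => F x, (contDiffOn_extZero fun _ => rfl).2 h⟩ : smoothSubalgebra U)

open Classical in
/-- A function that is smooth on `U`, as an element of `C^∞(U)`; all others are sent to `0`. -/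
def of (U : Opens E4) (F : E4 → ℝ) : Sm U :=
  if h : ContDiffOn ℝ ∞ F U then mk F h else 0

theorem ev_of {F : E4 → ℝ} (h : ContDiffOn ℝ ∞ F U) (x : U) : ev x (of U F) = F x := by
  rw [of, dif_pos h]; rfl

theorem eventuallyEq_of {F : E4 → ℝ} {f : Sm U} (h : ∀ x : U, ev x f = F x) (x : U) :
    f.fn =ᶠ[nhds (x : E4)] F := extZero_eventuallyEq h x

theorem isUnit_of_ne_zero {f : Sm U} (h : ∀ x, ev x f ≠ 0) : IsUnit f := by
  have hs : ContDiffOn ℝ ∞ (fun x => (f.fn x)⁻¹) U :=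
    f.contDiffOn_fn.inv fun x hx => by simpa [fn_apply f ⟨x, hx⟩] using h ⟨x, hx⟩
  refine IsUnit.of_mul_eq_one (of U fun x => (f.fn x)⁻¹) (ext fun x => ?_)
  rw [map_mul, ev_of hs, fn_apply, map_one, mul_inv_cancel₀ (h x)]

/-- The partial derivative as a derivation of `C^∞(U)`. -/
def der (v : E4) : Derivation ℝ (Sm U) (Sm U) :=
  have hs (f : Sm U) : ContDiffOn ℝ ∞ (fun x => fderiv ℝ f.fn x v) U :=
    (f.contDiffOn_fn.fderiv_of_isOpen U.isOpen (by simp)).clm_apply contDiffOn_const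
  Derivation.mk'
    { toFun := fun f => of U fun x => fderiv ℝ f.fn x v
      map_add' := fun f g => ext fun x => by
        rw [map_add, ev_of (hs _), ev_of (hs _), ev_of (hs _),
          (eventuallyEq_of (F := f.fn + g.fn) (fun y => by simp [fn_apply]) x).fderiv_eq,
          fderiv_add (f.differentiableAt_fn x) (g.differentiableAt_fn x)]
        rfl
      map_smul' := fun c f => ext fun x => by
        rw [map_smul, ev_of (hs _), ev_of (hs _),
          (eventuallyEq_of (F := c • f.fn) (fun y => by simp [fn_apply]) x).fderiv_eq,
          fderiv_const_smul (f.differentiableAt_fn x)]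
        rfl }
    fun f g => ext fun x => by
      change ev x (of U fun x => fderiv ℝ (f * g).fn x v) =
        ev x (f • (of U fun x => fderiv ℝ g.fn x v) + g • (of U fun x => fderiv ℝ f.fn x v))
      simp only [smul_eq_mul, map_add, map_mul]
      rw [ev_of (hs _), ev_of (hs _), ev_of (hs _),
        (eventuallyEq_of (F := f.fn * g.fn) (fun y => by simp [fn_apply]) x).fderiv_eq,
        fderiv_mul (f.differentiableAt_fn x) (g.differentiableAt_fn x)]
      simp [fn_apply]

theorem ev_der (v : E4) (f : Sm U) (x : U) : ev x (der v f) = fderiv ℝ f.fn x v :=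
  ev_of (F := fun x => fderiv ℝ f.fn x v)
    ((f.contDiffOn_fn.fderiv_of_isOpen U.isOpen (by simp)).clm_apply contDiffOn_const) x

theorem ev_der_eq {F : E4 → ℝ} {f : Sm U} (h : ∀ x : U, ev x f = F x) (v : E4) (x : U) :
    ev x (der v f) = fderiv ℝ F x v := by
  rw [ev_der, (eventuallyEq_of h x).fderiv_eq]

theorem ev_der_of {F : E4 → ℝ} (h : ContDiffOn ℝ ∞ F U) (v : E4) (x : U) :
    ev x (der v (of U F)) = fderiv ℝ F x v := ev_der_eq (ev_of h) v x

theorem der_comm (u v : E4) (f : Sm U) : der u (der v f) = der v (der u f) := by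
  refine ext fun x => ?_
  have h2 : ContDiffAt ℝ ∞ f.fn x := f.contDiffOn_fn.contDiffAt (U.isOpen.mem_nhds x.2)
  have hd : DifferentiableAt ℝ (fderiv ℝ f.fn) x :=
    (h2.fderiv_right (m := 1) (by norm_cast)).differentiableAt (by simp)
  rw [ev_der_eq (F := fun y => fderiv ℝ f.fn y v) (fun y => ev_der v f y),
    ev_der_eq (F := fun y => fderiv ℝ f.fn y u) (fun y => ev_der u f y)]
  have key (a b : E4) : fderiv ℝ (fun y => fderiv ℝ f.fn y a) x b
      = fderiv ℝ (fderiv ℝ f.fn) x b a := by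
    rw [fderiv_clm_apply hd (differentiableAt_const a)]; simp
  rw [key, key]
  exact (h2.isSymmSndFDerivAt (by rw [minSmoothness_of_isRCLikeNormedField]; exact WithTop.coe_le_coe.2 le_top)) u v

/-- The coordinate derivations `∂_i` of `C^∞(U)`. -/
def coordDer (i : Fin 4) : Derivation ℝ (Sm U) (Sm U) := der (bvec i)

end Sm

/-! ### Parallel sections of flat connections -/

section Parallel

open Set Metric

variable {E V : Type*} [NormedAddCommGroup E] [NormedSpace ℝ E]
  [NormedAddCommGroup V] [NormedSpace ℝ V]

/-- A connection form that is smooth near `p` obeys uniform bounds on a ball about `p`: on it and on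
its derivative, and on the remainder in its first-order Taylor expansion. -/
theorem exists_taylor_bounds {U : Set E} (hU : IsOpen U) {p : E} (hp : p ∈ U)
    {A : E → E →L[ℝ] V →L[ℝ] V} (hA : ContDiffOn ℝ ∞ A U) {ε : ℝ} (hε : 0 < ε) :
    ∃ r M L : ℝ, 0 < r ∧ 0 ≤ M ∧ 0 ≤ L ∧ M * r ≤ ε ∧ ball p r ⊆ U ∧
      (∀ x ∈ ball p r, ‖A x‖ ≤ M) ∧ (∀ x ∈ ball p r, ‖fderiv ℝ A x‖ ≤ M) ∧
      ∀ x ∈ ball p r, ∀ z ∈ ball p r, ‖A z - A x - fderiv ℝ A x (z - x)‖ ≤ L * ‖z - x‖ ^ 2 := by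
  have hAp : ContDiffAt ℝ ∞ A p := hA.contDiffAt (hU.mem_nhds hp)
  have hD : ContDiffAt ℝ 1 (fderiv ℝ A) p := hAp.fderiv_right (by norm_cast)
  obtain ⟨K, t, ht, hK⟩ := hD.exists_lipschitzOnWith
  have c1 := hAp.continuousAt.norm.eventually_lt continuousAt_const (lt_add_one ‖A p‖)
  have c2 := hD.continuousAt.norm.eventually_lt continuousAt_const (lt_add_one ‖fderiv ℝ A p‖)
  obtain ⟨r₁, hr₁, hb⟩ := Metric.eventually_nhds_iff_ball.1
    ((c1.and c2).and (Filter.inter_mem ht (hU.mem_nhds hp)))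
  set M := max (‖A p‖ + 1) (‖fderiv ℝ A p‖ + 1) with hM
  have hM0 : 0 < M := lt_max_of_lt_left (by positivity)
  have hr (x : E) (hx : x ∈ ball p (min r₁ (ε / M))) : x ∈ ball p r₁ :=
    ball_subset_ball (min_le_left _ _) hx
  refine ⟨min r₁ (ε / M), M, K, lt_min hr₁ (by positivity), hM0.le, K.2, ?_,
    fun x hx => (hb x (hr x hx)).2.2,
    fun x hx => (hb x (hr x hx)).1.1.le.trans (le_max_left _ _),
    fun x hx => (hb x (hr x hx)).1.2.le.trans (le_max_right _ _), fun x hx z hz => ?_⟩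
  · calc M * min r₁ (ε / M) ≤ M * (ε / M) := by gcongr; exact min_le_right _ _
      _ = ε := by field_simp
  · have hseg : segment ℝ x z ⊆ ball p r₁ :=
      (convex_ball p r₁).segment_subset (hr x hx) (hr z hz)
    have := (convex_segment (𝕜 := ℝ) x z).norm_image_sub_le_of_norm_hasFDerivWithin_le'
      (f := A) (f' := fderiv ℝ A) (φ := fderiv ℝ A x) (C := K * ‖z - x‖) (x := x) (y := z)
      (fun w hw => ((hA.contDiffAt (hU.mem_nhds (hb w (hseg hw)).2.2)).differentiableAt
        (by simp)).hasFDerivAt.hasFDerivWithinAt)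
      (fun w hw => by
        have h1 := hK.dist_le_mul w (hb w (hseg hw)).2.1 x (hb x (hr x hx)).2.1
        rw [dist_eq_norm, dist_eq_norm] at h1
        refine h1.trans ?_
        gcongr
        exact norm_sub_le_of_mem_segment hw)
      (left_mem_segment ℝ x z) (right_mem_segment ℝ x z)
    calc _ ≤ K * ‖z - x‖ * ‖z - x‖ := this
      _ = _ := by ring

/-- Solutions of a linear equation along the segments issuing from `p`. -/
theorem exists_radial_solution [CompleteSpace V] {p y : E} {r M : ℝ} (hy : y ∈ ball p r)
    {A : E → E →L[ℝ] V →L[ℝ] V} (hM : 0 ≤ M) (hA : ContinuousOn A (ball p r))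
    (hb : ∀ x ∈ ball p r, ‖A x‖ ≤ M) (X₀ : V) (hMr : M * r ≤ 1 / (‖X₀‖ + 1)) :
    ∃ x : ℝ → V, x 0 = X₀ ∧ ∀ t ∈ Icc (0 : ℝ) 1,
      HasDerivWithinAt x (A (p + t • (y - p)) (y - p) (x t)) (Icc 0 1) t := by
  have hmem (t : ℝ) (ht : t ∈ Icc (0 : ℝ) 1) : p + t • (y - p) ∈ ball p r :=
    (convex_ball p r).add_smul_sub_mem (mem_ball_self (dist_nonneg.trans_lt hy)) hy ht
  have hyr : ‖y - p‖ ≤ r := by rw [← dist_eq_norm]; exact (mem_ball.1 hy).le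
  have hr0 : 0 ≤ r := (norm_nonneg _).trans hyr
  have hB (t : ℝ) (ht : t ∈ Icc (0 : ℝ) 1) : ‖A (p + t • (y - p)) (y - p)‖ ≤ M * r :=
    (ContinuousLinearMap.le_opNorm _ _).trans (mul_le_mul (hb _ (hmem t ht)) hyr (norm_nonneg _) hM)
  have hN : 0 < ‖X₀‖ + 1 := by positivity
  refine IsPicardLindelof.exists_eq_forall_mem_Icc_hasDerivWithinAt₀ (tmin := 0) (tmax := 1) (t₀ := ⟨0, by simp⟩)
    (a := 1) (L := 1) (K := ⟨M * r, by positivity⟩)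
    (f := fun t x => A (p + t • (y - p)) (y - p) x) (x₀ := X₀) ⟨?_, ?_, ?_, by simp⟩
  · intro t ht
    exact ((A (p + t • (y - p)) (y - p)).lipschitz.weaken (by exact_mod_cast hB t ht)).lipschitzOnWith
  · intro x _
    have : ContinuousOn (fun t : ℝ => A (p + t • (y - p))) (Icc 0 1) :=
      hA.comp (by fun_prop) hmem
    exact (this.clm_apply continuousOn_const).clm_apply continuousOn_const
  · intro t ht x hx
    have hx1 : ‖x‖ ≤ ‖X₀‖ + 1 := by
      have : ‖x - X₀‖ ≤ 1 := by simpa [dist_eq_norm] using hx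
      linarith [norm_le_norm_add_norm_sub' x X₀]
    calc _ ≤ M * r * (‖X₀‖ + 1) :=
          (ContinuousLinearMap.le_opNorm _ _).trans
            (mul_le_mul (hB t ht) hx1 (norm_nonneg _) (by positivity))
      _ ≤ 1 / (‖X₀‖ + 1) * (‖X₀‖ + 1) := by gcongr
      _ = 1 := by field_simp

/-- A flat connection on a trivial bundle has, near each point, a parallel section with a prescribed
value there. The section is found by solving the equation along the segments issuing from `p`;
flatness makes `τ ↦ τ • A h x` a solution of the equation of variations. -/
theorem exists_parallel [CompleteSpace V] {U : Set E} (hU : IsOpen U) {p : E} (hp : p ∈ U)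
    {A : E → E →L[ℝ] V →L[ℝ] V} (hA : ContDiffOn ℝ ∞ A U)
    (flat : ∀ x ∈ U, ∀ u v, fderiv ℝ A x u v + (A x v).comp (A x u)
      = fderiv ℝ A x v u + (A x u).comp (A x v)) (X₀ : V) :
    ∃ r > 0, ball p r ⊆ U ∧ ∃ X : E → V, ContDiffOn ℝ ∞ X (ball p r) ∧ X p = X₀ ∧
      ∀ y ∈ ball p r, HasFDerivAt X ((A y).flip (X y)) y := by
  obtain ⟨r, M, L, hr, hM, hL, hMr, hrU, hb, hb', hT⟩ :=
    exists_taylor_bounds hU hp hA (ε := 1 / (‖X₀‖ + 1)) (by positivity)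
  have hsol (y : E) : ∃ x : ℝ → V, y ∈ ball p r → x 0 = X₀ ∧ ∀ t ∈ Icc (0 : ℝ) 1,
      HasDerivWithinAt x (A (p + t • (y - p)) (y - p) (x t)) (Icc 0 1) t := by
    by_cases hy : y ∈ ball p r
    · obtain ⟨x, h⟩ := exists_radial_solution hy hM (hA.continuousOn.mono hrU) hb X₀ hMr
      exact ⟨x, fun _ => h⟩
    · exact ⟨0, fun h => absurd h hy⟩
  choose x hx using hsol
  have hder : ∀ y ∈ ball p r, HasFDerivAt (fun z => x z 1) ((A y).flip (x y 1)) y := by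
    intro y hy
    obtain ⟨hy0, hyd⟩ := hx y hy
    have hmem (z : E) (hz : z ∈ ball p r) (t : ℝ) (ht : t ∈ Icc (0 : ℝ) 1) :
        p + t • (z - p) ∈ ball p r :=
      (convex_ball p r).add_smul_sub_mem (mem_ball_self hr) hz ht
    have hxc : ContinuousOn (x y) (Icc 0 1) := fun t ht => (hyd t ht).continuousWithinAt
    obtain ⟨N, hN⟩ := isCompact_Icc.exists_bound_of_continuousOn hxc
    have hN0 : 0 ≤ N := (norm_nonneg _).trans (hN 0 (by simp))
    have hyr : ‖y - p‖ ≤ r := by rw [← dist_eq_norm]; exact (mem_ball.1 hy).le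
    -- the error in the first-order expansion satisfies a Grönwall estimate
    obtain ⟨C, hC⟩ : ∃ C : ℝ, ∀ h, y + h ∈ ball p r →
        ‖x (y + h) 1 - x y 1 - A y h (x y 1)‖ ≤ C * ‖h‖ ^ 2 := by
      set C₀ : ℝ := (L * r + M + (2 * L * r + M) * r * M + M * M) * N with hC₀
      set K : ℝ := M * r + 1 with hK
      have hK0 : 0 < K := by positivity
      refine ⟨C₀ / K * (Real.exp K - 1), fun h hh => ?_⟩
      obtain ⟨hz0, hzd⟩ := hx (y + h) hh
      have hzr : ‖y + h - p‖ ≤ r := by rw [← dist_eq_norm]; exact (mem_ball.1 hh).le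
      set c : ℝ → E := fun t => p + t • (y - p) with hc
      have hcd (t : ℝ) : HasDerivAt c (y - p) t := by
        simpa [hc] using ((hasDerivAt_id t).smul_const (y - p)).const_add p
      have hAd (t : ℝ) (ht : t ∈ Icc (0 : ℝ) 1) :
          HasDerivAt (fun t => A (c t)) (fderiv ℝ A (c t) (y - p)) t :=
        ((hA.contDiffAt (hU.mem_nhds (hrU (hmem y hy t ht)))).differentiableAt
          (by simp)).hasFDerivAt.comp_hasDerivAt (f := c) t (hcd t)
      set e : ℝ → V := fun t => x (y + h) t - x y t - t • A (c t) h (x y t) with he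
      set e' : ℝ → V := fun t => A (p + t • (y + h - p)) (y + h - p) (x (y + h) t)
        - A (c t) (y - p) (x y t) - (t • (A (c t) h (A (c t) (y - p) (x y t))
          + fderiv ℝ A (c t) (y - p) h (x y t)) + A (c t) h (x y t)) with he'
      have hed (t : ℝ) (ht : t ∈ Icc (0 : ℝ) 1) : HasDerivWithinAt e (e' t) (Icc 0 1) t := by
        have h1 : HasDerivWithinAt (fun t => A (c t) h) (fderiv ℝ A (c t) (y - p) h) (Icc 0 1) t := by
          simpa using ((hAd t ht).clm_apply (hasDerivAt_const t h)).hasDerivWithinAt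
        have h2 := (hasDerivWithinAt_id t (Icc 0 1)).smul (h1.clm_apply (hyd t ht))
        refine (((hzd t ht).sub (hyd t ht)).sub h2).congr_deriv ?_
        simp only [he', id, one_smul]
        rw [add_comm (fderiv ℝ A (c t) (y - p) h (x y t))]
      have hbound (t : ℝ) (ht : t ∈ Ico (0 : ℝ) 1) : ‖e' t‖ ≤ K * ‖e t‖ + C₀ * ‖h‖ ^ 2 := by
        have ht' : t ∈ Icc (0 : ℝ) 1 := ⟨ht.1, ht.2.le⟩
        set B := A (p + t • (y + h - p)) with hB
        set a := A (c t) with ha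
        set D := fderiv ℝ A (c t) with hD
        have hfl := congrArg (fun T : V →L[ℝ] V => T (x y t))
          (flat (c t) (hrU (hmem y hy t ht')) (y - p) h)
        simp only [add_apply, ContinuousLinearMap.comp_apply] at hfl
        have key : e' t = B (y + h - p) (e t) + (B - a - t • D h) (y + h - p) (x y t)
            + t • D h h (x y t) + t • (B - a) (y + h - p) (a h (x y t)) + t • a h (a h (x y t)) := by
          have hfl' : a h (a (y - p) (x y t)) + D (y - p) h (x y t)
              = D h (y - p) (x y t) + a (y - p) (a h (x y t)) := by rw [← hfl]; abel
          have hyh : y + h - p = (y - p) + h := by abel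
          simp only [he', he]
          rw [← hB, ← ha, ← hD, hfl', hyh]
          simp only [map_add, map_sub, map_smul, add_apply,
            sub_apply, smul_apply, smul_add, smul_sub]
          module
        have hpt : p + t • (y + h - p) - c t = t • h := by
          simp only [hc]; module
        have hq := hT (c t) (hmem y hy t ht') _ (hmem _ hh t ht')
        rw [hpt, map_smul, ← hB, ← ha, ← hD, norm_smul, Real.norm_of_nonneg ht.1] at hq
        have ht1 := ht.2.le
        have hth : t * ‖h‖ ≤ ‖h‖ := mul_le_of_le_one_left (norm_nonneg _) ht1
        have hth0 : 0 ≤ t * ‖h‖ := mul_nonneg ht.1 (norm_nonneg _)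
        have hq1 : ‖B - a - t • D h‖ ≤ L * ‖h‖ ^ 2 := hq.trans (by gcongr)
        have hDn : ‖D‖ ≤ M := hb' _ (hmem y hy t ht')
        have han : ‖a‖ ≤ M := hb _ (hmem y hy t ht')
        have hBn : ‖B‖ ≤ M := hb _ (hmem _ hh t ht')
        have hhr : ‖h‖ ≤ 2 * r := by
          have : h = (y + h - p) - (y - p) := by abel
          rw [this]; exact (norm_sub_le _ _).trans (by linarith)
        have hDh : ‖t • D h‖ ≤ M * ‖h‖ := by
          rw [norm_smul, Real.norm_of_nonneg ht.1]
          calc t * ‖D h‖ ≤ 1 * (M * ‖h‖) := by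
                gcongr
                exact (D.le_opNorm h).trans (by gcongr)
            _ = _ := one_mul _
        have hBa : ‖B - a‖ ≤ (2 * L * r + M) * ‖h‖ := by
          calc ‖B - a‖ = ‖(B - a - t • D h) + t • D h‖ := by rw [sub_add_cancel]
            _ ≤ L * ‖h‖ ^ 2 + M * ‖h‖ := (norm_add_le _ _).trans (add_le_add hq1 hDh)
            _ ≤ L * (‖h‖ * (2 * r)) + M * ‖h‖ := by rw [pow_two]; gcongr
            _ = _ := by ring
        have n3 (T : E →L[ℝ] V →L[ℝ] V) (u : E) (v : V) {b₁ b₂ b₃ : ℝ} (h₁ : ‖T‖ ≤ b₁)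
            (h₂ : ‖u‖ ≤ b₂) (h₃ : ‖v‖ ≤ b₃) : ‖T u v‖ ≤ b₁ * b₂ * b₃ :=
          (T.le_opNorm₂ u v).trans (by
            have := norm_nonneg T; have := norm_nonneg u; have := norm_nonneg v
            have := h₁.trans' (norm_nonneg T); have := h₂.trans' (norm_nonneg u)
            gcongr)
        have ht0 (v : V) : ‖t • v‖ ≤ ‖v‖ := by
          rw [norm_smul, Real.norm_of_nonneg ht.1]
          exact mul_le_of_le_one_left (norm_nonneg _) ht1
        have b1 := n3 B (y + h - p) (e t) hBn hzr le_rfl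
        have b2 := n3 (B - a - t • D h) (y + h - p) (x y t) hq1 hzr (hN t ht')
        have b3 : ‖t • D h h (x y t)‖ ≤ M * ‖h‖ * ‖h‖ * N :=
          (ht0 _).trans (n3 (D h) h (x y t) ((D.le_opNorm h).trans (by gcongr)) le_rfl (hN t ht'))
        have ba := n3 a h (x y t) han le_rfl (hN t ht')
        have b4 : ‖t • (B - a) (y + h - p) (a h (x y t))‖
            ≤ (2 * L * r + M) * ‖h‖ * r * (M * ‖h‖ * N) :=
          (ht0 _).trans (n3 _ _ _ hBa hzr ba)
        have b5 : ‖t • a h (a h (x y t))‖ ≤ M * ‖h‖ * (M * ‖h‖ * N) :=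
          (ht0 _).trans (n3 _ _ _ han le_rfl ba)
        rw [key]
        calc _ ≤ M * r * ‖e t‖ + L * ‖h‖ ^ 2 * r * N + M * ‖h‖ * ‖h‖ * N
              + (2 * L * r + M) * ‖h‖ * r * (M * ‖h‖ * N) + M * ‖h‖ * (M * ‖h‖ * N) :=
              norm_add_le_of_le (norm_add_le_of_le (norm_add_le_of_le (norm_add_le_of_le b1 b2) b3)
                b4) b5
          _ = M * r * ‖e t‖ + C₀ * ‖h‖ ^ 2 := by rw [hC₀]; ring
          _ ≤ K * ‖e t‖ + C₀ * ‖h‖ ^ 2 := by rw [hK]; gcongr; linarith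
      have hfin := norm_le_gronwallBound_of_norm_deriv_right_le (f := e) (f' := e') (δ := 0)
        (K := K) (ε := C₀ * ‖h‖ ^ 2) (a := 0) (b := 1)
        (fun t ht => (hed t ht).continuousWithinAt)
        (fun t ht => (hed t ⟨ht.1, ht.2.le⟩).mono_of_mem_nhdsWithin (Icc_mem_nhdsGE_of_mem ht))
        (by simp [he, hy0, hz0]) hbound 1 (by simp)
      rw [gronwallBound_of_K_ne_0 hK0.ne'] at hfin
      simp only [he, hc, one_smul, add_sub_cancel] at hfin
      refine hfin.trans (le_of_eq ?_)
      simp; ring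
    rw [hasFDerivAt_iff_isLittleO_nhds_zero]
    refine Asymptotics.IsBigO.trans_isLittleO (g := fun h : E => ‖h‖ ^ 2) ?_ ?_
    · refine Asymptotics.IsBigO.of_bound C ?_
      have : ∀ᶠ h in nhds (0 : E), y + h ∈ ball p r :=
        (by fun_prop : Continuous fun h : E => y + h).continuousAt.eventually
          (isOpen_ball.mem_nhds (by simpa using hy))
      filter_upwards [this] with h hh
      simpa using hC h hh
    · exact (Asymptotics.isLittleO_norm_pow_id one_lt_two)
  refine ⟨r, hr, hrU, fun y => x y 1, ?_, ?_, hder⟩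
  · have hn (n : ℕ) : ContDiffOn ℝ n (fun y => x y 1) (ball p r) := by
      induction n with
      | zero =>
        exact contDiffOn_zero.2 fun y hy => (hder y hy).continuousAt.continuousWithinAt
      | succ n ih =>
        rw [Nat.cast_add, Nat.cast_one, contDiffOn_succ_iff_fderiv_of_isOpen isOpen_ball]
        refine ⟨fun y hy => (hder y hy).differentiableAt.differentiableWithinAt, by simp, ?_⟩
        refine ContDiffOn.congr (f := fun y => (A y).flip (x y 1)) ?_ fun y hy => (hder y hy).fderiv
        have hAn : ContDiffOn ℝ n A (ball p r) := (hA.mono hrU).of_le (by exact_mod_cast le_top)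
        have hfl : ContDiffOn ℝ n (fun y => (A y).flip) (ball p r) :=
          (ContinuousLinearMap.flipₗᵢ ℝ E V V).contDiff.comp_contDiffOn hAn
        exact hfl.clm_apply ih
    exact contDiffOn_infty.2 hn
  · obtain ⟨h0, hd⟩ := hx p (mem_ball_self hr)
    rw [← h0]
    refine constant_of_has_deriv_right_zero (f := x p) (a := 0) (b := 1)
      (fun t ht => (hd t ht).continuousWithinAt) (fun t ht => ?_) 1 (by simp)
    have := (hd t ⟨ht.1, ht.2.le⟩).mono_of_mem_nhdsWithin (Icc_mem_nhdsGE_of_mem ht)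
    simpa using this

end Parallel

/-! ### The Levi-Civita connection over a differential ring -/

section Christoffel

variable {R : Type*} [CommRing R] [Algebra ℝ R] (D : Fin 4 → Derivation ℝ R R)

/-- The Christoffel symbols `Γ^k_{ij}` of the matrix `g`, arranged as matrices `Γ_i`. -/
def chr (g : Matrix (Fin 4) (Fin 4) R) (i : Fin 4) : Matrix (Fin 4) (Fin 4) R :=
  Matrix.of fun k j => (1 / 2 : ℝ) • ∑ l, g⁻¹ k l * (D i (g j l) + D j (g i l) - D l (g i j))

variable {D}

theorem map_mul_der (d : Derivation ℝ R R) (M N : Matrix (Fin 4) (Fin 4) R) :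
    (M * N).map d = M.map d * N + M * N.map d := by
  ext i j
  simp only [Matrix.map_apply, Matrix.mul_apply, Matrix.add_apply, map_sum, Derivation.leibniz,
    smul_eq_mul, Finset.sum_add_distrib]
  rw [add_comm]
  congr 1
  exact Finset.sum_congr rfl fun k _ => mul_comm _ _

theorem map_one_der (d : Derivation ℝ R R) : (1 : Matrix (Fin 4) (Fin 4) R).map d = 0 := by
  ext i j
  by_cases h : i = j <;> simp [h]

theorem half_add_half (a : R) : (1 / 2 : ℝ) • a + (1 / 2 : ℝ) • a = a := by
  rw [← add_smul]; norm_num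

variable {g : Matrix (Fin 4) (Fin 4) R}

theorem chr_symm (hs : g.transpose = g) (i j k : Fin 4) : chr D g i k j = chr D g j k i := by
  have h (a b) : g a b = g b a := congrFun (congrFun hs b) a
  simp only [chr, Matrix.of_apply]
  congr 1
  exact Finset.sum_congr rfl fun l _ => by rw [h i j]; ring

theorem mul_chr (hu : IsUnit g.det) (i m j : Fin 4) :
    (g * chr D g i) m j = (1 / 2 : ℝ) • (D i (g j m) + D j (g i m) - D m (g i j)) := by
  set v : Fin 4 → R := fun l => D i (g j l) + D j (g i l) - D l (g i j) with hv
  have h2 : (g * chr D g i) m j = (1 / 2 : ℝ) • (g.mulVec (g⁻¹.mulVec v)) m := by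
    change ∑ k, g m k * ((1 / 2 : ℝ) • ∑ l, g⁻¹ k l * v l)
      = (1 / 2 : ℝ) • ∑ k, g m k * ∑ l, g⁻¹ k l * v l
    rw [Finset.smul_sum]
    exact Finset.sum_congr rfl fun k _ => by rw [mul_smul_comm]
  rw [h2, Matrix.mulVec_mulVec, Matrix.mul_nonsing_inv _ hu, Matrix.one_mulVec]

theorem map_der_eq_chr (hs : g.transpose = g) (hu : IsUnit g.det) (i : Fin 4) :
    g.map (D i) = g * chr D g i + (g * chr D g i).transpose := by
  have h (a b) : g a b = g b a := congrFun (congrFun hs b) a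
  ext a b
  rw [Matrix.add_apply, Matrix.transpose_apply, mul_chr hu, mul_chr hu, ← smul_add,
    Matrix.map_apply, h b a]
  refine (half_add_half _).symm.trans ?_
  rw [← smul_add]
  congr 1
  ring

end Christoffel

section Frame

variable {R : Type*} [CommRing R] [Algebra ℝ R] {D : Fin 4 → Derivation ℝ R R}
  {T E : Matrix (Fin 4) (Fin 4) R} {C : Fin 4 → Matrix (Fin 4) (Fin 4) R}

/-- The connection matrix `ω_i` in the frame `E` (with dual coframe `T`) of the connection with
symbols `C`. -/
def connMat (D : Fin 4 → Derivation ℝ R R) (T E : Matrix (Fin 4) (Fin 4) R)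
    (C : Fin 4 → Matrix (Fin 4) (Fin 4) R) (i : Fin 4) : Matrix (Fin 4) (Fin 4) R :=
  T * (E.map (D i) + C i * E)

/-- The components `G a b c = Γ^a_b(e_c)` in a frame. -/
def frameConn (E : Matrix (Fin 4) (Fin 4) R) (w : Fin 4 → Matrix (Fin 4) (Fin 4) R)
    (a b c : Fin 4) : R := ∑ i, E i c * w i a b

/-- The derivation along the vector field `e_a` of a frame. -/
def frameDer (D : Fin 4 → Derivation ℝ R R) (E : Matrix (Fin 4) (Fin 4) R) (a : Fin 4) :
    Derivation ℝ R R := ∑ i, E i a • D i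

theorem frameDer_apply (a : Fin 4) (f : R) : frameDer D E a f = ∑ i, E i a * D i f := by
  simp [frameDer, Fin.sum_univ_four]

theorem mul_connMat (hET : E * T = 1) (i : Fin 4) :
    E * connMat D T E C i = E.map (D i) + C i * E := by
  rw [connMat, ← Matrix.mul_assoc, hET, Matrix.one_mul]

/-- The bracket `[e_b, e_c]` of two frame fields, for a torsion-free connection. -/
theorem bracket_frame (hET : E * T = 1) (hC : ∀ i j k, C i k j = C j k i) (b c j : Fin 4) :
    ∑ i, (E i b * D i (E j c) - E i c * D i (E j b)) =
      ∑ a, E j a * (frameConn E (connMat D T E C) a c b - frameConn E (connMat D T E C) a b c) := by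
  have h (b c : Fin 4) : ∑ a, E j a * frameConn E (connMat D T E C) a c b
      = ∑ i, E i b * D i (E j c) + ∑ i, ∑ k, E i b * (C i j k * E k c) := by
    simp only [frameConn, Finset.mul_sum]
    rw [Finset.sum_comm, ← Finset.sum_add_distrib]
    refine Finset.sum_congr rfl fun i _ => ?_
    have := congrFun (congrFun (mul_connMat (D := D) (C := C) hET i) j) c
    simp only [Matrix.mul_apply, Matrix.add_apply, Matrix.map_apply] at this
    calc _ = E i b * ∑ a, E j a * connMat D T E C i a c := by
          rw [Finset.mul_sum]; exact Finset.sum_congr rfl fun a _ => by ring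
      _ = _ := by rw [this, mul_add, Finset.mul_sum]
  simp only [mul_sub, Finset.sum_sub_distrib]
  rw [h b c, h c b]
  have : ∑ i, ∑ k, E i b * (C i j k * E k c) = ∑ i, ∑ k, E i c * (C i j k * E k b) := by
    rw [Finset.sum_comm]
    exact Finset.sum_congr rfl fun i _ => Finset.sum_congr rfl fun k _ => by rw [hC k i j]; ring
  rw [this]; ring

theorem frameDer_comm (hD : ∀ i j f, D i (D j f) = D j (D i f)) (hET : E * T = 1)
    (hC : ∀ i j k, C i k j = C j k i) (b c : Fin 4) (f : R) :
    frameDer D E b (frameDer D E c f) - frameDer D E c (frameDer D E b f) =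
      ∑ a, (frameConn E (connMat D T E C) a c b - frameConn E (connMat D T E C) a b c)
        * frameDer D E a f := by
  have h (b c : Fin 4) : frameDer D E b (frameDer D E c f) =
      ∑ j, (∑ i, E i b * D i (E j c)) * D j f + ∑ i, ∑ j, E i b * E j c * D i (D j f) := by
    rw [frameDer_apply b, frameDer_apply c]
    simp only [map_sum, Derivation.leibniz, smul_eq_mul, Finset.mul_sum, Finset.sum_mul]
    rw [Finset.sum_comm (f := fun j i => E i b * D i (E j c) * D j f), ← Finset.sum_add_distrib]
    refine Finset.sum_congr rfl fun i _ => ?_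
    rw [← Finset.sum_add_distrib]
    exact Finset.sum_congr rfl fun j _ => by ring
  have h2 : ∑ i, ∑ j, E i b * E j c * D i (D j f) = ∑ i, ∑ j, E i c * E j b * D i (D j f) := by
    rw [Finset.sum_comm]
    exact Finset.sum_congr rfl fun i _ => Finset.sum_congr rfl fun j _ => by rw [hD j i]; ring
  rw [h b c, h c b, h2]
  have h3 : ∑ j, (∑ i, (E i b * D i (E j c) - E i c * D i (E j b))) * D j f =
      ∑ a, (frameConn E (connMat D T E C) a c b - frameConn E (connMat D T E C) a b c)
        * frameDer D E a f := by
    simp only [bracket_frame hET hC, frameDer_apply, Finset.sum_mul, Finset.mul_sum]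
    rw [Finset.sum_comm]
    exact Finset.sum_congr rfl fun i _ => Finset.sum_congr rfl fun j _ => by ring
  rw [← h3]
  simp only [Finset.sum_sub_distrib, sub_mul]
  ring

/-- The curvature matrices of a connection with symbols `C`. -/
def curvMat (D : Fin 4 → Derivation ℝ R R) (C : Fin 4 → Matrix (Fin 4) (Fin 4) R) (i j : Fin 4) :
    Matrix (Fin 4) (Fin 4) R := (C j).map (D i) - (C i).map (D j) + (C i * C j - C j * C i)

theorem map_der_inv (hTE : T * E = 1) (hET : E * T = 1) (d : Derivation ℝ R R) :
    T.map d = -(T * E.map d * T) := by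
  have h := map_mul_der d T E
  rw [hTE, map_one_der] at h
  have h2 : T.map d * E * T = -(T * E.map d) * T := by rw [eq_neg_of_add_eq_zero_left h.symm]
  rwa [Matrix.mul_assoc, hET, Matrix.mul_one, neg_mul] at h2

theorem map_add_der (d : Derivation ℝ R R) (M N : Matrix (Fin 4) (Fin 4) R) :
    (M + N).map d = M.map d + N.map d := by ext; simp

/-- Gauge covariance of the curvature. -/
theorem curvMat_connMat (hD : ∀ i j f, D i (D j f) = D j (D i f)) (hTE : T * E = 1)
    (hET : E * T = 1) (i j : Fin 4) :
    curvMat D (connMat D T E C) i j = T * curvMat D C i j * E := by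
  have h2 : (E.map (D j)).map (D i) = (E.map (D i)).map (D j) := by ext; simp [hD i j]
  have hd (i j : Fin 4) : (connMat D T E C j).map (D i) =
      -(T * E.map (D i) * T * (E.map (D j) + C j * E)) + T * ((E.map (D j)).map (D i)
        + ((C j).map (D i) * E + C j * E.map (D i))) := by
    rw [connMat, map_mul_der, map_der_inv hTE hET, map_add_der, map_mul_der, neg_mul]
  have hp (i j : Fin 4) : connMat D T E C i * connMat D T E C j =
      T * E.map (D i) * T * (E.map (D j) + C j * E) + T * C i * (E.map (D j) + C j * E) := by
    calc _ = T * E.map (D i) * T * (E.map (D j) + C j * E)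
          + T * C i * (E * T) * (E.map (D j) + C j * E) := by simp only [connMat]; noncomm_ring
      _ = _ := by rw [hET, Matrix.mul_one]
  rw [curvMat, hd i j, hd j i, hp i j, hp j i, h2, curvMat]
  noncomm_ring

/-- The curvature in a frame, expressed through the components of the connection. -/
def frameCurv (d : Fin 4 → Derivation ℝ R R) (G : Fin 4 → Fin 4 → Fin 4 → R) (a b c e : Fin 4) :
    R := d c (G a b e) - d e (G a b c) + ∑ m, (G a m c * G m b e - G a m e * G m b c)
      - ∑ m, (G m e c - G m c e) * G a b m

theorem frameCurv_eq (hET : E * T = 1) (hC : ∀ i j k, C i k j = C j k i) (a b c e : Fin 4) :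
    frameCurv (frameDer D E) (frameConn E (connMat D T E C)) a b c e =
      ∑ i, ∑ j, E i c * E j e * curvMat D (connMat D T E C) i j a b := by
  set w := connMat D T E C with hw
  have h1 (c e : Fin 4) : frameDer D E c (frameConn E w a b e) =
      ∑ j, (∑ i, E i c * D i (E j e)) * w j a b + ∑ i, ∑ j, E i c * E j e * D i (w j a b) := by
    rw [frameDer_apply c, frameConn]
    simp only [map_sum, Derivation.leibniz, smul_eq_mul, Finset.mul_sum, Finset.sum_mul]
    rw [Finset.sum_comm (f := fun j i => E i c * D i (E j e) * w j a b), ← Finset.sum_add_distrib]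
    refine Finset.sum_congr rfl fun i _ => ?_
    rw [← Finset.sum_add_distrib]
    exact Finset.sum_congr rfl fun j _ => by ring
  have h2 : ∑ m, (frameConn E w m e c - frameConn E w m c e) * frameConn E w a b m =
      ∑ j, (∑ i, (E i c * D i (E j e) - E i e * D i (E j c))) * w j a b := by
    simp only [hw, bracket_frame hET hC, Finset.sum_mul]
    rw [Finset.sum_comm]
    refine Finset.sum_congr rfl fun m _ => ?_
    conv_lhs => rw [frameConn.eq_def E (connMat D T E C) a b m, Finset.mul_sum]
    exact Finset.sum_congr rfl fun j _ => by ring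
  have h3 (c e : Fin 4) : ∑ m, frameConn E w a m c * frameConn E w m b e =
      ∑ i, ∑ j, E i c * E j e * (w i * w j) a b := by
    simp only [frameConn, Finset.sum_mul_sum]
    rw [Finset.sum_comm]
    refine Finset.sum_congr rfl fun i _ => ?_
    rw [Finset.sum_comm]
    simp only [Matrix.mul_apply, Finset.mul_sum]
    exact Finset.sum_congr rfl fun j _ => Finset.sum_congr rfl fun m _ => by ring
  have hsw (F : Fin 4 → Fin 4 → R) : ∑ i, ∑ j, E i e * E j c * F i j
      = ∑ i, ∑ j, E i c * E j e * F j i := by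
    rw [Finset.sum_comm]
    exact Finset.sum_congr rfl fun i _ => Finset.sum_congr rfl fun j _ => by ring
  rw [frameCurv, h1, h1, h2, Finset.sum_sub_distrib, h3, h3, hsw, hsw]
  simp only [curvMat, Matrix.add_apply, Matrix.sub_apply, Matrix.map_apply, mul_add, mul_sub,
    Finset.sum_add_distrib, Finset.sum_sub_distrib, sub_mul]
  ring

end Frame

section Bianchi

variable {R : Type*} [CommRing R] [Algebra ℝ R] {d : Fin 4 → Derivation ℝ R R}
  {G : Fin 4 → Fin 4 → Fin 4 → R}

set_option maxHeartbeats 4000000 in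
/-- The second Bianchi identity in a frame. The terms in the last line vanish by the first Bianchi
identity. -/
theorem frame_bianchi
    (hc : ∀ b c f, d b (d c f) - d c (d b f) = ∑ a, (G a c b - G a b c) * d a f)
    (a a' b c e : Fin 4) :
    (d b (frameCurv d G a a' c e) + d c (frameCurv d G a a' e b) + d e (frameCurv d G a a' b c))
      + ∑ m, (G a m b * frameCurv d G m a' c e - frameCurv d G a m c e * G m a' b
        + (G a m c * frameCurv d G m a' e b - frameCurv d G a m e b * G m a' c)
        + (G a m e * frameCurv d G m a' b c - frameCurv d G a m b c * G m a' e))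
      - ∑ m, ((G m c b - G m b c) * frameCurv d G a a' m e
        + (G m e c - G m c e) * frameCurv d G a a' m b
        + (G m b e - G m e b) * frameCurv d G a a' m c)
      + ∑ n, G a a' n * (frameCurv d G n b c e + frameCurv d G n c e b + frameCurv d G n e b c)
      = 0 := by
  have h1 := hc b c (G a a' e)
  have h2 := hc c e (G a a' b)
  have h3 := hc e b (G a a' c)
  simp only [Fin.sum_univ_four] at h1 h2 h3
  simp only [frameCurv, Fin.sum_univ_four, map_add, map_sub, Derivation.leibniz, smul_eq_mul]
  linear_combination h1 + h2 + h3

end Bianchi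

/-! ### Null coframes and their Levi-Civita connection forms -/

/-- `θ` is a smooth coframe on `U` with `g = 2 θ¹ θ³ + 2 θ² θ⁴`. -/
structure IsNullCoframeOn (U : Opens E4) (g : BilinField) (θ : FormQuad) : Prop where
  smooth : ∀ a, ContDiffOn ℝ ∞ (fun x => θ x a) U
  indep : ∀ x ∈ U, LinearIndependent ℝ (θ x)
  metric : ∀ x ∈ U, ∀ v w,
    g x v w = θ x 0 v * θ x 2 w + θ x 2 v * θ x 0 w + θ x 1 v * θ x 3 w + θ x 3 v * θ x 1 w

theorem sum_smul_bvec (v : E4) : ∑ i, v i • bvec i = v := by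
  ext k
  simp [bvec, Finset.sum_apply, Pi.single_apply]

section Dual

variable {θ : Fin 4 → E4 →L[ℝ] ℝ}

/-- The matrix of a quadruple of covectors. -/
def cofMat (θ : Fin 4 → E4 →L[ℝ] ℝ) : Matrix (Fin 4) (Fin 4) ℝ := Matrix.of fun a j => θ a (bvec j)

theorem apply_eq_sum (φ : E4 →L[ℝ] ℝ) (v : E4) : φ v = ∑ i, φ (bvec i) * v i := by
  conv_lhs => rw [← sum_smul_bvec v]
  simp [mul_comm]

theorem isUnit_cofMat (h : LinearIndependent ℝ θ) : IsUnit (cofMat θ) := by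
  rw [← Matrix.linearIndependent_rows_iff_isUnit]
  let L : (E4 →L[ℝ] ℝ) →ₗ[ℝ] (Fin 4 → ℝ) :=
    { toFun := fun φ j => φ (bvec j), map_add' := fun _ _ => rfl, map_smul' := fun _ _ => rfl }
  have hL : LinearMap.ker L = ⊥ := by
    rw [LinearMap.ker_eq_bot']
    intro φ hφ
    ext v
    rw [apply_eq_sum]
    simp [show ∀ i, φ (bvec i) = 0 from fun i => congrFun hφ i]
  exact h.map' L hL

theorem dualVec_apply (b i : Fin 4) : dualVec θ b i = (cofMat θ)⁻¹ i b := by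
  simp [dualVec, bvec, Pi.single_apply, cofMat]

theorem isUnit_det_cofMat (h : LinearIndependent ℝ θ) : IsUnit (cofMat θ).det :=
  (Matrix.isUnit_iff_isUnit_det _).1 (isUnit_cofMat h)

theorem apply_dualVec (h : LinearIndependent ℝ θ) (a b : Fin 4) :
    θ a (dualVec θ b) = if a = b then 1 else 0 := by
  rw [apply_eq_sum]
  simp only [dualVec_apply]
  change (cofMat θ * (cofMat θ)⁻¹) a b = _
  rw [Matrix.mul_nonsing_inv _ (isUnit_det_cofMat h), Matrix.one_apply]

theorem sum_smul_dualVec (h : LinearIndependent ℝ θ) (v : E4) :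
    ∑ b, θ b v • dualVec θ b = v := by
  ext i
  have : ((cofMat θ)⁻¹ * cofMat θ).mulVec v i = v i := by
    rw [Matrix.nonsing_inv_mul _ (isUnit_det_cofMat h), Matrix.one_mulVec]
  rw [← this, ← Matrix.mulVec_mulVec]
  simp only [Matrix.mulVec, dotProduct, PiLp.smul_apply, WithLp.ofLp_sum, Finset.sum_apply,
    dualVec_apply, smul_eq_mul]
  exact Finset.sum_congr rfl fun b _ => by
    rw [apply_eq_sum (θ b)]; simp [cofMat, mul_comm]

theorem dualVec_eq (h : LinearIndependent ℝ θ) {b : Fin 4} {v : E4}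
    (hv : ∀ a, θ a v = if a = b then 1 else 0) : dualVec θ b = v := by
  rw [← sum_smul_dualVec h v]; simp [hv]

theorem linearIndependent_of_dual {e : Fin 4 → E4}
    (h : ∀ a b, θ a (e b) = if a = b then 1 else 0) : LinearIndependent ℝ θ := by
  rw [Fintype.linearIndependent_iff]
  intro c hc i
  have := congrArg (fun φ : E4 →L[ℝ] ℝ => φ (e i)) hc
  simpa [h] using this

end Dual

section Ring

variable (U : Opens E4) (g : BilinField) (θ : FormQuad)

/-- The components `g_{ij}`, in the ring of smooth functions. -/
def gramSm : Matrix (Fin 4) (Fin 4) (Sm U) := Matrix.of fun i j => Sm.of U fun x => gram g x i j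

/-- The components of a coframe, in the ring of smooth functions. -/
def cofSm : Matrix (Fin 4) (Fin 4) (Sm U) := Matrix.of fun a i => Sm.of U fun x => θ x a (bvec i)

/-- The derivations along the frame dual to `θ`. -/
def dF : Fin 4 → Derivation ℝ (Sm U) (Sm U) := frameDer Sm.coordDer (cofSm U θ)⁻¹

/-- The connection matrices in the frame dual to `θ`. -/
def cW : Fin 4 → Matrix (Fin 4) (Fin 4) (Sm U) :=
  connMat Sm.coordDer (cofSm U θ) (cofSm U θ)⁻¹ (chr Sm.coordDer (gramSm U g))

/-- The components `Γ^a_b(e_c)` in the frame dual to `θ`. -/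
def cG : Fin 4 → Fin 4 → Fin 4 → Sm U := frameConn (cofSm U θ)⁻¹ (cW U g θ)

end Ring

section Basic

variable {U : Opens E4} {θ : FormQuad}

theorem ev_cofSm (hs : ∀ a, ContDiffOn ℝ ∞ (fun x => θ x a) U) (x : U) (a i : Fin 4) :
    Sm.ev x (cofSm U θ a i) = θ x a (bvec i) :=
  Sm.ev_of (F := fun x => θ x a (bvec i)) ((hs a).clm_apply contDiffOn_const) x

theorem map_cofSm (hs : ∀ a, ContDiffOn ℝ ∞ (fun x => θ x a) U) (x : U) :
    (cofSm U θ).map (Sm.ev x) = cofMat (θ x) := by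
  ext a i; exact ev_cofSm hs x a i

theorem isUnit_det_of_ev {M : Matrix (Fin 4) (Fin 4) (Sm U)}
    (h : ∀ x, IsUnit (M.map (Sm.ev x)).det) : IsUnit M.det :=
  Sm.isUnit_of_ne_zero fun x => by
    have := (h x).ne_zero
    rwa [← AlgHom.mapMatrix_apply, ← AlgHom.map_det] at this

theorem isUnit_det_cofSm (hs : ∀ a, ContDiffOn ℝ ∞ (fun x => θ x a) U)
    (hi : ∀ x ∈ U, LinearIndependent ℝ (θ x)) : IsUnit (cofSm U θ).det :=
  isUnit_det_of_ev fun x => by rw [map_cofSm hs]; exact isUnit_det_cofMat (hi x x.2)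

theorem map_inv_ev {M : Matrix (Fin 4) (Fin 4) (Sm U)} (h : IsUnit M.det) (x : U) :
    M⁻¹.map (Sm.ev x) = (M.map (Sm.ev x))⁻¹ := by
  refine (Matrix.inv_eq_right_inv ?_).symm
  have := congrArg (fun N => N.map (Sm.ev x)) (Matrix.mul_nonsing_inv _ h)
  simpa [Matrix.map_mul] using this

theorem ev_inv_cofSm (hs : ∀ a, ContDiffOn ℝ ∞ (fun x => θ x a) U)
    (hi : ∀ x ∈ U, LinearIndependent ℝ (θ x)) (x : U) (i b : Fin 4) :
    Sm.ev x ((cofSm U θ)⁻¹ i b) = dualVec (θ x) b i := by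
  rw [dualVec_apply, ← map_cofSm hs, ← map_inv_ev (isUnit_det_cofSm hs hi)]; rfl

theorem ev_dF (hs : ∀ a, ContDiffOn ℝ ∞ (fun x => θ x a) U)
    (hi : ∀ x ∈ U, LinearIndependent ℝ (θ x)) (x : U) (a : Fin 4) (f : Sm U) :
    Sm.ev x (dF U θ a f) = fderiv ℝ f.fn x (dualVec (θ x) a) := by
  rw [dF, frameDer_apply, map_sum, apply_eq_sum]
  exact Finset.sum_congr rfl fun i _ => by
    rw [map_mul, ev_inv_cofSm hs hi, Sm.coordDer, Sm.ev_der, mul_comm]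

theorem ev_dF_eq (hs : ∀ a, ContDiffOn ℝ ∞ (fun x => θ x a) U)
    (hi : ∀ x ∈ U, LinearIndependent ℝ (θ x)) {F : E4 → ℝ} {f : Sm U}
    (h : ∀ x : U, Sm.ev x f = F x) (x : U) (a : Fin 4) :
    Sm.ev x (dF U θ a f) = fderiv ℝ F x (dualVec (θ x) a) := by
  rw [ev_dF hs hi, (Sm.eventuallyEq_of h x).fderiv_eq]

theorem contDiffOn_dualVec (hs : ∀ a, ContDiffOn ℝ ∞ (fun x => θ x a) U)
    (hi : ∀ x ∈ U, LinearIndependent ℝ (θ x)) (b : Fin 4) :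
    ContDiffOn ℝ ∞ (fun x => dualVec (θ x) b) U := by
  have : ContDiffOn ℝ ∞ (fun x => ∑ i, ((cofSm U θ)⁻¹ i b).fn x • bvec i) U :=
    ContDiffOn.sum fun i _ => ((cofSm U θ)⁻¹ i b).contDiffOn_fn.smul contDiffOn_const
  refine this.congr fun x hx => ?_
  rw [← sum_smul_bvec (dualVec (θ x) b)]
  exact Finset.sum_congr rfl fun i _ => by
    rw [Sm.fn_apply _ ⟨x, hx⟩, ev_inv_cofSm hs hi]

end Basic

section Null

/-- The Gram matrix of a null coframe as a matrix over a ring. -/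
def nullMat (R : Type*) [CommRing R] : Matrix (Fin 4) (Fin 4) R :=
  Matrix.of fun i j => if j = i + 2 then 1 else 0

theorem nullMat_mul_self (R : Type*) [CommRing R] : nullMat R * nullMat R = 1 := by
  ext i j
  fin_cases i <;> fin_cases j <;> simp [nullMat, Matrix.mul_apply, Fin.sum_univ_four]

theorem nullMat_transpose (R : Type*) [CommRing R] : (nullMat R).transpose = nullMat R := by
  ext i j
  fin_cases i <;> fin_cases j <;> simp [nullMat]

theorem map_nullMat_der {R : Type*} [CommRing R] [Algebra ℝ R] (d : Derivation ℝ R R) :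
    (nullMat R).map d = 0 := by
  ext i j
  by_cases h : j = i + 2 <;> simp [nullMat, h]

variable {U : Opens E4} {g : BilinField} {θ : FormQuad}

theorem isUnit_det_null {R : Type*} [CommRing R] {T : Matrix (Fin 4) (Fin 4) R}
    (hT : IsUnit T.det) : IsUnit (T.transpose * nullMat R * T).det := by
  rw [Matrix.det_mul, Matrix.det_mul, Matrix.det_transpose]
  refine (hT.mul ?_).mul hT
  rw [← Matrix.isUnit_iff_isUnit_det]
  exact IsUnit.of_mul_eq_one _ (nullMat_mul_self R)

namespace IsNullCoframeOn

theorem gram_eq (h : IsNullCoframeOn U g θ) {x : E4} (hx : x ∈ U) :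
    gram g x = (cofMat (θ x)).transpose * nullMat ℝ * cofMat (θ x) := by
  ext i j
  simp [gram, h.metric x hx, Fin.sum_univ_four, nullMat, Matrix.mul_apply, cofMat]; ring

theorem contDiffOn_gram (h : IsNullCoframeOn U g θ) (i j : Fin 4) :
    ContDiffOn ℝ ∞ (fun x => gram g x i j) U := by
  have hc (a i : Fin 4) : ContDiffOn ℝ ∞ (fun x => θ x a (bvec i)) U :=
    (h.smooth a).clm_apply contDiffOn_const
  refine ContDiffOn.congr (f := fun x => θ x 0 (bvec i) * θ x 2 (bvec j)
    + θ x 2 (bvec i) * θ x 0 (bvec j) + θ x 1 (bvec i) * θ x 3 (bvec j)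
    + θ x 3 (bvec i) * θ x 1 (bvec j)) ?_ fun x hx => h.metric x hx _ _
  exact ((((hc 0 i).mul (hc 2 j)).add ((hc 2 i).mul (hc 0 j))).add ((hc 1 i).mul (hc 3 j))).add
    ((hc 3 i).mul (hc 1 j))

theorem ev_gramSm (h : IsNullCoframeOn U g θ) (x : U) (i j : Fin 4) :
    Sm.ev x (gramSm U g i j) = gram g x i j :=
  Sm.ev_of (F := fun x => gram g x i j) (h.contDiffOn_gram i j) x

theorem gramSm_eq (h : IsNullCoframeOn U g θ) :
    gramSm U g = (cofSm U θ).transpose * nullMat (Sm U) * cofSm U θ := by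
  ext i j
  refine Sm.ext fun x => ?_
  rw [h.ev_gramSm, h.gram_eq x.2, ← map_cofSm h.smooth x]
  simp [Matrix.mul_apply, nullMat, apply_ite (Sm.ev x)]

theorem isUnit_det_cof (h : IsNullCoframeOn U g θ) : IsUnit (cofSm U θ).det :=
  isUnit_det_cofSm h.smooth h.indep

theorem isUnit_det_gram (h : IsNullCoframeOn U g θ) : IsUnit (gramSm U g).det := by
  rw [h.gramSm_eq]; exact isUnit_det_null h.isUnit_det_cof

theorem gramSm_symm (h : IsNullCoframeOn U g θ) : (gramSm U g).transpose = gramSm U g := by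
  rw [h.gramSm_eq]
  simp only [Matrix.transpose_mul, Matrix.transpose_transpose, nullMat_transpose, Matrix.mul_assoc]

theorem map_gramSm (h : IsNullCoframeOn U g θ) (x : U) :
    (gramSm U g).map (Sm.ev x) = gram g x := by ext i j; exact h.ev_gramSm x i j

theorem ev_chr (h : IsNullCoframeOn U g θ) (x : U) (i k j : Fin 4) :
    Sm.ev x (chr Sm.coordDer (gramSm U g) i k j) = christoffel g k i j x := by
  have hd (m i j : Fin 4) : Sm.ev x (Sm.coordDer m (gramSm U g i j))
      = pd m (fun z => gram g z i j) x :=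
    Sm.ev_der_of (F := fun z => gram g z i j) (h.contDiffOn_gram i j) _ x
  have hi (k l : Fin 4) : Sm.ev x ((gramSm U g)⁻¹ k l) = (gram g x)⁻¹ k l := by
    rw [← h.map_gramSm, ← map_inv_ev h.isUnit_det_gram]; rfl
  simp only [chr, christoffel, Matrix.of_apply, map_smul, map_sum, map_mul, map_add, map_sub, hd,
    hi, smul_eq_mul]

theorem inv_mul_cof (h : IsNullCoframeOn U g θ) : (cofSm U θ)⁻¹ * cofSm U θ = 1 :=
  Matrix.nonsing_inv_mul _ h.isUnit_det_cof

theorem cof_mul_inv (h : IsNullCoframeOn U g θ) : cofSm U θ * (cofSm U θ)⁻¹ = 1 :=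
  Matrix.mul_nonsing_inv _ h.isUnit_det_cof

theorem chr_gram_symm (h : IsNullCoframeOn U g θ) (i j k : Fin 4) :
    chr Sm.coordDer (gramSm U g) i k j = chr Sm.coordDer (gramSm U g) j k i :=
  chr_symm h.gramSm_symm i j k

theorem connForm_eq_sum (h : IsNullCoframeOn U g θ) (x : U) (a b : Fin 4) (X : E4) :
    connForm g θ a b x X = ∑ i, X i * Sm.ev x (cW U g θ i a b) := by
  have hE (i : Fin 4) := ev_inv_cofSm h.smooth h.indep (U := U) x i b
  have hfd : fderiv ℝ (fun z => dualVec (θ z) b) x X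
      = ∑ k, (∑ i, X i * Sm.ev x (Sm.coordDer i ((cofSm U θ)⁻¹ k b))) • bvec k := by
    have he : (fun z => dualVec (θ z) b) =ᶠ[nhds (x : E4)]
        fun z => ∑ k, ((cofSm U θ)⁻¹ k b).fn z • bvec k := by
      filter_upwards [U.isOpen.mem_nhds x.2] with z hz
      rw [← sum_smul_bvec (dualVec (θ z) b)]
      exact Finset.sum_congr rfl fun k _ => by
        rw [Sm.fn_apply _ ⟨z, hz⟩, ev_inv_cofSm h.smooth h.indep]
    have hder : HasFDerivAt (fun z => ∑ k, ((cofSm U θ)⁻¹ k b).fn z • bvec k)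
        (∑ k, (fderiv ℝ ((cofSm U θ)⁻¹ k b).fn x).smulRight (bvec k)) (x : E4) :=
      HasFDerivAt.fun_sum fun k _ => (Sm.differentiableAt_fn _ x).hasFDerivAt.smul_const _
    rw [he.fderiv_eq, hder.fderiv]
    simp only [sum_apply, ContinuousLinearMap.smulRight_apply]
    refine Finset.sum_congr rfl fun k _ => ?_
    rw [apply_eq_sum]
    congr 1
    exact Finset.sum_congr rfl fun i _ => by rw [Sm.coordDer, Sm.ev_der, mul_comm]
  rw [connForm, hfd, ← Finset.sum_add_distrib]
  simp only [← add_smul, map_sum, map_smul, smul_eq_mul]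
  simp only [cW, connMat, Matrix.mul_apply, Matrix.add_apply, Matrix.map_apply, map_sum, map_mul,
    map_add, h.ev_chr, hE, ev_cofSm h.smooth, Finset.mul_sum]
  rw [Finset.sum_comm]
  refine Finset.sum_congr rfl fun k _ => ?_
  rw [← Finset.sum_add_distrib, Finset.sum_mul]
  refine Finset.sum_congr rfl fun i _ => ?_
  rw [mul_add, mul_add, Finset.mul_sum, Finset.mul_sum, add_mul, Finset.sum_mul]
  congr 1
  · ring
  · exact Finset.sum_congr rfl fun j _ => by ring

theorem ev_cG (h : IsNullCoframeOn U g θ) (x : U) (a b c : Fin 4) :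
    Sm.ev x (cG U g θ a b c) = connForm g θ a b x (dualVec (θ x) c) := by
  rw [h.connForm_eq_sum, cG, frameConn, map_sum]
  exact Finset.sum_congr rfl fun i _ => by rw [map_mul, ev_inv_cofSm h.smooth h.indep]

theorem connForm_eq (h : IsNullCoframeOn U g θ) (x : U) (a b : Fin 4) (X : E4) :
    connForm g θ a b x X = ∑ c, θ x c X * Sm.ev x (cG U g θ a b c) := by
  simp only [h.ev_cG, h.connForm_eq_sum, Finset.mul_sum]
  rw [Finset.sum_comm]
  refine Finset.sum_congr rfl fun i _ => ?_
  conv_lhs => rw [← sum_smul_dualVec (h.indep x x.2) X]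
  simp only [WithLp.ofLp_sum, PiLp.smul_apply, Finset.sum_apply, smul_eq_mul, Finset.sum_mul]
  exact Finset.sum_congr rfl fun c _ => by ring

theorem dF_comm (h : IsNullCoframeOn U g θ) (b c : Fin 4) (f : Sm U) :
    dF U θ b (dF U θ c f) - dF U θ c (dF U θ b f) =
      ∑ a, (cG U g θ a c b - cG U g θ a b c) * dF U θ a f :=
  frameDer_comm (fun _ _ => Sm.der_comm _ _) h.inv_mul_cof h.chr_gram_symm b c f

/-- The connection forms are skew with respect to the metric. -/
theorem cG_skew (h : IsNullCoframeOn U g θ) (a b c : Fin 4) :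
    cG U g θ (a + 2) b c + cG U g θ (b + 2) a c = 0 := by
  set T := cofSm U θ with hT
  set E := T⁻¹ with hE
  have hETg : E.transpose * gramSm U g = nullMat (Sm U) * T := by
    rw [h.gramSm_eq, ← Matrix.mul_assoc, ← Matrix.mul_assoc, ← Matrix.transpose_mul,
      h.cof_mul_inv, Matrix.transpose_one, Matrix.one_mul]
  have hEgE : E.transpose * gramSm U g * E = nullMat (Sm U) := by
    rw [hETg, Matrix.mul_assoc, h.cof_mul_inv, Matrix.mul_one]
  have hw (i : Fin 4) : nullMat (Sm U) * cW U g θ i + (nullMat (Sm U) * cW U g θ i).transpose = 0 := by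
    have h1 : nullMat (Sm U) * cW U g θ i = E.transpose * gramSm U g * E.map (Sm.coordDer i)
        + E.transpose * (gramSm U g * chr Sm.coordDer (gramSm U g) i) * E := by
      rw [cW, connMat, ← Matrix.mul_assoc, ← hETg]; noncomm_ring
    have h2 := congrArg (fun M => M.map (Sm.coordDer i)) hEgE
    simp only [map_mul_der, map_nullMat_der, map_der_eq_chr h.gramSm_symm h.isUnit_det_gram] at h2
    rw [← h2, h1]
    simp only [Matrix.transpose_add, Matrix.transpose_mul, Matrix.transpose_transpose,
      h.gramSm_symm, Matrix.transpose_map]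
    noncomm_ring
  have hsum (i : Fin 4) (a b : Fin 4) : cW U g θ i (a + 2) b + cW U g θ i (b + 2) a = 0 := by
    have := congrFun (congrFun (hw i) a) b
    simpa [Matrix.mul_apply, nullMat] using this
  simp only [cG, frameConn, ← Finset.sum_add_distrib, ← mul_add, hsum, mul_zero,
    Finset.sum_const_zero]

/-- The Riemann tensor in a null frame. -/
def rF (U : Opens E4) (g : BilinField) (θ : FormQuad) (a b c e : Fin 4) : Sm U :=
  frameCurv (dF U θ) (cG U g θ) a b c e

theorem ev_curvMat (h : IsNullCoframeOn U g θ) (x : U) (a b c e : Fin 4) :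
    Sm.ev x (curvMat Sm.coordDer (chr Sm.coordDer (gramSm U g)) c e a b) =
      riemannUp g a b c e x := by
  have hd (m i k j : Fin 4) : Sm.ev x (Sm.coordDer m (chr Sm.coordDer (gramSm U g) i k j))
      = pd m (christoffel g k i j) x := Sm.ev_der_eq (fun y => h.ev_chr y i k j) _ x
  simp only [curvMat, riemannUp, Matrix.add_apply, Matrix.sub_apply, Matrix.map_apply, map_add,
    map_sub, hd, Matrix.mul_apply, map_sum, map_mul, h.ev_chr, Finset.sum_sub_distrib]

theorem ev_rF (h : IsNullCoframeOn U g θ) (x : U) (a b c e : Fin 4) :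
    Sm.ev x (rF U g θ a b c e) = ∑ i, ∑ j, ∑ k, ∑ l, θ x a (bvec k) * riemannUp g k l i j x *
      dualVec (θ x) b l * dualVec (θ x) c i * dualVec (θ x) e j := by
  have hF (i j : Fin 4) := curvMat_connMat (D := Sm.coordDer) (C := chr Sm.coordDer (gramSm U g))
    (fun _ _ => Sm.der_comm _ _) h.cof_mul_inv h.inv_mul_cof i j
  rw [rF, dF, cG, cW, frameCurv_eq h.inv_mul_cof h.chr_gram_symm]
  simp only [hF, Matrix.mul_apply, map_sum, map_mul, ev_inv_cofSm h.smooth h.indep, ev_cofSm h.smooth,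
    h.ev_curvMat, Finset.mul_sum, Finset.sum_mul]
  refine Finset.sum_congr rfl fun i _ => Finset.sum_congr rfl fun j _ => ?_
  rw [Finset.sum_comm]
  exact Finset.sum_congr rfl fun k _ => Finset.sum_congr rfl fun l _ => by ring

end IsNullCoframeOn

end Null

/-! ### Curvature components in a null frame -/

section Sums

theorem sum_rotate {n : ℕ} (F : Fin n → Fin n → Fin n → Fin n → ℝ) :
    ∑ a, ∑ c, ∑ d, ∑ e, F a c d e = ∑ c, ∑ d, ∑ e, ∑ a, F a c d e := by
  rw [Finset.sum_comm]
  refine Finset.sum_congr rfl fun c _ => ?_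
  rw [Finset.sum_comm]
  refine Finset.sum_congr rfl fun d _ => ?_
  rw [Finset.sum_comm]

theorem sum_rotate3 {n : ℕ} (F : Fin n → Fin n → Fin n → ℝ) :
    ∑ a, ∑ c, ∑ d, F a c d = ∑ c, ∑ d, ∑ a, F a c d := by
  rw [Finset.sum_comm]
  refine Finset.sum_congr rfl fun c _ => ?_
  rw [Finset.sum_comm]

/-- The Riemann tensor evaluated on four tangent vectors. -/
def riemEval (g : BilinField) (x X Y Z W : E4) : ℝ :=
  ∑ a, ∑ b, ∑ c, ∑ d, riemannLow g a b c d x * X a * Y b * Z c * W d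

theorem sum_gram (g : BilinField) (x X Y : E4) : ∑ a, ∑ b, gram g x a b * X a * Y b = g x X Y := by
  conv_rhs => rw [← sum_smul_bvec X, ← sum_smul_bvec Y]
  simp only [map_sum, map_smul, sum_apply, smul_apply, gram, Matrix.of_apply, smul_eq_mul,
    Finset.mul_sum]
  rw [Finset.sum_comm]
  exact Finset.sum_congr rfl fun a _ => Finset.sum_congr rfl fun b _ => by ring

theorem weylEval_eq {g : BilinField} {x : E4} (hg : ∀ a b, gram g x a b = gram g x b a)
    (hE : ∀ a b, ricci g a b x - (1 / 4) * scalarCurv g x * gram g x a b = 0) (X Y Z W : E4) :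
    weylEval g x X Y Z W = riemEval g x X Y Z W
      + scalarCurv g x / 12 * (g x X W * g x Y Z - g x X Z * g x Y W) := by
  have h1 : ∑ a, ∑ b, ∑ c, ∑ d, gram g x a d * gram g x b c * X a * Y b * Z c * W d
      = g x X W * g x Y Z := by
    rw [← sum_gram, ← sum_gram, Finset.sum_mul]
    refine Finset.sum_congr rfl fun a _ => ?_
    conv_rhs => rw [Finset.sum_mul_sum, Finset.sum_comm]
    refine Finset.sum_congr rfl fun b _ => ?_
    simp only [Finset.mul_sum]
    conv_rhs => rw [Finset.sum_comm]
    exact Finset.sum_congr rfl fun c _ => Finset.sum_congr rfl fun d _ => by ring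
  have h2 : ∑ a, ∑ b, ∑ c, ∑ d, gram g x a c * gram g x b d * X a * Y b * Z c * W d
      = g x X Z * g x Y W := by
    rw [← sum_gram, ← sum_gram, Finset.sum_mul]
    refine Finset.sum_congr rfl fun a _ => ?_
    conv_rhs => rw [Finset.sum_mul_sum, Finset.sum_comm]
    refine Finset.sum_congr rfl fun b _ => ?_
    simp only [Finset.mul_sum]
    exact Finset.sum_congr rfl fun c _ => Finset.sum_congr rfl fun d _ => by ring
  rw [← h1, ← h2, weylEval, riemEval, ← Finset.sum_sub_distrib, Finset.mul_sum,
    ← Finset.sum_add_distrib]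
  refine Finset.sum_congr rfl fun a _ => ?_
  rw [← Finset.sum_sub_distrib, Finset.mul_sum, ← Finset.sum_add_distrib]
  refine Finset.sum_congr rfl fun b _ => ?_
  rw [← Finset.sum_sub_distrib, Finset.mul_sum, ← Finset.sum_add_distrib]
  refine Finset.sum_congr rfl fun c _ => ?_
  rw [← Finset.sum_sub_distrib, Finset.mul_sum, ← Finset.sum_add_distrib]
  refine Finset.sum_congr rfl fun d _ => ?_
  have hs (a b) : schouten g a b x = scalarCurv g x / 24 * gram g x a b := by
    rw [schouten]; linear_combination (1 / 2) * hE a b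
  simp only [weyl, hs]
  rw [hg c b, hg d b, hg d a, hg c a]
  ring

theorem riemEval_eq (g : BilinField) (x X Y Z W : E4) :
    riemEval g x X Y Z W = ∑ i, ∑ j, ∑ k, ∑ l, g x X (bvec k) * riemannUp g k l i j x *
      Y l * Z i * W j := by
  have hX (k : Fin 4) : g x X (bvec k) = ∑ a, gram g x a k * X a := by
    conv_lhs => rw [← sum_smul_bvec X]
    simp [gram, mul_comm]
  simp only [riemEval, riemannLow, hX, Finset.sum_mul]
  calc _ = ∑ a, ∑ c, ∑ d, ∑ e, ∑ b, gram g x a e * riemannUp g e b c d x * X a * Y b * Z c * W d :=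
        Finset.sum_congr rfl fun a _ => sum_rotate fun b c d e =>
          gram g x a e * riemannUp g e b c d x * X a * Y b * Z c * W d
    _ = ∑ c, ∑ d, ∑ e, ∑ a, ∑ b, gram g x a e * riemannUp g e b c d x * X a * Y b * Z c * W d :=
        sum_rotate fun a c d e =>
          ∑ b, gram g x a e * riemannUp g e b c d x * X a * Y b * Z c * W d
    _ = _ := by
        refine Finset.sum_congr rfl fun c _ => Finset.sum_congr rfl fun d _ =>
          Finset.sum_congr rfl fun e _ => ?_
        rw [Finset.sum_comm]
        exact Finset.sum_congr rfl fun b _ => Finset.sum_congr rfl fun a _ => by ring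

end Sums

namespace IsNullCoframeOn

variable {U : Opens E4} {g : BilinField} {θ : FormQuad}

theorem metric_dual (h : IsNullCoframeOn U g θ) {x : E4} (hx : x ∈ U) (a : Fin 4) (v : E4) :
    g x (dualVec (θ x) a) v = θ x (a + 2) v := by
  have := apply_dualVec (h.indep x hx)
  rw [h.metric x hx]
  fin_cases a <;> simp [this]

theorem metric_dual_dual (h : IsNullCoframeOn U g θ) {x : E4} (hx : x ∈ U) (a b : Fin 4) :
    g x (dualVec (θ x) a) (dualVec (θ x) b) = if a + 2 = b then 1 else 0 := by
  rw [h.metric_dual hx, apply_dualVec (h.indep x hx)]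

theorem gram_symm (h : IsNullCoframeOn U g θ) (x : U) (a b : Fin 4) :
    gram g x a b = gram g x b a := by
  simp only [gram, Matrix.of_apply, h.metric x x.2]; ring

theorem riemEval_dual (h : IsNullCoframeOn U g θ) (x : U) (a b c e : Fin 4) :
    riemEval g x (dualVec (θ x) a) (dualVec (θ x) b) (dualVec (θ x) c) (dualVec (θ x) e)
      = Sm.ev x (rF U g θ (a + 2) b c e) := by
  rw [riemEval_eq, h.ev_rF]
  simp only [h.metric_dual x.2]

theorem sum_ricci_dual (h : IsNullCoframeOn U g θ) (x : U) (b e : Fin 4) :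
    ∑ i, ∑ j, ricci g i j x * dualVec (θ x) b i * dualVec (θ x) e j
      = ∑ c, Sm.ev x (rF U g θ c b c e) := by
  have hd (k i : Fin 4) : ∑ c, θ x c (bvec k) * dualVec (θ x) c i = if i = k then 1 else 0 := by
    have := congrArg (fun v : E4 => v i) (sum_smul_dualVec (h.indep x x.2) (bvec k))
    simpa [bvec, Pi.single_apply] using this
  simp only [h.ev_rF]
  symm
  calc _ = ∑ i, ∑ j, ∑ k, ∑ c, ∑ l, θ x c (bvec k) * riemannUp g k l i j x * dualVec (θ x) b l *
        dualVec (θ x) c i * dualVec (θ x) e j := sum_rotate fun c i j k => ∑ l, θ x c (bvec k) *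
        riemannUp g k l i j x * dualVec (θ x) b l * dualVec (θ x) c i * dualVec (θ x) e j
    _ = ∑ i, ∑ j, ∑ k, ∑ l, (∑ c, θ x c (bvec k) * dualVec (θ x) c i) *
        (riemannUp g k l i j x * dualVec (θ x) b l * dualVec (θ x) e j) := by
        refine Finset.sum_congr rfl fun i _ => Finset.sum_congr rfl fun j _ =>
          Finset.sum_congr rfl fun k _ => ?_
        rw [Finset.sum_comm]
        refine Finset.sum_congr rfl fun l _ => ?_
        rw [Finset.sum_mul]
        exact Finset.sum_congr rfl fun c _ => by ring
    _ = ∑ i, ∑ j, ∑ l, riemannUp g i l i j x * dualVec (θ x) b l * dualVec (θ x) e j := by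
        refine Finset.sum_congr rfl fun i _ => Finset.sum_congr rfl fun j _ => ?_
        rw [Finset.sum_comm]
        refine Finset.sum_congr rfl fun l _ => ?_
        simp [hd]
    _ = _ := by
        simp only [ricci, Finset.sum_mul]
        calc _ = ∑ i, ∑ l, ∑ j, riemannUp g i l i j x * dualVec (θ x) b l * dualVec (θ x) e j :=
              Finset.sum_congr rfl fun i _ => Finset.sum_comm
          _ = ∑ l, ∑ i, ∑ j, riemannUp g i l i j x * dualVec (θ x) b l * dualVec (θ x) e j :=
              Finset.sum_comm
          _ = _ := Finset.sum_congr rfl fun l _ => Finset.sum_comm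

/-- The Einstein equation in a null frame. -/
theorem einstein_frame (h : IsNullCoframeOn U g θ) (x : U)
    (hE : ∀ a b, ricci g a b x - (1 / 4) * scalarCurv g x * gram g x a b = 0) (b e : Fin 4) :
    ∑ c, Sm.ev x (rF U g θ c b c e) = if b + 2 = e then scalarCurv g x / 4 else 0 := by
  rw [← h.sum_ricci_dual]
  have hR (i j) : ricci g i j x = scalarCurv g x / 4 * gram g x i j := by
    linear_combination hE i j
  simp only [hR]
  have : ∑ i, ∑ j, scalarCurv g x / 4 * gram g x i j * dualVec (θ x) b i * dualVec (θ x) e j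
      = scalarCurv g x / 4 * g x (dualVec (θ x) b) (dualVec (θ x) e) := by
    rw [← sum_gram, Finset.mul_sum]
    refine Finset.sum_congr rfl fun i _ => ?_
    rw [Finset.mul_sum]
    exact Finset.sum_congr rfl fun j _ => by ring
  rw [this, h.metric_dual_dual x.2]
  split_ifs <;> simp

/-- The Weyl tensor of an Einstein metric in a null frame. -/
theorem weylComp_eq (h : IsNullCoframeOn U g θ) (x : U)
    (hE : ∀ a b, ricci g a b x - (1 / 4) * scalarCurv g x * gram g x a b = 0) (a b c e : Fin 4) :
    weylComp g (θ x) x a b c e = Sm.ev x (rF U g θ (a + 2) b c e) + scalarCurv g x / 12 *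
      ((if a + 2 = e then 1 else 0) * (if b + 2 = c then 1 else 0)
        - (if a + 2 = c then 1 else 0) * (if b + 2 = e then 1 else 0)) := by
  rw [weylComp, weylEval_eq (h.gram_symm x) hE, h.riemEval_dual]
  simp only [h.metric_dual_dual x.2]

/-- The first Bianchi identity. -/
theorem first_bianchi (h : IsNullCoframeOn U g θ) (a b c e : Fin 4) :
    rF U g θ a b c e + rF U g θ a c e b + rF U g θ a e b c = 0 := by
  have hC (a b c e : Fin 4) (x : U) :
      riemannUp g a b c e x + riemannUp g a c e b x + riemannUp g a e b c x = 0 := by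
    simp only [← h.ev_curvMat, ← map_add]
    rw [← map_zero (Sm.ev x)]
    congr 1
    have hs := h.chr_gram_symm
    set C := chr Sm.coordDer (gramSm U g)
    simp only [curvMat, Matrix.add_apply, Matrix.sub_apply, Matrix.map_apply, Matrix.mul_apply,
      Fin.sum_univ_four]
    linear_combination congrArg (Sm.coordDer c) (hs e b a) - congrArg (Sm.coordDer e) (hs c b a)
      - congrArg (Sm.coordDer b) (hs e c a)
      + C c a 0 * hs e b 0 - C e a 0 * hs c b 0 - C b a 0 * hs e c 0
      + C c a 1 * hs e b 1 - C e a 1 * hs c b 1 - C b a 1 * hs e c 1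
      + C c a 2 * hs e b 2 - C e a 2 * hs c b 2 - C b a 2 * hs e c 2
      + C c a 3 * hs e b 3 - C e a 3 * hs c b 3 - C b a 3 * hs e c 3
  refine Sm.ext fun x => ?_
  rw [map_add, map_add, map_zero, h.ev_rF, h.ev_rF, h.ev_rF]
  set u := dualVec (θ x) b
  set v := dualVec (θ x) c
  set w := dualVec (θ x) e
  have key (u v w : E4) (F : Fin 4 → Fin 4 → Fin 4 → Fin 4 → ℝ) :
      ∑ i, ∑ j, ∑ k, ∑ l, θ x a (bvec k) * F k l i j * u l * v i * w j =
      ∑ k, θ x a (bvec k) * ∑ p, ∑ q, ∑ r, F k p q r * u p * v q * w r := by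
    symm
    simp only [Finset.mul_sum]
    rw [sum_rotate (fun k p q r => θ x a (bvec k) * (F k p q r * u p * v q * w r)),
      sum_rotate (fun p q r k => θ x a (bvec k) * (F k p q r * u p * v q * w r))]
    exact Finset.sum_congr rfl fun i _ => Finset.sum_congr rfl fun j _ =>
      Finset.sum_congr rfl fun k _ => Finset.sum_congr rfl fun l _ => by ring
  rw [key u v w fun k l i j => riemannUp g k l i j x, key v w u fun k l i j => riemannUp g k l i j x,
    key w u v fun k l i j => riemannUp g k l i j x, ← Finset.sum_add_distrib,
    ← Finset.sum_add_distrib]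
  refine Finset.sum_eq_zero fun k _ => ?_
  have r1 : ∑ p, ∑ q, ∑ r, riemannUp g k p q r x * v p * w q * u r
      = ∑ p, ∑ q, ∑ r, riemannUp g k q r p x * u p * v q * w r := by
    rw [← sum_rotate3]
    exact Finset.sum_congr rfl fun i _ => Finset.sum_congr rfl fun j _ =>
      Finset.sum_congr rfl fun k _ => by ring
  have r2 : ∑ p, ∑ q, ∑ r, riemannUp g k p q r x * w p * u q * v r
      = ∑ p, ∑ q, ∑ r, riemannUp g k r p q x * u p * v q * w r := by
    rw [sum_rotate3]
    exact Finset.sum_congr rfl fun i _ => Finset.sum_congr rfl fun j _ =>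
      Finset.sum_congr rfl fun k _ => by ring
  rw [r1, r2, ← mul_add, ← mul_add, ← Finset.sum_add_distrib, ← Finset.sum_add_distrib]
  refine mul_eq_zero_of_right _ (Finset.sum_eq_zero fun p _ => ?_)
  rw [← Finset.sum_add_distrib, ← Finset.sum_add_distrib]
  refine Finset.sum_eq_zero fun q _ => ?_
  rw [← Finset.sum_add_distrib, ← Finset.sum_add_distrib]
  refine Finset.sum_eq_zero fun r _ => ?_
  linear_combination (u p * v q * w r) * hC k p q r x

end IsNullCoframeOn

/-! ### The connection and the curvature of a para-Kähler–Einstein metric -/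

/-- `θ` is a smooth adapted coframe of `(g, K)` on `U`. -/
structure IsAdaptedOn (U : Opens E4) (g : BilinField) (K : EndoField) (θ : FormQuad) : Prop where
  smooth : ∀ a, ContDiffOn ℝ ∞ (fun x => θ x a) U
  adapted : ∀ x ∈ U, IsAdapted (g x) (K x) (θ x)

/-- The eigenvalues of `K` on an adapted frame. -/
def eps : Fin 4 → ℝ := ![1, 1, -1, -1]

theorem IsAdapted.apply_endo {G : E4 →L[ℝ] E4 →L[ℝ] ℝ} {k : E4 →L[ℝ] E4}
    {θ : Fin 4 → E4 →L[ℝ] ℝ} (h : IsAdapted G k θ) (a : Fin 4) (v : E4) :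
    θ a (k v) = eps a * θ a v := by
  fin_cases a <;> simp [eps, h.endo₀, h.endo₁, h.endo₂, h.endo₃]

theorem IsAdapted.endo_dualVec {G : E4 →L[ℝ] E4 →L[ℝ] ℝ} {k : E4 →L[ℝ] E4}
    {θ : Fin 4 → E4 →L[ℝ] ℝ} (h : IsAdapted G k θ) (a : Fin 4) :
    k (dualVec θ a) = eps a • dualVec θ a := by
  rw [← sum_smul_dualVec h.indep (k (dualVec θ a))]
  simp [h.apply_endo, apply_dualVec h.indep]

namespace IsNullCoframeOn

variable {U : Opens E4} {g : BilinField} {θ : FormQuad}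

theorem christoffel_symm (h : IsNullCoframeOn U g θ) (x : U) (k i j : Fin 4) :
    christoffel g k i j x = christoffel g k j i x := by
  rw [← h.ev_chr, ← h.ev_chr, h.chr_gram_symm]

theorem apply_lieBracket (h : IsNullCoframeOn U g θ) (x : U) (a b c : Fin 4) :
    θ x a (VectorField.lieBracket ℝ (fun z => dualVec (θ z) b) (fun z => dualVec (θ z) c) x)
      = Sm.ev x (cG U g θ a c b) - Sm.ev x (cG U g θ a b c) := by
  have hs : ∑ k, (∑ i, ∑ j, christoffel g k i j x * dualVec (θ x) b i * dualVec (θ x) c j) • bvec k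
      = ∑ k, (∑ i, ∑ j, christoffel g k i j x * dualVec (θ x) c i * dualVec (θ x) b j) • bvec k := by
    refine Finset.sum_congr rfl fun k _ => ?_
    congr 1
    rw [Finset.sum_comm]
    exact Finset.sum_congr rfl fun i _ => Finset.sum_congr rfl fun j _ => by
      rw [h.christoffel_symm]; ring
  rw [h.ev_cG, h.ev_cG, connForm, connForm, hs, ← map_sub, VectorField.lieBracket]
  congr 1
  abel

end IsNullCoframeOn

namespace IsAdaptedOn

variable {U : Opens E4} {g : BilinField} {K : EndoField} {θ : FormQuad}

theorem null (h : IsAdaptedOn U g K θ) : IsNullCoframeOn U g θ :=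
  ⟨h.smooth, fun x hx => (h.adapted x hx).indep, fun x hx => (h.adapted x hx).metric⟩

theorem kaehler_dual (h : IsAdaptedOn U g K θ) {x : E4} (hx : x ∈ U) (v : E4) (r : Fin 4) :
    kaehlerForm g K x v (dualVec (θ x) r) = eps (r + 2) * θ x (r + 2) v := by
  have hA := h.adapted x hx
  have h1 : g x (K x v) (dualVec (θ x) r) = θ x (r + 2) (K x v) := by
    have := apply_dualVec hA.indep
    rw [hA.metric]
    fin_cases r <;> simp [this]
  rw [← hA.apply_endo, ← h1]; rfl

theorem kaehler_dual' (h : IsAdaptedOn U g K θ) {x : E4} (hx : x ∈ U) (v : E4) (r : Fin 4) :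
    kaehlerForm g K x (dualVec (θ x) r) v = - (eps (r + 2) * θ x (r + 2) v) := by
  have hA := h.adapted x hx
  have := apply_dualVec hA.indep
  change g x (K x (dualVec (θ x) r)) v = _
  rw [hA.endo_dualVec, map_smul, smul_apply, hA.metric]
  fin_cases r <;> simp [this, eps]

/-- The exterior derivative of the para-Kähler form in an adapted frame. -/
theorem fderiv_kaehler_frame (h : IsAdaptedOn U g K θ) (hgs : ContDiffOn ℝ ∞ g U)
    (hKs : ContDiffOn ℝ ∞ K U) (x : U) (p q r : Fin 4) :
    eps (r + 2) * (Sm.ev x (cG U g θ (r + 2) q p) - Sm.ev x (cG U g θ (r + 2) p q))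
      + eps (p + 2) * (Sm.ev x (cG U g θ (p + 2) r q) - Sm.ev x (cG U g θ (p + 2) q r))
      + eps (q + 2) * (Sm.ev x (cG U g θ (q + 2) p r) - Sm.ev x (cG U g θ (q + 2) r p)) =
    -(fderiv ℝ (kaehlerForm g K) x (dualVec (θ x) p) (dualVec (θ x) q) (dualVec (θ x) r)
      + fderiv ℝ (kaehlerForm g K) x (dualVec (θ x) q) (dualVec (θ x) r) (dualVec (θ x) p)
      + fderiv ℝ (kaehlerForm g K) x (dualVec (θ x) r) (dualVec (θ x) p) (dualVec (θ x) q)) := by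
  have hn := h.null
  have hU : (U : Set E4) ∈ nhds (x : E4) := U.isOpen.mem_nhds x.2
  have hρ : DifferentiableAt ℝ (kaehlerForm g K) x :=
    ((hgs.clm_comp hKs).contDiffAt hU).differentiableAt (by simp)
  have he (b : Fin 4) : DifferentiableAt ℝ (fun z => dualVec (θ z) b) x :=
    ((contDiffOn_dualVec hn.smooth hn.indep b).contDiffAt hU).differentiableAt (by simp)
  have hD (p q r : Fin 4) : fderiv ℝ (kaehlerForm g K) x (dualVec (θ x) p) (dualVec (θ x) q)
      (dualVec (θ x) r) = - (eps (r + 2) * θ x (r + 2)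
          (fderiv ℝ (fun z => dualVec (θ z) q) x (dualVec (θ x) p)))
        + eps (q + 2) * θ x (q + 2) (fderiv ℝ (fun z => dualVec (θ z) r) x (dualVec (θ x) p)) := by
    have h1 := ((hρ.hasFDerivAt.clm_apply (he q).hasFDerivAt).clm_apply (he r).hasFDerivAt)
    have h2 : (fun z => kaehlerForm g K z (dualVec (θ z) q) (dualVec (θ z) r))
        =ᶠ[nhds (x : E4)] fun _ => eps (r + 2) * if r + 2 = q then 1 else 0 := by
      filter_upwards [hU] with z hz
      rw [h.kaehler_dual hz, apply_dualVec (hn.indep z hz)]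
    have h3 := congrArg (fun φ => φ (dualVec (θ x) p)) (h1.unique
      ((hasFDerivAt_const _ _).congr_of_eventuallyEq h2))
    simp only [add_apply, ContinuousLinearMap.comp_apply, ContinuousLinearMap.flip_apply,
      h.kaehler_dual x.2, h.kaehler_dual' x.2, zero_apply] at h3
    linarith
  have hb (a b c : Fin 4) := hn.apply_lieBracket x a b c
  simp only [VectorField.lieBracket, map_sub] at hb
  rw [hD, hD, hD, ← hb, ← hb, ← hb]
  ring

/-- The equation `dρ = 0` in an adapted frame. -/
theorem closed_frame (h : IsAdaptedOn U g K θ) (hg : IsPKEOn U g K) (x : U) (p q r : Fin 4) :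
    eps (r + 2) * (Sm.ev x (cG U g θ (r + 2) q p) - Sm.ev x (cG U g θ (r + 2) p q))
      + eps (p + 2) * (Sm.ev x (cG U g θ (p + 2) r q) - Sm.ev x (cG U g θ (p + 2) q r))
      + eps (q + 2) * (Sm.ev x (cG U g θ (q + 2) p r) - Sm.ev x (cG U g θ (q + 2) r p)) = 0 := by
  rw [h.fderiv_kaehler_frame hg.smooth_metric hg.smooth_endo, hg.closed x x.2, neg_zero]

theorem integrable_pos_frame (h : IsAdaptedOn U g K θ) (hg : IsPKEOn U g K) (x : U) (a : Fin 4)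
    (ha : eps a = -1) : Sm.ev x (cG U g θ a 1 0) = Sm.ev x (cG U g θ a 0 1) := by
  have hn := h.null
  have h1 := hg.integrable_pos (fun z => dualVec (θ z) 0) (fun z => dualVec (θ z) 1)
    (contDiffOn_dualVec hn.smooth hn.indep 0) (contDiffOn_dualVec hn.smooth hn.indep 1)
    (fun z hz => by rw [(h.adapted z hz).endo_dualVec]; simp [eps])
    (fun z hz => by rw [(h.adapted z hz).endo_dualVec]; simp [eps]) x x.2
  have h2 := congrArg (θ x a) h1
  rw [(h.adapted x x.2).apply_endo, ha, hn.apply_lieBracket] at h2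
  linarith

theorem integrable_neg_frame (h : IsAdaptedOn U g K θ) (hg : IsPKEOn U g K) (x : U) (a : Fin 4)
    (ha : eps a = 1) : Sm.ev x (cG U g θ a 3 2) = Sm.ev x (cG U g θ a 2 3) := by
  have hn := h.null
  have h1 := hg.integrable_neg (fun z => dualVec (θ z) 2) (fun z => dualVec (θ z) 3)
    (contDiffOn_dualVec hn.smooth hn.indep 2) (contDiffOn_dualVec hn.smooth hn.indep 3)
    (fun z hz => by rw [(h.adapted z hz).endo_dualVec]; simp [eps])
    (fun z hz => by rw [(h.adapted z hz).endo_dualVec]; simp [eps]) x x.2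
  have h2 := congrArg (θ x a) h1
  rw [map_neg, (h.adapted x x.2).apply_endo, ha, hn.apply_lieBracket] at h2
  linarith

end IsAdaptedOn

section Block

/-- A block matrix in the Lie algebra of the structure group `GL(2, ℝ)` of a para-Kähler metric. -/
def glBlock {R : Type*} [CommRing R] (γ α β δ : R) : Matrix (Fin 4) (Fin 4) R :=
  !![γ, α, 0, 0; β, δ, 0, 0; 0, 0, -γ, -β; 0, 0, -α, -δ]

/-- Connection components with values in `glBlock`: `Γ¹₁ = γ`, `Γ¹₂ = α`, `Γ²₁ = β`, `Γ²₂ = δ`. -/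
def glConn {R : Type*} [CommRing R] (γ α β δ : Fin 4 → R) (a b c : Fin 4) : R :=
  glBlock (γ c) (α c) (β c) (δ c) a b

theorem frameCurv_glConn {R : Type*} [CommRing R] [Algebra ℝ R] (d : Fin 4 → Derivation ℝ R R)
    (γ α β δ : Fin 4 → R) (a b c e : Fin 4) :
    frameCurv d (glConn γ α β δ) a b c e =
      glBlock (frameCurv d (glConn γ α β δ) 0 0 c e) (frameCurv d (glConn γ α β δ) 0 1 c e)
        (frameCurv d (glConn γ α β δ) 1 0 c e) (frameCurv d (glConn γ α β δ) 1 1 c e) a b := by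
  fin_cases a <;> fin_cases b <;>
    simp [frameCurv, glBlock, Fin.sum_univ_four, glConn] <;> ring

end Block

namespace IsAdaptedOn

variable {U : Opens E4} {g : BilinField} {K : EndoField} {θ : FormQuad}

/-- The Levi-Civita connection of a para-Kähler metric takes values in `𝔤𝔩(2, ℝ)`. -/
theorem cG_eq (h : IsAdaptedOn U g K θ) (hg : IsPKEOn U g K) :
    cG U g θ = glConn (cG U g θ 0 0) (cG U g θ 0 1) (cG U g θ 1 0) (cG U g θ 1 1) := by
  funext a b c
  refine Sm.ext fun x => ?_
  set G : Fin 4 → Fin 4 → Fin 4 → ℝ := fun a b c => Sm.ev x (cG U g θ a b c) with hG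
  have hsk (a b c) : G (a + 2) b c + G (b + 2) a c = 0 := by
    simp only [hG, ← map_add, h.null.cG_skew, map_zero]
  have hcl (p q r) := h.closed_frame hg x p q r
  have hp2 := h.integrable_pos_frame hg x 2 rfl
  have hp3 := h.integrable_pos_frame hg x 3 rfl
  have hn0 := h.integrable_neg_frame hg x 0 rfl
  have hn1 := h.integrable_neg_frame hg x 1 rfl
  change ∀ p q r, eps (r + 2) * (G (r + 2) q p - G (r + 2) p q)
      + eps (p + 2) * (G (p + 2) r q - G (p + 2) q r)
      + eps (q + 2) * (G (q + 2) p r - G (q + 2) r p) = 0 at hcl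
  change G 2 1 0 = G 2 0 1 at hp2
  change G 3 1 0 = G 3 0 1 at hp3
  change G 0 3 2 = G 0 2 3 at hn0
  change G 1 3 2 = G 1 2 3 at hn1
  have s00 (c) : G 2 0 c + G 2 0 c = 0 := hsk 0 0 c
  have s01 (c) : G 2 1 c + G 3 0 c = 0 := hsk 0 1 c
  have s11 (c) : G 3 1 c + G 3 1 c = 0 := hsk 1 1 c
  have s02 (c) : G 2 2 c + G 0 0 c = 0 := hsk 0 2 c
  have s03 (c) : G 2 3 c + G 1 0 c = 0 := hsk 0 3 c
  have s12 (c) : G 3 2 c + G 0 1 c = 0 := hsk 1 2 c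
  have s13 (c) : G 3 3 c + G 1 1 c = 0 := hsk 1 3 c
  have s22 (c) : G 0 2 c + G 0 2 c = 0 := hsk 2 2 c
  have s23 (c) : G 0 3 c + G 1 2 c = 0 := hsk 2 3 c
  have s33 (c) : G 1 3 c + G 1 3 c = 0 := hsk 3 3 c
  have c1 := hcl 0 1 2
  have c2 := hcl 0 1 3
  have c3 := hcl 2 3 0
  have c4 := hcl 2 3 1
  simp [eps] at c1 c2 c3 c4
  have k21 : ∀ c, G 2 1 c = 0 := by
    have := s00 1; have := s11 0; have := s01 1; have := s01 0
    have := s02 0; have := s02 1; have := s12 0; have := s12 1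
    have := s03 0; have := s03 1; have := s13 0; have := s13 1
    have := s01 2; have := s01 3
    intro c; fin_cases c <;> simp only [Fin.isValue, Fin.zero_eta, Fin.mk_one, Fin.reduceFinMk] <;>
      linarith
  have k03 : ∀ c, G 0 3 c = 0 := by
    have := s22 3; have := s33 2; have := s23 3; have := s23 2
    have := s02 2; have := s02 3; have := s12 2; have := s12 3
    have := s03 2; have := s03 3; have := s13 2; have := s13 3
    have := s23 0; have := s23 1
    intro c; fin_cases c <;> simp only [Fin.isValue, Fin.zero_eta, Fin.mk_one, Fin.reduceFinMk] <;>
      linarith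
  have := s00 c; have := s01 c; have := s11 c; have := s02 c; have := s03 c; have := s12 c
  have := s13 c; have := s22 c; have := s23 c; have := s33 c; have := k21 c; have := k03 c
  change G a b c = _
  fin_cases a <;> fin_cases b <;>
    simp [glConn, glBlock] <;> linarith

end IsAdaptedOn

/-! ### The curvature table -/

section Table

variable {R : Type*} [CommRing R]

/-- The 2-form `p₀₂ θ¹∧θ³ + p₀₃ θ¹∧θ⁴ + p₁₂ θ²∧θ³ + p₁₃ θ²∧θ⁴` as a skew matrix. -/
def skewBlock (p₀₂ p₀₃ p₁₂ p₁₃ : R) : Matrix (Fin 4) (Fin 4) R :=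
  !![0, 0, p₀₂, p₀₃; 0, 0, p₁₂, p₁₃; -p₀₂, -p₁₂, 0, 0; -p₀₃, -p₁₃, 0, 0]

/-- The curvature of a para-Kähler–Einstein metric in an adapted frame: `ψ₀, …, ψ₄` are the
coefficients of the anti-self-dual Weyl quartic, and `-12 s` is the scalar curvature. -/
def curvTable (ψ₀ ψ₁ ψ₂ ψ₃ ψ₄ s : R) (a b c e : Fin 4) : R :=
  glBlock (skewBlock (-ψ₂ - 2 * s) ψ₁ (-ψ₃) (ψ₂ - s) c e) (skewBlock (-ψ₃) (ψ₂ - s) (-ψ₄) ψ₃ c e)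
    (skewBlock ψ₁ (-ψ₀) (ψ₂ - s) (-ψ₁) c e) (skewBlock (ψ₂ - s) (-ψ₁) ψ₃ (-ψ₂ - 2 * s) c e) a b

end Table

theorem frameCurv_skew {R : Type*} [CommRing R] [Algebra ℝ R] (d : Fin 4 → Derivation ℝ R R)
    (G : Fin 4 → Fin 4 → Fin 4 → R) (a b c e : Fin 4) :
    frameCurv d G a b e c = - frameCurv d G a b c e := by
  simp only [frameCurv, Fin.sum_univ_four]; ring

section Multilinear

variable (g : BilinField) (x : E4) (p q : ℝ) (u v X Y Z W : E4)

theorem weylEval_left : weylEval g x (p • u + q • v) Y Z W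
    = p * weylEval g x u Y Z W + q * weylEval g x v Y Z W := by
  simp only [weylEval, Finset.mul_sum, ← Finset.sum_add_distrib, PiLp.add_apply, PiLp.smul_apply,
    smul_eq_mul]
  exact Finset.sum_congr rfl fun a _ => Finset.sum_congr rfl fun b _ =>
    Finset.sum_congr rfl fun c _ => Finset.sum_congr rfl fun e _ => by ring

theorem weylEval_midLeft : weylEval g x X (p • u + q • v) Z W
    = p * weylEval g x X u Z W + q * weylEval g x X v Z W := by
  simp only [weylEval, Finset.mul_sum, ← Finset.sum_add_distrib, PiLp.add_apply, PiLp.smul_apply,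
    smul_eq_mul]
  exact Finset.sum_congr rfl fun a _ => Finset.sum_congr rfl fun b _ =>
    Finset.sum_congr rfl fun c _ => Finset.sum_congr rfl fun e _ => by ring

theorem weylEval_midRight : weylEval g x X Y (p • u + q • v) W
    = p * weylEval g x X Y u W + q * weylEval g x X Y v W := by
  simp only [weylEval, Finset.mul_sum, ← Finset.sum_add_distrib, PiLp.add_apply, PiLp.smul_apply,
    smul_eq_mul]
  exact Finset.sum_congr rfl fun a _ => Finset.sum_congr rfl fun b _ =>
    Finset.sum_congr rfl fun c _ => Finset.sum_congr rfl fun e _ => by ring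

theorem weylEval_right : weylEval g x X Y Z (p • u + q • v)
    = p * weylEval g x X Y Z u + q * weylEval g x X Y Z v := by
  simp only [weylEval, Finset.mul_sum, ← Finset.sum_add_distrib, PiLp.add_apply, PiLp.smul_apply,
    smul_eq_mul]
  exact Finset.sum_congr rfl fun a _ => Finset.sum_congr rfl fun b _ =>
    Finset.sum_congr rfl fun c _ => Finset.sum_congr rfl fun e _ => by ring

end Multilinear

theorem asdQuartic_eq (g : BilinField) (θ : Fin 4 → E4 →L[ℝ] ℝ) (x : E4) (s ξ₀ ξ₁ : ℝ)
    (ψ : Fin 5 → ℝ)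
    (hw : ∀ a b c e, weylComp g θ x a b c e =
      curvTable (ψ 0) (ψ 1) (ψ 2) (ψ 3) (ψ 4) s (a + 2) b c e - s *
      ((if a + 2 = e then 1 else 0) * (if b + 2 = c then 1 else 0)
        - (if a + 2 = c then 1 else 0) * (if b + 2 = e then 1 else 0))) :
    asdQuartic g θ x ξ₀ ξ₁ = ψ 4 * ξ₁ ^ 4 + 4 * ψ 3 * ξ₀ * ξ₁ ^ 3 + 6 * ψ 2 * ξ₀ ^ 2 * ξ₁ ^ 2
      + 4 * ψ 1 * ξ₀ ^ 3 * ξ₁ + ψ 0 * ξ₀ ^ 4 := by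
  have hY : ξ₀ • dualVec θ 3 - ξ₁ • dualVec θ 2 = ξ₀ • dualVec θ 3 + (-ξ₁) • dualVec θ 2 := by
    rw [neg_smul, sub_eq_add_neg]
  simp only [asdQuartic, hY, weylEval_left, weylEval_midLeft, weylEval_midRight, weylEval_right,
    ← weylComp.eq_def, hw]
  simp [curvTable, glBlock, skewBlock]
  ring

namespace IsAdaptedOn

variable {U : Opens E4} {g : BilinField} {K : EndoField} {θ : FormQuad}

theorem rF_block (h : IsAdaptedOn U g K θ) (hg : IsPKEOn U g K) (a b c e : Fin 4) :
    IsNullCoframeOn.rF U g θ a b c e = glBlock (IsNullCoframeOn.rF U g θ 0 0 c e)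
      (IsNullCoframeOn.rF U g θ 0 1 c e) (IsNullCoframeOn.rF U g θ 1 0 c e)
      (IsNullCoframeOn.rF U g θ 1 1 c e) a b := by
  simp only [IsNullCoframeOn.rF]
  rw [h.cG_eq hg, frameCurv_glConn]

/-- The curvature in an adapted frame, together with `Ψ₂' = -R / 12`. -/
theorem ev_rF_eq (h : IsAdaptedOn U g K θ) (hg : IsPKEOn U g K) (x : U) :
    (∀ a b c e, Sm.ev x (IsNullCoframeOn.rF U g θ a b c e) = curvTable (psi0 g θ x) (psi1 g θ x)
      (psi2 g θ x) (psi3 g θ x) (psi4 g θ x) (-scalarCurv g x / 12) a b c e) ∧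
    psi2' g θ x = -scalarCurv g x / 12 := by
  set r : Fin 4 → Fin 4 → Fin 4 → Fin 4 → ℝ :=
    fun a b c e => Sm.ev x (IsNullCoframeOn.rF U g θ a b c e) with hr
  set S := scalarCurv g x
  have hb (a b c e) : r a b c e = glBlock (r 0 0 c e) (r 0 1 c e) (r 1 0 c e) (r 1 1 c e) a b := by
    simp only [hr]
    rw [h.rF_block hg]
    fin_cases a <;> fin_cases b <;> simp [glBlock]
  have hs (a b c e) : r a b e c = - r a b c e := by
    simp only [hr, IsNullCoframeOn.rF]; rw [frameCurv_skew, map_neg]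
  have hs0 (a b c) : r a b c c = 0 := by have := hs a b c c; linarith
  have hB (a b c e) : r a b c e + r a c e b + r a e b c = 0 := by
    simp only [hr, ← map_add, h.null.first_bianchi, map_zero]
  have hE (b e) : r 0 b 0 e + r 1 b 1 e + r 2 b 2 e + r 3 b 3 e
      = if b + 2 = e then S / 4 else 0 := by
    rw [← h.null.einstein_frame x (hg.einstein x x.2) b e, Fin.sum_univ_four]
  have hW (a b c e) := h.null.weylComp_eq x (hg.einstein x x.2) a b c e
  have b20 (c e) : r 2 0 c e = 0 := hb 2 0 c e
  have b21 (c e) : r 2 1 c e = 0 := hb 2 1 c e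
  have b30 (c e) : r 3 0 c e = 0 := hb 3 0 c e
  have b31 (c e) : r 3 1 c e = 0 := hb 3 1 c e
  have b02 (c e) : r 0 2 c e = 0 := hb 0 2 c e
  have b03 (c e) : r 0 3 c e = 0 := hb 0 3 c e
  have b12 (c e) : r 1 2 c e = 0 := hb 1 2 c e
  have b13 (c e) : r 1 3 c e = 0 := hb 1 3 c e
  have b22 (c e) : r 2 2 c e = - r 0 0 c e := hb 2 2 c e
  have b23 (c e) : r 2 3 c e = - r 1 0 c e := hb 2 3 c e
  have b32 (c e) : r 3 2 c e = - r 0 1 c e := hb 3 2 c e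
  have b33 (c e) : r 3 3 c e = - r 1 1 c e := hb 3 3 c e
  have z23 (a b : Fin 4) (ha : a = 0 ∨ a = 1) (hb' : b = 0 ∨ b = 1) : r a b 2 3 = 0 := by
    rcases ha with rfl | rfl <;> rcases hb' with rfl | rfl
    · have := hB 0 0 2 3; rw [b02, b03] at this; linarith
    · have := hB 0 1 2 3; rw [b02, b03] at this; linarith
    · have := hB 1 0 2 3; rw [b12, b13] at this; linarith
    · have := hB 1 1 2 3; rw [b12, b13] at this; linarith
  have z01 : r 0 0 0 1 = 0 ∧ r 0 1 0 1 = 0 ∧ r 1 0 0 1 = 0 ∧ r 1 1 0 1 = 0 := by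
    have h1 := hB 2 2 0 1; have h2 := hB 2 3 0 1; have h3 := hB 3 2 0 1; have h4 := hB 3 3 0 1
    rw [b22, b20, b21] at h1; rw [b23, b20, b21] at h2; rw [b32, b30, b31] at h3
    rw [b33, b30, b31] at h4
    refine ⟨?_, ?_, ?_, ?_⟩ <;> linarith
  have q1 (a e) : r a 0 1 e = r a 1 0 e - r a e 0 1 := by
    have := hB a 0 1 e; have := hs a 1 0 e; linarith
  have p1 := q1 0 2; have p2 := q1 0 3; have p3 := q1 1 2; have p4 := q1 1 3
  rw [b02, sub_zero] at p1; rw [b03, sub_zero] at p2; rw [b12, sub_zero] at p3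
  rw [b13, sub_zero] at p4
  have q2 (a e) : r a 2 3 e = r a 3 2 e - r a e 2 3 := by
    have := hB a 2 3 e; have := hs a 3 2 e; linarith
  have m1 := q2 2 0; have m2 := q2 2 1; have m3 := q2 3 0; have m4 := q2 3 1
  rw [b20, b22, b23, sub_zero, hs _ _ 0, hs _ _ 0 2] at m1
  rw [b21, b22, b23, sub_zero, hs _ _ 1, hs _ _ 1 2] at m2
  rw [b30, b32, b33, sub_zero, hs _ _ 0, hs _ _ 0 2] at m3
  rw [b31, b32, b33, sub_zero, hs _ _ 1, hs _ _ 1 2] at m4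
  have e02 := hE 0 2; have e03 := hE 0 3; have e12 := hE 1 2; have e13 := hE 1 3
  have e20 := hE 2 0; have e21 := hE 2 1; have e30 := hE 3 0; have e31 := hE 3 1
  simp [hs0, b20, b21, b30, b31, b02, b03, b12, b13, b22, b23, b32, b33] at e02 e03 e12 e13 e20 e21 e30 e31
  rw [hs _ _ 0 2, hs _ _ 0 3] at e20
  rw [hs _ _ 1 2, hs _ _ 1 3] at e21
  rw [hs _ _ 0 2, hs _ _ 0 3] at e30
  rw [hs _ _ 1 2, hs _ _ 1 3] at e31
  have w0 : psi0 g θ x = - r 1 0 0 3 := by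
    rw [psi0, hW, ← b23]; simp [hr]
  have w1 : psi1 g θ x = - r 1 1 0 3 := by
    rw [psi1, hW, ← b33]; simp [hr]
  have w2 : psi2 g θ x = r 1 0 1 2 - S / 12 := by
    have := b23 1 2
    simp only [hr] at this
    rw [psi2, hW]; simp [this, hr]; ring
  have w3 : psi3 g θ x = - r 0 0 1 2 := by
    rw [psi3, hW, ← b22]; simp [hr]
  have w4 : psi4 g θ x = - r 0 1 1 2 := by
    rw [psi4, hW, ← b32]; simp [hr]
  have w5 : psi2' g θ x = - S / 12 := by
    have := b21 2 3
    simp only [hr] at this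
    rw [psi2', hW]; simp [this]; ring
  refine ⟨fun a b c e => ?_, w5⟩
  change r a b c e = _
  rw [hb, curvTable]
  have t (a b c e : Fin 4) := hs a b c e
  obtain ⟨z1, z2, z3, z4⟩ := z01
  have y1 := z23 0 0 (.inl rfl) (.inl rfl); have y2 := z23 0 1 (.inl rfl) (.inr rfl)
  have y3 := z23 1 0 (.inr rfl) (.inl rfl); have y4 := z23 1 1 (.inr rfl) (.inr rfl)
  have key (a b c e : Fin 4) (M : Matrix (Fin 4) (Fin 4) ℝ) (hM : ∀ i j, M j i = - M i j)
      (h01 : r a b 0 1 = M 0 1) (h02 : r a b 0 2 = M 0 2) (h03 : r a b 0 3 = M 0 3)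
      (h12 : r a b 1 2 = M 1 2) (h13 : r a b 1 3 = M 1 3) (h23 : r a b 2 3 = M 2 3) :
      r a b c e = M c e := by
    have hM0 (i) : M i i = 0 := by have := hM i i; linarith
    fin_cases c <;> fin_cases e <;> simp only [Fin.isValue, Fin.zero_eta, Fin.mk_one,
      Fin.reduceFinMk, hs0, hM0, h01, h02, h03, h12, h13, h23, hs a b 0 1, hs a b 0 2, hs a b 0 3,
      hs a b 1 2, hs a b 1 3, hs a b 2 3, hM 0 1, hM 0 2, hM 0 3, hM 1 2, hM 1 3, hM 2 3]
  have sk (p q u v : ℝ) (i j) : skewBlock p q u v j i = - skewBlock p q u v i j := by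
    fin_cases i <;> fin_cases j <;> simp [skewBlock]
  congr 1
  · refine key _ _ _ _ _ (sk _ _ _ _) ?_ ?_ ?_ ?_ ?_ ?_ <;> simp [skewBlock] <;> linarith
  · refine key _ _ _ _ _ (sk _ _ _ _) ?_ ?_ ?_ ?_ ?_ ?_ <;> simp [skewBlock] <;> linarith
  · refine key _ _ _ _ _ (sk _ _ _ _) ?_ ?_ ?_ ?_ ?_ ?_ <;> simp [skewBlock] <;> linarith
  · refine key _ _ _ _ _ (sk _ _ _ _) ?_ ?_ ?_ ?_ ?_ ?_ <;> simp [skewBlock] <;> linarith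

theorem weylComp_table (h : IsAdaptedOn U g K θ) (hg : IsPKEOn U g K) (x : U) (a b c e : Fin 4) :
    weylComp g (θ x) x a b c e = curvTable (psi0 g θ x) (psi1 g θ x) (psi2 g θ x) (psi3 g θ x)
      (psi4 g θ x) (-scalarCurv g x / 12) (a + 2) b c e - (-scalarCurv g x / 12) *
      ((if a + 2 = e then 1 else 0) * (if b + 2 = c then 1 else 0)
        - (if a + 2 = c then 1 else 0) * (if b + 2 = e then 1 else 0)) := by
  rw [h.null.weylComp_eq x (hg.einstein x x.2), (h.ev_rF_eq hg x).1]
  ring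

/-- The quartic in an adapted coframe. -/
theorem quartic_eq (h : IsAdaptedOn U g K θ) (hg : IsPKEOn U g K) (x : U) (ξ₀ ξ₁ : ℝ) :
    asdQuartic g (θ x) x ξ₀ ξ₁ = psi4 g θ x * ξ₁ ^ 4 + 4 * psi3 g θ x * ξ₀ * ξ₁ ^ 3
      + 6 * psi2 g θ x * ξ₀ ^ 2 * ξ₁ ^ 2 + 4 * psi1 g θ x * ξ₀ ^ 3 * ξ₁ + psi0 g θ x * ξ₀ ^ 4 :=
  asdQuartic_eq g (θ x) x _ ξ₀ ξ₁ ![psi0 g θ x, psi1 g θ x, psi2 g θ x, psi3 g θ x, psi4 g θ x]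
    (h.weylComp_table hg x)

end IsAdaptedOn

/-! ### Frames of real Petrov type `D`: the Bianchi identity -/

/-- The structure equations of a reduced frame over a differential ring, where `d` are the
derivations along the frame, `γ`, `α`, `β`, `δ` the components of `Γ¹₁`, `Γ¹₂`, `Γ²₁`, `Γ²₂`, `ψ` stands
for `Ψ₂`, and `s` for `-R / 12`. -/
structure TypeDFrame {R : Type*} [CommRing R] [Algebra ℝ R] (d : Fin 4 → Derivation ℝ R R)
    (γ α β δ : Fin 4 → R) (ψ s : R) : Prop where
  comm : ∀ b c f, d b (d c f) - d c (d b f)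
    = ∑ a, (glConn γ α β δ a c b - glConn γ α β δ a b c) * d a f
  curv : ∀ a b c e, frameCurv d (glConn γ α β δ) a b c e = curvTable 0 0 ψ 0 0 s a b c e
  unit : IsUnit ψ

theorem isUnit_natCast_of_algebra {R : Type*} [CommRing R] [Algebra ℝ R] (n : ℕ) [NeZero n] :
    IsUnit (n : R) := by
  have : (algebraMap ℝ R) n = n := map_natCast _ n
  rw [← this]
  exact (IsUnit.mk0 (n : ℝ) (NeZero.ne _)).map _

theorem eq_zero_of_natCast_mul {R : Type*} [CommRing R] [Algebra ℝ R] (n : ℕ) [NeZero n] {u x : R}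
    (hu : IsUnit u) (h : (n : R) * u * x = 0) : x = 0 :=
  ((isUnit_natCast_of_algebra n).mul hu).mul_right_eq_zero.1 h

theorem der_two {R : Type*} [CommRing R] [Algebra ℝ R] (d : Derivation ℝ R R) : d 2 = 0 := by
  simpa using d.map_natCast 2

namespace TypeDFrame

variable {R : Type*} [CommRing R] [Algebra ℝ R] {d : Fin 4 → Derivation ℝ R R}
  {γ α β δ : Fin 4 → R} {ψ s : R}

/-- The Bianchi identity of a frame with `Ψ₀ = Ψ₁ = Ψ₃ = Ψ₄ = 0` has, apart from equations for `dΨ₂`,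
the algebraic consequences `Ψ₂ α₁ = Ψ₂ α₂ = Ψ₂ β₀ = Ψ₂ β₃ = 0`, as in the Goldberg–Sachs theorem. -/
theorem alpha_one (h : TypeDFrame d γ α β δ ψ s) : α 1 = 0 := by
  have b := frame_bianchi h.comm 0 1 0 1 2
  simp [h.curv, curvTable, glBlock, skewBlock, Fin.sum_univ_four, glConn] at b
  exact eq_zero_of_natCast_mul 3 h.unit (by push_cast; linear_combination -b)

theorem alpha_two (h : TypeDFrame d γ α β δ ψ s) : α 2 = 0 := by
  have b := frame_bianchi h.comm 0 1 1 2 3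
  simp [h.curv, curvTable, glBlock, skewBlock, Fin.sum_univ_four, glConn] at b
  exact eq_zero_of_natCast_mul 3 h.unit (by push_cast; linear_combination b)

theorem beta_zero (h : TypeDFrame d γ α β δ ψ s) : β 0 = 0 := by
  have b := frame_bianchi h.comm 1 0 0 1 3
  simp [h.curv, curvTable, glBlock, skewBlock, Fin.sum_univ_four, glConn] at b
  exact eq_zero_of_natCast_mul 3 h.unit (by push_cast; linear_combination b)

theorem beta_three (h : TypeDFrame d γ α β δ ψ s) : β 3 = 0 := by
  have b := frame_bianchi h.comm 1 0 0 2 3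
  simp [h.curv, curvTable, glBlock, skewBlock, Fin.sum_univ_four, glConn] at b
  exact eq_zero_of_natCast_mul 3 h.unit (by push_cast; linear_combination -b)

/-- The Bianchi identity determines the differential of `Ψ₂`. -/
theorem der_psi (h : TypeDFrame d γ α β δ ψ s) (i : Fin 4) :
    d i ψ = 3 * ψ * ![- β 1, - α 0, α 3, β 2] i := by
  have b1 := frame_bianchi h.comm 0 1 0 1 3
  have b2 := frame_bianchi h.comm 0 1 0 2 3
  have c1 := frame_bianchi h.comm 1 0 0 1 2
  have c4 := frame_bianchi h.comm 1 0 1 2 3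
  have d1 := frame_bianchi h.comm 0 0 0 1 2
  have d2 := frame_bianchi h.comm 1 1 0 1 3
  have d3 := frame_bianchi h.comm 0 0 0 2 3
  have d4 := frame_bianchi h.comm 1 1 1 2 3
  simp [h.curv, curvTable, glBlock, skewBlock, Fin.sum_univ_four, glConn, der_two]
    at b1 b2 c1 c4 d1 d2 d3 d4
  have key {u : R} (hu : 3 * u = 0) : u = 0 :=
    eq_zero_of_natCast_mul 3 isUnit_one (by push_cast; linear_combination hu)
  rw [← sub_eq_zero]
  fin_cases i <;> simp only [Fin.isValue, Fin.zero_eta, Fin.mk_one, Fin.reduceFinMk,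
    Matrix.cons_val_zero, Matrix.cons_val_one, Matrix.cons_val] <;> apply key
  · linear_combination 2 * c1 - d2
  · linear_combination -2 * b1 + d1
  · linear_combination -2 * b2 + d4
  · linear_combination 2 * c4 - d3

/-- The scalar curvature is constant. -/
theorem der_scal (h : TypeDFrame d γ α β δ ψ s) (i : Fin 4) : d i s = 0 := by
  have b1 := frame_bianchi h.comm 0 1 0 1 3
  have b2 := frame_bianchi h.comm 0 1 0 2 3
  have c1 := frame_bianchi h.comm 1 0 0 1 2
  have c4 := frame_bianchi h.comm 1 0 1 2 3
  have e0 := h.der_psi 0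
  have e1 := h.der_psi 1
  have e2 := h.der_psi 2
  have e3 := h.der_psi 3
  simp [h.curv, curvTable, glBlock, skewBlock, Fin.sum_univ_four, glConn]
    at b1 b2 c1 c4 e0 e1 e2 e3
  fin_cases i <;> simp only [Fin.isValue, Fin.zero_eta, Fin.mk_one, Fin.reduceFinMk]
  · linear_combination -c1 + e0
  · linear_combination b1 + e1
  · linear_combination b2 + e2
  · linear_combination -c4 + e3

end TypeDFrame

/-! ### The structure equations of the first branch -/

/-- The 1-form with components `p` in a frame with connection `G` is closed. -/
def IsClosedFrame {R : Type*} [CommRing R] [Algebra ℝ R] (d : Fin 4 → Derivation ℝ R R)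
    (G : Fin 4 → Fin 4 → Fin 4 → R) (p : Fin 4 → R) : Prop :=
  ∀ b c, d b (p c) - d c (p b) = ∑ a, (G a c b - G a b c) * p a

/-- The structure equations of the first branch, in the gauge `J₂ = J₄ = 1`. The unknowns are
`ψ = Ψ₂`, `s = -R / 12`, `j₁ = J₁`, `j₃ = J₃` and the components `g` of `Γ¹₁` and `e` of `Γ²₂` along the
first and the second vector of the frame; the system expresses all their differentials. -/
structure GenericFrame {R : Type*} [CommRing R] [Algebra ℝ R] (d : Fin 4 → Derivation ℝ R R)
    (γ δ : Fin 4 → R) (ψ s j₁ j₃ g e : R) : Prop where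
  gamma_eq : γ = ![g, j₃, 1, 2]
  delta_eq : δ = ![-j₁, e, 2, 1]
  add_eq : g + e = ψ - s
  der_psi : ∀ i, d i ψ = 3 * ψ * ![-j₁, j₃, 1, 1] i
  der_s : ∀ i, d i s = 0
  der_one : ∀ i, d i j₁ = ![j₁ * g - j₁ ^ 2, 3 * j₁ * j₃, j₁ - g, 3 * j₁] i
  der_three : ∀ i, d i j₃ = ![-3 * j₁ * j₃, j₃ * e + j₃ ^ 2, 3 * j₃, j₃ + e] i
  der_g : ∀ i, d i g = ![-3 * ψ * j₁ + 2 * e * j₁ + 2 * j₁ * j₃, 2 * g * j₃ - 2 * j₁ * j₃,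
    2 * g - 2 * j₃ + ψ + 2 * s, 2 * g - 2 * j₁] i

namespace TypeDFrame

variable {R : Type*} [CommRing R] [Algebra ℝ R] {d : Fin 4 → Derivation ℝ R R}
  {γ δ : Fin 4 → R} {ψ s j₁ j₃ : R}

/-- The curvature equations leave two functions undetermined, the component `m` of `Γ²₂` and the
derivative `q = ∂₁ J₃`. The commutators of derivations, applied to the unknowns, fix them as `m = 2` and
`q = -3 J₁ J₃`, and thereby close the system. -/
theorem genericFrame (h : TypeDFrame d γ ![-j₃, 0, 0, 1] ![0, j₁, 1, 0] δ ψ s) (hs : IsUnit s) :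
    GenericFrame d γ δ ψ s j₁ j₃ (γ 0) (δ 1) := by
  have a01 := h.curv 0 1 0 1
  have a02 := h.curv 0 1 0 2
  have a03 := h.curv 0 1 0 3
  have a13 := h.curv 0 1 1 3
  have a23 := h.curv 0 1 2 3
  have b01 := h.curv 1 0 0 1
  have b02 := h.curv 1 0 0 2
  have b12 := h.curv 1 0 1 2
  have b13 := h.curv 1 0 1 3
  have b23 := h.curv 1 0 2 3
  simp [curvTable, glBlock, skewBlock, Fin.sum_univ_four, glConn, frameCurv]
    at a01 a02 a03 a13 a23 b01 b02 b12 b13 b23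
  have hγ1 : γ 1 = j₃ := by linear_combination a13
  have hγ2 : γ 2 = 1 := by linear_combination a23
  have hδ0 : δ 0 = -j₁ := by linear_combination b02
  have hδ3 : δ 3 = 1 := by linear_combination -b23
  have c01 := h.curv 0 0 0 1
  have c02 := h.curv 0 0 0 2
  have c03 := h.curv 0 0 0 3
  have c23 := h.curv 0 0 2 3
  have e01 := h.curv 1 1 0 1
  have e02 := h.curv 1 1 0 2
  have e12 := h.curv 1 1 1 2
  have e13 := h.curv 1 1 1 3
  have e23 := h.curv 1 1 2 3
  simp [curvTable, glBlock, skewBlock, Fin.sum_univ_four, glConn, frameCurv, hγ1, hγ2, hδ0, hδ3]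
    at a01 a02 a03 b01 b12 b13 c01 c02 c03 c23 e01 e02 e12 e13 e23
  have p0 : d 0 ψ = 3 * ψ * -j₁ := h.der_psi 0
  have p1 : d 1 ψ = 3 * ψ * j₃ := by rw [h.der_psi 1]; simp
  have p2 : d 2 ψ = 3 * ψ * 1 := h.der_psi 2
  have p3 : d 3 ψ = 3 * ψ * 1 := h.der_psi 3
  have hsd := h.der_scal
  have d2 := fun i => der_two (d i)
  have d3 : ∀ i, d i 3 = 0 := fun i => by simpa using (d i).map_natCast 3
  have d4 : ∀ i, d i 4 = 0 := fun i => by simpa using (d i).map_natCast 4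
  have d5 : ∀ i, d i 5 = 0 := fun i => by simpa using (d i).map_natCast 5
  have k01 := h.comm 0 1 ψ
  have k02 := h.comm 0 2 ψ
  have k23 := h.comm 2 3 ψ
  rw [p1, p0] at k01
  rw [p2, p0] at k02
  rw [p3, p2] at k23
  simp [glBlock, Fin.sum_univ_four, glConn, p0, p1, p2, p3, d3, hγ1, hγ2, hδ0, hδ3] at k01 k02 k23
  have hmn : γ 3 = δ 2 := by
    rw [← sub_eq_zero]
    exact eq_zero_of_natCast_mul 3 h.unit (by push_cast; linear_combination -k23)
  simp only [hmn] at a02 a03 b13 c02 c03 c23 e01 e02 e12 e13 e23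
  set m := δ 2 with hm
  set g := γ 0 with hg
  set e := δ 1 with he
  have o2 : d 2 j₁ = j₁ - g := by
    rw [← sub_eq_zero]
    exact eq_zero_of_natCast_mul 3 h.unit (by push_cast; linear_combination k02)
  have ha : g + e = ψ - s := by linear_combination b12 + o2
  have q1 : d 1 j₁ = -d 0 j₃ := by
    rw [← sub_eq_zero]
    exact eq_zero_of_natCast_mul 3 h.unit (by push_cast; linear_combination k01)
  have o0 : d 0 j₁ = j₁ * g - j₁ ^ 2 := by linear_combination b01
  have o3 : d 3 j₁ = j₁ * (m + 1) := by linear_combination -b13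
  have t1 : d 1 j₃ = j₃ * e + j₃ ^ 2 := by linear_combination a01
  have t2 : d 2 j₃ = j₃ * (m + 1) := by linear_combination a02
  have t3 : d 3 j₃ = j₃ + e := by linear_combination a03 - ha
  have m2 : d 2 m = (2 - m) * m := by linear_combination c23
  have m3 : d 3 m = (2 - m) * m := by linear_combination -e23
  have m0 : d 0 m = (2 - m) * g := by linear_combination e02 - o2 - ha
  have g2 : d 2 g = 2 * g - m * j₃ + ψ + 2 * s := by linear_combination -c02
  have g3 : d 3 g = 2 * g - m * j₁ := by linear_combination -c03 + m0
  -- the condition `d² g = 0` is the equation `3 s (m - 2) = 0`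
  have hm2 : m = 2 := by
    have k := h.comm 2 3 g
    rw [g2, g3] at k
    simp [glBlock, Fin.sum_univ_four, glConn, d2, o2, t3, m2, m3, g2, g3, p3, hsd, hγ2,
      hδ3, hmn] at k
    rw [← sub_eq_zero]
    exact eq_zero_of_natCast_mul 3 hs (by push_cast; linear_combination -k + m * ha)
  rw [hm2] at o3 t2 g2 g3 m2 m3 m0
  set q := d 0 j₃ with hq
  have g1 : d 1 g = 2 * g * j₃ + q + j₁ * j₃ := by linear_combination -c01
  have e0 : d 0 e = -2 * e * j₁ + q + j₁ * j₃ := by linear_combination e01 - q1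
  have ga (i) : d i g + d i e = d i ψ := by
    rw [← map_add, ha, map_sub, hsd, sub_zero]
  have g0 : d 0 g = -3 * ψ * j₁ + 2 * e * j₁ - q - j₁ * j₃ := by
    linear_combination ga 0 - e0 + p0
  have e1 : d 1 e = 3 * ψ * j₃ - (2 * g * j₃ + q + j₁ * j₃) := by
    linear_combination ga 1 - g1 + p1
  have e2 : d 2 e = 2 * e + 2 * j₃ := by linear_combination ga 2 - g2 + p2 - 2 * ha
  have e3 : d 3 e = 2 * e + 2 * j₁ + ψ + 2 * s := by linear_combination ga 3 - g3 + p3 - 2 * ha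
  have r3 : d 3 q = 4 * q - 3 * e * j₁ := by
    have k := h.comm 0 3 j₃
    rw [t3] at k
    simp [glBlock, Fin.sum_univ_four, glConn, e0, ← hq, hδ0, hmn, t3, hm2, t2] at k
    linear_combination -k
  have r2 : d 2 q = 4 * q + 3 * g * j₃ := by
    have k := h.comm 0 2 j₃
    rw [t2] at k
    simp [glBlock, Fin.sum_univ_four, glConn, ← hq, hγ2, d2, t1, t2, t3, ← hg] at k
    linear_combination -k
  have r1 : d 1 q = q * e + 5 * j₃ * q + 3 * j₁ * j₃ ^ 2 := by
    have k := h.comm 0 1 j₃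
    rw [t1] at k
    simp [glBlock, Fin.sum_univ_four, glConn, ← hq, t1, e0, hδ0, hγ1, pow_two] at k
    linear_combination -k
  have r0 : d 0 q = q * g - 5 * j₁ * q - 3 * j₃ * j₁ ^ 2 := by
    have k := h.comm 0 1 j₁
    rw [o0, q1, map_neg] at k
    simp [glBlock, Fin.sum_univ_four, glConn, o0, g1, q1, hδ0, hγ1, pow_two, ← hg] at k
    linear_combination -k
  -- the condition `d² q = 0` is the equation `3 s (q + 3 j₁ j₃) = 0`
  have hq3 : q = -3 * j₁ * j₃ := by
    have k := h.comm 1 3 q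
    rw [r3, r1] at k
    simp [glBlock, Fin.sum_univ_four, glConn, r0, r1, r2, r3, o3, t3, e1, e3, q1, d3, d4, d5, hδ3,
      pow_two, ← he] at k
    rw [← sub_eq_zero]
    exact eq_zero_of_natCast_mul 3 hs
      (by push_cast; linear_combination -k + (q + 9 * j₁ * j₃) * ha)
  refine ⟨?_, ?_, ha, ?_, hsd, ?_, ?_, ?_⟩
  · ext i; fin_cases i <;> simp [hγ1, hγ2, hmn, hm2]; rfl
  · ext i; fin_cases i <;> simp [hδ0, hδ3, ← hm, hm2]; rfl
  · intro i; fin_cases i <;> simp [p0, p1, p2, p3]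
  · intro i; fin_cases i <;> simp [o0, q1, o2, o3, hq3] <;> ring
  · intro i; fin_cases i <;> simp [← hq, t1, t2, t3, hq3]; ring
  · intro i; fin_cases i <;> simp [g0, g1, g2, g3, hq3] <;> ring

end TypeDFrame

/-! ### Integration of closed forms and of flat linear systems in a frame -/

section Frame

variable {F : Type*} [NormedAddCommGroup F] [NormedSpace ℝ F]

theorem bilinear_ext_frame {θ : Fin 4 → E4 →L[ℝ] ℝ} (hθ : LinearIndependent ℝ θ)
    {A B : E4 →L[ℝ] E4 →L[ℝ] F}
    (h : ∀ b c, A (dualVec θ b) (dualVec θ c) = B (dualVec θ b) (dualVec θ c)) : A = B := by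
  ext u v
  rw [← sum_smul_dualVec hθ u, ← sum_smul_dualVec hθ v]
  simp only [map_sum, map_smul, sum_apply, smul_apply, h]

namespace IsNullCoframeOn

variable {U : Opens E4} {g : BilinField} {θ : FormQuad}

/-- The exterior derivative of a vector-valued 1-form, evaluated on two fields of a frame. -/
theorem fderiv_form_frame (h : IsNullCoframeOn U g θ) (x : U) {A : E4 → E4 →L[ℝ] F}
    {P : Fin 4 → E4 → F} (hA : DifferentiableAt ℝ A x)
    (hP : ∀ c, ∀ z ∈ U, A z (dualVec (θ z) c) = P c z) (b c : Fin 4) :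
    fderiv ℝ A x (dualVec (θ x) b) (dualVec (θ x) c)
      - fderiv ℝ A x (dualVec (θ x) c) (dualVec (θ x) b)
      = fderiv ℝ (P c) x (dualVec (θ x) b) - fderiv ℝ (P b) x (dualVec (θ x) c)
        - ∑ a, (Sm.ev x (cG U g θ a c b) - Sm.ev x (cG U g θ a b c)) • P a x := by
  have hU : (U : Set E4) ∈ nhds (x : E4) := U.isOpen.mem_nhds x.2
  have he (b : Fin 4) : DifferentiableAt ℝ (fun z => dualVec (θ z) b) x :=
    ((contDiffOn_dualVec h.smooth h.indep b).contDiffAt hU).differentiableAt (by simp)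
  have hD (b c : Fin 4) : fderiv ℝ A x (dualVec (θ x) b) (dualVec (θ x) c)
      = fderiv ℝ (P c) x (dualVec (θ x) b)
        - A x (fderiv ℝ (fun z => dualVec (θ z) c) x (dualVec (θ x) b)) := by
    have h1 := hA.hasFDerivAt.clm_apply (he c).hasFDerivAt
    have h2 : (fun z => A z (dualVec (θ z) c)) =ᶠ[nhds (x : E4)] P c := by
      filter_upwards [hU] with z hz using hP c z hz
    rw [← h2.fderiv_eq, h1.fderiv]
    simp
  have hb : ∑ a, (Sm.ev x (cG U g θ a c b) - Sm.ev x (cG U g θ a b c)) • P a x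
      = A x (fderiv ℝ (fun z => dualVec (θ z) c) x (dualVec (θ x) b))
        - A x (fderiv ℝ (fun z => dualVec (θ z) b) x (dualVec (θ x) c)) := by
    rw [← map_sub]
    conv_rhs => rw [← sum_smul_dualVec (h.indep x x.2) (fderiv ℝ (fun z => dualVec (θ z) c) x
      (dualVec (θ x) b) - fderiv ℝ (fun z => dualVec (θ z) b) x (dualVec (θ x) c))]
    rw [map_sum]
    refine Finset.sum_congr rfl fun a _ => ?_
    rw [map_smul, hP a x x.2, ← h.apply_lieBracket]; rfl
  rw [hD, hD, hb]
  abel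

theorem fderiv_eq_sum (h : IsNullCoframeOn U g θ) (x : U) (f : Sm U) (v : E4) :
    fderiv ℝ f.fn x v = ∑ c, θ x c v * Sm.ev x (dF U θ c f) := by
  conv_lhs => rw [← sum_smul_dualVec (h.indep x x.2) v]
  simp only [map_sum, map_smul, smul_eq_mul, ev_dF h.smooth h.indep]

/-- A function with vanishing differential is constant. -/
theorem exists_eq_algebraMap (h : IsNullCoframeOn U g θ) (hU : Convex ℝ (U : Set E4))
    {f : Sm U} (hf : ∀ a, dF U θ a f = 0) : ∃ c : ℝ, f = algebraMap ℝ (Sm U) c := by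
  by_cases hne : Nonempty U
  · obtain ⟨p⟩ := hne
    refine ⟨Sm.ev p f, Sm.ext fun x => ?_⟩
    rw [AlgHom.commutes, ← Sm.fn_apply, ← Sm.fn_apply]
    have hd (z : E4) (hz : z ∈ U) : fderiv ℝ f.fn z = 0 := by
      ext v
      rw [h.fderiv_eq_sum ⟨z, hz⟩]
      simp [hf]
    exact (hU.is_const_of_fderivWithin_eq_zero
      (fun z hz => (Sm.differentiableAt_fn f ⟨z, hz⟩).differentiableWithinAt)
      (fun z hz => by rw [fderivWithin_of_isOpen U.isOpen hz, hd z hz]) x.2 p.2)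
  · exact ⟨0, Sm.ext fun x => (hne ⟨x⟩).elim⟩

/-- The Poincaré lemma in a frame. -/
theorem exists_potential (h : IsNullCoframeOn U g θ) (hU : Convex ℝ (U : Set E4))
    {p : Fin 4 → Sm U} (hp : IsClosedFrame (dF U θ) (cG U g θ) p) :
    ∃ f : Sm U, ∀ a, dF U θ a f = p a := by
  set η : E4 → E4 →L[ℝ] ℝ := fun z => ∑ a, (p a).fn z • θ z a with hη
  have hs : ContDiffOn ℝ ∞ η U :=
    ContDiffOn.sum fun a _ => (p a).contDiffOn_fn.smul (h.smooth a)
  have hP (c : Fin 4) (z : E4) (hz : z ∈ U) : η z (dualVec (θ z) c) = (p c).fn z := by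
    simp [hη, apply_dualVec (h.indep z hz)]
  have hd : ∀ z ∈ (U : Set E4), DifferentiableAt ℝ η z := fun z hz =>
    (hs.contDiffAt (U.isOpen.mem_nhds hz)).differentiableAt (by simp)
  have hsym : ∀ z ∈ (U : Set E4), ∀ u v, fderiv ℝ η z u v = fderiv ℝ η z v u := by
    intro z hz u v
    have : fderiv ℝ η z = (fderiv ℝ η z).flip := by
      refine bilinear_ext_frame (h.indep z hz) fun b c => ?_
      rw [ContinuousLinearMap.flip_apply, ← sub_eq_zero,
        h.fderiv_form_frame ⟨z, hz⟩ (hd z hz) hP b c]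
      have := congrArg (Sm.ev ⟨z, hz⟩) (hp b c)
      simp only [map_sub, map_sum, map_mul, ev_dF h.smooth h.indep] at this
      rw [this, sub_eq_zero]
      exact Finset.sum_congr rfl fun a _ => by
        rw [smul_eq_mul, Sm.fn_apply _ ⟨z, hz⟩]
    exact congrArg (fun B => B u v) this
  obtain ⟨f, hf⟩ := hU.exists_forall_hasFDerivAt_of_fderiv_symmetric U.isOpen
    (fun z hz => (hd z hz).differentiableWithinAt) hsym
  have hfs : ContDiffOn ℝ ∞ f U := by
    rw [contDiffOn_infty_iff_fderiv_of_isOpen U.isOpen]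
    exact ⟨fun z hz => (hf z hz).differentiableAt.differentiableWithinAt,
      hs.congr fun z hz => (hf z hz).fderiv⟩
  refine ⟨Sm.of U f, fun a => Sm.ext fun x => ?_⟩
  rw [ev_dF_eq h.smooth h.indep (Sm.ev_of hfs), (hf x x.2).fderiv, hP a x x.2, Sm.fn_apply]

end IsNullCoframeOn

end Frame

section LinearSystem

variable {n : ℕ}

/-- The elementary endomorphisms of `ℝⁿ`. -/
def elemMap (i j : Fin n) : (Fin n → ℝ) →L[ℝ] (Fin n → ℝ) :=
  (ContinuousLinearMap.proj j : (Fin n → ℝ) →L[ℝ] ℝ).smulRight (Pi.single i (1 : ℝ))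

/-- The continuous linear map of a matrix. -/
def matMap (M : Matrix (Fin n) (Fin n) ℝ) : (Fin n → ℝ) →L[ℝ] (Fin n → ℝ) :=
  ∑ i, ∑ j, M i j • elemMap i j

theorem matMap_apply (M : Matrix (Fin n) (Fin n) ℝ) (w : Fin n → ℝ) :
    matMap M w = M.mulVec w := by
  ext k
  simp [matMap, elemMap, Matrix.mulVec, dotProduct, Finset.sum_apply, Pi.single_apply]

namespace IsNullCoframeOn

variable {U : Opens E4} {g : BilinField} {θ : FormQuad}

/-- Frobenius' theorem for a flat linear system, in a frame. -/
theorem exists_flat_solution (h : IsNullCoframeOn U g θ) {p : E4} (hp : p ∈ U)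
    {B : Fin 4 → Matrix (Fin n) (Fin n) (Sm U)}
    (hB : ∀ b c, (B c).map (dF U θ b) - (B b).map (dF U θ c) + (B c * B b - B b * B c)
      = ∑ a, (cG U g θ a c b - cG U g θ a b c) • B a) (X₀ : Fin n → ℝ) :
    ∃ r > 0, ∃ hr : Metric.ball p r ⊆ U, ∃ X : E4 → Fin n → ℝ,
      ContDiffOn ℝ ∞ X (Metric.ball p r) ∧ X p = X₀ ∧
      ∀ y (hy : y ∈ Metric.ball p r), ∀ c, fderiv ℝ X y (dualVec (θ y) c)
        = ((B c).map (Sm.ev ⟨y, hr hy⟩)).mulVec (X y) := by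
  set P : Fin 4 → E4 → (Fin n → ℝ) →L[ℝ] (Fin n → ℝ) :=
    fun c z => ∑ i, ∑ j, (B c i j).fn z • elemMap i j with hPdef
  have hPm (c : Fin 4) (x : U) : P c x = matMap ((B c).map (Sm.ev x)) := by
    simp only [hPdef, matMap, Sm.fn_apply, Matrix.map_apply]
  have hPs (c : Fin 4) : ContDiffOn ℝ ∞ (P c) U :=
    ContDiffOn.sum fun i _ => ContDiffOn.sum fun j _ =>
      (B c i j).contDiffOn_fn.smul contDiffOn_const
  set A : E4 → E4 →L[ℝ] (Fin n → ℝ) →L[ℝ] (Fin n → ℝ) :=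
    fun z => ∑ c, (θ z c).smulRight (P c z) with hAdef
  have hA : ContDiffOn ℝ ∞ A U :=
    ContDiffOn.sum fun c _ => (h.smooth c).smulRight (hPs c)
  have hAP (c : Fin 4) (z : E4) (hz : z ∈ U) : A z (dualVec (θ z) c) = P c z := by
    simp [hAdef, apply_dualVec (h.indep z hz)]
  have hflat : ∀ x ∈ (U : Set E4), ∀ u v, fderiv ℝ A x u v + (A x v).comp (A x u)
      = fderiv ℝ A x v u + (A x u).comp (A x v) := by
    intro x hx u v
    let L : E4 →L[ℝ] E4 →L[ℝ] (Fin n → ℝ) →L[ℝ] (Fin n → ℝ) :=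
      (ContinuousLinearMap.compL ℝ (Fin n → ℝ) (Fin n → ℝ) (Fin n → ℝ)).bilinearComp (A x) (A x)
    have hL (u v) : L u v = (A x u).comp (A x v) := rfl
    have : fderiv ℝ A x + L.flip = (fderiv ℝ A x).flip + L := by
      refine bilinear_ext_frame (h.indep x hx) fun b c => ?_
      simp only [add_apply, ContinuousLinearMap.flip_apply, hL]
      have h1 := h.fderiv_form_frame ⟨x, hx⟩
        ((hA.contDiffAt (U.isOpen.mem_nhds hx)).differentiableAt (by simp)) hAP b c
      have hfd (b c : Fin 4) : fderiv ℝ (P c) x (dualVec (θ x) b)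
          = matMap (((B c).map (dF U θ b)).map (Sm.ev ⟨x, hx⟩)) := by
        have : HasFDerivAt (P c) (∑ i, ∑ j, (fderiv ℝ (B c i j).fn x).smulRight (elemMap i j)) x :=
          HasFDerivAt.fun_sum fun i _ => HasFDerivAt.fun_sum fun j _ =>
            (Sm.differentiableAt_fn _ ⟨x, hx⟩).hasFDerivAt.smul_const _
        rw [this.fderiv]
        simp only [sum_apply, ContinuousLinearMap.smulRight_apply, matMap, Matrix.map_apply,
          ev_dF h.smooth h.indep]
      have h2 := congrArg (fun M => matMap (M.map (Sm.ev ⟨x, hx⟩))) (hB b c)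
      rw [hAP b x hx, hAP c x hx]
      simp only [hfd] at h1
      rw [← sub_eq_zero]
      refine ContinuousLinearMap.ext fun w => ?_
      have h1' := congrArg (fun T => T w) h1
      have h2' := congrArg (fun T => T w) h2
      simp only [sub_apply, sum_apply, smul_apply, matMap_apply, hPm _ ⟨x, hx⟩] at h1' h2'
      simp only [Matrix.map_sub _ (fun a b => map_sub (Sm.ev (⟨x, hx⟩ : U)) a b),
        Matrix.map_add _ (fun a b => map_add (Sm.ev (⟨x, hx⟩ : U)) a b), Matrix.map_mul,
        Matrix.add_mulVec, Matrix.sub_mulVec, ← Matrix.mulVec_mulVec] at h2'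
      have h3 : (∑ a, (cG U g θ a c b - cG U g θ a b c) • B a).map (Sm.ev ⟨x, hx⟩)
          = ∑ a, (Sm.ev ⟨x, hx⟩ (cG U g θ a c b) - Sm.ev ⟨x, hx⟩ (cG U g θ a b c)) •
            (B a).map (Sm.ev ⟨x, hx⟩) := by
        ext i j
        simp [Matrix.sum_apply]
      rw [h3, Matrix.sum_mulVec] at h2'
      simp only [Matrix.smul_mulVec] at h2'
      rw [← h2'] at h1'
      simp only [sub_apply, add_apply, ContinuousLinearMap.comp_apply, matMap_apply,
        hPm _ ⟨x, hx⟩, zero_apply]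
      have h4 := sub_eq_zero.2 h1'
      rw [← h4]
      abel
    exact congrArg (fun T => T u v) this
  obtain ⟨r, hr, hrU, X, hX, hXp, hXd⟩ := exists_parallel U.isOpen hp hA hflat X₀
  refine ⟨r, hr, hrU, X, hX, hXp, fun y hy c => ?_⟩
  rw [(hXd y hy).fderiv, ContinuousLinearMap.flip_apply, hAP c y (hrU hy), hPm c ⟨y, hrU hy⟩,
    matMap_apply]

end IsNullCoframeOn

end LinearSystem

/-! ### Para-Kähler–Einstein structures from solutions of the structure equations -/

theorem isAdapted_metricOf {θ : FormQuad} {x : E4} (h : LinearIndependent ℝ (θ x)) :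
    IsAdapted (metricOf θ x) (endoOf θ x) (θ x) := by
  have hd := apply_dualVec h
  refine ⟨h, fun v w => ?_, fun v => ?_, fun v => ?_, fun v => ?_, fun v => ?_⟩
  · simp [metricOf]
  all_goals simp [endoOf, hd]

theorem IsAdapted.paracomplex {G : E4 →L[ℝ] E4 →L[ℝ] ℝ} {k : E4 →L[ℝ] E4}
    {θ : Fin 4 → E4 →L[ℝ] ℝ} (h : IsAdapted G k θ) (v : E4) : k (k v) = v := by
  rw [← sum_smul_dualVec h.indep (k (k v)), ← sum_smul_dualVec h.indep v]
  refine Finset.sum_congr rfl fun a _ => ?_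
  rw [sum_smul_dualVec h.indep v, h.apply_endo, h.apply_endo, ← mul_assoc]
  congr 1
  fin_cases a <;> simp [eps]

namespace IsNullCoframeOn

variable {U : Opens E4} {g : BilinField} {θ : FormQuad}

/-- The Levi-Civita connection is determined by being metric and torsion-free, in a frame. -/
theorem cG_unique (h : IsNullCoframeOn U g θ) {G : Fin 4 → Fin 4 → Fin 4 → Sm U}
    (hsk : ∀ a b c, G (a + 2) b c + G (b + 2) a c = 0)
    (hE : ∀ j, IsClosedFrame (dF U θ) G ((cofSm U θ)⁻¹ j)) : cG U g θ = G := by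
  set S : Fin 4 → Fin 4 → Fin 4 → Sm U := fun a b c => cG U g θ a b c - G a b c with hS
  have hs (a b c : Fin 4) : S (a + 2) b c = - S (b + 2) a c := by
    simp only [hS]; linear_combination h.cG_skew a b c - hsk a b c
  have ht (j b c : Fin 4) : ∑ a, (cofSm U θ)⁻¹ j a * (S a c b - S a b c) = 0 := by
    have h1 := bracket_frame (D := Sm.coordDer) h.inv_mul_cof h.chr_gram_symm b c j
    have h2 := hE j b c
    rw [Finset.sum_sub_distrib, ← frameDer_apply, ← frameDer_apply] at h1
    change dF U θ b _ - dF U θ c _ = ∑ a, _ * (cG U g θ a c b - cG U g θ a b c) at h1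
    rw [h1] at h2
    rw [← sub_eq_zero.2 h2, ← Finset.sum_sub_distrib]
    exact Finset.sum_congr rfl fun a _ => by simp only [hS]; ring
  have hsym (a b c : Fin 4) : S a c b = S a b c := by
    have h1 : (cofSm U θ).mulVec ((cofSm U θ)⁻¹.mulVec fun a => S a c b - S a b c) a = 0 := by
      have : ((cofSm U θ)⁻¹.mulVec fun a => S a c b - S a b c) = 0 := funext fun j => ht j b c
      rw [this, Matrix.mulVec_zero]; rfl
    rw [Matrix.mulVec_mulVec, h.cof_mul_inv, Matrix.one_mulVec] at h1
    exact sub_eq_zero.1 h1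
  have h0 (a b c : Fin 4) : S (a + 2) b c = 0 := by
    have key : S (a + 2) b c = - S (a + 2) b c := by
      calc S (a + 2) b c = S (a + 2) c b := hsym _ _ _
        _ = - S (c + 2) a b := hs _ _ _
        _ = - S (c + 2) b a := by rw [hsym]
        _ = S (b + 2) c a := by rw [hs c b a, neg_neg]
        _ = S (b + 2) a c := hsym _ _ _
        _ = - S (a + 2) b c := hs _ _ _
    exact eq_zero_of_natCast_mul 2 isUnit_one (by push_cast; linear_combination key)
  funext a b c
  have := h0 (a + 2) b c
  rw [add_assoc, show (2 : Fin 4) + 2 = 0 from rfl, add_zero] at this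
  exact sub_eq_zero.1 this

/-- The Einstein equation and the scalar curvature from the frame components of the curvature. -/
theorem ricci_eq (h : IsNullCoframeOn U g θ) (x : U) {s : ℝ}
    (hr : ∀ b e, ∑ c, Sm.ev x (rF U g θ c b c e) = if b + 2 = e then -3 * s else 0) (a b : Fin 4) :
    ricci g a b x = -3 * s * gram g x a b := by
  have h1 : (∑ i, ∑ j, ricci g i j x • (dy i).smulRight (dy j) : E4 →L[ℝ] E4 →L[ℝ] ℝ)
      = (-3 * s) • g x := by
    refine bilinear_ext_frame (h.indep x x.2) fun b e => ?_
    have h2 := h.sum_ricci_dual x b e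
    rw [hr] at h2
    rw [smul_apply, smul_apply, h.metric_dual_dual x.2, smul_eq_mul, mul_ite, mul_one, mul_zero,
      ← h2]
    have hp (i : Fin 4) (v : E4) : dy i v = v i := rfl
    simp only [sum_apply, smul_apply, ContinuousLinearMap.smulRight_apply, smul_eq_mul, hp]
    exact Finset.sum_congr rfl fun i _ => Finset.sum_congr rfl fun j _ => by ring
  have h3 := congrArg (fun L => L (bvec a) (bvec b)) h1
  simpa [dy, bvec, gram, Pi.single_apply] using h3

theorem scalarCurv_eq (h : IsNullCoframeOn U g θ) (x : U) {s : ℝ}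
    (hr : ∀ a b, ricci g a b x = -3 * s * gram g x a b) : scalarCurv g x = -12 * s := by
  have hi : (gram g x)⁻¹ * gram g x = 1 := by
    refine Matrix.nonsing_inv_mul _ ?_
    rw [← h.map_gramSm, ← AlgHom.mapMatrix_apply, ← AlgHom.map_det]
    exact h.isUnit_det_gram.map _
  have ht : ∑ a, ∑ b, (gram g x)⁻¹ a b * gram g x b a = 4 := by
    have := congrArg Matrix.trace hi
    simpa [Matrix.trace, Matrix.mul_apply] using this
  calc scalarCurv g x = ∑ a, ∑ b, -3 * s * ((gram g x)⁻¹ a b * gram g x b a) := by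
        refine Finset.sum_congr rfl fun a _ => Finset.sum_congr rfl fun b _ => ?_
        rw [hr, h.gram_symm x a b]; ring
    _ = -3 * s * 4 := by rw [← ht, Finset.mul_sum]; simp only [Finset.mul_sum]
    _ = _ := by ring

end IsNullCoframeOn

theorem curvTable_trace (ψ₀ ψ₁ ψ₂ ψ₃ ψ₄ s : ℝ) (b e : Fin 4) :
    ∑ c, curvTable ψ₀ ψ₁ ψ₂ ψ₃ ψ₄ s c b c e = if b + 2 = e then -3 * s else 0 := by
  fin_cases b <;> fin_cases e <;>
    simp [curvTable, glBlock, skewBlock, Fin.sum_univ_four] <;> ring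

theorem map_glBlock {R S : Type*} [CommRing R] [CommRing S] (f : R →+* S) (γ α β δ : R)
    (a b : Fin 4) : f (glBlock γ α β δ a b) = glBlock (f γ) (f α) (f β) (f δ) a b := by
  fin_cases a <;> fin_cases b <;> simp [glBlock]

theorem map_skewBlock {R S : Type*} [CommRing R] [CommRing S] (f : R →+* S) (p q u v : R)
    (a b : Fin 4) : f (skewBlock p q u v a b) = skewBlock (f p) (f q) (f u) (f v) a b := by
  fin_cases a <;> fin_cases b <;> simp [skewBlock]

theorem map_curvTable {R S : Type*} [CommRing R] [CommRing S] (f : R →+* S)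
    (ψ₀ ψ₁ ψ₂ ψ₃ ψ₄ s : R) (a b c e : Fin 4) :
    f (curvTable ψ₀ ψ₁ ψ₂ ψ₃ ψ₄ s a b c e)
      = curvTable (f ψ₀) (f ψ₁) (f ψ₂) (f ψ₃) (f ψ₄) (f s) a b c e := by
  simp only [curvTable, map_glBlock, map_skewBlock, map_neg, map_sub, map_mul, map_ofNat]

namespace IsAdaptedOn

variable {U : Opens E4} {g : BilinField} {K : EndoField} {θ : FormQuad}

/-- If the components of the Levi-Civita connection lie in `𝔤𝔩(2, ℝ)`, then the annihilator of two
of the forms of an adapted coframe is integrable. -/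
theorem apply_lieBracket_eq_zero (h : IsAdaptedOn U g K θ) {a b c : Fin 4}
    (hG : cG U g θ a b c = cG U g θ a c b) {X Y : E4 → E4} (hX : ContDiffOn ℝ ∞ X U)
    (hY : ContDiffOn ℝ ∞ Y U) (hab : a ≠ b) (hac : a ≠ c)
    (hXs : ∀ z ∈ U, X z = θ z b (X z) • dualVec (θ z) b + θ z c (X z) • dualVec (θ z) c)
    (hYs : ∀ z ∈ U, Y z = θ z b (Y z) • dualVec (θ z) b + θ z c (Y z) • dualVec (θ z) c)
    (x : U) : θ x a (VectorField.lieBracket ℝ X Y x) = 0 := by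
  have hU : (U : Set E4) ∈ nhds (x : E4) := U.isOpen.mem_nhds x.2
  have hn := h.null
  have hd : DifferentiableAt ℝ (fun z => θ z a) x :=
    ((h.smooth a).contDiffAt hU).differentiableAt (by simp)
  have hXd := ((hX.contDiffAt hU).differentiableAt (by simp)).hasFDerivAt
  have hYd := ((hY.contDiffAt hU).differentiableAt (by simp)).hasFDerivAt
  have hz {Z : E4 → E4} (hZs : ∀ z ∈ U, Z z = θ z b (Z z) • dualVec (θ z) b
      + θ z c (Z z) • dualVec (θ z) c) (hZd : HasFDerivAt Z (fderiv ℝ Z x) x) (v : E4) :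
      θ x a (fderiv ℝ Z x v) = - fderiv ℝ (fun z => θ z a) x v (Z x) := by
    have h1 := hd.hasFDerivAt.clm_apply hZd
    have h2 : (fun z => θ z a (Z z)) =ᶠ[nhds (x : E4)] fun _ => 0 := by
      filter_upwards [hU] with z hz
      rw [hZs z hz, map_add, map_smul, map_smul, apply_dualVec (hn.indep z hz),
        apply_dualVec (hn.indep z hz), if_neg hab, if_neg hac, smul_zero, smul_zero, add_zero]
    have h3 := congrArg (fun φ => φ v) (h1.unique
      ((hasFDerivAt_const _ _).congr_of_eventuallyEq h2))
    simp at h3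
    linarith
  have hfr (p q : Fin 4) := hn.fderiv_form_frame x (A := fun z => θ z a)
    (P := fun c _ => if a = c then 1 else 0) hd (fun c z hz => apply_dualVec (hn.indep z hz) _ _) p q
  have hbc := hfr b c
  simp [hG] at hbc
  rw [VectorField.lieBracket, map_sub, hz hXs hXd, hz hYs hYd, hXs x x.2, hYs x x.2]
  simp only [map_add, map_smul, add_apply, smul_apply, smul_eq_mul]
  linear_combination (θ x b (X x) * θ x c (Y x) - θ x b (Y x) * θ x c (X x)) * (-hbc)

/-- If the connection of an adapted coframe takes values in `𝔤𝔩(2, ℝ)` and its curvature is given by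
`curvTable`, then the structure is para-Kähler–Einstein. -/
theorem isPKEOn (h : IsAdaptedOn U g K θ) (hgs : ContDiffOn ℝ ∞ g U) (hKs : ContDiffOn ℝ ∞ K U)
    {γ α β δ : Fin 4 → Sm U} (hG : cG U g θ = glConn γ α β δ) {ψ₀ ψ₁ ψ₂ ψ₃ ψ₄ s : U → ℝ}
    (hr : ∀ x a b c e, Sm.ev x (IsNullCoframeOn.rF U g θ a b c e)
      = curvTable (ψ₀ x) (ψ₁ x) (ψ₂ x) (ψ₃ x) (ψ₄ x) (s x) a b c e) : IsPKEOn U g K where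
  smooth_metric := hgs
  smooth_endo := hKs
  symm x hx v w := by simp only [(h.adapted x hx).metric]; ring
  nondegenerate x hx v hv := by
    have := h.null.metric_dual hx
    rw [← sum_smul_dualVec (h.adapted x hx).indep v]
    refine Finset.sum_eq_zero fun a _ => ?_
    have h1 := hv (dualVec (θ x) (a + 2))
    have h2 : g x v (dualVec (θ x) (a + 2)) = g x (dualVec (θ x) (a + 2)) v := by
      simp only [(h.adapted x hx).metric]; ring
    rw [h2, h.null.metric_dual hx, add_assoc, show (2 : Fin 4) + 2 = 0 from rfl, add_zero] at h1
    rw [h1, zero_smul]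
  paracomplex x hx := (h.adapted x hx).paracomplex
  compat x hx v w := by
    have hA := h.adapted x hx
    simp only [hA.metric, hA.endo₀, hA.endo₁, hA.endo₂, hA.endo₃]; ring
  integrable_pos X Y hX hY hKX hKY x hx := by
    have hA := h.adapted x hx
    have hdec {Z : E4 → E4} (hZ : ∀ x ∈ U, K x (Z x) = Z x) : ∀ z ∈ U, Z z
        = θ z 0 (Z z) • dualVec (θ z) 0 + θ z 1 (Z z) • dualVec (θ z) 1 := by
      intro z hz
      have hA := h.adapted z hz
      have h2 := hA.endo₂ (Z z)
      have h3 := hA.endo₃ (Z z)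
      rw [hZ z hz] at h2 h3
      conv_lhs => rw [← sum_smul_dualVec hA.indep (Z z)]
      rw [Fin.sum_univ_four, show θ z 2 (Z z) = 0 by linarith, show θ z 3 (Z z) = 0 by linarith]
      simp
    have k2 := h.apply_lieBracket_eq_zero (a := 2) (b := 0) (c := 1) (by simp [hG, glConn, glBlock])
      hX hY (by decide) (by decide) (hdec hKX) (hdec hKY) ⟨x, hx⟩
    have k3 := h.apply_lieBracket_eq_zero (a := 3) (b := 0) (c := 1) (by simp [hG, glConn, glBlock])
      hX hY (by decide) (by decide) (hdec hKX) (hdec hKY) ⟨x, hx⟩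
    set L := VectorField.lieBracket ℝ X Y x
    rw [← sum_smul_dualVec hA.indep (K x L)]
    conv_rhs => rw [← sum_smul_dualVec hA.indep L]
    simp only [Fin.sum_univ_four, hA.endo₀, hA.endo₁, hA.endo₂, hA.endo₃] at *
    simp only [k2, k3, neg_zero]
  integrable_neg X Y hX hY hKX hKY x hx := by
    have hA := h.adapted x hx
    have hdec {Z : E4 → E4} (hZ : ∀ x ∈ U, K x (Z x) = - Z x) : ∀ z ∈ U, Z z
        = θ z 2 (Z z) • dualVec (θ z) 2 + θ z 3 (Z z) • dualVec (θ z) 3 := by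
      intro z hz
      have hA := h.adapted z hz
      have h2 := hA.endo₀ (Z z)
      have h3 := hA.endo₁ (Z z)
      rw [hZ z hz, map_neg] at h2 h3
      conv_lhs => rw [← sum_smul_dualVec hA.indep (Z z)]
      rw [Fin.sum_univ_four, show θ z 0 (Z z) = 0 by linarith, show θ z 1 (Z z) = 0 by linarith]
      simp
    have k2 := h.apply_lieBracket_eq_zero (a := 0) (b := 2) (c := 3) (by simp [hG, glConn, glBlock])
      hX hY (by decide) (by decide) (hdec hKX) (hdec hKY) ⟨x, hx⟩
    have k3 := h.apply_lieBracket_eq_zero (a := 1) (b := 2) (c := 3) (by simp [hG, glConn, glBlock])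
      hX hY (by decide) (by decide) (hdec hKX) (hdec hKY) ⟨x, hx⟩
    set L := VectorField.lieBracket ℝ X Y x
    rw [← sum_smul_dualVec hA.indep (K x L), ← sum_smul_dualVec hA.indep (-L)]
    simp only [Fin.sum_univ_four, hA.endo₀, hA.endo₁, hA.endo₂, hA.endo₃, map_neg] at *
    simp only [k2, k3, neg_zero]
  closed x hx := by
    have hA := h.adapted x hx
    intro u v w
    set B := fderiv ℝ (kaehlerForm g K) x with hB
    have h0 (p q r : Fin 4) : B (dualVec (θ x) p) (dualVec (θ x) q) (dualVec (θ x) r)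
        + B (dualVec (θ x) q) (dualVec (θ x) r) (dualVec (θ x) p)
        + B (dualVec (θ x) r) (dualVec (θ x) p) (dualVec (θ x) q) = 0 := by
      rw [hB, ← neg_eq_zero, ← h.fderiv_kaehler_frame hgs hKs ⟨x, hx⟩ p q r, hG]
      fin_cases p <;> fin_cases q <;> fin_cases r <;> simp [eps, glConn, glBlock] <;> ring
    have hsum (u : E4) : ∃ c : Fin 4 → ℝ, u = ∑ p, c p • dualVec (θ x) p :=
      ⟨fun p => θ x p u, (sum_smul_dualVec hA.indep u).symm⟩
    obtain ⟨a, rfl⟩ := hsum u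
    obtain ⟨b, rfl⟩ := hsum v
    obtain ⟨c, rfl⟩ := hsum w
    have h1 (q r : Fin 4) (a : Fin 4 → ℝ) : B (∑ p, a p • dualVec (θ x) p) (dualVec (θ x) q)
        (dualVec (θ x) r) + B (dualVec (θ x) q) (dualVec (θ x) r) (∑ p, a p • dualVec (θ x) p)
        + B (dualVec (θ x) r) (∑ p, a p • dualVec (θ x) p) (dualVec (θ x) q) = 0 := by
      simp only [map_sum, map_smul, sum_apply, smul_apply, ← Finset.sum_add_distrib, ← smul_add,
        h0, smul_zero, Finset.sum_const_zero]
    have h1' := fun q r => h1 q r a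
    generalize ∑ p, a p • dualVec (θ x) p = u at h1' ⊢
    have h2 (r : Fin 4) (b : Fin 4 → ℝ) : B u (∑ p, b p • dualVec (θ x) p) (dualVec (θ x) r)
        + B (∑ p, b p • dualVec (θ x) p) (dualVec (θ x) r) u
        + B (dualVec (θ x) r) u (∑ p, b p • dualVec (θ x) p) = 0 := by
      simp only [map_sum, map_smul, sum_apply, smul_apply, ← Finset.sum_add_distrib, ← smul_add,
        h1', smul_zero, Finset.sum_const_zero]
    have h2' := fun r => h2 r b
    generalize ∑ p, b p • dualVec (θ x) p = v at h2' ⊢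
    simp only [map_sum, map_smul, sum_apply, smul_apply, ← Finset.sum_add_distrib, ← smul_add,
      h2', smul_zero, Finset.sum_const_zero]
  einstein x hx a b := by
    have h1 := h.null.ricci_eq ⟨x, hx⟩ (s := s ⟨x, hx⟩) fun b e => by
      simp only [hr]; exact curvTable_trace _ _ _ _ _ _ b e
    have h2 := h.null.scalarCurv_eq ⟨x, hx⟩ h1
    simp only at h1 h2
    rw [h1, h2]; ring

end IsAdaptedOn

/-! ### Reduced coframes -/

section CurvTable

theorem curvTable_injective {ψ₀ ψ₁ ψ₂ ψ₃ ψ₄ s φ₀ φ₁ φ₂ φ₃ φ₄ t : ℝ}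
    (h : ∀ a b c e, curvTable ψ₀ ψ₁ ψ₂ ψ₃ ψ₄ s a b c e = curvTable φ₀ φ₁ φ₂ φ₃ φ₄ t a b c e) :
    ψ₀ = φ₀ ∧ ψ₁ = φ₁ ∧ ψ₂ = φ₂ ∧ ψ₃ = φ₃ ∧ ψ₄ = φ₄ ∧ s = t := by
  have h0 := h 1 0 0 3
  have h1 := h 0 0 0 3
  have h2 := h 0 0 0 2
  have h2' := h 1 0 1 2
  have h3 := h 0 0 1 2
  have h4 := h 0 1 1 2
  simp [curvTable, glBlock, skewBlock] at h0 h1 h2 h2' h3 h4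
  refine ⟨?_, ?_, ?_, ?_, ?_, ?_⟩ <;> linarith

end CurvTable

section Ring

variable (U : Opens E4) (g : BilinField) (θ : FormQuad)

/-- `-R / 12`, in the ring of smooth functions. -/
def scalSm : Sm U := -((1 / 3 : ℝ) • (IsNullCoframeOn.rF U g θ 0 0 0 2
  + IsNullCoframeOn.rF U g θ 1 0 1 2))

/-- `Ψ₂`, in the ring of smooth functions. -/
def psiSm : Sm U := IsNullCoframeOn.rF U g θ 1 0 1 2 + scalSm U g θ

end Ring

section Reduced

variable {U : Opens E4} {g : BilinField} {K : EndoField} {θ : FormQuad}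

theorem IsAdaptedOn.ev_scalSm (h : IsAdaptedOn U g K θ) (hg : IsPKEOn U g K) (x : U) :
    Sm.ev x (scalSm U g θ) = -scalarCurv g x / 12 := by
  rw [scalSm, map_neg, map_smul, map_add, (h.ev_rF_eq hg x).1, (h.ev_rF_eq hg x).1]
  simp [curvTable, glBlock, skewBlock]; ring

theorem IsAdaptedOn.ev_psiSm (h : IsAdaptedOn U g K θ) (hg : IsPKEOn U g K) (x : U) :
    Sm.ev x (psiSm U g θ) = psi2 g θ x := by
  rw [psiSm, map_add, (h.ev_rF_eq hg x).1, h.ev_scalSm hg]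
  simp [curvTable, glBlock, skewBlock]

namespace IsReducedCoframeOn

theorem isAdaptedOn (h : IsReducedCoframeOn U g K θ) : IsAdaptedOn U g K θ := ⟨h.smooth, h.adapted⟩

theorem mono {V W : Set E4} (h : IsReducedCoframeOn V g K θ) (hW : W ⊆ V) :
    IsReducedCoframeOn W g K θ where
  smooth a := (h.smooth a).mono hW
  adapted x hx := h.adapted x (hW hx)
  psi0_eq x hx := h.psi0_eq x (hW hx)
  psi1_eq x hx := h.psi1_eq x (hW hx)
  psi2_ne x hx := h.psi2_ne x (hW hx)
  psi3_eq x hx := h.psi3_eq x (hW hx)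
  psi4_eq x hx := h.psi4_eq x (hW hx)

/-- A reduced coframe satisfies the structure equations over `C^∞(U)`. -/
theorem typeDFrame (h : IsReducedCoframeOn U g K θ) (hg : IsPKEOn U g K) :
    TypeDFrame (dF U θ) (cG U g θ 0 0) (cG U g θ 0 1) (cG U g θ 1 0) (cG U g θ 1 1)
      (psiSm U g θ) (scalSm U g θ) := by
  have hA := h.isAdaptedOn
  refine ⟨fun b c f => ?_, fun a b c e => ?_, Sm.isUnit_of_ne_zero fun x => ?_⟩
  · rw [← hA.cG_eq hg]; exact hA.null.dF_comm b c f
  · rw [← hA.cG_eq hg]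
    refine Sm.ext fun x => ?_
    have := (hA.ev_rF_eq hg x).1 a b c e
    rw [IsNullCoframeOn.rF] at this
    rw [this, ← RingHom.coe_coe (Sm.ev x), map_curvTable, RingHom.coe_coe, map_zero,
      hA.ev_psiSm hg, hA.ev_scalSm hg, h.psi0_eq x x.2, h.psi1_eq x x.2, h.psi3_eq x x.2,
      h.psi4_eq x x.2]
  · rw [hA.ev_psiSm hg]; exact h.psi2_ne x x.2

theorem isUnit_scalSm (h : IsReducedCoframeOn U g K θ) (hg : IsPKEOn U g K)
    (hS : ∀ x ∈ U, scalarCurv g x ≠ 0) : IsUnit (scalSm U g θ) :=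
  Sm.isUnit_of_ne_zero fun x => by
    rw [h.isAdaptedOn.ev_scalSm hg]
    exact div_ne_zero (neg_ne_zero.2 (hS x x.2)) (by norm_num)

/-- The form of `Γ¹₂` and `Γ²₁` in a reduced coframe. -/
theorem connForm_offdiag (h : IsReducedCoframeOn U g K θ) (hg : IsPKEOn U g K) (x : U) (X : E4) :
    connForm g θ 1 0 x X = J1 g θ x * θ x 1 X + J2 g θ x * θ x 2 X ∧
      connForm g θ 0 1 x X = - J3 g θ x * θ x 0 X + J4 g θ x * θ x 3 X := by
  have hn := h.isAdaptedOn.null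
  have hT := h.typeDFrame hg
  constructor
  · rw [hn.connForm_eq, Fin.sum_univ_four, hT.beta_zero, hT.beta_three, hn.ev_cG, hn.ev_cG, J1, J2]
    simp only [map_zero]; ring
  · rw [hn.connForm_eq, Fin.sum_univ_four, hT.alpha_one, hT.alpha_two, hn.ev_cG, hn.ev_cG, J3, J4]
    simp only [map_zero]; ring

end IsReducedCoframeOn

/-- A coframe that solves the structure equations of a reduced coframe is a model: `hE` says that
the connection with components `glConn γ α β δ` is torsion-free, and it is metric, so that it is the
Levi-Civita connection. -/
theorem isModel_of_frame {D : Opens E4} (hs : ∀ a, ContDiffOn ℝ ∞ (fun x => θ x a) D)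
    (hi : ∀ x ∈ D, LinearIndependent ℝ (θ x)) {γ α β δ : Fin 4 → Sm D} {ψ : Sm D} {s j₂ j₄ : ℝ}
    (hE : ∀ j, IsClosedFrame (dF D θ) (glConn γ α β δ) ((cofSm D θ)⁻¹ j))
    (hr : ∀ a b c e, frameCurv (dF D θ) (glConn γ α β δ) a b c e
      = curvTable 0 0 ψ 0 0 (algebraMap ℝ (Sm D) s) a b c e)
    (hψ : ∀ x, Sm.ev x ψ ≠ 0) (h2 : β 2 = algebraMap ℝ (Sm D) j₂)
    (h4 : α 3 = algebraMap ℝ (Sm D) j₄) :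
    IsModel D θ s j₂ j₄ := by
  have hA : IsAdaptedOn D (metricOf θ) (endoOf θ) θ :=
    ⟨hs, fun x hx => isAdapted_metricOf (hi x hx)⟩
  have hn := hA.null
  have hG : cG D (metricOf θ) θ = glConn γ α β δ := by
    refine hn.cG_unique (fun a b c => ?_) hE
    fin_cases a <;> fin_cases b <;> simp [glConn, glBlock]
  have hR (x : D) (a b c e : Fin 4) : Sm.ev x (IsNullCoframeOn.rF D (metricOf θ) θ a b c e)
      = curvTable 0 0 (Sm.ev x ψ) 0 0 s a b c e := by
    rw [IsNullCoframeOn.rF, hG, hr, ← RingHom.coe_coe (Sm.ev x), map_curvTable, RingHom.coe_coe,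
      map_zero, AlgHom.commutes, Algebra.algebraMap_self, RingHom.id_apply]
  have hgs : ContDiffOn ℝ ∞ (metricOf θ) D :=
    ((((hs 0).smulRight (hs 2)).add ((hs 2).smulRight (hs 0))).add
      ((hs 1).smulRight (hs 3))).add ((hs 3).smulRight (hs 1))
  have hed := contDiffOn_dualVec (U := D) hs hi
  have hKs : ContDiffOn ℝ ∞ (endoOf θ) D :=
    ((((hs 0).smulRight (hed 0)).add ((hs 1).smulRight (hed 1))).sub
      ((hs 2).smulRight (hed 2))).sub ((hs 3).smulRight (hed 3))
  have hg : IsPKEOn D (metricOf θ) (endoOf θ) := hA.isPKEOn hgs hKs hG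
    (ψ₀ := fun _ => 0) (ψ₁ := fun _ => 0) (ψ₂ := fun x => Sm.ev x ψ) (ψ₃ := fun _ => 0)
    (ψ₄ := fun _ => 0) (s := fun _ => s) hR
  have hval (x : D) := curvTable_injective fun a b c e =>
    ((hA.ev_rF_eq hg x).1 a b c e).symm.trans (hR x a b c e)
  have hred : IsReducedCoframeOn D (metricOf θ) (endoOf θ) θ :=
    ⟨hs, hA.adapted, fun x hx => (hval ⟨x, hx⟩).1, fun x hx => (hval ⟨x, hx⟩).2.1,
      fun x hx => by rw [(hval ⟨x, hx⟩).2.2.1]; exact hψ _, fun x hx => (hval ⟨x, hx⟩).2.2.2.1,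
      fun x hx => (hval ⟨x, hx⟩).2.2.2.2.1⟩
  refine ⟨D.isOpen, hg, fun x hx => ?_, fun x hx => ⟨θ x, hA.adapted x hx,
    6 * Sm.ev ⟨x, hx⟩ ψ, 1, 0, 0, 1, mul_ne_zero (by norm_num) (hψ _), by norm_num,
    fun ξ₀ ξ₁ => ?_⟩, hred, fun x hx => ?_, fun x hx => ?_, fun x hx => ?_⟩
  · have := (hval ⟨x, hx⟩).2.2.2.2.2
    simp only at this
    linarith
  · rw [hA.quartic_eq hg ⟨x, hx⟩, hred.psi0_eq x hx, hred.psi1_eq x hx, hred.psi3_eq x hx,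
      hred.psi4_eq x hx, (hval ⟨x, hx⟩).2.2.1]
    ring
  · exact (hA.ev_rF_eq hg ⟨x, hx⟩).2.trans (hval ⟨x, hx⟩).2.2.2.2.2
  · have := hn.ev_cG ⟨x, hx⟩ 1 0 2
    rw [hG] at this
    rw [J2, ← this]
    simp [glConn, glBlock, h2]
  · have := hn.ev_cG ⟨x, hx⟩ 0 1 3
    rw [hG] at this
    rw [J4, ← this]
    simp [glConn, glBlock, h4]

end Reduced

/-! ### Changes of adapted coframes -/

section Change

variable {G : E4 →L[ℝ] E4 →L[ℝ] ℝ} {k : E4 →L[ℝ] E4} {η η' : Fin 4 → E4 →L[ℝ] ℝ}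

/-- The adapted coframe whose dual frame begins with `p ∂_{θ¹} + q ∂_{θ²}` and
`u ∂_{θ¹} + v ∂_{θ²}`. -/
def changeCoframe (p q u v : ℝ) (η : Fin 4 → E4 →L[ℝ] ℝ) : Fin 4 → E4 →L[ℝ] ℝ :=
  ![(p * v - q * u)⁻¹ • (v • η 0 - u • η 1), (p * v - q * u)⁻¹ • (p • η 1 - q • η 0),
    p • η 2 + q • η 3, u • η 2 + v • η 3]

/-- The frame dual to `changeCoframe`. -/
def changeFrame (p q u v : ℝ) (η : Fin 4 → E4 →L[ℝ] ℝ) : Fin 4 → E4 :=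
  ![p • dualVec η 0 + q • dualVec η 1, u • dualVec η 0 + v • dualVec η 1,
    (p * v - q * u)⁻¹ • (v • dualVec η 2 - u • dualVec η 3),
    (p * v - q * u)⁻¹ • (p • dualVec η 3 - q • dualVec η 2)]

variable {p q u v : ℝ}

theorem change_apply_frame (h : LinearIndependent ℝ η) (hΔ : p * v - q * u ≠ 0) (a b : Fin 4) :
    changeCoframe p q u v η a (changeFrame p q u v η b) = if a = b then 1 else 0 := by
  have hd := apply_dualVec h
  fin_cases a <;> fin_cases b <;> simp [changeCoframe, changeFrame, hd] <;>
    first | (right; ring) | (field_simp; ring) | field_simp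

theorem linearIndependent_change (h : LinearIndependent ℝ η) (hΔ : p * v - q * u ≠ 0) :
    LinearIndependent ℝ (changeCoframe p q u v η) :=
  linearIndependent_of_dual (change_apply_frame h hΔ)

theorem dualVec_change (h : LinearIndependent ℝ η) (hΔ : p * v - q * u ≠ 0) (b : Fin 4) :
    dualVec (changeCoframe p q u v η) b = changeFrame p q u v η b :=
  dualVec_eq (linearIndependent_change h hΔ) fun a => change_apply_frame h hΔ a b

theorem IsAdapted.change (h : IsAdapted G k η) (hΔ : p * v - q * u ≠ 0) :
    IsAdapted G k (changeCoframe p q u v η) := by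
  refine ⟨linearIndependent_change h.indep hΔ, fun x y => ?_, fun x => ?_, fun x => ?_,
    fun x => ?_, fun x => ?_⟩
  · rw [h.metric]
    simp [changeCoframe]; field_simp; ring
  all_goals simp [changeCoframe, h.endo₀, h.endo₁, h.endo₂, h.endo₃]
  all_goals ring

theorem asdQuartic_change (g : BilinField) (x : E4) (h : LinearIndependent ℝ η)
    (hΔ : p * v - q * u ≠ 0) (ξ₀ ξ₁ : ℝ) : asdQuartic g (changeCoframe p q u v η) x ξ₀ ξ₁
      = ((p * v - q * u)⁻¹) ^ 2 * asdQuartic g η x (p * ξ₀ + u * ξ₁) (q * ξ₀ + v * ξ₁) := by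
  have hX : ξ₀ • (p • dualVec η 0 + q • dualVec η 1) + ξ₁ • (u • dualVec η 0 + v • dualVec η 1)
      = (p * ξ₀ + u * ξ₁) • dualVec η 0 + (q * ξ₀ + v * ξ₁) • dualVec η 1 := by module
  have hY : ξ₀ • (p * v - q * u)⁻¹ • (p • dualVec η 3 - q • dualVec η 2)
      - ξ₁ • (p * v - q * u)⁻¹ • (v • dualVec η 2 - u • dualVec η 3)
      = (p * v - q * u)⁻¹ • ((p * ξ₀ + u * ξ₁) • dualVec η 3 - (q * ξ₀ + v * ξ₁) • dualVec η 2)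
        + (0 : ℝ) • (0 : E4) := by module
  simp only [asdQuartic, dualVec_change h hΔ, changeFrame, Matrix.cons_val_zero,
    Matrix.cons_val_one, Matrix.cons_val, hX, hY, weylEval_midLeft g x _ 0 _ 0,
    weylEval_right g x _ 0 _ 0]
  ring

/-- Any two adapted coframes at a point differ by an element of `GL(2, ℝ)`. -/
theorem IsAdapted.eq_change (h : IsAdapted G k η) (h' : IsAdapted G k η') :
    η 0 (dualVec η' 0) * η 1 (dualVec η' 1) - η 1 (dualVec η' 0) * η 0 (dualVec η' 1) ≠ 0 ∧
      η' = changeCoframe (η 0 (dualVec η' 0)) (η 1 (dualVec η' 0)) (η 0 (dualVec η' 1))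
        (η 1 (dualVec η' 1)) η := by
  have hd := apply_dualVec h.indep
  have hd' := apply_dualVec h'.indep
  have hz (a b : Fin 4) (hab : eps a = - eps b) : η a (dualVec η' b) = 0 := by
    have h1 := h.apply_endo a (dualVec η' b)
    rw [h'.endo_dualVec, map_smul, smul_eq_mul, hab] at h1
    have : eps b ≠ 0 := by fin_cases b <;> simp [eps]
    have h2 : eps b * η a (dualVec η' b) = 0 := by linarith
    exact (mul_eq_zero.1 h2).resolve_left this
  set p := η 0 (dualVec η' 0)
  set q := η 1 (dualVec η' 0)
  set u := η 0 (dualVec η' 1)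
  set v := η 1 (dualVec η' 1)
  have h0 (w : E4) : η 0 w = p * η' 0 w + u * η' 1 w := by
    conv_lhs => rw [← sum_smul_dualVec h'.indep w]
    simp [Fin.sum_univ_four, hz 0 2 (by simp [eps]), hz 0 3 (by simp [eps]), p, u, mul_comm]
  have h1 (w : E4) : η 1 w = q * η' 0 w + v * η' 1 w := by
    conv_lhs => rw [← sum_smul_dualVec h'.indep w]
    simp [Fin.sum_univ_four, hz 1 2 (by simp [eps]), hz 1 3 (by simp [eps]), q, v, mul_comm]
  have hΔ : p * v - q * u ≠ 0 := by
    intro h0'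
    have e0 := h0 (dualVec η 0)
    have e1 := h0 (dualVec η 1)
    have e2 := h1 (dualVec η 0)
    have e3 := h1 (dualVec η 1)
    simp only [hd] at e0 e1 e2 e3
    norm_num at e0 e1 e2 e3
    have : (p * v - q * u) * (η' 0 (dualVec η 0) * η' 1 (dualVec η 1)
        - η' 0 (dualVec η 1) * η' 1 (dualVec η 0)) = 1 := by
      linear_combination (-(q * η' 0 (dualVec η 1) + v * η' 1 (dualVec η 1))) * e0 - e3
        + (q * η' 0 (dualVec η 0) + v * η' 1 (dualVec η 0)) * e1
    rw [h0', zero_mul] at this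
    exact zero_ne_one this
  refine ⟨hΔ, funext fun a => ContinuousLinearMap.ext fun w => ?_⟩
  have h2 : η' 2 w = p * η 2 w + q * η 3 w := by
    have e1 := h.metric (dualVec η' 0) w
    have e2 := h'.metric (dualVec η' 0) w
    simp [hd', hz 2 0 (by simp [eps]), hz 3 0 (by simp [eps])] at e1 e2
    linarith
  have h3 : η' 3 w = u * η 2 w + v * η 3 w := by
    have e1 := h.metric (dualVec η' 1) w
    have e2 := h'.metric (dualVec η' 1) w
    simp [hd', hz 2 1 (by simp [eps]), hz 3 1 (by simp [eps])] at e1 e2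
    linarith
  fin_cases a
  · simp [changeCoframe, h0, h1]; field_simp; ring
  · simp [changeCoframe, h0, h1]; field_simp; ring
  · simp [changeCoframe, h2]
  · simp [changeCoframe, h3]

end Change

section Conn

variable {U : Opens E4} {g : BilinField} {K : EndoField} {θ : FormQuad}

theorem contDiffOn_change {V : Opens E4} {p q u v : E4 → ℝ} (hs : ∀ a, ContDiffOn ℝ ∞ (fun x => θ x a) V)
    (hp : ContDiffOn ℝ ∞ p V) (hq : ContDiffOn ℝ ∞ q V) (hu : ContDiffOn ℝ ∞ u V)
    (hv : ContDiffOn ℝ ∞ v V) (hΔ : ∀ x ∈ V, p x * v x - q x * u x ≠ 0) (a : Fin 4) :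
    ContDiffOn ℝ ∞ (fun x => changeCoframe (p x) (q x) (u x) (v x) (θ x) a) V := by
  have hi : ContDiffOn ℝ ∞ (fun x => (p x * v x - q x * u x)⁻¹) V :=
    ((hp.mul hv).sub (hq.mul hu)).inv hΔ
  fin_cases a
  · exact hi.smul ((hv.smul (hs 0)).sub (hu.smul (hs 1)))
  · exact hi.smul ((hp.smul (hs 1)).sub (hq.smul (hs 0)))
  · exact (hp.smul (hs 2)).add (hq.smul (hs 3))
  · exact (hu.smul (hs 2)).add (hv.smul (hs 3))

/-- An off-diagonal connection form scales under a rescaling of the coframe. -/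
theorem connForm_eq_mul {θ' : FormQuad} {x : E4} (hi : LinearIndependent ℝ (θ x)) {a b a' b' : Fin 4}
    {κ : ℝ} {f : E4 → ℝ} (hf : DifferentiableAt ℝ f x)
    (hd : DifferentiableAt ℝ (fun z => dualVec (θ z) b') x)
    (he : (fun z => dualVec (θ' z) b) =ᶠ[nhds x] fun z => f z • dualVec (θ z) b')
    (ha : θ' x a = κ • θ x a') (hne : a' ≠ b') (X : E4) :
    connForm g θ' a b x X = κ * f x * connForm g θ a' b' x X := by
  have h1 : fderiv ℝ (fun z => dualVec (θ' z) b) x X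
      = f x • fderiv ℝ (fun z => dualVec (θ z) b') x X + fderiv ℝ f x X • dualVec (θ x) b' := by
    rw [he.fderiv_eq, (hf.hasFDerivAt.fun_smul hd.hasFDerivAt).fderiv]
    simp
  rw [connForm, connForm, h1, he.eq_of_nhds, ha]
  simp only [map_add, map_sum, map_smul, smul_apply, smul_eq_mul, PiLp.smul_apply,
    apply_dualVec hi, if_neg hne, mul_zero, add_zero, mul_add, Finset.mul_sum, Finset.sum_mul]
  congr 1
  · ring
  · refine Finset.sum_congr rfl fun k _ => Finset.sum_congr rfl fun i _ =>
      Finset.sum_congr rfl fun j _ => by ring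

theorem IsReducedCoframeOn.of_quartic (h : IsAdaptedOn U g K θ) (hg : IsPKEOn U g K)
    (hq : ∀ x ∈ U, ∃ r : ℝ, r ≠ 0 ∧ ∀ ξ₀ ξ₁, asdQuartic g (θ x) x ξ₀ ξ₁ = r * ξ₀ ^ 2 * ξ₁ ^ 2) :
    IsReducedCoframeOn U g K θ := by
  have key (x : E4) (hx : x ∈ U) : psi0 g θ x = 0 ∧ psi1 g θ x = 0 ∧ psi2 g θ x ≠ 0 ∧
      psi3 g θ x = 0 ∧ psi4 g θ x = 0 := by
    obtain ⟨r, hr, h1⟩ := hq x hx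
    have h2 (ξ₀ ξ₁ : ℝ) := (h.quartic_eq hg ⟨x, hx⟩ ξ₀ ξ₁).symm.trans (h1 ξ₀ ξ₁)
    simp only at h2
    have e0 := h2 1 0
    have e1 := h2 0 1
    have e2 := h2 1 1
    have e3 := h2 1 (-1)
    have e4 := h2 1 2
    norm_num at e0 e1 e2 e3 e4
    refine ⟨by linarith, by linarith, fun h0 => hr ?_, by linarith, by linarith⟩
    rw [h0] at e2 e3
    linarith
  exact ⟨h.smooth, h.adapted, fun x hx => (key x hx).1, fun x hx => (key x hx).2.1,
    fun x hx => (key x hx).2.2.1, fun x hx => (key x hx).2.2.2.1, fun x hx => (key x hx).2.2.2.2⟩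

theorem IsReducedCoframeOn.quartic_eq (h : IsReducedCoframeOn U g K θ) (hg : IsPKEOn U g K) {x : E4}
    (hx : x ∈ U) (ξ₀ ξ₁ : ℝ) :
    asdQuartic g (θ x) x ξ₀ ξ₁ = 6 * psi2 g θ x * ξ₀ ^ 2 * ξ₁ ^ 2 := by
  rw [h.isAdaptedOn.quartic_eq hg ⟨x, hx⟩, h.psi0_eq x hx, h.psi1_eq x hx, h.psi3_eq x hx,
    h.psi4_eq x hx]
  ring

end Conn

/-! ### The structure equations of the four families -/

section Algebra

variable {R : Type*} [CommRing R] [Algebra ℝ R] {d : Fin 4 → Derivation ℝ R R}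

theorem eq_of_skew {F H : Fin 4 → Fin 4 → R} (hF : ∀ c e, F e c = - F c e)
    (hH : ∀ c e, H e c = - H c e) (h01 : F 0 1 = H 0 1) (h02 : F 0 2 = H 0 2)
    (h03 : F 0 3 = H 0 3) (h12 : F 1 2 = H 1 2) (h13 : F 1 3 = H 1 3) (h23 : F 2 3 = H 2 3)
    (c e : Fin 4) : F c e = H c e := by
  have h0 {F : Fin 4 → Fin 4 → R} (hF : ∀ c e, F e c = - F c e) (c) : F c c = 0 :=
    eq_zero_of_natCast_mul 2 isUnit_one (by push_cast; linear_combination hF c c)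
  fin_cases c <;> fin_cases e <;> simp only [Fin.isValue, Fin.zero_eta, Fin.mk_one,
    Fin.reduceFinMk, h0 hF, h0 hH, h01, h02, h03, h12, h13, h23, hF 0 1, hF 0 2, hF 0 3,
    hF 1 2, hF 1 3, hF 2 3, hH 0 1, hH 0 2, hH 0 3, hH 1 2, hH 1 3, hH 2 3]

theorem skewBlock_skew {R : Type*} [CommRing R] (p q u v : R) (i j) : skewBlock p q u v j i = - skewBlock p q u v i j := by
  fin_cases i <;> fin_cases j <;> simp [skewBlock]

/-- The curvature equations of a reduced frame have to be checked on four blocks only. -/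
theorem curv_eq_of_blocks {γ α β δ : Fin 4 → R} {ψ s : R}
    (h : ∀ c e, c < e → ∀ i j : Fin 2,
      frameCurv d (glConn γ α β δ) (i.castLE (by decide)) (j.castLE (by decide)) c e
        = curvTable 0 0 ψ 0 0 s (i.castLE (by decide)) (j.castLE (by decide)) c e)
    (a b c e : Fin 4) :
    frameCurv d (glConn γ α β δ) a b c e = curvTable 0 0 ψ 0 0 s a b c e := by
  rw [frameCurv_glConn, curvTable]
  have key (p q u v : R) (i j : Fin 2)
      (hij : ∀ c e, curvTable 0 0 ψ 0 0 s (i.castLE (by decide)) (j.castLE (by decide)) c e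
        = skewBlock p q u v c e) (c e) :
      frameCurv d (glConn γ α β δ) (i.castLE (by decide)) (j.castLE (by decide)) c e
        = skewBlock p q u v c e := by
    refine eq_of_skew (fun c e => frameCurv_skew d _ _ _ c e) (skewBlock_skew p q u v)
      ?_ ?_ ?_ ?_ ?_ ?_ c e <;> rw [← hij] <;> exact h _ _ (by decide) i j
  congr 1
  · exact key _ _ _ _ 0 0 (fun c e => by simp [curvTable, glBlock]) c e
  · exact key _ _ _ _ 0 1 (fun c e => by simp [curvTable, glBlock]) c e
  · exact key _ _ _ _ 1 0 (fun c e => by simp [curvTable, glBlock]) c e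
  · exact key _ _ _ _ 1 1 (fun c e => by simp [curvTable, glBlock]) c e

/-- Closedness has to be checked on six pairs of indices only. -/
theorem isClosedFrame_of_lt {G : Fin 4 → Fin 4 → Fin 4 → R} {p : Fin 4 → R}
    (h : ∀ b c, b < c → d b (p c) - d c (p b) = ∑ a, (G a c b - G a b c) * p a) :
    IsClosedFrame d G p := by
  intro b c
  rcases lt_trichotomy b c with hbc | rfl | hbc
  · exact h b c hbc
  · simp
  · rw [← neg_sub, h c b hbc, ← Finset.sum_neg_distrib]
    exact Finset.sum_congr rfl fun a _ => by ring

namespace GenericFrame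

variable {γ δ : Fin 4 → R} {ψ s j₁ j₃ g e : R}

theorem der_e (h : GenericFrame d γ δ ψ s j₁ j₃ g e) (i : Fin 4) :
    d i e = ![-2 * e * j₁ - 2 * j₁ * j₃, 3 * ψ * j₃ - 2 * g * j₃ + 2 * j₁ * j₃, 2 * e + 2 * j₃,
      2 * e + 2 * j₁ + ψ + 2 * s] i := by
  have h1 : e = ψ - s - g := by linear_combination h.add_eq
  have h2 : d i e = d i ψ - d i s - d i g := by rw [← map_sub, ← map_sub, ← h1]
  rw [h2, h.der_psi, h.der_s, h.der_g]
  fin_cases i <;> simp [h1] <;> ring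

theorem curv (h : GenericFrame d γ δ ψ s j₁ j₃ g e) (a b c e' : Fin 4) :
    frameCurv d (glConn γ ![-j₃, 0, 0, 1] ![0, j₁, 1, 0] δ) a b c e'
      = curvTable 0 0 ψ 0 0 s a b c e' := by
  have h1 : ψ = g + e + s := by linear_combination -h.add_eq
  have d2 := fun i => der_two (d i)
  refine curv_eq_of_blocks (fun c e' hlt i j => ?_) a b c e'
  rw [h.gamma_eq, h.delta_eq]
  fin_cases c <;> fin_cases e' <;> first | (exact absurd hlt (by decide)) | skip
  all_goals fin_cases i <;> fin_cases j <;>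
    simp [curvTable, glBlock, skewBlock, Fin.sum_univ_four, glConn, frameCurv, h.der_one, h.der_e,
      h.der_three, h.der_g, d2] <;> (try rw [h1]) <;> ring

variable {x y u : R}

/-- This and the next three lemmas are the torsion-free equations in the coordinates of the first family:
the components of each `dyⁱ` in the frame are a closed form. Here `y⁴ = 1 / u` and `y³ = x`. -/
theorem closed_first (h : GenericFrame d γ δ ψ s j₁ j₃ g e)
    (hu : ∀ i, d i u = u * ![-j₁, j₃, 1, 1] i) :
    IsClosedFrame d (glConn γ ![-j₃, 0, 0, 1] ![0, j₁, 1, 0] δ) ![u ^ 2, u ^ 2, 0, 0] := by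
  refine isClosedFrame_of_lt fun b c hlt => ?_
  rw [h.gamma_eq, h.delta_eq]
  fin_cases b <;> fin_cases c <;> first | (exact absurd hlt (by decide)) | skip
  all_goals simp [glBlock, Fin.sum_univ_four, glConn, pow_two, hu] <;> ring

theorem closed_second (h : GenericFrame d γ δ ψ s j₁ j₃ g e)
    (hu : ∀ i, d i u = u * ![-j₁, j₃, 1, 1] i)
    (hx : ∀ i, d i x = ![j₁ - x * j₁, x * j₃, x - 1, x] i) :
    IsClosedFrame d (glConn γ ![-j₃, 0, 0, 1] ![0, j₁, 1, 0] δ)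
      ![-(x * u), (1 - x) * u, 0, 0] := by
  refine isClosedFrame_of_lt fun b c hlt => ?_
  rw [h.gamma_eq, h.delta_eq]
  fin_cases b <;> fin_cases c <;> first | (exact absurd hlt (by decide)) | skip
  all_goals simp [glBlock, Fin.sum_univ_four, glConn, hu, hx] <;> ring

theorem closed_third (h : GenericFrame d γ δ ψ s j₁ j₃ g e)
    (hx : ∀ i, d i x = ![j₁ - x * j₁, x * j₃, x - 1, x] i) :
    IsClosedFrame d (glConn γ ![-j₃, 0, 0, 1] ![0, j₁, 1, 0] δ)
      ![j₁ - x * j₁, x * j₃, x - 1, x] := by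
  refine isClosedFrame_of_lt fun b c hlt => ?_
  rw [h.gamma_eq, h.delta_eq]
  fin_cases b <;> fin_cases c <;> first | (exact absurd hlt (by decide)) | skip
  all_goals simp [glBlock, Fin.sum_univ_four, glConn, hx, h.der_one, h.der_three] <;> ring

theorem closed_fourth (h : GenericFrame d γ δ ψ s j₁ j₃ g e)
    (hy : ∀ i, d i y = -(y * ![-j₁, j₃, 1, 1] i)) :
    IsClosedFrame d (glConn γ ![-j₃, 0, 0, 1] ![0, j₁, 1, 0] δ)
      ![y * j₁, -(y * j₃), -y, -y] := by
  refine isClosedFrame_of_lt fun b c hlt => ?_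
  rw [h.gamma_eq, h.delta_eq]
  fin_cases b <;> fin_cases c <;> first | (exact absurd hlt (by decide)) | skip
  all_goals simp [glBlock, Fin.sum_univ_four, glConn, hy, h.der_one, h.der_three] <;> ring

/-- The explicit solution of the structure equations of the first branch, in polynomials in `x = y³` and
`u = 1 / y⁴` with constant coefficients. -/
theorem of_explicit {k₁ k₂ k₃ k : R} (hk₁ : ∀ i, d i k₁ = 0) (hk₂ : ∀ i, d i k₂ = 0)
    (hk₃ : ∀ i, d i k₃ = 0) (hk : ∀ i, d i k = 0) (hs : ∀ i, d i s = 0)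
    (h1 : j₁ = -s * x ^ 3 + k₁ * x ^ 2 * u - k₂ * x * u ^ 2 - (k₃ + k) * u ^ 3)
    (h3 : j₃ = -(s * (x - 1) ^ 3 - k₁ * (x - 1) ^ 2 * u + k₂ * (x - 1) * u ^ 2 + k₃ * u ^ 3))
    (hg : g = -3 * s * x ^ 2 + 2 * k₁ * x * u - k₂ * u ^ 2 - 2 * j₁)
    (he : e = -(3 * s * (x - 1) ^ 2 - 2 * k₁ * (x - 1) * u + k₂ * u ^ 2) + 2 * j₃)
    (hu : ∀ i, d i u = u * ![-j₁, j₃, 1, 1] i)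
    (hx : ∀ i, d i x = ![j₁ - x * j₁, x * j₃, x - 1, x] i) :
    GenericFrame d ![g, j₃, 1, 2] ![-j₁, e, 2, 1] (2 * k * u ^ 3) s j₁ j₃ g e := by
  have d2 := fun i => der_two (d i)
  have d3 : ∀ i, d i 3 = 0 := fun i => by simpa using (d i).map_natCast 3
  have e1 (i) : d i j₁ = ![j₁ * g - j₁ ^ 2, 3 * j₁ * j₃, j₁ - g, 3 * j₁] i := by
    have : d i j₁ = (-3 * s * x ^ 2 + 2 * k₁ * x * u - k₂ * u ^ 2) * d i x
        + (k₁ * x ^ 2 - 2 * k₂ * x * u - 3 * (k₃ + k) * u ^ 2) * d i u := by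
      rw [h1]; simp [hk₁, hk₂, hk₃, hk, hs, pow_succ]; ring
    rw [this, hu, hx]
    fin_cases i <;> simp [hg]
    · linear_combination 3 * j₁ * h1
    · linear_combination -3 * j₃ * h1
    · linear_combination -3 * h1
    · linear_combination -3 * h1
  have e3 (i) : d i j₃ = ![-3 * j₁ * j₃, j₃ * e + j₃ ^ 2, 3 * j₃, j₃ + e] i := by
    have : d i j₃ = -(3 * s * (x - 1) ^ 2 - 2 * k₁ * (x - 1) * u + k₂ * u ^ 2) * d i x
        - (-k₁ * (x - 1) ^ 2 + 2 * k₂ * (x - 1) * u + 3 * k₃ * u ^ 2) * d i u := by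
      rw [h3]; simp [hk₁, hk₂, hk₃, hs, pow_succ]; ring
    rw [this, hu, hx]
    fin_cases i <;> simp [he]
    · linear_combination 3 * j₁ * h3
    · linear_combination -3 * j₃ * h3
    · linear_combination -3 * h3
    · linear_combination -3 * h3
  have ha : g + e = 2 * k * u ^ 3 - s := by linear_combination hg + he - 2 * h1 + 2 * h3
  have hL : -6 * s * x + 2 * k₁ * u = 2 * g + 2 * j₁ + 2 * j₃ - 2 * k * u ^ 3 - 2 * s := by
    linear_combination -2 * hg + 2 * h1 - 2 * h3
  refine ⟨rfl, rfl, ha, fun i => ?_, hs, e1, e3, fun i => ?_⟩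
  · have : d i (2 * k * u ^ 3) = 6 * k * u ^ 2 * d i u := by simp [hk, pow_succ, d2]; ring
    rw [this, hu]
    fin_cases i <;> simp <;> ring
  · have : d i g = (-6 * s * x + 2 * k₁ * u) * d i x + (2 * k₁ * x - 2 * k₂ * u) * d i u
        - 2 * d i j₁ := by
      rw [hg]; simp [hk₁, hk₂, hs, pow_succ, d2, d3]; ring
    rw [this, hu, hx, e1]
    fin_cases i <;> simp
    · linear_combination j₁ * hL + 2 * j₁ * hg - 2 * j₁ * ha
    · linear_combination -2 * j₃ * hg
    · linear_combination -hL - 2 * hg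
    · linear_combination -2 * hg

end GenericFrame

end Algebra

/-! ### The four families of para-Kähler–Einstein structures -/

section Models

variable {D : Opens E4} {θ : FormQuad}

/-- The coordinate function `y^i`. -/
def coordSm (D : Opens E4) (i : Fin 4) : Sm D := Sm.of D fun y => y i

theorem ev_coordSm (i : Fin 4) (y : D) : Sm.ev y (coordSm D i) = (y : E4) i :=
  Sm.ev_of (by fun_prop) y

theorem coordDer_coordSm (i j : Fin 4) :
    Sm.coordDer j (coordSm D i) = if i = j then 1 else 0 := by
  refine Sm.ext fun y => ?_
  rw [Sm.coordDer, Sm.ev_der_eq (F := (EuclideanSpace.proj i : E4 →L[ℝ] ℝ))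
    (fun y => ev_coordSm i y), ContinuousLinearMap.fderiv]
  by_cases h : i = j <;> simp [bvec, h]

theorem ev_algebraMap (c : ℝ) (y : D) : Sm.ev y (algebraMap ℝ (Sm D) c) = c :=
  AlgHom.commutes (Sm.ev y) c

theorem inv_cofSm_eq (hs : ∀ a, ContDiffOn ℝ ∞ (fun x => θ x a) D)
    {E : Matrix (Fin 4) (Fin 4) (Sm D)}
    (hE : ∀ (y : D) (a c : Fin 4), ∑ i, θ y a (bvec i) * Sm.ev y (E i c) = if a = c then 1 else 0) :
    (∀ y ∈ D, LinearIndependent ℝ (θ y)) ∧ (cofSm D θ)⁻¹ = E := by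
  have h1 : cofSm D θ * E = 1 := by
    ext a c
    refine Sm.ext fun y => ?_
    rw [Matrix.mul_apply, map_sum]
    simp only [map_mul, ev_cofSm hs, hE, Matrix.one_apply]
    split_ifs <;> simp
  refine ⟨fun y hy => linearIndependent_of_dual (e := fun c => ∑ i, Sm.ev ⟨y, hy⟩ (E i c) • bvec i)
    fun a c => ?_, Matrix.inv_eq_right_inv h1⟩
  rw [← hE ⟨y, hy⟩ a c, map_sum]
  exact Finset.sum_congr rfl fun i _ => by rw [map_smul, smul_eq_mul, mul_comm]

theorem dF_coordSm {E : Matrix (Fin 4) (Fin 4) (Sm D)} (hE : (cofSm D θ)⁻¹ = E) (a i : Fin 4) :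
    dF D θ a (coordSm D i) = E i a := by
  rw [dF, frameDer_apply, hE]
  simp [coordDer_coordSm]

theorem der_algebraMap (a : Fin 4) (c : ℝ) : dF D θ a (algebraMap ℝ (Sm D) c) = 0 :=
  Derivation.map_algebraMap _ c

theorem isOpen_domainNe : IsOpen domainNe :=
  isOpen_ne_fun (by fun_prop) continuous_const

/-- The inverse of the coordinate `y⁴` on the domain of `genericCoframe`. -/
def invSm : Sm ⟨domainNe, isOpen_domainNe⟩ := Sm.of _ fun y => (y 3)⁻¹

theorem ev_invSm (y : (⟨domainNe, isOpen_domainNe⟩ : Opens E4)) : Sm.ev y invSm = ((y : E4) 3)⁻¹ :=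
  Sm.ev_of (ContDiffOn.inv (by fun_prop) fun _ h => h) y

theorem invSm_mul : invSm * coordSm _ 3 = 1 := by
  refine Sm.ext fun y => ?_
  rw [map_mul, ev_invSm, ev_coordSm, map_one]
  exact inv_mul_cancel₀ y.2

theorem der_invSm (a : Fin 4) :
    dF _ θ a invSm = - invSm ^ 2 * dF _ θ a (coordSm _ 3) := by
  have h : dF _ θ a (invSm * coordSm _ 3) = 0 := by rw [invSm_mul, Derivation.map_one_eq_zero]
  rw [Derivation.leibniz, smul_eq_mul, smul_eq_mul] at h
  linear_combination invSm * h - dF _ θ a invSm * invSm_mul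

theorem contDiffOn_genericCoframe (k₁ k₂ k₃ k₄ s : ℝ) (a : Fin 4) :
    ContDiffOn ℝ ∞ (fun y => genericCoframe k₁ k₂ k₃ k₄ s y a) domainNe := by
  have h3 : ∀ y ∈ domainNe, y 3 ≠ 0 := fun _ h => h
  have h4 : ∀ y ∈ domainNe, y 3 ^ 2 ≠ 0 := fun y h => pow_ne_zero 2 h
  have h5 : ∀ y ∈ domainNe, y 3 ^ 3 ≠ 0 := fun y h => pow_ne_zero 3 h
  have g1 : ContDiffOn ℝ ∞ generic₁ domainNe := by unfold generic₁; fun_prop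
  have g2 : ContDiffOn ℝ ∞ generic₂ domainNe := by unfold generic₂; fun_prop
  have c1 : ContDiffOn ℝ ∞ (fun y : E4 => -s * (y 2) ^ 3 + k₁ * (y 2) ^ 2 / (y 3)
      - k₂ * (y 2) / (y 3) ^ 2 - (k₃ + (1 / 2) * k₄) / (y 3) ^ 3) domainNe := by
    fun_prop (disch := assumption)
  have c2 : ContDiffOn ℝ ∞ (fun y : E4 => y 2 / y 3) domainNe := by fun_prop (disch := assumption)
  have c3 : ContDiffOn ℝ ∞ (fun y : E4 => s * (y 2 - 1) ^ 3 - k₁ * (y 2 - 1) ^ 2 / (y 3)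
      + k₂ * (y 2 - 1) / (y 3) ^ 2 + k₃ / (y 3) ^ 3) domainNe := by
    fun_prop (disch := assumption)
  have c4 : ContDiffOn ℝ ∞ (fun y : E4 => (y 2 - 1) / y 3) domainNe := by
    fun_prop (disch := assumption)
  fin_cases a
  · exact g1
  · exact g2
  · exact ((c1.smul g1).sub contDiffOn_const).sub (c2.smul contDiffOn_const)
  · exact ((c3.smul g2).add contDiffOn_const).add (c4.smul contDiffOn_const)

/-- The frame dual to `genericCoframe`. -/
theorem generic_dual (k₁ k₂ k₃ k₄ s : ℝ) {z : E4} (hz : z 3 ≠ 0) {x u j₁ j₃ : ℝ} (hx : x = z 2)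
    (hu : u = (z 3)⁻¹)
    (h1 : j₁ = -s * x ^ 3 + k₁ * x ^ 2 * u - k₂ * x * u ^ 2 - (k₃ + k₄ / 2) * u ^ 3)
    (h3 : j₃ = -(s * (x - 1) ^ 3 - k₁ * (x - 1) ^ 2 * u + k₂ * (x - 1) * u ^ 2 + k₃ * u ^ 3))
    (a c : Fin 4) : ∑ i, genericCoframe k₁ k₂ k₃ k₄ s z a (bvec i) *
      Matrix.of ![![u ^ 2, u ^ 2, 0, 0], ![-(x * u), (1 - x) * u, 0, 0],
        ![j₁ - x * j₁, x * j₃, x - 1, x], ![z 3 * j₁, -(z 3 * j₃), -z 3, -z 3]] i c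
      = if a = c then 1 else 0 := by
  fin_cases a <;> fin_cases c <;>
    simp [Fin.sum_univ_four, genericCoframe, generic₁, generic₂, dy, bvec, h1, h3, hx, hu] <;>
    field_simp <;> ring

theorem isModel_generic (k₁ k₂ k₃ k₄ s : ℝ) (hk₄ : k₄ ≠ 0) :
    IsModel domainNe (genericCoframe k₁ k₂ k₃ k₄ s) s 1 1 := by
  set D : Opens E4 := ⟨domainNe, isOpen_domainNe⟩
  let c := algebraMap ℝ (Sm D)
  let x := coordSm D 2
  let y := coordSm D 3
  let u : Sm D := invSm
  let j₁ : Sm D := -c s * x ^ 3 + c k₁ * x ^ 2 * u - c k₂ * x * u ^ 2 - (c k₃ + c (k₄ / 2)) * u ^ 3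
  let j₃ : Sm D := -(c s * (x - 1) ^ 3 - c k₁ * (x - 1) ^ 2 * u + c k₂ * (x - 1) * u ^ 2
    + c k₃ * u ^ 3)
  let E : Matrix (Fin 4) (Fin 4) (Sm D) := Matrix.of ![![u ^ 2, u ^ 2, 0, 0],
    ![-(x * u), (1 - x) * u, 0, 0], ![j₁ - x * j₁, x * j₃, x - 1, x],
    ![y * j₁, -(y * j₃), -y, -y]]
  have hs := contDiffOn_genericCoframe k₁ k₂ k₃ k₄ s
  obtain ⟨hi, hE⟩ := inv_cofSm_eq (D := D) hs (E := E) (fun z a b => by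
    have e1 : Sm.ev z u = ((z : E4) 3)⁻¹ := ev_invSm z
    have e2 : Sm.ev z x = (z : E4) 2 := ev_coordSm 2 z
    have e3 : Sm.ev z y = (z : E4) 3 := ev_coordSm 3 z
    rw [← generic_dual k₁ k₂ k₃ k₄ s z.2 (j₁ := Sm.ev z j₁) (j₃ := Sm.ev z j₃) e2 e1
      (by simp [j₁, c]) (by simp [j₃, c]) a b]
    refine Finset.sum_congr rfl fun i _ => congrArg _ ?_
    fin_cases i <;> fin_cases b <;> simp [E, e3])
  have hx (i) : dF D (genericCoframe k₁ k₂ k₃ k₄ s) i x = ![j₁ - x * j₁, x * j₃, x - 1, x] i :=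
    dF_coordSm hE i 2
  have hy (i) : dF D (genericCoframe k₁ k₂ k₃ k₄ s) i y = -(y * ![-j₁, j₃, 1, 1] i) := by
    rw [dF_coordSm hE i 3]
    fin_cases i <;> simp [E]
  have huy : u * y = 1 := invSm_mul
  have hu (i) : dF D (genericCoframe k₁ k₂ k₃ k₄ s) i u = u * ![-j₁, j₃, 1, 1] i := by
    have := der_invSm (θ := genericCoframe k₁ k₂ k₃ k₄ s) i
    refine this.trans ?_
    have h2 := hy i
    simp only [y] at h2 huy
    rw [h2]
    linear_combination u * ![-j₁, j₃, 1, 1] i * huy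
  have hF := GenericFrame.of_explicit (d := dF D (genericCoframe k₁ k₂ k₃ k₄ s)) (k := c (k₄ / 2))
    (fun i => der_algebraMap i k₁) (fun i => der_algebraMap i k₂) (fun i => der_algebraMap i k₃)
    (fun i => der_algebraMap i _) (fun i => der_algebraMap i s) (j₁ := j₁) (j₃ := j₃) rfl rfl rfl rfl
    hu hx
  refine isModel_of_frame hs hi (fun j => ?_) hF.curv (fun z => ?_) (map_one _).symm (map_one _).symm
  · rw [hE]
    fin_cases j
    · exact hF.closed_first hu
    · exact hF.closed_second hu hx
    · exact hF.closed_third hx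
    · exact hF.closed_fourth hy
  · have hz : (z : E4) 3 ≠ 0 := z.2
    have e1 : Sm.ev z u = ((z : E4) 3)⁻¹ := ev_invSm z
    simp [c, e1, hk₄, hz, map_ofNat]

/-- The frame equations of the second branch, for the solution given by `specialCoframe`. -/
theorem special_structure {R : Type*} [CommRing R] [Algebra ℝ R] {d : Fin 4 → Derivation ℝ R R}
    {x y j k₁ k₂ s : R} (hk₁ : ∀ i, d i k₁ = 0) (hk₂ : ∀ i, d i k₂ = 0) (hs : ∀ i, d i s = 0)
    (hj : 2 * j = k₁ * y ^ 3 + 2 * k₂ * y + 2 * s)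
    (hx : ∀ i, d i x = ![1, -(x * j), -(k₂ * x ^ 2 * y), -x] i)
    (hy : ∀ i, d i y = ![0, y * j, 0, y] i) :
    (∀ a b c e, frameCurv d (glConn ![0, 0, 2 * k₂ * x * y, 1] ![-j, 0, 0, 0] ![0, 0, 1, 0]
        ![0, k₁ * y ^ 3 - s, 0, 1]) a b c e = curvTable 0 0 (k₁ * y ^ 3) 0 0 s a b c e) ∧
      ∀ p ∈ [![1, -(x * j), -(k₂ * x ^ 2 * y), -x], ![0, y, -(y * x), 0], ![0, 0, 1, 0],
        ![0, y * j, 0, y]],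
        IsClosedFrame d (glConn ![0, 0, 2 * k₂ * x * y, 1] ![-j, 0, 0, 0] ![0, 0, 1, 0]
          ![0, k₁ * y ^ 3 - s, 0, 1]) p := by
  have d2 := fun i => der_two (d i)
  have hdj (i) : d i j = ![0, (j + k₁ * y ^ 3 - s) * j, 0, j + k₁ * y ^ 3 - s] i := by
    have h1 : 2 * d i j = (3 * k₁ * y ^ 2 + 2 * k₂) * d i y := by
      have := congrArg (d i) hj
      simp [hk₁, hk₂, hs, d2, pow_succ] at this
      linear_combination this
    refine sub_eq_zero.1 (eq_zero_of_natCast_mul 2 isUnit_one ?_)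
    push_cast
    rw [mul_one, mul_sub, h1, hy]
    fin_cases i <;> simp
    · linear_combination -j * hj
    · linear_combination -hj
  constructor
  · refine curv_eq_of_blocks fun c e hlt i j' => ?_
    fin_cases c <;> fin_cases e <;> first | (exact absurd hlt (by decide)) | skip
    all_goals fin_cases i <;> fin_cases j' <;>
      simp [curvTable, glBlock, skewBlock, Fin.sum_univ_four, glConn, frameCurv, hx, hy, hdj, hk₁,
        hk₂, hs, d2, pow_succ]
    all_goals first | ring1 | linear_combination -hj
  · intro p hp
    simp only [List.mem_cons, List.not_mem_nil, or_false] at hp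
    rcases hp with rfl | rfl | rfl | rfl
    all_goals
      refine isClosedFrame_of_lt fun b c hlt => ?_
      fin_cases b <;> fin_cases c <;> first | (exact absurd hlt (by decide)) | skip
    all_goals simp [glBlock, Fin.sum_univ_four, glConn, hx, hy, hdj, hk₂, pow_succ]
    all_goals ring1

theorem contDiffOn_specialCoframe (k₁ k₂ s : ℝ) (a : Fin 4) :
    ContDiffOn ℝ ∞ (fun y => specialCoframe k₁ k₂ s y a) domainNe := by
  have h3 : ∀ y ∈ domainNe, y 3 ≠ 0 := fun _ h => h
  have h4 : ∀ y ∈ domainNe, 2 * y 3 ≠ 0 := fun y h => mul_ne_zero two_ne_zero h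
  have c1 : ContDiffOn ℝ ∞ (fun y : E4 => k₂ * (y 0) ^ 2 * (y 3)) domainNe := by fun_prop
  have c2 : ContDiffOn ℝ ∞ (fun y : E4 => y 0 / y 3) domainNe := by fun_prop (disch := assumption)
  have c3 : ContDiffOn ℝ ∞ (fun y : E4 => y 0) domainNe := by fun_prop
  have c4 : ContDiffOn ℝ ∞ (fun y : E4 => 1 / y 3) domainNe := by fun_prop (disch := assumption)
  have c5 : ContDiffOn ℝ ∞ (fun y : E4 => - ((k₁ * (y 3) ^ 3 + 2 * k₂ * (y 3) + 2 * s)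
      / (2 * (y 3)))) domainNe := by fun_prop (disch := assumption)
  have c6 : ContDiffOn ℝ ∞ (fun y : E4 => (k₁ * (y 3) ^ 3 + 2 * k₂ * (y 3) + 2 * s) / 2 * (y 0))
      domainNe := by fun_prop
  fin_cases a
  · exact ((c1.smul contDiffOn_const).add (c2.smul contDiffOn_const)).add contDiffOn_const
  · exact (c3.smul contDiffOn_const).add (c4.smul contDiffOn_const)
  · exact contDiffOn_const
  · refine ContDiffOn.congr (((c5.smul (contDiffOn_const (c := dy 1))).sub (c6.smul
      (contDiffOn_const (c := dy 2)))).add (c4.smul (contDiffOn_const (c := dy 3)))) fun y _ => ?_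
    simp [specialCoframe]

/-- The frame dual to `specialCoframe`. -/
theorem special_dual (k₁ k₂ s : ℝ) {z : E4} (hz : z 3 ≠ 0) {x y j : ℝ} (hx : x = z 0) (hy : y = z 3)
    (hj : j = 1 / 2 * (k₁ * y ^ 3 + 2 * k₂ * y + 2 * s)) (a c : Fin 4) :
    ∑ i, specialCoframe k₁ k₂ s z a (bvec i) * Matrix.of ![![1, -(x * j), -(k₂ * x ^ 2 * y), -x],
      ![0, y, -(y * x), 0], ![0, 0, 1, 0], ![0, y * j, 0, y]] i c = if a = c then 1 else 0 := by
  fin_cases a <;> fin_cases c <;>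
    simp [Fin.sum_univ_four, specialCoframe, dy, bvec, hj, hx, hy] <;>
    (try field_simp) <;> (try ring)

theorem isModel_special (k₁ k₂ s : ℝ) (hk₁ : k₁ ≠ 0) :
    IsModel domainNe (specialCoframe k₁ k₂ s) s 1 0 := by
  set D : Opens E4 := ⟨domainNe, isOpen_domainNe⟩
  let c := algebraMap ℝ (Sm D)
  let x := coordSm D 0
  let y := coordSm D 3
  let j : Sm D := c (1 / 2) * (c k₁ * y ^ 3 + 2 * c k₂ * y + 2 * c s)
  let E : Matrix (Fin 4) (Fin 4) (Sm D) := Matrix.of ![![1, -(x * j), -(c k₂ * x ^ 2 * y), -x],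
    ![0, y, -(y * x), 0], ![0, 0, 1, 0], ![0, y * j, 0, y]]
  have hs := contDiffOn_specialCoframe k₁ k₂ s
  have e2 (z : D) : Sm.ev z x = (z : E4) 0 := ev_coordSm 0 z
  have e3 (z : D) : Sm.ev z y = (z : E4) 3 := ev_coordSm 3 z
  obtain ⟨hi, hE⟩ := inv_cofSm_eq (D := D) hs (E := E) (fun z a b => by
    rw [← special_dual k₁ k₂ s z.2 (j := Sm.ev z j) (e2 z) (e3 z)
      (by simp [j, c, map_ofNat]) a b]
    refine Finset.sum_congr rfl fun i _ => congrArg _ ?_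
    fin_cases i <;> fin_cases b <;> simp [E, c])
  have hj : 2 * j = c k₁ * y ^ 3 + 2 * c k₂ * y + 2 * c s := by
    refine Sm.ext fun z => ?_
    simp [j, c, map_ofNat]
  obtain ⟨h1, h2⟩ := special_structure (d := dF D (specialCoframe k₁ k₂ s))
    (fun i => der_algebraMap i k₁) (fun i => der_algebraMap i k₂) (fun i => der_algebraMap i s) hj
    (fun i => dF_coordSm hE i 0) (fun i => dF_coordSm hE i 3)
  refine isModel_of_frame hs hi (fun i => ?_) h1 (fun z => ?_) (map_one _).symm (map_zero _).symm
  · rw [hE]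
    fin_cases i
    · exact h2 _ (.head _)
    · exact h2 _ (.tail _ (.head _))
    · exact h2 _ (.tail _ (.tail _ (.head _)))
    · exact h2 _ (.tail _ (.tail _ (.tail _ (.head _))))
  · have hz : (z : E4) 3 ≠ 0 := z.2
    simp [hk₁, hz, e3]

theorem isOpen_domainHom (s : ℝ) : IsOpen (domainHom s) :=
  (isOpen_ne_fun (by fun_prop) continuous_const).inter (isOpen_ne_fun (by fun_prop) continuous_const)

theorem contDiffOn_homogeneousCoframe (s : ℝ) (a : Fin 4) :
    ContDiffOn ℝ ∞ (fun y => homogeneousCoframe s y a) (domainHom s) := by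
  have c1 : ContDiffOn ℝ ∞ (fun y : E4 => 1 / (1 - (3 / 2) * s * (y 0) * (y 2))) (domainHom s) :=
    contDiffOn_const.div (by fun_prop) fun y h => h.1
  have c2 : ContDiffOn ℝ ∞ (fun y : E4 => 1 / (1 - (3 / 2) * s * (y 1) * (y 3))) (domainHom s) :=
    contDiffOn_const.div (by fun_prop) fun y h => h.2
  fin_cases a
  · exact c1.smul contDiffOn_const
  · exact c2.smul contDiffOn_const
  · exact c1.smul contDiffOn_const
  · exact c2.smul contDiffOn_const

/-- The frame equations of the fourth branch, for the solution given by `homogeneousCoframe`. -/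
theorem homogeneous_structure {R : Type*} [CommRing R] [Algebra ℝ R]
    {d : Fin 4 → Derivation ℝ R R} {y : Fin 4 → R} {c s m n : R} (hc : ∀ i, d i c = 0)
    (hcs : 2 * c = 3 * s) (hm : m = 1 - c * y 0 * y 2) (hn : n = 1 - c * y 1 * y 3)
    (hy : ∀ i j, d i (y j) = Matrix.diagonal ![m, n, m, n] j i) :
    (∀ a b e f, frameCurv d (glConn ![c * y 2, 0, -(c * y 0), 0] ![0, 0, 0, 0] ![0, 0, 0, 0]
        ![0, c * y 3, 0, -(c * y 1)]) a b e f = curvTable 0 0 s 0 0 s a b e f) ∧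
      ∀ j, IsClosedFrame d (glConn ![c * y 2, 0, -(c * y 0), 0] ![0, 0, 0, 0] ![0, 0, 0, 0]
        ![0, c * y 3, 0, -(c * y 1)]) (Matrix.diagonal ![m, n, m, n] j) := by
  have h0 (i) := hy i 0
  have h1 (i) := hy i 1
  have h2 (i) := hy i 2
  have h3 (i) := hy i 3
  constructor
  · refine curv_eq_of_blocks fun e f hlt i j => ?_
    fin_cases e <;> fin_cases f <;> first | (exact absurd hlt (by decide)) | skip
    all_goals fin_cases i <;> fin_cases j <;>
      simp [curvTable, glBlock, skewBlock, Fin.sum_univ_four, glConn, frameCurv, hy, hc,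
        Matrix.diagonal]
    · linear_combination -2 * c * hm - hcs
    · linear_combination -2 * c * hn - hcs
  · intro j
    refine isClosedFrame_of_lt fun b c hlt => ?_
    fin_cases b <;> fin_cases c <;> first | (exact absurd hlt (by decide)) | skip
    all_goals fin_cases j <;>
      simp [glBlock, glConn, hy, hc, hm, hn, Matrix.diagonal]
    all_goals ring

theorem isModel_homogeneous (s : ℝ) (hs0 : s ≠ 0) :
    IsModel (domainHom s) (homogeneousCoframe s) s 0 0 := by
  set D : Opens E4 := ⟨domainHom s, isOpen_domainHom s⟩
  let a := algebraMap ℝ (Sm D)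
  let y := coordSm D
  let m := 1 - a (3 / 2 * s) * y 0 * y 2
  let n := 1 - a (3 / 2 * s) * y 1 * y 3
  have hs := contDiffOn_homogeneousCoframe s
  have e (z : D) (i) : Sm.ev z (y i) = (z : E4) i := ev_coordSm i z
  obtain ⟨hi, hE⟩ := inv_cofSm_eq (D := D) hs (E := Matrix.diagonal ![m, n, m, n]) (fun z a b => by
    have h1 := z.2.1
    have h2 := z.2.2
    fin_cases a <;> fin_cases b <;>
      simp [homogeneousCoframe, dy, bvec, Matrix.diagonal] <;>
      simp [m, n, a, e] <;> exact inv_mul_cancel₀ (by assumption))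
  obtain ⟨h1, h2⟩ := homogeneous_structure (d := dF D (homogeneousCoframe s)) (c := a (3 / 2 * s))
    (s := a s) (fun i => der_algebraMap i _) (by
      refine Sm.ext fun z => ?_
      simp [a, map_ofNat]; ring) rfl rfl (fun i j => dF_coordSm hE i j)
  refine isModel_of_frame hs hi (fun i => ?_) h1 (fun z => ?_) (map_zero _).symm (map_zero _).symm
  · rw [hE]
    exact h2 i
  · rw [ev_algebraMap]; exact hs0

end Models

/-! ### Switching the two planes of the coframe -/

section Swap

/-- The permutation `1 ↔ 2`, `3 ↔ 4` of the indices. -/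
def swapPerm : Equiv.Perm (Fin 4) where
  toFun := ![1, 0, 3, 2]
  invFun := ![1, 0, 3, 2]
  left_inv := by decide
  right_inv := by decide

theorem dualVec_swap (θ : FormQuad) (y : E4) (b : Fin 4) :
    dualVec (swapCoframe θ y) b = dualVec (θ y) (swapPerm b) := by
  have h : (Matrix.of fun a j => swapCoframe θ y a (bvec j))
      = (Matrix.of fun a j => θ y a (bvec j)).submatrix swapPerm (Equiv.refl _) := by
    ext a j
    fin_cases a <;> rfl
  rw [dualVec, dualVec, h, Matrix.inv_submatrix_equiv]
  rfl

theorem metricOf_swap (θ : FormQuad) : metricOf (swapCoframe θ) = metricOf θ := by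
  funext y
  simp only [metricOf, swapCoframe]
  simp
  abel

theorem endoOf_swap (θ : FormQuad) : endoOf (swapCoframe θ) = endoOf θ := by
  funext y
  simp only [endoOf, dualVec_swap]
  simp [swapCoframe, swapPerm]
  abel

variable {U : Opens E4} {g : BilinField} {K : EndoField} {θ : FormQuad}

theorem connForm_swap (a b : Fin 4) (x X : E4) :
    connForm g (swapCoframe θ) a b x X = connForm g θ (swapPerm a) (swapPerm b) x X := by
  have h : swapCoframe θ x a = θ x (swapPerm a) := by fin_cases a <;> rfl
  simp only [connForm, dualVec_swap, h]

theorem J2_swap (x : E4) : J2 g (swapCoframe θ) x = J4 g θ x := by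
  rw [J2, connForm_swap, dualVec_swap]; rfl

theorem J4_swap (x : E4) : J4 g (swapCoframe θ) x = J2 g θ x := by
  rw [J4, connForm_swap, dualVec_swap]; rfl

theorem weylComp_swap (x : E4) (a b c d : Fin 4) : weylComp g (swapCoframe θ x) x a b c d
    = weylComp g (θ x) x (swapPerm a) (swapPerm b) (swapPerm c) (swapPerm d) := by
  simp only [weylComp, dualVec_swap]

theorem IsAdapted.swap {G : E4 →L[ℝ] E4 →L[ℝ] ℝ} {k : E4 →L[ℝ] E4} {x : E4}
    (h : IsAdapted G k (θ x)) : IsAdapted G k (swapCoframe θ x) where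
  indep := by
    have h1 : swapCoframe θ x = θ x ∘ swapPerm := by
      funext a
      fin_cases a <;> rfl
    rw [h1]
    exact h.indep.comp _ swapPerm.injective
  metric v w := by rw [h.metric]; simp [swapCoframe]; ring
  endo₀ := h.endo₁
  endo₁ := h.endo₀
  endo₂ := h.endo₃
  endo₃ := h.endo₂

theorem psi2'_swap (h : IsAdaptedOn U g K θ) (hg : IsPKEOn U g K) (x : U) :
    psi2' g (swapCoframe θ) x = psi2' g θ x := by
  rw [(h.ev_rF_eq hg x).2, psi2', weylComp_swap, h.weylComp_table hg]
  simp [swapPerm, curvTable, glBlock]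

theorem IsReducedCoframeOn.swap (h : IsReducedCoframeOn U g K θ) (hg : IsPKEOn U g K) :
    IsReducedCoframeOn U g K (swapCoframe θ) where
  smooth a := by fin_cases a <;> exact h.smooth _
  adapted x hx := (h.adapted x hx).swap
  psi0_eq x hx := (weylComp_swap ..).trans (h.psi4_eq x hx)
  psi1_eq x hx := (weylComp_swap ..).trans (h.psi3_eq x hx)
  psi2_ne x hx := by
    have := h.psi2_ne x hx
    rw [psi2, weylComp_swap, h.isAdaptedOn.weylComp_table hg ⟨x, hx⟩]
    simpa [swapPerm, curvTable, glBlock, skewBlock] using this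
  psi3_eq x hx := (weylComp_swap ..).trans (h.psi1_eq x hx)
  psi4_eq x hx := (weylComp_swap ..).trans (h.psi0_eq x hx)

theorem IsModel.swap {D : Set E4} {s j₂ j₄ : ℝ} (h : IsModel D θ s j₂ j₄) :
    IsModel D (swapCoframe θ) s j₄ j₂ := by
  have hr : IsReducedCoframeOn (⟨D, h.isOpen⟩ : Opens E4) (metricOf θ) (endoOf θ) θ := h.reduced
  have hg : IsPKEOn (⟨D, h.isOpen⟩ : Opens E4) (metricOf θ) (endoOf θ) := h.pke
  have h1 := hr.swap hg
  refine ⟨h.isOpen, ?_, ?_, ?_, ?_, ?_, ?_, ?_⟩ <;> (try rw [endoOf_swap]) <;> rw [metricOf_swap]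
  · exact h.pke
  · exact h.scal
  · exact h.typeD
  · exact h1
  · exact fun y hy => (psi2'_swap hr.isAdaptedOn hg ⟨y, hy⟩).trans (h.psi2'_eq y hy)
  · exact fun y hy => (J2_swap y).trans (h.J4_eq y hy)
  · exact fun y hy => (J4_swap y).trans (h.J2_eq y hy)

end Swap

/-! ### The invariance of `J₂` and `J₄` -/

section Gauge

variable {U : Opens E4} {g : BilinField} {K : EndoField} {θ θ' : FormQuad}

theorem connForm_smul (a b : Fin 4) (x X : E4) (c : ℝ) :
    connForm g θ a b x (c • X) = c * connForm g θ a b x X := by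
  have h (k : Fin 4) : ∑ i, ∑ j, christoffel g k i j x * (c • X) i * dualVec (θ x) b j
      = c * ∑ i, ∑ j, christoffel g k i j x * X i * dualVec (θ x) b j := by
    simp only [Finset.mul_sum, PiLp.smul_apply, smul_eq_mul]
    exact Finset.sum_congr rfl fun i _ => Finset.sum_congr rfl fun j _ => by ring
  simp only [connForm, h, ← smul_smul, ← Finset.smul_sum, map_smul, ← smul_add, smul_eq_mul]

/-- The change between two reduced coframes is diagonal or antidiagonal. -/
theorem IsReducedCoframeOn.offdiag (h : IsReducedCoframeOn U g K θ)
    (h' : IsReducedCoframeOn U g K θ') (hg : IsPKEOn U g K) {x : E4} (hx : x ∈ U) :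
    (θ x 0 (dualVec (θ' x) 0) = 0 ∨ θ x 1 (dualVec (θ' x) 0) = 0) ∧
      (θ x 0 (dualVec (θ' x) 1) = 0 ∨ θ x 1 (dualVec (θ' x) 1) = 0) := by
  obtain ⟨hΔ, h1⟩ := (h.adapted x hx).eq_change (h'.adapted x hx)
  have hq := h'.quartic_eq hg hx
  rw [h1] at hq
  simp only [asdQuartic_change g x (h.adapted x hx).indep hΔ, h.quartic_eq hg hx] at hq
  have h2 := h.psi2_ne x hx
  have e0 := hq 1 0
  have e1 := hq 0 1
  simp [h2, hΔ] at e0 e1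
  exact ⟨e0, e1⟩

/-- The effect of a diagonal change of the coframe on `J₂` and `J₄`. -/
theorem J_change_diag (hs : ∀ a, ContDiffOn ℝ ∞ (fun x => θ x a) U)
    (hi : ∀ x ∈ U, LinearIndependent ℝ (θ x)) {x : E4} (hx : x ∈ U) {p v : E4 → ℝ}
    (hp : DifferentiableAt ℝ p x) (hv : DifferentiableAt ℝ v x) (hp0 : p x ≠ 0) (hv0 : v x ≠ 0)
    (he : ∀ᶠ z in nhds x, θ' z = changeCoframe (p z) 0 0 (v z) (θ z)) :
    J2 g θ' x = (v x)⁻¹ * J2 g θ x ∧ J4 g θ' x = (p x)⁻¹ * J4 g θ x := by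
  have hΔ : ∀ᶠ z in nhds x, p z * v z - 0 * 0 ≠ 0 := by
    filter_upwards [hp.continuousAt.eventually_ne hp0, hv.continuousAt.eventually_ne hv0]
      with z h1 h2
    simp [h1, h2]
  have hU : ∀ᶠ z in nhds x, z ∈ U := U.isOpen.mem_nhds hx
  have hd (b) : ∀ᶠ z in nhds x, dualVec (θ' z) b = changeFrame (p z) 0 0 (v z) (θ z) b := by
    filter_upwards [he, hΔ, hU] with z h1 h2 h3
    rw [h1, dualVec_change (hi z h3) h2]
  have hdd (b) : DifferentiableAt ℝ (fun z => dualVec (θ z) b) x :=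
    ((contDiffOn_dualVec hs hi b).contDiffAt (U.isOpen.mem_nhds hx)).differentiableAt (by simp)
  have hx' := he.self_of_nhds
  have h0 : (fun z => dualVec (θ' z) 0) =ᶠ[nhds x] fun z => p z • dualVec (θ z) 0 :=
    (hd 0).mono fun z hz => by simpa [changeFrame] using hz
  have h1 : (fun z => dualVec (θ' z) 1) =ᶠ[nhds x] fun z => v z • dualVec (θ z) 1 :=
    (hd 1).mono fun z hz => by simpa [changeFrame] using hz
  have h2 : dualVec (θ' x) 2 = (p x)⁻¹ • dualVec (θ x) 2 := by
    rw [(hd 2).self_of_nhds]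
    simp only [changeFrame, Matrix.cons_val, smul_smul, zero_smul, sub_zero]
    congr 1
    field_simp
    ring
  have h3 : dualVec (θ' x) 3 = (v x)⁻¹ • dualVec (θ x) 3 := by
    rw [(hd 3).self_of_nhds]
    simp [changeFrame, smul_smul, hp0]
  constructor
  · rw [J2, J2, connForm_eq_mul (g := g) (a' := 1) (b' := 0) (κ := (v x)⁻¹) (hi x hx) hp (hdd 0)
      h0 (by rw [hx']; simp [changeCoframe, smul_smul, hp0]) (by decide), h2, connForm_smul]
    field_simp
  · rw [J4, J4, connForm_eq_mul (g := g) (a' := 0) (b' := 1) (κ := (p x)⁻¹) (hi x hx) hv (hdd 1)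
      h1 (by rw [hx']; simp [changeCoframe, smul_smul]; congr 1; field_simp) (by decide), h3, connForm_smul]
    field_simp

/-- If the change between two reduced coframes does not switch the two roots of the quartic at `x`, then
it is diagonal near `x`, and `J₂` and `J₄` are only rescaled. -/
theorem IsReducedCoframeOn.J_eq_of_diag (h : IsReducedCoframeOn U g K θ)
    (h' : IsReducedCoframeOn U g K θ') (hg : IsPKEOn U g K) {x : E4} (hx : x ∈ U)
    (hp : θ x 0 (dualVec (θ' x) 0) ≠ 0) (hv : θ x 1 (dualVec (θ' x) 1) ≠ 0) :
    J2 g θ' x = (θ x 1 (dualVec (θ' x) 1))⁻¹ * J2 g θ x ∧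
      J4 g θ' x = (θ x 0 (dualVec (θ' x) 0))⁻¹ * J4 g θ x := by
  have hi (z) (hz : z ∈ U) := (h.adapted z hz).indep
  have hd (a b) : DifferentiableAt ℝ (fun z => θ z a (dualVec (θ' z) b)) x := by
    have h1 := ((h.smooth a).contDiffAt (U.isOpen.mem_nhds hx)).differentiableAt (by simp)
    have h2 := ((contDiffOn_dualVec h'.smooth (fun z hz => (h'.adapted z hz).indep) b).contDiffAt
      (U.isOpen.mem_nhds hx)).differentiableAt (by simp)
    exact h1.clm_apply h2
  refine J_change_diag h.smooth hi hx (hd 0 0) (hd 1 1) hp hv ?_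
  filter_upwards [U.isOpen.mem_nhds hx, (hd 0 0).continuousAt.eventually_ne hp,
    (hd 1 1).continuousAt.eventually_ne hv] with z hz h1 h2
  obtain ⟨q0, u0⟩ := h.offdiag h' hg hz
  have h3 := ((h.adapted z hz).eq_change (h'.adapted z hz)).2
  rwa [q0.resolve_left h1, u0.resolve_right h2] at h3

/-- `J₂` and `J₄` do not depend on the reduced coframe, up to non-zero factors and order. -/
theorem IsReducedCoframeOn.J_eq (h : IsReducedCoframeOn U g K θ)
    (h' : IsReducedCoframeOn U g K θ') (hg : IsPKEOn U g K) {x : E4} (hx : x ∈ U) :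
    ∃ a b : ℝ, a ≠ 0 ∧ b ≠ 0 ∧ ((J2 g θ' x = a * J2 g θ x ∧ J4 g θ' x = b * J4 g θ x) ∨
      (J2 g θ' x = a * J4 g θ x ∧ J4 g θ' x = b * J2 g θ x)) := by
  obtain ⟨hq, hu⟩ := h.offdiag h' hg hx
  have hΔ := ((h.adapted x hx).eq_change (h'.adapted x hx)).1
  by_cases hp : θ x 0 (dualVec (θ' x) 0) = 0
  · have h1 : θ x 1 (dualVec (θ' x) 0) ≠ 0 := fun h1 => hΔ (by rw [hp, h1]; ring)
    have h2 : θ x 0 (dualVec (θ' x) 1) ≠ 0 := fun h2 => hΔ (by rw [hp, h2]; ring)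
    have e0 : dualVec (swapCoframe θ' x) 0 = dualVec (θ' x) 1 := dualVec_swap θ' x 0
    have e1 : dualVec (swapCoframe θ' x) 1 = dualVec (θ' x) 0 := dualVec_swap θ' x 1
    have := h.J_eq_of_diag (h'.swap hg) hg hx (by rwa [e0]) (by rwa [e1])
    rw [J2_swap, J4_swap] at this
    exact ⟨_, _, inv_ne_zero (by rwa [e0]), inv_ne_zero (by rwa [e1]), .inr ⟨this.2, this.1⟩⟩
  · have hv : θ x 1 (dualVec (θ' x) 1) ≠ 0 := fun h1 =>
      hΔ (by rw [h1, hq.resolve_left hp]; ring)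
    have := h.J_eq_of_diag h' hg hx hp hv
    exact ⟨_, _, inv_ne_zero hv, inv_ne_zero hp, .inl this⟩

end Gauge

/-! ### The existence of reduced coframes -/

section Existence

variable {U : Opens E4} {g : BilinField} {K : EndoField} {θ : FormQuad}

/-- A null frame adapted to `K` gives an adapted coframe. -/
theorem isAdapted_of_frame {G : E4 →L[ℝ] E4 →L[ℝ] ℝ} {k : E4 →L[ℝ] E4} {F : Fin 4 → E4}
    (hk : ∀ v, k (k v) = v) (hc : ∀ v w, G (k v) (k w) = - G v w)
    (hF : ∀ a, k (F a) = eps a • F a) (hGF : ∀ a b, G (F (a + 2)) (F b) = if a = b then 1 else 0) :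
    IsAdapted G k (fun a => G (F (a + 2))) ∧ ∀ b, dualVec (fun a => G (F (a + 2))) b = F b := by
  have hi : LinearIndependent ℝ fun a => G (F (a + 2)) := linearIndependent_of_dual hGF
  have hd (b) : dualVec (fun a => G (F (a + 2))) b = F b := dualVec_eq hi fun a => hGF a b
  have hk' (a v) : G (F (a + 2)) (k v) = eps a * G (F (a + 2)) v := by
    have h1 := hc (F (a + 2)) (k v)
    rw [hk, hF, map_smul, smul_apply, smul_eq_mul] at h1
    have h2 : eps (a + 2) = - eps a := by fin_cases a <;> simp [eps]
    rw [h2] at h1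
    linarith
  refine ⟨⟨hi, fun v w => ?_, fun v => ?_, fun v => ?_, fun v => ?_, fun v => ?_⟩, hd⟩
  · conv_lhs => rw [← sum_smul_dualVec hi v]
    simp only [hd, Fin.sum_univ_four, map_add, map_smul, add_apply, smul_apply, smul_eq_mul,
      Fin.reduceAdd, zero_add]
    ring
  · simpa [eps] using hk' 0 v
  · simpa [eps] using hk' 1 v
  · simpa [eps] using hk' 2 v
  · simpa [eps] using hk' 3 v

/-- An adapted coframe at a point extends to a smooth adapted coframe near that point. -/
theorem exists_isAdaptedOn (hg : IsPKEOn U g K) {x₀ : E4} (hx₀ : x₀ ∈ U)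
    {η : Fin 4 → E4 →L[ℝ] ℝ} (hη : IsAdapted (g x₀) (K x₀) η) :
    ∃ V ≤ U, x₀ ∈ V ∧ ∃ θ : FormQuad, IsAdaptedOn V g K θ ∧
      ∀ b, dualVec (θ x₀) b = dualVec η b := by
  let E (b : Fin 4) (x : E4) : E4 := (1 / 2 : ℝ) • (dualVec η b + eps b • K x (dualVec η b))
  have hee (b) : eps b * eps b = 1 := by fin_cases b <;> simp [eps]
  have hE (b x) (hx : x ∈ U) : K x (E b x) = eps b • E b x := by
    simp only [E, map_smul, map_add, hg.paracomplex x hx, smul_add, smul_smul]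
    rw [show eps b * (1 / 2 * eps b) = 1 / 2 by linear_combination (1 / 2) * hee b]
    rw [add_comm]; congr 2; ring
  have hE0 (b) : E b x₀ = dualVec η b := by
    simp only [E, hη.endo_dualVec, smul_smul, hee, one_smul]
    module
  have hEs (b) : ContDiffOn ℝ ∞ (E b) U :=
    ContDiffOn.const_smul _ (contDiffOn_const.add (ContDiffOn.const_smul _
      (hg.smooth_endo.clm_apply contDiffOn_const)))
  have hgE (a b x) (hx : x ∈ U) (hab : eps a = eps b) : g x (E a x) (E b x) = 0 := by
    have h1 := hg.compat x hx (E a x) (E b x)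
    rw [hE a x hx, hE b x hx, (g x).map_smul, smul_apply, (g x (E a x)).map_smul, smul_eq_mul,
      smul_eq_mul, ← hab, ← mul_assoc, hee] at h1
    linarith
  let m (a b : Fin 4) (x : E4) : ℝ := g x (E a x) (E b x)
  have hm (a b) : ContDiffOn ℝ ∞ (m a b) U := (hg.smooth_metric.clm_apply (hEs a)).clm_apply (hEs b)
  let D (x : E4) : ℝ := m 0 2 x * m 1 3 x - m 0 3 x * m 1 2 x
  have hD : ContDiffOn ℝ ∞ D U := ((hm 0 2).mul (hm 1 3)).sub ((hm 0 3).mul (hm 1 2))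
  have hD0 : D x₀ = 1 := by
    have hd := apply_dualVec hη.indep
    simp [D, m, hE0, hη.metric, hd]
  refine ⟨⟨(U : Set E4) ∩ D ⁻¹' {0}ᶜ, hD.continuousOn.isOpen_inter_preimage U.isOpen
    isOpen_compl_singleton⟩, fun x hx => hx.1, ⟨hx₀, by simp [hD0]⟩, ?_⟩
  let F (x : E4) : Fin 4 → E4 := ![E 0 x, E 1 x,
    (D x)⁻¹ • (m 1 3 x • E 2 x - m 1 2 x • E 3 x), (D x)⁻¹ • (m 0 2 x • E 3 x - m 0 3 x • E 2 x)]
  have hF (x) (hx : x ∈ U) (hDx : D x ≠ 0) : IsAdapted (g x) (K x) (fun a => g x (F x (a + 2))) ∧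
      ∀ b, dualVec (fun a => g x (F x (a + 2))) b = F x b := by
    refine isAdapted_of_frame (hg.paracomplex x hx) (hg.compat x hx) (fun a => ?_)
      fun a b => ?_
    · have e (b) := hE b x hx
      fin_cases a
      · exact e 0
      · exact e 1
      · simp [F, e, eps]; module
      · simp [F, e, eps]; module
    · have hz (a b) (hab : eps a = eps b) : m a b x = 0 := hgE a b x hx hab
      have hs (a b) : m a b x = m b a x := hg.symm x hx _ _
      have z00 := hz 0 0 rfl
      have z01 := hz 0 1 rfl
      have z10 := hz 1 0 rfl
      have z11 := hz 1 1 rfl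
      have z22 := hz 2 2 rfl
      have z23 := hz 2 3 rfl
      have z32 := hz 3 2 rfl
      have z33 := hz 3 3 rfl
      have hme (a b) : g x (E a x) (E b x) = m a b x := rfl
      have s20 := hs 2 0
      have s21 := hs 2 1
      have s30 := hs 3 0
      have s31 := hs 3 1
      have hDe : D x = m 0 2 x * m 1 3 x - m 0 3 x * m 1 2 x := rfl
      fin_cases a <;> fin_cases b <;> simp [F, hme, z00, z01, z10, z11, z22, z23, z32, z33, s20,
        s21, s30, s31] <;> (try field_simp) <;> (try rw [hDe]) <;>
        first | ring1 | (right; ring1)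
  refine ⟨fun x a => g x (F x (a + 2)), ⟨fun a => ?_, fun x hx => (hF x hx.1 hx.2).1⟩, fun b => ?_⟩
  · have hFs (b) : ContDiffOn ℝ ∞ (fun x => F x b) ((U : Set E4) ∩ D ⁻¹' {0}ᶜ) := by
      have hi : ContDiffOn ℝ ∞ (fun x => (D x)⁻¹) ((U : Set E4) ∩ D ⁻¹' {0}ᶜ) :=
        (hD.mono fun x hx => hx.1).inv fun x hx => hx.2
      have e (b) := (hEs b).mono fun x (hx : x ∈ (U : Set E4) ∩ D ⁻¹' {0}ᶜ) => hx.1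
      have mm (a b) := (hm a b).mono fun x (hx : x ∈ (U : Set E4) ∩ D ⁻¹' {0}ᶜ) => hx.1
      fin_cases b
      · exact e 0
      · exact e 1
      · exact hi.smul (((mm 1 3).smul (e 2)).sub ((mm 1 2).smul (e 3)))
      · exact hi.smul (((mm 0 2).smul (e 3)).sub ((mm 0 3).smul (e 2)))
    exact (hg.smooth_metric.mono fun x hx => hx.1).clm_apply (hFs (a + 2))
  · rw [(hF x₀ hx₀ (by simp [hD0])).2 b]
    have hd := apply_dualVec hη.indep
    fin_cases b <;> simp [F, hE0, hD0, m, hη.metric, hd]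

theorem IsAdaptedOn.contDiffOn_psi (h : IsAdaptedOn U g K θ) (hg : IsPKEOn U g K) :
    ContDiffOn ℝ ∞ (psi0 g θ) U ∧ ContDiffOn ℝ ∞ (psi1 g θ) U ∧ ContDiffOn ℝ ∞ (psi2 g θ) U ∧
      ContDiffOn ℝ ∞ (psi3 g θ) U ∧ ContDiffOn ℝ ∞ (psi4 g θ) U := by
  have key {f : E4 → ℝ} (F : Sm U) (hF : ∀ x : U, Sm.ev x F = f x) : ContDiffOn ℝ ∞ f U :=
    F.contDiffOn_fn.congr fun x hx => by rw [← hF ⟨x, hx⟩, ← Sm.fn_apply]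
  have hr := fun x => (h.ev_rF_eq hg x).1
  refine ⟨key (-IsNullCoframeOn.rF U g θ 1 0 0 3) fun x => ?_,
    key (IsNullCoframeOn.rF U g θ 0 0 0 3) fun x => ?_, key (psiSm U g θ) (h.ev_psiSm hg),
    key (-IsNullCoframeOn.rF U g θ 0 0 1 2) fun x => ?_,
    key (-IsNullCoframeOn.rF U g θ 0 1 1 2) fun x => ?_⟩ <;>
  simp [hr, curvTable, glBlock, skewBlock]

/-- For the quartic `r (A ξ₀² + B ξ₀ ξ₁ + C ξ₁²)²`, the product `r B²` is a rational function of the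
coefficients, since the two invariants of the quartic are multiples of the square and of the cube of
`r (B² - 4 A C)`. This makes the square root of a smooth family of such quartics smooth. -/
theorem quartic_square {ψ₀ ψ₁ ψ₂ ψ₃ ψ₄ r A B C : ℝ} (h0 : ψ₀ = r * A ^ 2)
    (h1 : 4 * ψ₁ = 2 * r * A * B) (h2 : 6 * ψ₂ = r * (B ^ 2 + 2 * A * C))
    (h3 : 4 * ψ₃ = 2 * r * B * C) (h4 : ψ₄ = r * C ^ 2) (hr : r ≠ 0) (hd : B ^ 2 - 4 * A * C ≠ 0) :
    4 * ψ₂ - 6 * (ψ₀ * ψ₂ * ψ₄ + 2 * ψ₁ * ψ₂ * ψ₃ - ψ₂ ^ 3 - ψ₀ * ψ₃ ^ 2 - ψ₄ * ψ₁ ^ 2)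
      / (ψ₀ * ψ₄ - 4 * ψ₁ * ψ₃ + 3 * ψ₂ ^ 2) = r * B ^ 2 ∧
      ψ₀ * ψ₄ - 4 * ψ₁ * ψ₃ + 3 * ψ₂ ^ 2 ≠ 0 := by
  have e1 : ψ₁ = r * A * B / 2 := by linarith
  have e2 : ψ₂ = r * (B ^ 2 + 2 * A * C) / 6 := by linarith
  have e3 : ψ₃ = r * B * C / 2 := by linarith
  have hI : ψ₀ * ψ₄ - 4 * ψ₁ * ψ₃ + 3 * ψ₂ ^ 2 = r ^ 2 * (B ^ 2 - 4 * A * C) ^ 2 / 12 := by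
    rw [h0, h4, e1, e2, e3]; ring
  have hJ : ψ₀ * ψ₂ * ψ₄ + 2 * ψ₁ * ψ₂ * ψ₃ - ψ₂ ^ 3 - ψ₀ * ψ₃ ^ 2 - ψ₄ * ψ₁ ^ 2
      = - r ^ 3 * (B ^ 2 - 4 * A * C) ^ 3 / 216 := by
    rw [h0, h4, e1, e2, e3]; ring
  refine ⟨?_, by rw [hI]; positivity⟩
  rw [hI, hJ, e2]
  field_simp
  ring

/-- The type of the quartic does not depend on the adapted coframe. -/
theorem IsAdapted.quartic_form {k : E4 →L[ℝ] E4} {η η' : Fin 4 → E4 →L[ℝ] ℝ} {x : E4}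
    (h : IsAdapted (g x) k η) (h' : IsAdapted (g x) k η')
    (hq : ∃ r a b c d : ℝ, r ≠ 0 ∧ a * d - b * c ≠ 0 ∧
      ∀ ξ₀ ξ₁ : ℝ, asdQuartic g η x ξ₀ ξ₁ = r * (a * ξ₀ + b * ξ₁) ^ 2 * (c * ξ₀ + d * ξ₁) ^ 2) :
    ∃ r a b c d : ℝ, r ≠ 0 ∧ a * d - b * c ≠ 0 ∧
      ∀ ξ₀ ξ₁ : ℝ, asdQuartic g η' x ξ₀ ξ₁
        = r * (a * ξ₀ + b * ξ₁) ^ 2 * (c * ξ₀ + d * ξ₁) ^ 2 := by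
  obtain ⟨r, a, b, c, d, hr, hd, hq⟩ := hq
  obtain ⟨hΔ, h1⟩ := h.eq_change h'
  generalize η 0 (dualVec η' 0) = p at hΔ h1
  generalize η 1 (dualVec η' 0) = q at hΔ h1
  generalize η 0 (dualVec η' 1) = u at hΔ h1
  generalize η 1 (dualVec η' 1) = v at hΔ h1
  refine ⟨((p * v - q * u)⁻¹) ^ 2 * r, a * p + b * q, a * u + b * v, c * p + d * q, c * u + d * v,
    by positivity, ?_, fun ξ₀ ξ₁ => ?_⟩
  · have : (a * p + b * q) * (c * u + d * v) - (a * u + b * v) * (c * p + d * q)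
        = (a * d - b * c) * (p * v - q * u) := by ring
    rw [this]
    exact mul_ne_zero hd hΔ
  · rw [h1, asdQuartic_change g x h.indep hΔ, hq]
    ring

theorem mul_eq_of_sq {q₀ q₂ D σ : ℝ} (hD : D ^ 2 = 1 - 4 * (q₀ * q₂)) (hσ : σ = (1 + D) / 2) :
    q₀ * q₂ = σ * (1 - σ) := by
  rw [hσ]
  linear_combination hD / 4

/-- The change of basis that diagonalizes `q₀ ξ₀² + ξ₀ ξ₁ + q₂ ξ₁²`. -/
theorem quadratic_factor {q₀ q₂ σ ξ₀ ξ₁ : ℝ} (hσ : σ ≠ 0) (h : q₀ * q₂ = σ * (1 - σ)) :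
    q₀ * (1 * ξ₀ + -q₂ * ξ₁) ^ 2 + (1 * ξ₀ + -q₂ * ξ₁) * (-q₀ / σ * ξ₀ + σ * ξ₁)
      + q₂ * (-q₀ / σ * ξ₀ + σ * ξ₁) ^ 2 = (2 * σ - 1) ^ 2 * ξ₀ * ξ₁ := by
  obtain ⟨w, rfl⟩ : ∃ w, q₀ = w * σ := ⟨q₀ / σ, (div_mul_cancel₀ _ hσ).symm⟩
  have e : w * q₂ = 1 - σ := mul_left_cancel₀ hσ (by linear_combination h)
  rw [show -(w * σ) / σ = -w by field_simp]
  linear_combination (-(ξ₀ - q₂ * ξ₁) * (-w * ξ₀ + σ * ξ₁)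
    - (3 * σ - 1 - w * q₂) * ξ₀ * ξ₁) * e

/-- Reduced coframes exist near every point at which the quartic has real type `D`. -/
theorem exists_isReducedCoframeOn (hg : ∀ V ≤ U, IsPKEOn V g K) (hD : IsRealTypeDOn U g K)
    {x₀ : E4} (hx₀ : x₀ ∈ U) :
    ∃ V ≤ U, x₀ ∈ V ∧ ∃ θ : FormQuad, IsReducedCoframeOn V g K θ := by
  -- an adapted coframe whose quartic at `x₀` is a multiple of `ξ₀² ξ₁²`
  obtain ⟨η, hη, r, a, b, c, d, hr, hΔ, hq⟩ := hD x₀ hx₀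
  have hΔ' : d * a - -c * -b ≠ 0 := fun h => hΔ (by linarith)
  obtain ⟨V, hVU, hxV, θ, hθ, hθ0⟩ := exists_isAdaptedOn (hg U le_rfl) hx₀ (hη.change hΔ')
  have hgV := hg V hVU
  have hq0 (ξ₀ ξ₁) : asdQuartic g (θ x₀) x₀ ξ₀ ξ₁ = r * (a * d - b * c) ^ 2 * ξ₀ ^ 2 * ξ₁ ^ 2 := by
    have : asdQuartic g (θ x₀) x₀ ξ₀ ξ₁
        = asdQuartic g (changeCoframe d (-c) (-b) a η) x₀ ξ₀ ξ₁ := by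
      simp only [asdQuartic, hθ0]
    rw [this, asdQuartic_change g x₀ hη.indep hΔ', hq,
      show d * a - -c * -b = a * d - b * c by ring]
    field_simp
    ring
  have hq0' (ξ₀ ξ₁) := (hθ.quartic_eq hgV ⟨x₀, hxV⟩ ξ₀ ξ₁).symm.trans (hq0 ξ₀ ξ₁)
  simp only at hq0'
  have v0 : psi0 g θ x₀ = 0 := by simpa using hq0' 1 0
  have v4 : psi4 g θ x₀ = 0 := by simpa using hq0' 0 1
  have v1 : psi1 g θ x₀ = 0 := by
    have e1 := hq0' 1 1
    have e2 := hq0' 1 (-1)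
    have e3 := hq0' 1 2
    rw [v0, v4] at e1 e2 e3
    linarith
  have v3 : psi3 g θ x₀ = 0 := by
    have e1 := hq0' 1 1
    have e2 := hq0' 1 (-1)
    rw [v0, v4, v1] at e1 e2
    linarith
  have v2 : psi2 g θ x₀ ≠ 0 := by
    have e1 := hq0' 1 1
    rw [v0, v1, v3, v4] at e1
    have : r * (a * d - b * c) ^ 2 ≠ 0 := by positivity
    exact fun h => this (by rw [h] at e1; linarith)
  -- the square root of the quartic, normalized to be `ξ₀ ξ₁` at `x₀`
  obtain ⟨s0, s1, s2, s3, s4⟩ := hθ.contDiffOn_psi hgV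
  let I (x : E4) : ℝ := psi0 g θ x * psi4 g θ x - 4 * psi1 g θ x * psi3 g θ x + 3 * psi2 g θ x ^ 2
  let J (x : E4) : ℝ := psi0 g θ x * psi2 g θ x * psi4 g θ x + 2 * psi1 g θ x * psi2 g θ x
    * psi3 g θ x - psi2 g θ x ^ 3 - psi0 g θ x * psi3 g θ x ^ 2 - psi4 g θ x * psi1 g θ x ^ 2
  let ρ (x : E4) : ℝ := 4 * psi2 g θ x - 6 * J x / I x
  let q₀ (x : E4) : ℝ := 2 * psi1 g θ x / ρ x
  let q₂ (x : E4) : ℝ := 2 * psi3 g θ x / ρ x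
  have key (x) (hx : x ∈ V) : I x ≠ 0 ∧ (ρ x ≠ 0 → ∀ ξ₀ ξ₁, asdQuartic g (θ x) x ξ₀ ξ₁
      = ρ x * (q₀ x * ξ₀ ^ 2 + ξ₀ * ξ₁ + q₂ x * ξ₁ ^ 2) ^ 2) := by
    obtain ⟨η, hη, hη'⟩ := hD x (hVU hx)
    obtain ⟨r, a, b, c, d, hr, hΔ, hq⟩ := hη.quartic_form (hθ.adapted x hx) hη'
    have hq' (ξ₀ ξ₁) := (hθ.quartic_eq hgV ⟨x, hx⟩ ξ₀ ξ₁).symm.trans (hq ξ₀ ξ₁)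
    simp only at hq'
    have e0 := hq' 1 0
    have e1 := hq' 0 1
    have e2 := hq' 1 1
    have e3 := hq' 1 (-1)
    have e4 := hq' 1 2
    have c0 : psi0 g θ x = r * (a * c) ^ 2 := by linear_combination e0
    have c4 : psi4 g θ x = r * (b * d) ^ 2 := by linear_combination e1
    have c2 : 6 * psi2 g θ x = r * ((a * d + b * c) ^ 2 + 2 * (a * c) * (b * d)) := by
      linear_combination e2 / 2 + e3 / 2 - c0 - c4
    have c1 : 4 * psi1 g θ x = 2 * r * (a * c) * (a * d + b * c) := by
      linear_combination -e4 / 6 + e2 - e3 / 3 - c0 / 2 + 2 * c4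
    have c3 : 4 * psi3 g θ x = 2 * r * (a * d + b * c) * (b * d) := by
      linear_combination e2 / 2 - e3 / 2 - c1
    obtain ⟨hρ, hI⟩ := quartic_square c0 c1 c2 c3 c4 hr (by
      have : (a * d + b * c) ^ 2 - 4 * (a * c) * (b * d) = (a * d - b * c) ^ 2 := by ring
      rw [this]; positivity)
    have hρ' : ρ x = r * (a * d + b * c) ^ 2 := hρ
    refine ⟨hI, fun hρ0 ξ₀ ξ₁ => ?_⟩
    have hB : a * d + b * c ≠ 0 := fun h => hρ0 (by rw [hρ', h]; ring)
    have f0 : q₀ x = a * c / (a * d + b * c) := by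
      simp only [q₀]
      rw [hρ', div_eq_div_iff (by positivity) hB]
      linear_combination (a * d + b * c) / 2 * c1
    have f2 : q₂ x = b * d / (a * d + b * c) := by
      simp only [q₂]
      rw [hρ', div_eq_div_iff (by positivity) hB]
      linear_combination (a * d + b * c) / 2 * c3
    rw [hq, f0, f2, hρ']
    field_simp
    ring
  have hIs : ContDiffOn ℝ ∞ I V := ((s0.mul s4).sub ((contDiffOn_const.mul s1).mul s3)).add
    (contDiffOn_const.mul (s2.pow 2))
  have hJs : ContDiffOn ℝ ∞ J V := (((((s0.mul s2).mul s4).add (((contDiffOn_const.mul s1).mul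
    s2).mul s3)).sub (s2.pow 3)).sub (s0.mul (s3.pow 2))).sub (s4.mul (s1.pow 2))
  have hρs : ContDiffOn ℝ ∞ ρ V := (contDiffOn_const.mul s2).sub
    ((contDiffOn_const.mul hJs).div hIs fun x hx => (key x hx).1)
  have hρ0 : ρ x₀ ≠ 0 := by
    have : ρ x₀ = 6 * psi2 g θ x₀ := by
      simp only [ρ, J, I, v0, v1, v3, v4]
      field_simp
      ring
    rw [this]
    exact mul_ne_zero (by norm_num) v2
  let V₁ : Opens E4 := ⟨(V : Set E4) ∩ ρ ⁻¹' {0}ᶜ, hρs.continuousOn.isOpen_inter_preimage V.isOpen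
    isOpen_compl_singleton⟩
  have h1V : V₁ ≤ V := fun x hx => hx.1
  have q0s : ContDiffOn ℝ ∞ q₀ V₁ := (contDiffOn_const.mul (s1.mono h1V)).div (hρs.mono h1V)
    fun x hx => hx.2
  have q2s : ContDiffOn ℝ ∞ q₂ V₁ := (contDiffOn_const.mul (s3.mono h1V)).div (hρs.mono h1V)
    fun x hx => hx.2
  -- diagonalize the quadratic form; its discriminant is positive near `x₀`, where it equals `1`
  let dsc (x : E4) : ℝ := 1 - 4 * (q₀ x * q₂ x)
  have hds : ContDiffOn ℝ ∞ dsc V₁ := contDiffOn_const.sub (contDiffOn_const.mul (q0s.mul q2s))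
  let W : Opens E4 := ⟨(V₁ : Set E4) ∩ dsc ⁻¹' Set.Ioi 0,
    hds.continuousOn.isOpen_inter_preimage V₁.isOpen isOpen_Ioi⟩
  have hW1 : W ≤ V₁ := fun x hx => hx.1
  have hWV : W ≤ V := hW1.trans h1V
  have hx₀W : x₀ ∈ W := ⟨⟨hxV, hρ0⟩, by simp [dsc, q₀, v1]⟩
  let σ (x : E4) : ℝ := (1 + √(dsc x)) / 2
  have hσs : ContDiffOn ℝ ∞ σ W := (contDiffOn_const.add ((hds.mono hW1).sqrt
    fun x hx => ne_of_gt hx.2)).div_const 2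
  have hsq (x) (hx : x ∈ W) : 0 < √(dsc x) := Real.sqrt_pos.2 hx.2
  have hσ0 (x) (hx : x ∈ W) : σ x ≠ 0 := by
    have := hsq x hx
    simp only [σ]; positivity
  have hσq (x) (hx : x ∈ W) : q₀ x * q₂ x = σ x * (1 - σ x) := by
    exact mul_eq_of_sq (Real.sq_sqrt (le_of_lt hx.2)) rfl
  have hΔW (x) (hx : x ∈ W) : 1 * σ x - -q₀ x / σ x * -q₂ x = √(dsc x) := by
    have h1 : q₀ x / σ x * q₂ x = 1 - σ x := by
      rw [div_mul_eq_mul_div, hσq x hx, mul_div_cancel_left₀ _ (hσ0 x hx)]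
    have h2 : √(dsc x) = 2 * σ x - 1 := by simp only [σ]; ring
    rw [h2, neg_div]
    linear_combination -h1
  have hΔ0 (x) (hx : x ∈ W) : 1 * σ x - -q₀ x / σ x * -q₂ x ≠ 0 := by
    rw [hΔW x hx]; exact (hsq x hx).ne'
  have hnew : IsAdaptedOn W g K
      fun x => changeCoframe 1 (-q₀ x / σ x) (-q₂ x) (σ x) (θ x) :=
    ⟨contDiffOn_change (fun a => (hθ.smooth a).mono hWV) contDiffOn_const
      ((q0s.mono hW1).neg.div hσs hσ0) (q2s.mono hW1).neg hσs hΔ0,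
      fun x hx => (hθ.adapted x (hWV hx)).change (hΔ0 x hx)⟩
  refine ⟨W, hWV.trans hVU, hx₀W, _, .of_quartic hnew (hg W (hWV.trans hVU)) fun x hx =>
    ⟨ρ x * √(dsc x) ^ 2, mul_ne_zero hx.1.2 (pow_ne_zero 2 (hsq x hx).ne'), fun ξ₀ ξ₁ => ?_⟩⟩
  rw [asdQuartic_change g x (hθ.adapted x (hWV hx)).indep (hΔ0 x hx), (key x (hWV hx)).2 hx.1.2,
    hΔW x hx]
  have h2 : √(dsc x) = 2 * σ x - 1 := by simp only [σ]; ring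
  have h3 : 2 * σ x - 1 ≠ 0 := by rw [← h2]; exact (hsq x hx).ne'
  rw [h2, quadratic_factor (hσ0 x hx) (hσq x hx)]
  field_simp

end Existence

/-! ### Normalization of reduced coframes and maps to the models -/

section Normalize

variable {U : Opens E4} {g : BilinField} {K : EndoField} {θ : FormQuad}

theorem IsReducedCoframeOn.contDiffOn_J (h : IsReducedCoframeOn U g K θ) :
    ContDiffOn ℝ ∞ (J2 g θ) U ∧ ContDiffOn ℝ ∞ (J4 g θ) U := by
  have hn := h.isAdaptedOn.null
  exact ⟨(cG U g θ 1 0 2).contDiffOn_fn.congr fun x hx => by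
      rw [Sm.fn_apply _ ⟨x, hx⟩, hn.ev_cG]; rfl,
    (cG U g θ 0 1 3).contDiffOn_fn.congr fun x hx => by
      rw [Sm.fn_apply _ ⟨x, hx⟩, hn.ev_cG]; rfl⟩

/-- A diagonal change of a reduced coframe is reduced, and rescales `J₂` and `J₄`. -/
theorem IsReducedCoframeOn.changeDiag (h : IsReducedCoframeOn U g K θ) (hg : IsPKEOn U g K)
    {p v : E4 → ℝ} (hp : ContDiffOn ℝ ∞ p U) (hv : ContDiffOn ℝ ∞ v U)
    (hp0 : ∀ x ∈ U, p x ≠ 0) (hv0 : ∀ x ∈ U, v x ≠ 0) :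
    IsReducedCoframeOn U g K (fun x => changeCoframe (p x) 0 0 (v x) (θ x)) ∧
      ∀ x ∈ U, J2 g (fun x => changeCoframe (p x) 0 0 (v x) (θ x)) x = (v x)⁻¹ * J2 g θ x ∧
        J4 g (fun x => changeCoframe (p x) 0 0 (v x) (θ x)) x = (p x)⁻¹ * J4 g θ x := by
  have hi (x) (hx : x ∈ U) := (h.adapted x hx).indep
  have hΔ (x) (hx : x ∈ U) : p x * v x - 0 * 0 ≠ 0 := by
    simpa using ⟨hp0 x hx, hv0 x hx⟩
  have hd {f : E4 → ℝ} (hf : ContDiffOn ℝ ∞ f U) (x) (hx : x ∈ U) : DifferentiableAt ℝ f x :=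
    (hf.contDiffAt (U.isOpen.mem_nhds hx)).differentiableAt (by simp)
  refine ⟨.of_quartic ⟨contDiffOn_change h.smooth hp contDiffOn_const contDiffOn_const hv hΔ,
    fun x hx => (h.adapted x hx).change (hΔ x hx)⟩ hg fun x hx =>
      ⟨6 * psi2 g θ x, mul_ne_zero (by norm_num) (h.psi2_ne x hx), fun ξ₀ ξ₁ => ?_⟩,
    fun x hx => J_change_diag h.smooth hi hx (hd hp x hx) (hd hv x hx) (hp0 x hx) (hv0 x hx)
      (Filter.Eventually.of_forall fun _ => rfl)⟩
  rw [asdQuartic_change g x (hi x hx) (hΔ x hx), h.quartic_eq hg hx]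
  have h1 := hp0 x hx
  have h2 := hv0 x hx
  simp only [mul_zero, sub_zero, zero_mul, add_zero, zero_add]
  field_simp

/-- `Y` maps `V` to `D` and pulls the coframe `θ₀` back to the coframe `θ`. -/
structure PullsBack (V : Opens E4) (D : Set E4) (θ₀ θ : FormQuad) (Y : E4 → E4) : Prop where
  smooth : ContDiffOn ℝ ∞ Y V
  maps : ∀ z ∈ V, Y z ∈ D
  pull : ∀ z ∈ V, ∀ a w, θ₀ (Y z) a (fderiv ℝ Y z w) = θ z a w

/-- The map with components `F i`. -/
def mapOf (F : Fin 4 → Sm U) (z : E4) : E4 := WithLp.toLp 2 fun i => (F i).fn z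

theorem IsNullCoframeOn.pullsBack (h : IsNullCoframeOn U g θ) (F : Fin 4 → Sm U) {D : Set E4}
    {θ₀ θ' : FormQuad} (hD : ∀ z ∈ U, mapOf F z ∈ D)
    (hE : ∀ (z : U) a c, ∑ i, θ₀ (mapOf F z) a (bvec i) * Sm.ev z (dF U θ c (F i))
      = θ' z a (dualVec (θ z) c)) : PullsBack U D θ₀ θ' (mapOf F) := by
  have hs : ContDiffOn ℝ ∞ (mapOf F) U := contDiffOn_euclidean.2 fun i => (F i).contDiffOn_fn
  refine ⟨hs, hD, fun z hz a w => ?_⟩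
  have hd := (hs.contDiffAt (U.isOpen.mem_nhds hz)).differentiableAt (by simp)
  have hi (i : Fin 4) (w : E4) : fderiv ℝ (mapOf F) z w i = fderiv ℝ (F i).fn z w := by
    have := ((EuclideanSpace.proj i : E4 →L[ℝ] ℝ).hasFDerivAt.comp z hd.hasFDerivAt).fderiv
    exact (congrArg (fun L => L w) this).symm
  conv_rhs => rw [← sum_smul_dualVec (h.indep z hz) w]
  conv_lhs => rw [← sum_smul_dualVec (h.indep z hz) w]
  simp only [map_sum, map_smul, smul_eq_mul]
  refine Finset.sum_congr rfl fun c _ => congrArg _ ?_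
  rw [← hE ⟨z, hz⟩ a c, apply_eq_sum]
  exact Finset.sum_congr rfl fun i _ => by rw [hi, ev_dF h.smooth h.indep]

end Normalize

/-! ### The normal form of the first branch -/

section First

variable {R : Type*} [CommRing R] [Algebra ℝ R] {d : Fin 4 → Derivation ℝ R R}
  {γ δ : Fin 4 → R} {ψ s j₁ j₃ g e : R}

/-- First integrals of the structure equations of the first branch. Along every solution, `j₁ u⁻³` is a
cubic polynomial in `x / u`, where `u = 1 / y`; its lower coefficients are the first integrals, and `x`
is the choice for which the quadratic term is absent. -/
theorem GenericFrame.first_integrals (h : GenericFrame d γ δ ψ s j₁ j₃ g e) {x y : R}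
    (hs : IsUnit s) (hx : -(6 * s * x) = 2 * g + 2 * j₁ + 2 * j₃ - ψ - 2 * s)
    (hy : ∀ i, d i y = -(y * ![-j₁, j₃, 1, 1] i)) :
    (∀ i, d i x = ![j₁ - x * j₁, x * j₃, x - 1, x] i) ∧
      (∀ i, d i (-(y ^ 2 * (3 * s * x ^ 2 + g + 2 * j₁))) = 0) ∧
      ∀ i, d i (y ^ 3 * (j₁ - 2 * s * x ^ 3 - g * x - 2 * j₁ * x)) = 0 := by
  have d2 := fun i => der_two (d i)
  have d3 : ∀ i, d i 3 = 0 := fun i => by simpa using (d i).map_natCast 3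
  have d6 : ∀ i, d i 6 = 0 := fun i => by simpa using (d i).map_natCast 6
  have he : e = ψ - s - g := by linear_combination h.add_eq
  have hdx (i) : d i x = ![j₁ - x * j₁, x * j₃, x - 1, x] i := by
    have h1 : 6 * s * d i x = -(2 * d i g + 2 * d i j₁ + 2 * d i j₃ - d i ψ) := by
      have := congrArg (d i) hx
      simp [h.der_s, d2, d6] at this
      linear_combination -this
    refine sub_eq_zero.1 (eq_zero_of_natCast_mul 6 hs ?_)
    push_cast
    rw [mul_sub, h1, h.der_g, h.der_one, h.der_three, h.der_psi]
    fin_cases i <;> simp [he]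
    · linear_combination -(j₁ * hx)
    · linear_combination j₃ * hx
    · linear_combination hx
    · linear_combination hx
  refine ⟨hdx, fun i => ?_, fun i => ?_⟩
  · simp only [map_neg, map_add, Derivation.leibniz, Derivation.leibniz_pow, hy, hdx, h.der_s, h.der_g, h.der_one, d2, d3]
    fin_cases i <;> simp [he]
    · linear_combination y ^ 2 * j₁ * hx
    · ring
    · linear_combination -(y ^ 2 * hx)
    · ring
  · simp only [map_sub, Derivation.leibniz, Derivation.leibniz_pow, hy, hdx, h.der_s, h.der_g, h.der_one, d2]
    fin_cases i <;> simp [he]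
    · linear_combination y ^ 3 * x * j₁ * hx
    · ring
    · linear_combination -(y ^ 3 * x * hx)
    · ring

theorem Sm.exists_cube_root {U : Opens E4} {f : Sm U} (hf : ∀ x, Sm.ev x f ≠ 0) :
    ∃ u : Sm U, u ^ 3 = f := by
  have hs : ContDiffOn ℝ ∞ (fun z => f.fn z * (f.fn z ^ 2) ^ (-(1 / 3) : ℝ)) U :=
    f.contDiffOn_fn.mul ((f.contDiffOn_fn.pow 2).rpow_const_of_ne fun x hx => by
      rw [Sm.fn_apply f ⟨x, hx⟩]; exact pow_ne_zero 2 (hf _))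
  refine ⟨Sm.of U fun z => f.fn z * (f.fn z ^ 2) ^ (-(1 / 3) : ℝ), Sm.ext fun x => ?_⟩
  rw [map_pow, Sm.ev_of hs, Sm.fn_apply]
  have h0 : 0 ≤ Sm.ev x f ^ 2 := sq_nonneg _
  have h1 := hf x
  rw [mul_pow, ← Real.rpow_natCast (_ ^ (-(1 / 3) : ℝ)) 3, ← Real.rpow_mul h0]
  norm_num
  rw [Real.rpow_neg_one]
  field_simp

/-- A function `u` with `u³ = f`, and its inverse, when `df = 3 f φ`. It is applied to `f = Ψ₂`. -/
theorem exists_cube_root_der {U : Opens E4} {d : Fin 4 → Derivation ℝ (Sm U) (Sm U)} {f : Sm U}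
    (hf : ∀ x, Sm.ev x f ≠ 0) {φ : Fin 4 → Sm U} (hd : ∀ i, d i f = 3 * f * φ i) :
    ∃ u y : Sm U, u ^ 3 = f ∧ u * y = 1 ∧ (∀ i, d i u = u * φ i) ∧ ∀ i, d i y = -(y * φ i) := by
  obtain ⟨u, rfl⟩ := Sm.exists_cube_root hf
  have hu : IsUnit u := Sm.isUnit_of_ne_zero fun x h0 => hf x (by rw [map_pow, h0]; norm_num)
  obtain ⟨y, hy⟩ := hu.exists_right_inv
  have hdu (i) : d i u = u * φ i := by
    refine sub_eq_zero.1 (eq_zero_of_natCast_mul 3 (hu.pow 2) ?_)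
    have := hd i
    simp only [pow_succ, pow_zero, one_mul, Derivation.leibniz, smul_eq_mul] at this
    push_cast
    linear_combination this
  refine ⟨u, y, rfl, hy, hdu, fun i => ?_⟩
  have h0 : d i (u * y) = 0 := by rw [hy, Derivation.map_one_eq_zero]
  rw [Derivation.leibniz, hdu, smul_eq_mul, smul_eq_mul] at h0
  linear_combination y * h0 - (d i y + y * φ i) * hy

/-- A reduced coframe with `J₂ = J₄ = 1` is the coframe of the first family, in suitable
coordinates. -/
theorem exists_pullsBack_generic {U : Opens E4} {g : BilinField} {K : EndoField} {θ : FormQuad}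
    (h : IsReducedCoframeOn U g K θ) (hg : IsPKEOn U g K) (hS : ∀ x ∈ U, scalarCurv g x ≠ 0)
    (hU : Convex ℝ (U : Set E4)) (h2 : ∀ x ∈ U, J2 g θ x = 1) (h4 : ∀ x ∈ U, J4 g θ x = 1)
    {p : E4} (hp : p ∈ U) : ∃ k₁ k₂ k₃ k₄ s : ℝ, k₄ ≠ 0 ∧ s ≠ 0 ∧
      ∃ Y, PullsBack U domainNe (genericCoframe k₁ k₂ k₃ k₄ s) θ Y := by
  have hn := h.isAdaptedOn.null
  have hT := h.typeDFrame hg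
  have hs := h.isUnit_scalSm hg hS
  obtain ⟨j₃, hα⟩ : ∃ j₃, cG U g θ 0 1 = ![-j₃, 0, 0, 1] := by
    refine ⟨-cG U g θ 0 1 0, funext fun b => ?_⟩
    fin_cases b
    · simp
    · exact hT.alpha_one
    · exact hT.alpha_two
    · exact Sm.ext fun x => (hn.ev_cG x 0 1 3).trans ((h4 x x.2).trans (map_one _).symm)
  obtain ⟨j₁, hβ⟩ : ∃ j₁, cG U g θ 1 0 = ![0, j₁, 1, 0] := by
    refine ⟨cG U g θ 1 0 1, funext fun b => ?_⟩
    fin_cases b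
    · exact hT.beta_zero
    · simp
    · exact Sm.ext fun x => (hn.ev_cG x 1 0 2).trans ((h2 x x.2).trans (map_one _).symm)
    · exact hT.beta_three
  have hc := h.isAdaptedOn.cG_eq hg
  obtain ⟨s, hs'⟩ := hn.exists_eq_algebraMap hU hT.der_scal
  rw [hα, hβ] at hT hc
  generalize cG U g θ 0 0 = γ at hT hc
  generalize cG U g θ 1 1 = δ at hT hc
  rw [hs'] at hT hs
  have hs0 : s ≠ 0 := by
    rintro rfl
    rw [map_zero] at hs
    exact (hs.map (Sm.ev ⟨p, hp⟩)).ne_zero (map_zero _)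
  have hF := hT.genericFrame hs
  obtain ⟨u, y, hu3, huy, hu, hy⟩ := exists_cube_root_der (f := psiSm U g θ) (fun x => by
    rw [h.isAdaptedOn.ev_psiSm hg]; exact h.psi2_ne x x.2) hF.der_psi
  set a := algebraMap ℝ (Sm U)
  set g₁ := γ 0
  set e := δ 1
  set ψ := psiSm U g θ
  obtain ⟨x, hx⟩ : ∃ x, -(6 * a s * x) = 2 * g₁ + 2 * j₁ + 2 * j₃ - ψ - 2 * a s := by
    refine ⟨a (-(6 * s)⁻¹) * (2 * g₁ + 2 * j₁ + 2 * j₃ - ψ - 2 * a s), ?_⟩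
    have : 6 * a s * a (-(6 * s)⁻¹) = -1 := by
      rw [← map_ofNat a 6, ← map_mul, ← map_mul, mul_neg, mul_inv_cancel₀ (by simpa), map_neg, map_one]
    linear_combination -(2 * g₁ + 2 * j₁ + 2 * j₃ - ψ - 2 * a s) * this
  obtain ⟨hdx, hk, hk'⟩ := hF.first_integrals hs hx hy
  obtain ⟨k₂, hk₂⟩ := hn.exists_eq_algebraMap hU hk
  obtain ⟨k₃, hk₃⟩ := hn.exists_eq_algebraMap hU hk'
  obtain ⟨Y₁, hY₁⟩ := hn.exists_potential hU (p := ![u ^ 2, u ^ 2, 0, 0]) (by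
    rw [hc]; exact hF.closed_first hu)
  obtain ⟨Y₂, hY₂⟩ := hn.exists_potential hU (p := ![-(x * u), (1 - x) * u, 0, 0]) (by
    rw [hc]; exact hF.closed_second hu hdx)
  have hq : 3 * a s * x ^ 2 + g₁ + 2 * j₁ = -(a k₂ * u ^ 2) := by
    linear_combination u ^ 2 * (-hk₂) - (3 * a s * x ^ 2 + g₁ + 2 * j₁) * (u * y + 1) * huy
  have hr : j₁ - 2 * a s * x ^ 3 - g₁ * x - 2 * j₁ * x = a k₃ * u ^ 3 := by
    linear_combination u ^ 3 * hk₃ - (j₁ - 2 * a s * x ^ 3 - g₁ * x - 2 * j₁ * x) *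
      ((u * y) ^ 2 + u * y + 1) * huy
  have h1 : j₁ = -a s * x ^ 3 - a k₂ * x * u ^ 2 + a k₃ * u ^ 3 := by
    linear_combination hr + x * hq
  have h3 : 2 * j₃ = -2 * (a s * (x - 1) ^ 3 + a k₂ * (x - 1) * u ^ 2
      + (-a k₃ - a (1 / 2)) * u ^ 3) := by
    have : 2 * a (1 / 2) = 1 := by rw [← map_ofNat a 2, ← map_mul]; norm_num
    linear_combination -hx - 2 * hq + 2 * h1 - hu3 - u ^ 3 * this
  -- `k₁ = 0` by the choice of `x`, and `k₄ = 1` since `u³ = Ψ₂`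
  refine ⟨0, k₂, -k₃ - 1 / 2, 1, s, one_ne_zero, hs0, mapOf ![Y₁, Y₂, x, y], hn.pullsBack _
    (fun z hz h0 => ?_) fun z b c => ?_⟩
  · have e1 := congrArg (Sm.ev ⟨z, hz⟩) huy
    have e2 : (mapOf ![Y₁, Y₂, x, y] z) 3 = Sm.ev ⟨z, hz⟩ y := Sm.fn_apply y ⟨z, hz⟩
    rw [e2] at h0
    rw [map_mul, h0, map_one, mul_zero] at e1
    exact zero_ne_one e1
  · have e0 : Sm.ev z u * Sm.ev z y = 1 := by rw [← map_mul, huy, map_one]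
    have ex : (mapOf ![Y₁, Y₂, x, y] z) 2 = Sm.ev z x := Sm.fn_apply x z
    have ey : (mapOf ![Y₁, Y₂, x, y] z) 3 = Sm.ev z y := Sm.fn_apply y z
    rw [apply_dualVec (hn.indep z z.2), ← generic_dual 0 k₂ (-k₃ - 1 / 2) 1 s
      (z := mapOf ![Y₁, Y₂, x, y] z) (x := Sm.ev z x) (u := Sm.ev z u)
      (j₁ := Sm.ev z j₁) (j₃ := Sm.ev z j₃) (by rw [ey]; exact right_ne_zero_of_mul_eq_one e0) ex.symm
      (by rw [ey]; exact eq_inv_of_mul_eq_one_left e0) ?_ ?_ b c]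
    · refine Finset.sum_congr rfl fun i _ => congrArg _ ?_
      fin_cases i <;> fin_cases c <;> simp [hY₁, hY₂, hdx, hy, ey]
    · have := congrArg (Sm.ev z) h1
      simp [a] at this
      rw [this]; ring
    · have := congrArg (Sm.ev z) h3
      simp [a, map_ofNat] at this
      linear_combination this / 2

end First

/-! ### Restriction to smaller open sets -/

section Restriction

variable {U V : Opens E4} {g : BilinField} {θ : FormQuad}

/-- Restriction of smooth functions. -/
def Sm.restr (h : V ≤ U) : Sm U →ₐ[ℝ] Sm V where
  toFun f := Sm.of V f.fn
  map_one' := Sm.ext fun x => by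
    rw [Sm.ev_of ((1 : Sm U).contDiffOn_fn.mono h), Sm.fn_apply _ ⟨x, h x.2⟩, map_one, map_one]
  map_zero' := Sm.ext fun x => by
    rw [Sm.ev_of ((0 : Sm U).contDiffOn_fn.mono h), Sm.fn_apply _ ⟨x, h x.2⟩, map_zero, map_zero]
  map_add' f k := Sm.ext fun x => by
    rw [map_add]
    simp only [Sm.ev_of (Sm.contDiffOn_fn _ |>.mono h), Sm.fn_apply _ ⟨x, h x.2⟩, map_add]
  map_mul' f k := Sm.ext fun x => by
    rw [map_mul]
    simp only [Sm.ev_of (Sm.contDiffOn_fn _ |>.mono h), Sm.fn_apply _ ⟨x, h x.2⟩, map_mul]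
  commutes' c := Sm.ext fun x => by
    rw [Sm.ev_of (Sm.contDiffOn_fn _ |>.mono h), Sm.fn_apply _ ⟨x, h x.2⟩, ev_algebraMap,
      ev_algebraMap]

theorem Sm.ev_restr (h : V ≤ U) (f : Sm U) (x : V) : Sm.ev x (Sm.restr h f) = Sm.ev ⟨x, h x.2⟩ f :=
  (Sm.ev_of (f.contDiffOn_fn.mono h) x).trans (Sm.fn_apply f ⟨x, h x.2⟩)

theorem IsNullCoframeOn.mono (hn : IsNullCoframeOn U g θ) (h : V ≤ U) : IsNullCoframeOn V g θ :=
  ⟨fun a => (hn.smooth a).mono h, fun x hx => hn.indep x (h hx), fun x hx => hn.metric x (h hx)⟩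

theorem IsNullCoframeOn.dF_restr (hn : IsNullCoframeOn U g θ) (h : V ≤ U) (a : Fin 4) (f : Sm U) :
    dF V θ a (Sm.restr h f) = Sm.restr h (dF U θ a f) := by
  refine Sm.ext fun x => ?_
  have hn' := hn.mono h
  rw [ev_dF_eq hn'.smooth hn'.indep (F := f.fn) (fun z => (Sm.ev_restr h f z).trans
    (Sm.fn_apply f ⟨z, h z.2⟩).symm), Sm.ev_restr, ev_dF hn.smooth hn.indep]

theorem IsNullCoframeOn.cG_restr (hn : IsNullCoframeOn U g θ) (h : V ≤ U) (a b c : Fin 4) :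
    cG V g θ a b c = Sm.restr h (cG U g θ a b c) := by
  refine Sm.ext fun x => ?_
  rw [(hn.mono h).ev_cG, Sm.ev_restr, hn.ev_cG]

end Restriction

/-! ### Null planes of constant curvature -/

section Planes

/-- The components of the exterior derivative of the 1-form with components `η`, in a frame with
connection `G`. -/
def dForm {R : Type*} [CommRing R] [Algebra ℝ R] (d : Fin 4 → Derivation ℝ R R)
    (G : Fin 4 → Fin 4 → Fin 4 → R) (η : Fin 4 → R) (b c : Fin 4) : R :=
  d b (η c) - d c (η b) - ∑ a, (G a c b - G a b c) * η a

variable {U : Opens E4} {g : BilinField} {θ : FormQuad}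

/-- A pair of 1-forms `q`, `r` with `dq = - P ∧ q`, `dr = P ∧ r` and `dP = 2 k q ∧ r`: there are
functions `τ`, `σ`, `w` with `σ q = d(τ σ) + k (τ σ)² dw` and `r = σ dw`. They are
found as `τ = t / v` and `σ = v²`, where `(t, v)` is a parallel section of a flat bundle of rank two. -/
theorem IsNullCoframeOn.exists_plane (h : IsNullCoframeOn U g θ) {p : E4} (hp : p ∈ U) {k : Sm U}
    (hk : ∀ i, dF U θ i k = 0) {P q r : Fin 4 → Sm U}
    (hq : ∀ b c, dForm (dF U θ) (cG U g θ) q b c = -(P b * q c - P c * q b))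
    (hr : ∀ b c, dForm (dF U θ) (cG U g θ) r b c = P b * r c - P c * r b)
    (hP : ∀ b c, dForm (dF U θ) (cG U g θ) P b c = 2 * k * (q b * r c - q c * r b)) :
    ∃ V : Opens E4, ∃ hV : V ≤ U, ∃ hpV : p ∈ V, Convex ℝ (V : Set E4) ∧ ∃ τ σ w : Sm V,
      (∀ x, Sm.ev x σ ≠ 0) ∧ Sm.ev ⟨p, hpV⟩ τ = 0 ∧ Sm.ev ⟨p, hpV⟩ w = 0 ∧
      (∀ c, dF V θ c τ = Sm.restr hV (q c) - Sm.restr hV (P c) * τ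
        + Sm.restr hV k * τ ^ 2 * Sm.restr hV (r c)) ∧
      (∀ c, dF V θ c σ = σ * (Sm.restr hV (P c) - 2 * Sm.restr hV k * τ * Sm.restr hV (r c))) ∧
      ∀ c, σ * dF V θ c w = Sm.restr hV (r c) := by
  let κ : Sm U := algebraMap ℝ _ (1 / 2)
  have hκ : 2 * κ = 1 := by rw [← map_ofNat (algebraMap ℝ (Sm U)) 2, ← map_mul]; norm_num
  have hκd (i) : dF U θ i κ = 0 := der_algebraMap i _
  let B : Fin 4 → Matrix (Fin 2) (Fin 2) (Sm U) := fun c => !![-(κ * P c), q c; -(k * r c), κ * P c]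
  obtain ⟨ε, hε, hεU, X, hXs, hXp, hX⟩ := h.exists_flat_solution hp (B := B) (fun b c => by
    have e1 := hq b c
    have e2 := hr b c
    have e3 := hP b c
    simp only [dForm, Fin.sum_univ_four] at e1 e2 e3
    ext i j
    fin_cases i <;> fin_cases j <;>
      simp [B, Fin.sum_univ_four, hκd, hk]
    · linear_combination -κ * e3 - k * (q b * r c - q c * r b) * hκ
    · linear_combination e1 + (P b * q c - P c * q b) * hκ
    · linear_combination -k * e2 + k * (P b * r c - P c * r b) * hκ
    · linear_combination κ * e3 + k * (q b * r c - q c * r b) * hκ) ![0, 1]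
  have hc : ContinuousAt (fun z => X z 1) p :=
    ((continuous_apply 1).continuousAt.comp
      (hXs.contDiffAt (Metric.ball_mem_nhds p hε)).continuousAt)
  have hne : ∀ᶠ z in nhds p, X z 1 ≠ 0 := hc.eventually_ne (by simp [hXp])
  obtain ⟨ε', hε', hε'X⟩ := Metric.mem_nhds_iff.1
    (Filter.inter_mem hne (Metric.ball_mem_nhds p hε))
  let V : Opens E4 := ⟨Metric.ball p ε', Metric.isOpen_ball⟩
  have hVb : (V : Set E4) ⊆ Metric.ball p ε := fun z hz => (hε'X hz).2
  have hV : V ≤ U := fun z hz => hεU (hVb hz)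
  have hpV : p ∈ V := Metric.mem_ball_self hε'
  have hn := h.mono hV
  have hconv : Convex ℝ (V : Set E4) := convex_ball p ε'
  have hXi (i) : ContDiffOn ℝ ∞ (fun z => X z i) V := fun z hz =>
    (contDiffWithinAt_pi.1 ((hXs.mono hVb) z hz)) i
  have hev (i) (x : V) : Sm.ev x (Sm.of V fun z => X z i) = X x i := Sm.ev_of (hXi i) x
  have hd (i c) (x : V) : Sm.ev x (dF V θ c (Sm.of V fun z => X z i))
      = ((B c).map (Sm.ev ⟨x, hV x.2⟩)).mulVec (X x) i := by
    rw [ev_dF_eq hn.smooth hn.indep (F := fun z => X z i) (hev i), ← hX x (hVb x.2) c]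
    have hXd : DifferentiableAt ℝ X x :=
      (hXs.contDiffAt (Metric.isOpen_ball.mem_nhds (hVb x.2))).differentiableAt (by simp)
    rw [fderiv_apply hXd]
    rfl
  have hκx (x : U) : Sm.ev x κ = 1 / 2 := ev_algebraMap _ x
  set t := Sm.of V fun z => X z 0
  set v := Sm.of V fun z => X z 1
  have hv0 (x) : Sm.ev x v ≠ 0 := by rw [hev]; exact (hε'X x.2).1
  have hdt (c) : 2 * dF V θ c t = -Sm.restr hV (P c) * t + 2 * Sm.restr hV (q c) * v := by
    refine Sm.ext fun x => ?_
    have e := hd 0 c x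
    simp [B, Matrix.mulVec, dotProduct, hκx, ← hev] at e
    simp only [map_mul, map_add, map_neg, map_ofNat, Sm.ev_restr]
    linear_combination 2 * e
  have hdv (c) : 2 * dF V θ c v = -2 * Sm.restr hV k * Sm.restr hV (r c) * t
      + Sm.restr hV (P c) * v := by
    refine Sm.ext fun x => ?_
    have e := hd 1 c x
    simp [B, Matrix.mulVec, dotProduct, hκx, ← hev] at e
    simp only [map_mul, map_add, map_neg, map_ofNat, Sm.ev_restr]
    linear_combination 2 * e
  obtain ⟨m, hm⟩ := (Sm.isUnit_of_ne_zero hv0).exists_right_inv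
  have hdm (c) : 2 * dF V θ c m = m ^ 2 * (2 * Sm.restr hV k * Sm.restr hV (r c) * t
      - Sm.restr hV (P c) * v) := by
    have h0 : dF V θ c (v * m) = 0 := by rw [hm, Derivation.map_one_eq_zero]
    rw [Derivation.leibniz, smul_eq_mul, smul_eq_mul] at h0
    linear_combination 2 * m * h0 - 2 * dF V θ c m * hm - m ^ 2 * hdv c
  obtain ⟨w, hw⟩ := hn.exists_potential hconv (p := fun c => m ^ 2 * Sm.restr hV (r c))
    fun b c => by
      have e2 := congrArg (Sm.restr hV) (hr b c)
      simp only [dForm, map_sub, map_sum, map_mul, ← h.cG_restr hV,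
        ← h.dF_restr hV] at e2
      simp only [Derivation.leibniz, Derivation.leibniz_pow, smul_eq_mul, nsmul_eq_mul]
      have hb := hdm b
      have hc := hdm c
      rw [← sub_eq_zero]
      have e3 : ∑ a, (cG V g θ a c b - cG V g θ a b c) * (m ^ 2 * Sm.restr hV (r a))
          = m ^ 2 * ∑ a, (cG V g θ a c b - cG V g θ a b c) * Sm.restr hV (r a) := by
        rw [Finset.mul_sum]
        exact Finset.sum_congr rfl fun a _ => by ring
      rw [e3]
      simp
      linear_combination m ^ 2 * e2 + m * Sm.restr hV (r c) * hb - m * Sm.restr hV (r b) * hc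
        - m ^ 2 * (Sm.restr hV (P b) * Sm.restr hV (r c) - Sm.restr hV (P c) * Sm.restr hV (r b)) * hm
  refine ⟨V, hV, hpV, hconv, t * m, v ^ 2, w - algebraMap ℝ _ (Sm.ev ⟨p, hpV⟩ w), fun x => ?_, ?_,
    ?_, fun c => ?_, fun c => ?_, fun c => ?_⟩
  · rw [map_pow]; exact pow_ne_zero 2 (hv0 x)
  · rw [map_mul, hev]; simp [hXp]
  · rw [map_sub, ev_algebraMap, sub_self]
  · refine sub_eq_zero.1 (eq_zero_of_natCast_mul 2 isUnit_one ?_)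
    rw [Derivation.leibniz, smul_eq_mul, smul_eq_mul]
    push_cast
    linear_combination t * hdm c + m * hdt c + (2 * Sm.restr hV (q c)
      - Sm.restr hV (P c) * t * m) * hm
  · refine sub_eq_zero.1 (eq_zero_of_natCast_mul 2 isUnit_one ?_)
    simp only [Derivation.leibniz_pow, smul_eq_mul, nsmul_eq_mul]
    push_cast
    linear_combination 2 * v * hdv c + 4 * Sm.restr hV k * Sm.restr hV (r c) * t * v * hm
  · rw [map_sub, der_algebraMap, sub_zero, hw]
    linear_combination Sm.restr hV (r c) * (v * m + 1) * hm

end Planes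

/-! ### The structure equations of the second and of the fourth branch -/

namespace TypeDFrame

variable {R : Type*} [CommRing R] [Algebra ℝ R] {d : Fin 4 → Derivation ℝ R R}
  {γ α β δ : Fin 4 → R} {ψ s j₁ j₃ : R}

/-- The 1-form `d log |Ψ₂| / 3` is closed. -/
theorem closed_phi (h : TypeDFrame d γ α β δ ψ s) :
    IsClosedFrame d (glConn γ α β δ) ![-β 1, -α 0, α 3, β 2] := by
  intro b c
  have h1 := h.comm b c ψ
  have d3 (i) : d i 3 = 0 := by simpa using (d i).map_natCast 3
  simp only [h.der_psi, Derivation.leibniz, smul_eq_mul, d3] at h1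
  rw [← sub_eq_zero]
  refine eq_zero_of_natCast_mul 3 h.unit ?_
  have h2 : ∑ a, (glConn γ α β δ a c b - glConn γ α β δ a b c) *
      (3 * ψ * ![-β 1, -α 0, α 3, β 2] a) = 3 * ψ * ∑ a, (glConn γ α β δ a c b
        - glConn γ α β δ a b c) * ![-β 1, -α 0, α 3, β 2] a := by
    rw [Finset.mul_sum]
    exact Finset.sum_congr rfl fun a _ => by ring
  rw [h2] at h1
  push_cast
  linear_combination h1

/-- If `J₂ = 1` and `J₄ = 0`, the integrability condition of the equations for `dJ₃` is
`s J₁ (2 J₃ - Ψ₂ - 2 s) = 0`, and its derivative makes `J₁` nilpotent. -/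
theorem special_sq (h : TypeDFrame d γ ![-j₃, 0, 0, 0] ![0, j₁, 1, 0] δ ψ s) (hs : IsUnit s) :
    j₁ ^ 2 = 0 := by
  have a01 := h.curv 0 1 0 1
  have a02 := h.curv 0 1 0 2
  have a03 := h.curv 0 1 0 3
  have b01 := h.curv 1 0 0 1
  have b02 := h.curv 1 0 0 2
  have b12 := h.curv 1 0 1 2
  have b13 := h.curv 1 0 1 3
  have b23 := h.curv 1 0 2 3
  have p01 := h.closed_phi 0 1
  have p02 := h.closed_phi 0 2
  have p12 := h.closed_phi 1 2
  have p13 := h.closed_phi 1 3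
  have p23 := h.closed_phi 2 3
  have c01 := h.curv 1 1 0 1
  simp [curvTable, glBlock, skewBlock, Fin.sum_univ_four, glConn, frameCurv] at a01 a02 a03 b01 b02 b12 b13 b23 p01 p02 p12 p13 p23 c01
  have hδ0 : δ 0 = -j₁ := by linear_combination b02
  have hδ3 : δ 3 = 1 := by linear_combination -b23
  have hδ1 : δ 1 = ψ - s := by linear_combination p13 + a03
  have q0 : d 0 ψ = 3 * ψ * -j₁ := h.der_psi 0
  have q1 : d 1 ψ = 3 * ψ * j₃ := by rw [h.der_psi 1]; simp
  have hsd := h.der_scal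
  rw [hδ1, hδ0] at c01
  simp [q0, hsd] at c01
  rw [hδ0] at b01 p01
  rw [hδ1] at a01
  have e11 : d 1 j₁ = j₁ * γ 1 + j₁ * (ψ + 2 * s) := by linear_combination c01
  have e03 : d 0 j₃ = -j₁ * (ψ + 2 * s + j₃) := by linear_combination p01 - e11
  have e13 : d 1 j₃ = j₃ * (ψ - s) + j₃ ^ 2 := by linear_combination a01
  have e01 : d 0 j₁ = j₁ * γ 0 - j₁ ^ 2 := by linear_combination b01
  have k := h.comm 0 1 j₃
  have d2 := fun i => der_two (d i)
  rw [e03, e13] at k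
  simp [e03, e13, e11, q0, q1, hsd, d2, pow_two, Fin.sum_univ_four, glConn, glBlock, hδ0] at k
  have k1 : j₁ * (2 * j₃ - ψ - 2 * s) = 0 := by
    refine eq_zero_of_natCast_mul 3 hs ?_
    push_cast
    linear_combination -k
  have k2 := congrArg (d 0) k1
  simp [e03, e01, q0, hsd, d2] at k2
  refine eq_zero_of_natCast_mul 6 hs ?_
  push_cast
  linear_combination -k2 + (γ 0 - 2 * j₁) * k1

/-- The structure equations of the second branch, in a gauge with `J₂ = 1`. -/
theorem special_eqs (h : TypeDFrame d γ ![-j₃, 0, 0, 0] ![0, 0, 1, 0] δ ψ s) :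
    δ = ![0, ψ - s, 0, 1] ∧ (∀ i, d i j₃ = ![0, j₃ * (ψ - s) + j₃ ^ 2, 0, ψ - s + j₃] i) := by
  have a01 := h.curv 0 1 0 1
  have a02 := h.curv 0 1 0 2
  have a03 := h.curv 0 1 0 3
  have b02 := h.curv 1 0 0 2
  have b23 := h.curv 1 0 2 3
  have p01 := h.closed_phi 0 1
  have p13 := h.closed_phi 1 3
  have p23 := h.closed_phi 2 3
  simp [curvTable, glBlock, skewBlock, Fin.sum_univ_four, glConn, frameCurv]
    at a01 a02 a03 b02 b23 p01 p13 p23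
  have hδ0 : δ 0 = 0 := by linear_combination b02
  have hδ3 : δ 3 = 1 := by linear_combination -b23
  have hδ1 : δ 1 = ψ - s := by linear_combination p13 + a03
  rw [hδ3] at a03
  rw [hδ1] at a01
  refine ⟨funext fun i => by fin_cases i <;> assumption, fun i => ?_⟩
  fin_cases i <;> simp
  · linear_combination p01 + j₃ * hδ0
  · linear_combination a01
  · linear_combination a02 + j₃ * p23
  · linear_combination a03

/-- The structure equations of the fourth branch. -/
theorem homogeneous_eqs (h : TypeDFrame d γ ![-j₃, 0, 0, 0] ![0, j₁, 0, 0] δ ψ s) :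
    ψ = s ∧ j₁ = 0 ∧ j₃ = 0 := by
  have a03 := h.curv 0 1 0 3
  have p13 := h.closed_phi 1 3
  simp [curvTable, glBlock, skewBlock, Fin.sum_univ_four, glConn, frameCurv] at a03 p13
  have hψ : ψ = s := by linear_combination -a03 + p13
  have q0 : d 0 ψ = 3 * ψ * -j₁ := h.der_psi 0
  have q1 : d 1 ψ = 3 * ψ * j₃ := by rw [h.der_psi 1]; simp
  rw [hψ, h.der_scal, ← hψ] at q0 q1
  refine ⟨hψ, eq_zero_of_natCast_mul 3 h.unit ?_, eq_zero_of_natCast_mul 3 h.unit ?_⟩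
  · push_cast; linear_combination q0
  · push_cast; linear_combination -q1

end TypeDFrame

section Second

variable {R : Type*} [CommRing R] [Algebra ℝ R] {d : Fin 4 → Derivation ℝ R R}
  {γ : Fin 4 → R} {ψ s j₃ k y : R}

/-- In the second branch, `γ + J₃ θ²`, `θ¹` and `y θ³` satisfy the structure equations of a null
plane of constant curvature. -/
theorem TypeDFrame.special_plane (h : TypeDFrame d γ ![-j₃, 0, 0, 0] ![0, 0, 1, 0]
      ![0, ψ - s, 0, 1] ψ s) (hj : ∀ i, d i j₃ = ![0, j₃ * (ψ - s) + j₃ ^ 2, 0, ψ - s + j₃] i)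
    (hy : ∀ i, d i y = y * ![0, j₃, 0, 1] i) (hk : 2 * k * y = 2 * j₃ - ψ - 2 * s) :
    (∀ b c, dForm d (glConn γ ![-j₃, 0, 0, 0] ![0, 0, 1, 0] ![0, ψ - s, 0, 1]) ![1, 0, 0, 0] b c
      = -((γ + ![0, j₃, 0, 0]) b * ![1, 0, 0, 0] c - (γ + ![0, j₃, 0, 0]) c * ![1, 0, 0, 0] b)) ∧
    (∀ b c, dForm d (glConn γ ![-j₃, 0, 0, 0] ![0, 0, 1, 0] ![0, ψ - s, 0, 1]) ![0, 0, y, 0] b c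
      = (γ + ![0, j₃, 0, 0]) b * ![0, 0, y, 0] c - (γ + ![0, j₃, 0, 0]) c * ![0, 0, y, 0] b) ∧
    ∀ b c, dForm d (glConn γ ![-j₃, 0, 0, 0] ![0, 0, 1, 0] ![0, ψ - s, 0, 1])
      (γ + ![0, j₃, 0, 0]) b c
      = 2 * k * (![1, 0, 0, 0] b * ![0, 0, y, 0] c - ![1, 0, 0, 0] c * ![0, 0, y, 0] b) := by
  refine ⟨fun b c => ?_, fun b c => ?_, fun b c => ?_⟩
  · fin_cases b <;> fin_cases c <;> simp [dForm, Fin.sum_univ_four, glConn, glBlock]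
  · fin_cases b <;> fin_cases c <;> simp [dForm, Fin.sum_univ_four, glConn, glBlock, hy] <;> ring
  · have e := h.curv 0 0 b c
    fin_cases b <;> fin_cases c <;>
      simp [curvTable, glBlock, skewBlock, Fin.sum_univ_four, glConn, frameCurv] at e <;>
      simp [dForm, Fin.sum_univ_four, glConn, glBlock, hj]
    all_goals first | linear_combination e | linear_combination e - hk | linear_combination e + hk

end Second

/-! ### The normal form of the second branch -/

section Normal

variable {U : Opens E4} {g : BilinField} {K : EndoField} {θ : FormQuad}

/-- The shape of `Γ¹₂` in a reduced coframe with `J₄ = 0`. -/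
theorem IsReducedCoframeOn.exists_alpha (h : IsReducedCoframeOn U g K θ) (hg : IsPKEOn U g K)
    (h4 : ∀ x ∈ U, J4 g θ x = 0) : ∃ j₃, cG U g θ 0 1 = ![-j₃, 0, 0, 0] := by
  have hT := h.typeDFrame hg
  refine ⟨-cG U g θ 0 1 0, funext fun b => ?_⟩
  fin_cases b
  · simp
  · exact hT.alpha_one
  · exact hT.alpha_two
  · exact Sm.ext fun x => (h.isAdaptedOn.null.ev_cG x 0 1 3).trans
      ((h4 x x.2).trans (map_zero _).symm)

/-- The shape of `Γ²₁` in a reduced coframe with constant `J₂`. -/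
theorem IsReducedCoframeOn.exists_beta (h : IsReducedCoframeOn U g K θ) (hg : IsPKEOn U g K) {c : ℝ}
    (h2 : ∀ x ∈ U, J2 g θ x = c) :
    ∃ j₁, cG U g θ 1 0 = ![0, j₁, algebraMap ℝ _ c, 0] := by
  have hT := h.typeDFrame hg
  refine ⟨cG U g θ 1 0 1, funext fun b => ?_⟩
  fin_cases b
  · exact hT.beta_zero
  · simp
  · exact Sm.ext fun x => (h.isAdaptedOn.null.ev_cG x 1 0 2).trans
      ((h2 x x.2).trans (ev_algebraMap _ _).symm)
  · exact hT.beta_three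

theorem Sm.eq_zero_of_sq {f : Sm U} (h : f ^ 2 = 0) : f = 0 :=
  Sm.ext fun x => by
    have := congrArg (Sm.ev x) h
    rw [map_pow, map_zero] at this
    rw [map_zero]
    exact pow_eq_zero_iff (two_ne_zero) |>.1 this

theorem change_diag_dual {η : Fin 4 → E4 →L[ℝ] ℝ} (hη : LinearIndependent ℝ η) {p v : ℝ}
    (hp : p ≠ 0) (hv : v ≠ 0) (a c : Fin 4) : changeCoframe p 0 0 v η a (dualVec η c)
      = ![p⁻¹, v⁻¹, p, v] c * if a = c then 1 else 0 := by
  have hd := apply_dualVec hη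
  fin_cases a <;> fin_cases c <;> simp [changeCoframe, hd] <;> field_simp

/-- A reduced coframe with `J₂ = 1` and `J₄ = 0` is, after a rescaling of `θ¹` and `θ³`, the coframe
of the second family in suitable coordinates. -/
theorem exists_pullsBack_special (h : IsReducedCoframeOn U g K θ) (hg : ∀ V ≤ U, IsPKEOn V g K)
    (hS : ∀ x ∈ U, scalarCurv g x ≠ 0) (hU : Convex ℝ (U : Set E4))
    (h2 : ∀ x ∈ U, J2 g θ x = 1) (h4 : ∀ x ∈ U, J4 g θ x = 0) {p : E4} (hp : p ∈ U) :
    ∃ k₁ k₂ s : ℝ, k₁ ≠ 0 ∧ s ≠ 0 ∧ ∃ V ≤ U, p ∈ V ∧ ∃ θ' : FormQuad,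
      (∀ z ∈ V, IsAdapted (g z) (K z) (θ' z)) ∧
      ∃ Y, PullsBack V domainNe (specialCoframe k₁ k₂ s) θ' Y := by
  have hgU := hg U le_rfl
  have hn := h.isAdaptedOn.null
  have hT := h.typeDFrame hgU
  have hs := h.isUnit_scalSm hgU hS
  obtain ⟨j₃, hα⟩ := h.exists_alpha hgU h4
  obtain ⟨j₁, hβ⟩ := h.exists_beta hgU h2
  have hc := h.isAdaptedOn.cG_eq hgU
  obtain ⟨s, hs'⟩ := hn.exists_eq_algebraMap hU hT.der_scal
  rw [map_one] at hβ
  rw [hα, hβ] at hT hc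
  generalize cG U g θ 0 0 = γ at hT hc
  generalize cG U g θ 1 1 = δ at hT hc
  rw [hs'] at hT hs
  have hs0 : s ≠ 0 := by
    rintro rfl
    rw [map_zero] at hs
    exact (hs.map (Sm.ev ⟨p, hp⟩)).ne_zero (map_zero _)
  -- the ring of smooth functions is reduced
  obtain rfl : j₁ = 0 := Sm.eq_zero_of_sq (hT.special_sq hs)
  obtain ⟨rfl, hj⟩ := hT.special_eqs
  have hψd (i) : dF U θ i (psiSm U g θ) = 3 * psiSm U g θ * ![0, j₃, 0, 1] i := by
    rw [hT.der_psi]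
    fin_cases i <;> simp
  obtain ⟨y, m, hy3, hym, hy, hm⟩ := exists_cube_root_der (f := psiSm U g θ) (fun x => by
    rw [h.isAdaptedOn.ev_psiSm hgU]; exact h.psi2_ne x x.2) hψd
  set a := algebraMap ℝ (Sm U)
  set ψ := psiSm U g θ
  have hsd := hT.der_scal
  have d2 := fun i => der_two (dF U θ i)
  -- a first integral, which becomes the parameter `k₂ = c / 2`
  obtain ⟨c, hc2⟩ := hn.exists_eq_algebraMap hU (f := (2 * j₃ - ψ - 2 * a s) * m) fun i => by
    simp only [Derivation.leibniz, map_sub, hm, hψd, hj, hsd, d2, smul_eq_mul]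
    fin_cases i <;> simp <;> ring
  have hκ : 2 * a (c / 2) = a c := by rw [← map_ofNat a 2, ← map_mul]; congr 1; ring
  have hk : 2 * a (c / 2) * y = 2 * j₃ - ψ - 2 * a s := by
    linear_combination y * hκ - y * hc2 + (2 * j₃ - ψ - 2 * a s) * hym
  obtain ⟨e1, e2, e3⟩ := hT.special_plane hj hy hk
  rw [← hc] at e1 e2 e3
  obtain ⟨V, hV, hpV, hVc, τ, σ, w, hσ0, -, -, hτ, hσ, hw⟩ :=
    hn.exists_plane hp (fun i => der_algebraMap i (c / 2)) e1 e2 e3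
  have hnV := hn.mono hV
  have hcV : cG V g θ = glConn (fun i => Sm.restr hV (γ i)) ![-Sm.restr hV j₃, 0, 0, 0] ![0, 0, 1, 0]
      ![0, Sm.restr hV ψ - Sm.restr hV (a s), 0, 1] := by
    funext b b' b''
    rw [hn.cG_restr hV, hc]
    fin_cases b <;> fin_cases b' <;> fin_cases b'' <;> simp [glConn, glBlock]
  set ρ := Sm.restr hV
  have hyV (i) : dF V θ i (ρ y) = ρ (y * ![0, j₃, 0, 1] i) := by rw [hn.dF_restr hV, hy]
  have hmV (i) : dF V θ i (ρ m) = ρ (-(m * ![0, j₃, 0, 1] i)) := by rw [hn.dF_restr hV, hm]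
  obtain ⟨σi, hσi⟩ := (Sm.isUnit_of_ne_zero hσ0).exists_right_inv
  have hymV : ρ y * ρ m = 1 := by rw [← map_mul, hym, map_one]
  obtain ⟨Y₂, hY₂⟩ := hnV.exists_potential hVc (p := ![0, ρ y, -(τ * ρ y), 0]) (by
    rw [hcV]
    refine isClosedFrame_of_lt fun b c hlt => ?_
    fin_cases b <;> fin_cases c <;> first | (exact absurd hlt (by decide)) | skip
    all_goals simp [glBlock, Fin.sum_univ_four, glConn, hyV, hτ]
    all_goals ring)
  set κ := ρ (a (c / 2))
  have hκe (z) : Sm.ev z κ = c / 2 := (Sm.ev_restr hV _ z).trans (ev_algebraMap _ _)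
  have hY₁ (b) : dF V θ b (τ * σ * ρ m) = ![σ * ρ m, -(τ * σ * ρ m * ρ j₃),
      -(κ * (τ * σ * ρ m) ^ 2 * ρ y * (ρ y * σi)), -(τ * σ * ρ m)] b := by
    simp only [Derivation.leibniz, smul_eq_mul, hτ, hσ, hmV]
    fin_cases b <;> simp
    · ring
    · ring
    · linear_combination κ * τ ^ 2 * σ * ρ y * ρ m * (ρ y * ρ m * hσi + hymV)
    · ring
  have hw' (b) : dF V θ b w = ![0, 0, ρ y * σi, 0] b := by
    have e : dF V θ b w = σi * ρ (![0, 0, y, 0] b) := by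
      linear_combination σi * hw b - dF V θ b w * hσi
    rw [e]
    fin_cases b <;> simp [mul_comm]
  have hmy (z) : Sm.ev z (ρ y) * Sm.ev z (ρ m) = 1 := by rw [← map_mul, hymV, map_one]
  have hσσ (z) : Sm.ev z σ * Sm.ev z σi = 1 := by rw [← map_mul, hσi, map_one]
  have hP (z) : Sm.ev z (ρ y * σi) ≠ 0 := by
    rw [map_mul]
    exact mul_ne_zero (left_ne_zero_of_mul_eq_one (hmy z)) (right_ne_zero_of_mul_eq_one (hσσ z))
  -- `k₁ = 1` since `y³ = Ψ₂`
  refine ⟨1, c / 2, s, one_ne_zero, hs0, V, hV, hpV,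
    fun z => changeCoframe ((ρ y * σi).fn z) 0 0 1 (θ z), fun z hz => (h.adapted z (hV hz)).change ?_,
    mapOf ![τ * σ * ρ m, Y₂, w, ρ y], hnV.pullsBack _ (fun z hz => ?_) fun z b b' => ?_⟩
  · rw [Sm.fn_apply _ ⟨z, hz⟩]
    simpa using hP ⟨z, hz⟩
  · have e2 : (mapOf ![τ * σ * ρ m, Y₂, w, ρ y] z) 3 = Sm.ev ⟨z, hz⟩ (ρ y) := Sm.fn_apply _ ⟨z, hz⟩
    exact fun h0 => left_ne_zero_of_mul_eq_one (hmy ⟨z, hz⟩) (e2.symm.trans h0)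
  · have ex : (mapOf ![τ * σ * ρ m, Y₂, w, ρ y] z) 0 = Sm.ev z (τ * σ * ρ m) := Sm.fn_apply _ z
    have ey : (mapOf ![τ * σ * ρ m, Y₂, w, ρ y] z) 3 = Sm.ev z (ρ y) := Sm.fn_apply _ z
    have hinv : (Sm.ev z (ρ y * σi))⁻¹ = Sm.ev z (σ * ρ m) := by
      rw [inv_eq_iff_eq_inv]
      refine eq_inv_of_mul_eq_one_left ?_
      rw [map_mul, map_mul]
      linear_combination hmy z + Sm.ev z (ρ y) * Sm.ev z (ρ m) * hσσ z
    have hjz : Sm.ev z (ρ j₃) = 1 / 2 * (1 * Sm.ev z (ρ y) ^ 3 + 2 * (c / 2) * Sm.ev z (ρ y) + 2 * s) := by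
      have e4 := congrArg (fun f => Sm.ev z (ρ f)) hk
      have e5 := congrArg (fun f => Sm.ev z (ρ f)) hy3
      have e6 : Sm.ev z (ρ (a s)) = s := (Sm.ev_restr hV _ z).trans (ev_algebraMap _ _)
      simp only [map_mul, map_sub, map_ofNat, map_pow] at e4 e5
      rw [hκe, e6] at e4
      linear_combination -e4 / 2 - e5 / 2
    rw [change_diag_dual (hnV.indep z z.2) (by rw [Sm.fn_apply]; exact hP z) one_ne_zero, Sm.fn_apply,
      hinv, ← special_dual 1 (c / 2) s (z := mapOf ![τ * σ * ρ m, Y₂, w, ρ y] z)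
      (by rw [ey]; exact left_ne_zero_of_mul_eq_one (hmy z)) ex.symm ey.symm hjz b b', Finset.mul_sum]
    refine Finset.sum_congr rfl fun i _ => ?_
    have e7 := hmy z
    have e8 := hσσ z
    fin_cases i <;> fin_cases b' <;> simp [hY₁, hY₂, hw', hyV, hκe] <;> first
      | ring1
      | linear_combination -(specialCoframe 1 (c / 2) s (mapOf ![τ * σ * ρ m, Y₂, w, ρ y] z) b (bvec 1)
          * Sm.ev z τ * Sm.ev z (ρ y)) * (e8 * Sm.ev z (ρ y) * Sm.ev z (ρ m) + e7)

end Normal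

/-! ### The normal form of the fourth branch -/

section Fourth

variable {U : Opens E4} {g : BilinField} {K : EndoField} {θ : FormQuad}

theorem Sm.restr_restr {U V W : Opens E4} (h : V ≤ U) (h' : W ≤ V) (f : Sm U) :
    Sm.restr h' (Sm.restr h f) = Sm.restr (h'.trans h) f :=
  Sm.ext fun x => by simp only [Sm.ev_restr]

/-- The nonvanishing locus of a smooth function. -/
def Sm.supp (f : Sm U) : Opens E4 :=
  ⟨U ∩ f.fn ⁻¹' {0}ᶜ, f.contDiffOn_fn.continuousOn.isOpen_inter_preimage U.isOpen isOpen_compl_singleton⟩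

theorem Sm.supp_le (f : Sm U) : f.supp ≤ U := fun _ h => h.1

/-- Coordinates for a pair of 1-forms `q`, `r` with `dq = - P ∧ q`, `dr = P ∧ r` and
`dP = 2 κ q ∧ r`: up to inverse factors, `q` and `r` are `dX / (1 + κ X Z)` and `dZ / (1 + κ X Z)`. -/
theorem IsNullCoframeOn.exists_plane_coordinates (h : IsNullCoframeOn U g θ) {p : E4} (hp : p ∈ U)
    {κ : ℝ} {P q r : Fin 4 → Sm U}
    (hq : ∀ b c, dForm (dF U θ) (cG U g θ) q b c = -(P b * q c - P c * q b))
    (hr : ∀ b c, dForm (dF U θ) (cG U g θ) r b c = P b * r c - P c * r b)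
    (hP : ∀ b c, dForm (dF U θ) (cG U g θ) P b c
      = 2 * algebraMap ℝ _ κ * (q b * r c - q c * r b)) :
    ∃ V : Opens E4, ∃ hV : V ≤ U, ∃ hpV : p ∈ V, ∃ X Z f f' : Sm V, f * f' = 1 ∧
      Sm.ev ⟨p, hpV⟩ X = 0 ∧ Sm.ev ⟨p, hpV⟩ Z = 0 ∧
      (∀ x, Sm.ev x (1 + algebraMap ℝ _ κ * X * Z) ≠ 0) ∧
      (∀ c, dF V θ c X = (1 + algebraMap ℝ _ κ * X * Z) * (f * Sm.restr hV (q c))) ∧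
      ∀ c, dF V θ c Z = (1 + algebraMap ℝ _ κ * X * Z) * (f' * Sm.restr hV (r c)) := by
  obtain ⟨V, hV, hpV, -, τ, σ, w, hσ0, hτp, hwp, hτ, hσ, hw⟩ :=
    h.exists_plane hp (fun i => der_algebraMap i κ) hq hr hP
  rw [AlgHom.commutes] at hτ hσ
  set N := 1 - algebraMap ℝ (Sm V) κ * (τ * σ) * w with hN
  have hnV := h.mono hV
  have hW := N.supp_le
  have hpW : p ∈ N.supp := ⟨hpV, by
    rw [Set.mem_preimage, Sm.fn_apply _ ⟨p, hpV⟩]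
    simp [hN, hwp]⟩
  have hd := hnV.dF_restr hW
  obtain ⟨n, hn⟩ := (Sm.isUnit_of_ne_zero (f := Sm.restr hW N) fun x => by
    rw [Sm.ev_restr, ← Sm.fn_apply]; exact x.2.2).exists_right_inv
  obtain ⟨σi, hσi⟩ := (Sm.isUnit_of_ne_zero hσ0).exists_right_inv
  have hσi' : Sm.restr hW σ * Sm.restr hW σi = 1 := by rw [← map_mul, hσi, map_one]
  set k := algebraMap ℝ (Sm N.supp) κ
  have hNr : Sm.restr hW N = 1 - k * (Sm.restr hW τ * Sm.restr hW σ) * Sm.restr hW w := by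
    simp only [hN, map_sub, map_mul, map_one, AlgHom.commutes, k]
  have hn' : 1 + k * (Sm.restr hW τ * Sm.restr hW σ * n) * Sm.restr hW w = n := by
    linear_combination -hn + n * hNr
  have hw' (c) : dF V θ c w = σi * Sm.restr hV (r c) := by
    linear_combination σi * hw c - dF V θ c w * hσi
  have hdu (c) : dF N.supp θ c (Sm.restr hW τ * Sm.restr hW σ) = Sm.restr hW σ *
      (Sm.restr (hW.trans hV) (q c) - k * Sm.restr hW τ ^ 2 * Sm.restr (hW.trans hV) (r c)) := by
    rw [Derivation.leibniz, hd, hd, hτ, hσ]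
    simp only [map_add, map_mul, map_sub, map_pow, smul_eq_mul, AlgHom.commutes, Sm.restr_restr,
      map_ofNat, k]
    ring
  have hdw (c) : dF N.supp θ c (Sm.restr hW w)
      = Sm.restr hW σi * Sm.restr (hW.trans hV) (r c) := by
    rw [hd, hw', map_mul, Sm.restr_restr]
  have hdn (c) : dF N.supp θ c n = k * n ^ 2 * (Sm.restr hW w *
      dF N.supp θ c (Sm.restr hW τ * Sm.restr hW σ) + Sm.restr hW τ * Sm.restr hW σ *
        dF N.supp θ c (Sm.restr hW w)) := by
    have h0 : dF N.supp θ c (Sm.restr hW N * n) = 0 := by rw [hn, Derivation.map_one_eq_zero]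
    have hN' : dF N.supp θ c (Sm.restr hW N) = -(k * (Sm.restr hW w *
      dF N.supp θ c (Sm.restr hW τ * Sm.restr hW σ) + Sm.restr hW τ * Sm.restr hW σ *
        dF N.supp θ c (Sm.restr hW w))) := by
      rw [hNr, map_sub, Derivation.map_one_eq_zero, Derivation.leibniz, (dF N.supp θ c).leibniz k]
      simp only [smul_eq_mul, show dF N.supp θ c k = 0 from der_algebraMap c κ]
      ring
    rw [Derivation.leibniz, smul_eq_mul, smul_eq_mul] at h0
    linear_combination n * h0 - n ^ 2 * hN' - dF N.supp θ c n * hn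
  refine ⟨N.supp, hW.trans hV, hpW, Sm.restr hW τ * Sm.restr hW σ * n, Sm.restr hW w,
    Sm.restr hW σ * n, Sm.restr hW σi * Sm.restr hW N, ?_, ?_, ?_, fun x => ?_, fun c => ?_,
    fun c => ?_⟩
  · linear_combination hσi' + Sm.restr hW σ * Sm.restr hW σi * hn
  · simp only [map_mul, Sm.ev_restr, hτp, zero_mul]
  · rw [Sm.ev_restr, hwp]
  · rw [hn']
    have := congrArg (Sm.ev x) hn
    rw [map_mul, map_one] at this
    exact right_ne_zero_of_mul_eq_one this
  · rw [hn', Derivation.leibniz, smul_eq_mul, smul_eq_mul, hdn, hdu, hdw]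
    set A := Sm.restr hW τ
    set S := Sm.restr hW σ
    set Q := Sm.restr (hW.trans hV) (q c)
    set R := Sm.restr (hW.trans hV) (r c)
    linear_combination n * S * (Q - k * A ^ 2 * R) * hn' + k * A ^ 2 * S * n ^ 2 * R * hσi'
  · rw [hn', hdw]
    linear_combination -(Sm.restr hW σi * Sm.restr (hW.trans hV) (r c)) * hn

/-- In the fourth branch, `γ` and `θ¹`, `θ³`, and likewise `δ` and `θ²`, `θ⁴`, satisfy the structure
equations of a null plane of constant curvature. -/
theorem TypeDFrame.homogeneous_planes {R : Type*} [CommRing R] [Algebra ℝ R]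
    {d : Fin 4 → Derivation ℝ R R} {γ δ : Fin 4 → R} {s k : R}
    (h : TypeDFrame d γ ![0, 0, 0, 0] ![0, 0, 0, 0] δ s s) (hk : 2 * k = -(3 * s)) :
    ((∀ b c, dForm d (glConn γ ![0, 0, 0, 0] ![0, 0, 0, 0] δ) ![1, 0, 0, 0] b c
        = -(γ b * ![1, 0, 0, 0] c - γ c * ![1, 0, 0, 0] b)) ∧
      (∀ b c, dForm d (glConn γ ![0, 0, 0, 0] ![0, 0, 0, 0] δ) ![0, 0, 1, 0] b c
        = γ b * ![0, 0, 1, 0] c - γ c * ![0, 0, 1, 0] b) ∧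
      ∀ b c, dForm d (glConn γ ![0, 0, 0, 0] ![0, 0, 0, 0] δ) γ b c
        = 2 * k * (![1, 0, 0, 0] b * ![0, 0, 1, 0] c - ![1, 0, 0, 0] c * ![0, 0, 1, 0] b)) ∧
    (∀ b c, dForm d (glConn γ ![0, 0, 0, 0] ![0, 0, 0, 0] δ) ![0, 1, 0, 0] b c
        = -(δ b * ![0, 1, 0, 0] c - δ c * ![0, 1, 0, 0] b)) ∧
      (∀ b c, dForm d (glConn γ ![0, 0, 0, 0] ![0, 0, 0, 0] δ) ![0, 0, 0, 1] b c
        = δ b * ![0, 0, 0, 1] c - δ c * ![0, 0, 0, 1] b) ∧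
      ∀ b c, dForm d (glConn γ ![0, 0, 0, 0] ![0, 0, 0, 0] δ) δ b c
        = 2 * k * (![0, 1, 0, 0] b * ![0, 0, 0, 1] c - ![0, 1, 0, 0] c * ![0, 0, 0, 1] b) := by
  refine ⟨⟨fun b c => ?_, fun b c => ?_, fun b c => ?_⟩, fun b c => ?_, fun b c => ?_,
    fun b c => ?_⟩
  · fin_cases b <;> fin_cases c <;> simp [dForm, Fin.sum_univ_four, glConn, glBlock]
  · fin_cases b <;> fin_cases c <;> simp [dForm, Fin.sum_univ_four, glConn, glBlock]
  · have e := h.curv 0 0 b c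
    fin_cases b <;> fin_cases c <;>
      simp [curvTable, glBlock, skewBlock, Fin.sum_univ_four, glConn, frameCurv] at e <;>
      simp [dForm, Fin.sum_univ_four, glConn, glBlock]
    all_goals first | linear_combination e | linear_combination e - hk | linear_combination e + hk
  · fin_cases b <;> fin_cases c <;> simp [dForm, Fin.sum_univ_four, glConn, glBlock]
  · fin_cases b <;> fin_cases c <;> simp [dForm, Fin.sum_univ_four, glConn, glBlock]
  · have e := h.curv 1 1 b c
    fin_cases b <;> fin_cases c <;>
      simp [curvTable, glBlock, skewBlock, Fin.sum_univ_four, glConn, frameCurv] at e <;>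
      simp [dForm, Fin.sum_univ_four, glConn, glBlock]
    all_goals first | linear_combination e | linear_combination e - hk | linear_combination e + hk

/-- A reduced coframe with `J₂ = J₄ = 0` is, after a rescaling, the coframe of the fourth family in
suitable coordinates centred at a given point. -/
theorem exists_pullsBack_homogeneous (h : IsReducedCoframeOn U g K θ) (hg : IsPKEOn U g K)
    (hS : ∀ x ∈ U, scalarCurv g x ≠ 0) (hU : Convex ℝ (U : Set E4))
    (h2 : ∀ x ∈ U, J2 g θ x = 0) (h4 : ∀ x ∈ U, J4 g θ x = 0) {p : E4} (hp : p ∈ U) :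
    ∃ s : ℝ, s ≠ 0 ∧ ∃ V ≤ U, p ∈ V ∧ ∃ θ' : FormQuad,
      (∀ z ∈ V, IsAdapted (g z) (K z) (θ' z)) ∧
      ∃ Y, PullsBack V (domainHom s) (homogeneousCoframe s) θ' Y ∧ Y p = 0 := by
  have hn := h.isAdaptedOn.null
  have hT := h.typeDFrame hg
  have hs := h.isUnit_scalSm hg hS
  obtain ⟨j₃, hα⟩ := h.exists_alpha hg h4
  obtain ⟨j₁, hβ⟩ := h.exists_beta hg h2
  have hc := h.isAdaptedOn.cG_eq hg
  obtain ⟨s, hs'⟩ := hn.exists_eq_algebraMap hU hT.der_scal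
  rw [map_zero] at hβ
  rw [hα, hβ] at hT hc
  generalize cG U g θ 0 0 = γ at hT hc
  generalize cG U g θ 1 1 = δ at hT hc
  rw [hs'] at hT hs
  have hs0 : s ≠ 0 := by
    rintro rfl
    rw [map_zero] at hs
    exact (hs.map (Sm.ev ⟨p, hp⟩)).ne_zero (map_zero _)
  obtain ⟨hψ, rfl, rfl⟩ := hT.homogeneous_eqs
  rw [hψ, neg_zero] at hT
  rw [neg_zero] at hc
  set κ := -(3 / 2 * s)
  have hκ : 2 * algebraMap ℝ (Sm U) κ = -(3 * algebraMap ℝ (Sm U) s) := by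
    rw [← map_ofNat (algebraMap ℝ (Sm U)) 2, ← map_ofNat (algebraMap ℝ (Sm U)) 3, ← map_mul,
      ← map_mul, ← map_neg]
    congr 1
    simp only [κ]
    ring
  obtain ⟨⟨a1, a2, a3⟩, b1, b2, b3⟩ := hT.homogeneous_planes hκ
  rw [← hc] at a1 a2 a3 b1 b2 b3
  obtain ⟨V₁, hV₁, hp₁, X₁, Z₁, f₁, f₁', hf₁, hX₁p, hZ₁p, hN₁, hX₁, hZ₁⟩ :=
    hn.exists_plane_coordinates hp a1 a2 a3
  obtain ⟨V₂, hV₂, hp₂, X₂, Z₂, f₂, f₂', hf₂, hX₂p, hZ₂p, hN₂, hX₂, hZ₂⟩ :=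
    hn.exists_plane_coordinates hp b1 b2 b3
  have hn₁ := hn.mono hV₁
  have hn₂ := hn.mono hV₂
  let W := V₁ ⊓ V₂
  have hW₁ : W ≤ V₁ := inf_le_left
  have hW₂ : W ≤ V₂ := inf_le_right
  have hnW := hn₁.mono hW₁
  let F : Fin 4 → Sm W := ![Sm.restr hW₁ X₁, Sm.restr hW₂ X₂, Sm.restr hW₁ Z₁, Sm.restr hW₂ Z₂]
  have ev₁ (z : W) (f : Sm V₁) : Sm.ev z (Sm.restr hW₁ f) = Sm.ev ⟨z, hW₁ z.2⟩ f := Sm.ev_restr _ _ _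
  have ev₂ (z : W) (f : Sm V₂) : Sm.ev z (Sm.restr hW₂ f) = Sm.ev ⟨z, hW₂ z.2⟩ f := Sm.ev_restr _ _ _
  have hF (z : W) (i) : mapOf F z i = ![Sm.ev ⟨z, hW₁ z.2⟩ X₁, Sm.ev ⟨z, hW₂ z.2⟩ X₂,
      Sm.ev ⟨z, hW₁ z.2⟩ Z₁, Sm.ev ⟨z, hW₂ z.2⟩ Z₂] i := by
    rw [show mapOf F z i = Sm.ev z (F i) from Sm.fn_apply _ z]
    fin_cases i
    exacts [ev₁ z X₁, ev₂ z X₂, ev₁ z Z₁, ev₂ z Z₂]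
  have ef₁ (z : W) : Sm.ev ⟨z, hW₁ z.2⟩ f₁ * Sm.ev ⟨z, hW₁ z.2⟩ f₁' = 1 := by
    rw [← map_mul, hf₁, map_one]
  have ef₂ (z : W) : Sm.ev ⟨z, hW₂ z.2⟩ f₂ * Sm.ev ⟨z, hW₂ z.2⟩ f₂' = 1 := by
    rw [← map_mul, hf₂, map_one]
  have e1 (z : W) : Sm.ev ⟨z, hW₁ z.2⟩ (1 + algebraMap ℝ _ κ * X₁ * Z₁)
      = 1 - 3 / 2 * s * mapOf F z 0 * mapOf F z 2 := by
    rw [hF, hF]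
    simp [κ]
    ring
  have e2 (z : W) : Sm.ev ⟨z, hW₂ z.2⟩ (1 + algebraMap ℝ _ κ * X₂ * Z₂)
      = 1 - 3 / 2 * s * mapOf F z 1 * mapOf F z 3 := by
    rw [hF, hF]
    simp [κ]
    ring
  have m1 (z : W) : 1 - 3 / 2 * s * mapOf F z 0 * mapOf F z 2 ≠ 0 := by rw [← e1]; exact hN₁ _
  have m2 (z : W) : 1 - 3 / 2 * s * mapOf F z 1 * mapOf F z 3 ≠ 0 := by rw [← e2]; exact hN₂ _
  refine ⟨s, hs0, W, hW₁.trans hV₁, ⟨hp₁, hp₂⟩,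
    fun z => changeCoframe (f₁'.fn z) 0 0 (f₂'.fn z) (θ z), fun z hz =>
      (h.adapted z (hV₁ (hW₁ hz))).change ?_, mapOf F,
    hnW.pullsBack F (fun z hz => ⟨m1 ⟨z, hz⟩, m2 ⟨z, hz⟩⟩) fun z b c => ?_, ?_⟩
  · rw [Sm.fn_apply _ ⟨z, hW₁ hz⟩, Sm.fn_apply _ ⟨z, hW₂ hz⟩]
    simpa using ⟨right_ne_zero_of_mul_eq_one (ef₁ ⟨z, hz⟩), right_ne_zero_of_mul_eq_one (ef₂ ⟨z, hz⟩)⟩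
  · have n1 := m1 z
    have n2 := m2 z
    have g1 := right_ne_zero_of_mul_eq_one (ef₁ z)
    have g2 := right_ne_zero_of_mul_eq_one (ef₂ z)
    have i1 := inv_eq_of_mul_eq_one_left (ef₁ z)
    have i2 := inv_eq_of_mul_eq_one_left (ef₂ z)
    have hd (i) : Sm.ev z (dF W θ c (F i)) = ![
        (1 - 3 / 2 * s * mapOf F z 0 * mapOf F z 2) * (Sm.ev ⟨z, hW₁ z.2⟩ f₁ * ![1, 0, 0, 0] c),
        (1 - 3 / 2 * s * mapOf F z 1 * mapOf F z 3) * (Sm.ev ⟨z, hW₂ z.2⟩ f₂ * ![0, 1, 0, 0] c),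
        (1 - 3 / 2 * s * mapOf F z 0 * mapOf F z 2) * (Sm.ev ⟨z, hW₁ z.2⟩ f₁' * ![0, 0, 1, 0] c),
        (1 - 3 / 2 * s * mapOf F z 1 * mapOf F z 3) * (Sm.ev ⟨z, hW₂ z.2⟩ f₂' * ![0, 0, 0, 1] c)] i := by
      fin_cases i
      · simp only [F, Fin.zero_eta, Matrix.cons_val_zero, hn₁.dF_restr hW₁, ev₁, hX₁, map_mul, e1]
        fin_cases c <;> simp
      · simp only [F, Fin.mk_one, Matrix.cons_val_one, Matrix.cons_val_zero, hn₂.dF_restr hW₂, ev₂,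
          hX₂, map_mul, e2]
        fin_cases c <;> simp
      · simp only [F, Fin.reduceFinMk, Matrix.cons_val, hn₁.dF_restr hW₁, ev₁, hZ₁, map_mul, e1]
        fin_cases c <;> simp
      · simp only [F, Fin.reduceFinMk, Matrix.cons_val, hn₂.dF_restr hW₂, ev₂, hZ₂, map_mul, e2]
        fin_cases c <;> simp
    rw [Sm.fn_apply _ ⟨z, hW₁ z.2⟩, Sm.fn_apply _ ⟨z, hW₂ z.2⟩,
      change_diag_dual (hnW.indep z z.2) g1 g2, i1, i2]
    simp only [hd]
    generalize mapOf F z = y at n1 n2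
    fin_cases b <;> fin_cases c <;>
      simp [homogeneousCoframe, dy, bvec, n1, n2]
  · ext i
    rw [hF ⟨p, hp₁, hp₂⟩]
    fin_cases i <;> simp [hX₁p, hX₂p, hZ₁p, hZ₂p]

end Fourth

/-! ### Naturality of the connection and of the curvature -/

section Naturality

variable {U V : Opens E4} {g g₀ : BilinField} {K K₀ : EndoField} {θ θ₀ : FormQuad} {Y : E4 → E4}

theorem IsNullCoframeOn.isClosedFrame_dF (h : IsNullCoframeOn V g θ) (f : Sm V) :
    IsClosedFrame (dF V θ) (cG V g θ) fun a => dF V θ a f := fun b c => h.dF_comm b c f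

/-- A metric connection is the Levi-Civita connection if it is torsion-free on the differentials of
four functions with independent differentials. -/
theorem IsNullCoframeOn.cG_eq_of_functions (h : IsNullCoframeOn V g θ)
    {G : Fin 4 → Fin 4 → Fin 4 → Sm V} (hsk : ∀ a b c, G (a + 2) b c + G (b + 2) a c = 0)
    {f : Fin 4 → Sm V} {T : Matrix (Fin 4) (Fin 4) (Sm V)}
    (hT : T * Matrix.of (fun j a => dF V θ a (f j)) = 1)
    (hf : ∀ j, IsClosedFrame (dF V θ) G fun a => dF V θ a (f j)) : cG V g θ = G := by
  have ht (b c) : (fun a => (G a c b - G a b c) - (cG V g θ a c b - cG V g θ a b c)) = 0 := by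
    have h0 : (Matrix.of fun j a => dF V θ a (f j)).mulVec
        (fun a => (G a c b - G a b c) - (cG V g θ a c b - cG V g θ a b c)) = 0 := by
      funext j
      have h1 := hf j b c
      have h2 := h.isClosedFrame_dF (f j) b c
      rw [h1] at h2
      simp only [Matrix.mulVec, dotProduct, Matrix.of_apply, mul_sub, Finset.sum_sub_distrib,
        Pi.zero_apply] at h2 ⊢
      simp only [sub_mul, Finset.sum_sub_distrib, mul_comm] at h2 ⊢
      linear_combination h2
    rw [← Matrix.one_mulVec (fun a => (G a c b - G a b c) - (cG V g θ a c b - cG V g θ a b c)),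
      ← hT, ← Matrix.mulVec_mulVec, h0, Matrix.mulVec_zero]
  refine h.cG_unique hsk fun j b c => ?_
  have h1 := h.isClosedFrame_dF (coordSm V j) b c
  have h2 : (fun a => dF V θ a (coordSm V j)) = (cofSm V θ)⁻¹ j := funext fun a => dF_coordSm rfl a j
  rw [← h2]
  refine h1.trans (Finset.sum_congr rfl fun a _ => ?_)
  rw [← sub_eq_zero.1 (congrFun (ht b c) a)]

/-- Composition of smooth functions with a smooth map. -/
def Sm.comp (hs : ContDiffOn ℝ ∞ Y V) (hm : ∀ z ∈ V, Y z ∈ U) : Sm U →ₐ[ℝ] Sm V where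
  toFun f := Sm.of V (f.fn ∘ Y)
  map_one' := Sm.ext fun x => by
    rw [Sm.ev_of ((1 : Sm U).contDiffOn_fn.comp hs hm), Function.comp,
      Sm.fn_apply _ ⟨Y x, hm x x.2⟩, map_one, map_one]
  map_zero' := Sm.ext fun x => by
    rw [Sm.ev_of ((0 : Sm U).contDiffOn_fn.comp hs hm), Function.comp,
      Sm.fn_apply _ ⟨Y x, hm x x.2⟩, map_zero, map_zero]
  map_add' f k := Sm.ext fun x => by
    rw [map_add]
    simp only [Sm.ev_of (Sm.contDiffOn_fn _ |>.comp hs hm), Function.comp,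
      Sm.fn_apply _ ⟨Y x, hm x x.2⟩, map_add]
  map_mul' f k := Sm.ext fun x => by
    rw [map_mul]
    simp only [Sm.ev_of (Sm.contDiffOn_fn _ |>.comp hs hm), Function.comp,
      Sm.fn_apply _ ⟨Y x, hm x x.2⟩, map_mul]
  commutes' c := Sm.ext fun x => by
    rw [Sm.ev_of (Sm.contDiffOn_fn _ |>.comp hs hm), Function.comp,
      Sm.fn_apply _ ⟨Y x, hm x x.2⟩, ev_algebraMap, ev_algebraMap]

theorem Sm.ev_comp (hs : ContDiffOn ℝ ∞ Y V) (hm : ∀ z ∈ V, Y z ∈ U) (f : Sm U) (x : V) :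
    Sm.ev x (Sm.comp hs hm f) = Sm.ev ⟨Y x, hm x x.2⟩ f :=
  (Sm.ev_of (f.contDiffOn_fn.comp hs hm) x).trans (Sm.fn_apply f ⟨Y x, hm x x.2⟩)

namespace PullsBack

theorem fderiv_dual (hY : PullsBack V U θ₀ θ Y) (h : IsNullCoframeOn V g θ)
    (h₀ : IsNullCoframeOn U g₀ θ₀) {z : E4} (hz : z ∈ V) (b : Fin 4) :
    fderiv ℝ Y z (dualVec (θ z) b) = dualVec (θ₀ (Y z)) b :=
  (dualVec_eq (h₀.indep _ (hY.maps z hz)) fun a => by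
    rw [hY.pull z hz, apply_dualVec (h.indep z hz)]).symm

theorem dF_comp (hY : PullsBack V U θ₀ θ Y) (h : IsNullCoframeOn V g θ)
    (h₀ : IsNullCoframeOn U g₀ θ₀) (a : Fin 4) (f : Sm U) :
    dF V θ a (Sm.comp hY.smooth hY.maps f) = Sm.comp hY.smooth hY.maps (dF U θ₀ a f) := by
  refine Sm.ext fun x => ?_
  have hd := (hY.smooth.contDiffAt (V.isOpen.mem_nhds x.2)).differentiableAt (by simp)
  have hf : DifferentiableAt ℝ f.fn (Y x) := f.differentiableAt_fn ⟨Y x, hY.maps x x.2⟩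
  rw [ev_dF_eq h.smooth h.indep (F := f.fn ∘ Y) (fun z => (Sm.ev_comp _ _ f z).trans
    (Sm.fn_apply f ⟨Y z, _⟩).symm), Sm.ev_comp, ev_dF h₀.smooth h₀.indep,
    fderiv_comp _ hf hd, ContinuousLinearMap.comp_apply,
    hY.fderiv_dual h h₀ x.2]

/-- The connection of the pulled back metric. -/
theorem cG_comp (hY : PullsBack V U θ₀ θ Y) (h : IsNullCoframeOn V g θ)
    (h₀ : IsNullCoframeOn U g₀ θ₀) :
    cG V g θ = fun a b c => Sm.comp hY.smooth hY.maps (cG U g₀ θ₀ a b c) := by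
  refine h.cG_eq_of_functions (f := fun j => Sm.comp hY.smooth hY.maps (coordSm U j))
    (T := (cofSm U θ₀).map (Sm.comp hY.smooth hY.maps)) (fun a b c => ?_) ?_ fun j b c => ?_
  · rw [← map_add, h₀.cG_skew, map_zero]
  · have h2 : (Matrix.of fun j a => dF V θ a (Sm.comp hY.smooth hY.maps (coordSm U j)))
        = (cofSm U θ₀)⁻¹.map (Sm.comp hY.smooth hY.maps) := by
      ext1 j a
      rw [Matrix.of_apply, hY.dF_comp h h₀, Matrix.map_apply, dF_coordSm rfl]
    have h3 := congrArg (Sm.comp hY.smooth hY.maps).mapMatrix h₀.cof_mul_inv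
    rw [map_mul, map_one] at h3
    rw [h2]
    exact h3
  · simp only [hY.dF_comp h h₀, ← map_sub, ← map_mul, ← map_sum]
    exact congrArg (Sm.comp hY.smooth hY.maps) (h₀.isClosedFrame_dF (coordSm U j) b c)

/-- The curvature of the pulled back metric. -/
theorem rF_comp (hY : PullsBack V U θ₀ θ Y) (h : IsNullCoframeOn V g θ)
    (h₀ : IsNullCoframeOn U g₀ θ₀) (a b c e : Fin 4) : IsNullCoframeOn.rF V g θ a b c e
      = Sm.comp hY.smooth hY.maps (IsNullCoframeOn.rF U g₀ θ₀ a b c e) := by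
  rw [IsNullCoframeOn.rF, hY.cG_comp h h₀]
  simp only [IsNullCoframeOn.rF, frameCurv, hY.dF_comp h h₀, map_sub, map_add, map_mul, map_sum]

/-- The curvature components `Ψ₀, …, Ψ₄` and the scalar curvature are preserved by pull-backs of coframes. -/
theorem psi_eq (hY : PullsBack V U θ₀ θ Y) (h : IsAdaptedOn V g K θ) (hg : IsPKEOn V g K)
    (h₀ : IsAdaptedOn U g₀ K₀ θ₀) (hg₀ : IsPKEOn U g₀ K₀) (z : V) :
    psi0 g θ z = psi0 g₀ θ₀ (Y z) ∧ psi1 g θ z = psi1 g₀ θ₀ (Y z) ∧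
      psi2 g θ z = psi2 g₀ θ₀ (Y z) ∧ psi3 g θ z = psi3 g₀ θ₀ (Y z) ∧
      psi4 g θ z = psi4 g₀ θ₀ (Y z) ∧ -scalarCurv g z / 12 = -scalarCurv g₀ (Y z) / 12 := by
  refine curvTable_injective fun a b c e => ?_
  have h3 := congrArg (Sm.ev z) (hY.rF_comp h.null h₀.null a b c e)
  rw [Sm.ev_comp, (h.ev_rF_eq hg z).1] at h3
  exact h3.trans ((h₀.ev_rF_eq hg₀ ⟨Y z, hY.maps z z.2⟩).1 a b c e)

/-- The connection forms of the pulled back metric. -/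
theorem connForm_dual (hY : PullsBack V U θ₀ θ Y) (h : IsNullCoframeOn V g θ)
    (h₀ : IsNullCoframeOn U g₀ θ₀) {z : E4} (hz : z ∈ V) (a b c : Fin 4) :
    connForm g θ a b z (dualVec (θ z) c) = connForm g₀ θ₀ a b (Y z) (dualVec (θ₀ (Y z)) c) := by
  have h1 := h.ev_cG ⟨z, hz⟩ a b c
  rw [hY.cG_comp h h₀, Sm.ev_comp, h₀.ev_cG] at h1
  exact h1.symm

theorem isReducedCoframeOn (hY : PullsBack V U θ₀ θ Y) (h : IsAdaptedOn V g K θ)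
    (hg : IsPKEOn V g K) (h₀ : IsReducedCoframeOn U g₀ K₀ θ₀) (hg₀ : IsPKEOn U g₀ K₀) :
    IsReducedCoframeOn V g K θ := by
  have key {z} (hz : z ∈ V) := hY.psi_eq h hg h₀.isAdaptedOn hg₀ ⟨z, hz⟩
  refine ⟨h.smooth, h.adapted, fun z hz => (key hz).1.trans (h₀.psi0_eq _ (hY.maps z hz)),
    fun z hz => (key hz).2.1.trans (h₀.psi1_eq _ (hY.maps z hz)), fun z hz => ?_,
    fun z hz => (key hz).2.2.2.1.trans (h₀.psi3_eq _ (hY.maps z hz)),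
    fun z hz => (key hz).2.2.2.2.1.trans (h₀.psi4_eq _ (hY.maps z hz))⟩
  rw [(key hz).2.2.1]
  exact h₀.psi2_ne _ (hY.maps z hz)

end PullsBack

end Naturality

/-! ### Charts in which a coframe takes a given form -/

section Charts

universe v

variable {M : Type v} [TopologicalSpace M] [ChartedSpace E4 M]
  {g : ∀ x : M, TangentSpace (𝓡 4) x →L[ℝ] TangentSpace (𝓡 4) x →L[ℝ] ℝ}
  {K : ∀ x : M, TangentSpace (𝓡 4) x →L[ℝ] TangentSpace (𝓡 4) x}
  {e e' : OpenPartialHomeomorph M E4}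

/-- The derivative of the inverse of a chart, on the model space. -/
def dSymm (e : OpenPartialHomeomorph M E4) (y : E4) : E4 →L[ℝ] E4 := mfderiv (𝓡 4) (𝓡 4) e.symm y

/-- The derivative of a chart, on the model space. -/
def dChart (e : OpenPartialHomeomorph M E4) (x : M) : E4 →L[ℝ] E4 := mfderiv (𝓡 4) (𝓡 4) e x

/-- The value of `g` at `x`, on the model space. -/
def metricAt (g : ∀ x : M, TangentSpace (𝓡 4) x →L[ℝ] TangentSpace (𝓡 4) x →L[ℝ] ℝ) (x : M) :
    E4 →L[ℝ] E4 →L[ℝ] ℝ := g x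

/-- The value of `K` at `x`, on the model space. -/
def endoAt (K : ∀ x : M, TangentSpace (𝓡 4) x →L[ℝ] TangentSpace (𝓡 4) x) (x : M) :
    E4 →L[ℝ] E4 := K x

theorem localMetric_apply (g : ∀ x : M, TangentSpace (𝓡 4) x →L[ℝ] TangentSpace (𝓡 4) x →L[ℝ] ℝ)
    (e : OpenPartialHomeomorph M E4) (y v w : E4) :
    localMetric g e y v w = metricAt g (e.symm y) (dSymm e y v) (dSymm e y w) := rfl

theorem localEndo_apply (K : ∀ x : M, TangentSpace (𝓡 4) x →L[ℝ] TangentSpace (𝓡 4) x)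
    (e : OpenPartialHomeomorph M E4) (y v : E4) :
    localEndo K e y v = dChart e (e.symm y) (endoAt K (e.symm y) (dSymm e y v)) := rfl

theorem mdifferentiableAt_chart (he : e ∈ IsManifold.maximalAtlas (𝓡 4) ∞ M) {x : M}
    (hx : x ∈ e.source) : MDifferentiableAt (𝓡 4) (𝓡 4) e x :=
  (contMDiffAt_of_mem_maximalAtlas he hx).mdifferentiableAt (by simp)

theorem mdifferentiableAt_chart_symm (he : e ∈ IsManifold.maximalAtlas (𝓡 4) ∞ M) {y : E4}
    (hy : y ∈ e.target) : MDifferentiableAt (𝓡 4) (𝓡 4) e.symm y :=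
  (contMDiffAt_symm_of_mem_maximalAtlas he hy).mdifferentiableAt (by simp)

/-- The derivative of a transition map. -/
theorem fderiv_transition (he : e ∈ IsManifold.maximalAtlas (𝓡 4) ∞ M)
    (he' : e' ∈ IsManifold.maximalAtlas (𝓡 4) ∞ M) {y : E4} (hy : y ∈ e.target)
    (hy' : e.symm y ∈ e'.source) :
    fderiv ℝ (e' ∘ e.symm) y = (dChart e' (e.symm y)).comp (dSymm e y) := by
  rw [← mfderiv_eq_fderiv]
  exact mfderiv_comp y (mdifferentiableAt_chart he' hy') (mdifferentiableAt_chart_symm he hy)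

theorem dChart_dSymm (he : e ∈ IsManifold.maximalAtlas (𝓡 4) ∞ M) {y : E4} (hy : y ∈ e.target)
    (v : E4) : dChart e (e.symm y) (dSymm e y v) = v := by
  have h1 := fderiv_transition he he hy (e.map_target hy)
  have h2 : e ∘ e.symm =ᶠ[nhds y] id := by
    filter_upwards [e.open_target.mem_nhds hy] with z hz using e.right_inv hz
  rw [h2.fderiv_eq, fderiv_id] at h1
  exact (congrArg (fun L => L v) h1).symm

theorem dSymm_dChart (he : e ∈ IsManifold.maximalAtlas (𝓡 4) ∞ M) {x : M} (hx : x ∈ e.source)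
    (v : E4) : dSymm e (e x) (dChart e x v) = v := by
  have hi : Function.Injective (dChart e x) := by
    have hs : Function.Surjective (dChart e x) := fun w => ⟨dSymm e (e x) w, by
      have := dChart_dSymm he (e.map_source hx) w
      rwa [e.left_inv hx] at this⟩
    exact (LinearMap.injective_iff_surjective (f := (dChart e x).toLinearMap)).2 hs
  apply hi
  have := dChart_dSymm he (e.map_source hx) (dChart e x v)
  rwa [e.left_inv hx] at this

/-- The coordinate expressions of a metric in two charts. -/
theorem localMetric_transition (he : e ∈ IsManifold.maximalAtlas (𝓡 4) ∞ M)
    (he' : e' ∈ IsManifold.maximalAtlas (𝓡 4) ∞ M) {y : E4} (hy : y ∈ e.target)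
    (hy' : e.symm y ∈ e'.source) (v w : E4) :
    localMetric g e' (e' (e.symm y)) (fderiv ℝ (e' ∘ e.symm) y v) (fderiv ℝ (e' ∘ e.symm) y w)
      = localMetric g e y v w := by
  rw [fderiv_transition he he' hy hy', localMetric_apply, localMetric_apply, e'.left_inv hy']
  simp only [ContinuousLinearMap.comp_apply, dSymm_dChart he' hy']

/-- The coordinate expressions of a field of endomorphisms in two charts. -/
theorem localEndo_transition (he : e ∈ IsManifold.maximalAtlas (𝓡 4) ∞ M)
    (he' : e' ∈ IsManifold.maximalAtlas (𝓡 4) ∞ M) {y : E4} (hy : y ∈ e.target)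
    (hy' : e.symm y ∈ e'.source) (v : E4) :
    localEndo K e' (e' (e.symm y)) (fderiv ℝ (e' ∘ e.symm) y v)
      = fderiv ℝ (e' ∘ e.symm) y (localEndo K e y v) := by
  rw [fderiv_transition he he' hy hy', localEndo_apply, localEndo_apply, e'.left_inv hy']
  simp only [ContinuousLinearMap.comp_apply, dSymm_dChart he' hy']
  have := dSymm_dChart he (e.map_target hy) (endoAt K (e.symm y) (dSymm e y v))
  rw [e.right_inv hy] at this
  rw [this]

/-- Adaptedness passes from `L^* η'` to `η'`. -/
theorem IsAdapted.of_pullback {G G' : E4 →L[ℝ] E4 →L[ℝ] ℝ} {k k' : E4 →L[ℝ] E4}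
    {η η' : Fin 4 → E4 →L[ℝ] ℝ} {L : E4 →L[ℝ] E4} (h : IsAdapted G k η)
    (hL : Function.Surjective L) (hη : ∀ a v, η' a (L v) = η a v)
    (hG : ∀ v w, G' (L v) (L w) = G v w) (hk : ∀ v, k' (L v) = L (k v)) : IsAdapted G' k' η' := by
  refine ⟨linearIndependent_of_dual (e := fun b => L (dualVec η b)) fun a b => by
    rw [hη, apply_dualVec h.indep], fun v w => ?_, fun v => ?_, fun v => ?_, fun v => ?_, fun v => ?_⟩
  · obtain ⟨v, rfl⟩ := hL v
    obtain ⟨w, rfl⟩ := hL w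
    simp only [hG, hη, h.metric]
  all_goals
    obtain ⟨v, rfl⟩ := hL v
    simp only [hk, hη, h.endo₀, h.endo₁, h.endo₂, h.endo₃]

theorem PullsBack.injective {V : Opens E4} {D : Set E4} {θ₀ θ : FormQuad} {Y : E4 → E4}
    (hY : PullsBack V D θ₀ θ Y) {z : E4} (hz : z ∈ V) (hi : LinearIndependent ℝ (θ z)) :
    Function.Injective (fderiv ℝ Y z) := by
  rw [injective_iff_map_eq_zero]
  intro w hw
  rw [← sum_smul_dualVec hi w]
  simp [← hY.pull z hz, hw]

/-- A chart in which the coframe of a model is adapted is a normal form. -/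
theorem IsModel.hasNormalFormAt {D : Set E4} {θ₀ : FormQuad} {s j₂ j₄ : ℝ}
    (hM : IsModel D θ₀ s j₂ j₄) (hg : IsPKE g K) {p : M}
    (he : e ∈ IsManifold.maximalAtlas (𝓡 4) ∞ M) (hp : p ∈ e.source) (hD : e.target ⊆ D)
    (hA : ∀ y ∈ e.target, IsAdapted (localMetric g e y) (localEndo K e y) (θ₀ y)) :
    HasNormalFormAt g K p D θ₀ s j₂ j₄ := by
  let V : Opens E4 := ⟨e.target, e.open_target⟩
  let U : Opens E4 := ⟨D, hM.isOpen⟩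
  have hgV : IsPKEOn V (localMetric g e) (localEndo K e) := hg e he
  have hAV : IsAdaptedOn V (localMetric g e) (localEndo K e) θ₀ :=
    ⟨fun a => (hM.reduced.smooth a).mono hD, hA⟩
  have hAU : IsReducedCoframeOn U (metricOf θ₀) (endoOf θ₀) θ₀ := hM.reduced
  have hY : PullsBack V U θ₀ θ₀ id := ⟨contDiffOn_id, hD, fun z _ a w => by simp⟩
  refine ⟨e, he, hp, hD, hY.isReducedCoframeOn hAV hgV hAU hM.pke, fun y hy => ⟨?_, ?_, ?_⟩⟩
  · rw [(hAV.ev_rF_eq hgV ⟨y, hy⟩).2, ← hM.psi2'_eq y (hD hy)]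
    exact (hY.psi_eq hAV hgV hAU.isAdaptedOn hM.pke ⟨y, hy⟩).2.2.2.2.2.trans
      (hAU.isAdaptedOn.ev_rF_eq hM.pke ⟨y, hD hy⟩).2.symm
  · exact (hY.connForm_dual hAV.null hAU.isAdaptedOn.null hy 1 0 2).trans (hM.J2_eq y (hD hy))
  · exact (hY.connForm_dual hAV.null hAU.isAdaptedOn.null hy 0 1 3).trans (hM.J4_eq y (hD hy))

variable [IsManifold (𝓡 4) ∞ M]

/-- Functions that pull back a model coframe to an adapted coframe are coordinates in which the
model coframe is adapted, by the inverse function theorem. -/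
theorem exists_chart_of_pullsBack (he : e ∈ IsManifold.maximalAtlas (𝓡 4) ∞ M) {p : M}
    (hp : p ∈ e.source) {V : Opens E4} (hpV : e p ∈ V)
    {θ₀ θ : FormQuad} {D : Set E4} {Y : E4 → E4}
    (hA : ∀ z ∈ V, IsAdapted (localMetric g e z) (localEndo K e z) (θ z))
    (hY : PullsBack V D θ₀ θ Y) :
    ∃ e' ∈ IsManifold.maximalAtlas (𝓡 4) ∞ M, p ∈ e'.source ∧ e' p = Y (e p) ∧ e'.target ⊆ D ∧
      ∀ y ∈ e'.target, IsAdapted (localMetric g e' y) (localEndo K e' y) (θ₀ y) := by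
  have hYs (z) (hz : z ∈ V) : ContDiffAt ℝ ∞ Y z := hY.smooth.contDiffAt (V.isOpen.mem_nhds hz)
  have hYd (z) (hz : z ∈ V) : DifferentiableAt ℝ Y z := (hYs z hz).differentiableAt (by simp)
  have hinj (z) (hz : z ∈ V) := hY.injective hz (hA z hz).indep
  have hsurj (z) (hz : z ∈ V) : Function.Surjective (fderiv ℝ Y z) :=
    (LinearMap.injective_iff_surjective (f := (fderiv ℝ Y z).toLinearMap)).1 (hinj z hz)
  let L (z) (hz : z ∈ V) : E4 ≃L[ℝ] E4 :=
    (LinearEquiv.ofInjectiveEndo (fderiv ℝ Y z).toLinearMap (hinj z hz)).toContinuousLinearEquiv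
  have hL (z) (hz : z ∈ V) : HasFDerivAt Y (L z hz : E4 →L[ℝ] E4) z := by
    have h1 : (L z hz : E4 →L[ℝ] E4) = fderiv ℝ Y z := by ext1 w; rfl
    rw [h1]
    exact (hYd z hz).hasFDerivAt
  let F₀ := (hYs _ hpV).toOpenPartialHomeomorph Y (hL _ hpV) (by simp)
  let F := F₀.restrOpen V V.isOpen
  have hFV (z) (hz : z ∈ F.source) : z ∈ V := hz.2
  have hpF : e p ∈ F.source := ⟨(hYs _ hpV).mem_toOpenPartialHomeomorph_source (hL _ hpV) (by simp), hpV⟩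
  have hF : ContMDiffOn (𝓡 4) (𝓡 4) ∞ F F.source :=
    contMDiffOn_iff_contDiffOn.2 (hY.smooth.mono hFV)
  have hFs : ContMDiffOn (𝓡 4) (𝓡 4) ∞ F.symm F.target :=
    contMDiffOn_iff_contDiffOn.2 fun y hy =>
      (F.contDiffAt_symm hy (hL _ (hFV _ (F.map_target hy)))
        (hYs _ (hFV _ (F.map_target hy)))).contDiffWithinAt
  have he' : e.trans F ∈ IsManifold.maximalAtlas (𝓡 4) ∞ M := by
    refine (e.trans F).mem_maximalAtlas_of_contMDiffOn ?_ ?_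
    · exact hF.comp ((contMDiffOn_of_mem_maximalAtlas he).mono fun x hx => hx.1) fun x hx => hx.2
    · exact (contMDiffOn_symm_of_mem_maximalAtlas he).comp (hFs.mono fun y hy => hy.1)
        fun y hy => hy.2
  refine ⟨e.trans F, he', ⟨hp, hpF⟩, rfl, fun y hy => ?_, fun y hy => ?_⟩
  · have h1 := hY.maps _ (hFV _ (F.map_target hy.1))
    have h2 : Y (F.symm y) = y := F.right_inv hy.1
    rwa [h2] at h1
  · set z := F.symm y with hz
    have hzt : z ∈ e.target := hy.2
    have hzF : z ∈ F.source := F.map_target hy.1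
    have hzV : z ∈ V := hFV _ hzF
    have hYz : Y z = y := F.right_inv hy.1
    have hz' : e.symm z ∈ (e.trans F).source := ⟨e.map_target hzt, by
      change e (e.symm z) ∈ F.source
      rwa [e.right_inv hzt]⟩
    have h1 : (e.trans F) ∘ e.symm =ᶠ[nhds z] Y := by
      filter_upwards [e.open_target.mem_nhds hzt] with w hw
      exact congrArg Y (e.right_inv hw)
    have hy' : (e.trans F) (e.symm z) = y := h1.self_of_nhds.trans hYz
    have hG := localMetric_transition (g := g) he he' hzt hz'
    have hK := localEndo_transition (K := K) he he' hzt hz'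
    rw [hy', h1.fderiv_eq] at hG hK
    exact (hA z hzV).of_pullback (hsurj z hzV) (fun a v => by rw [← hY.pull z hzV, hYz]) hG hK

end Charts

/-! ### The normal forms of the branches -/

section Branches

universe v

variable {M : Type v} [TopologicalSpace M] [ChartedSpace E4 M] [IsManifold (𝓡 4) ∞ M]
  {g : ∀ x : M, TangentSpace (𝓡 4) x →L[ℝ] TangentSpace (𝓡 4) x →L[ℝ] ℝ}
  {K : ∀ x : M, TangentSpace (𝓡 4) x →L[ℝ] TangentSpace (𝓡 4) x}
  {e : OpenPartialHomeomorph M E4} {θ : FormQuad} {p : M}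

/-- The restriction of a chart to an open subset of its target. -/
theorem restr_target_mem_maximalAtlas (he : e ∈ IsManifold.maximalAtlas (𝓡 4) ∞ M)
    (V : Opens E4) : (e.symm.restrOpen V V.isOpen).symm ∈ IsManifold.maximalAtlas (𝓡 4) ∞ M := by
  refine OpenPartialHomeomorph.mem_maximalAtlas_of_contMDiffOn _ ?_ ?_
  · exact (contMDiffOn_of_mem_maximalAtlas he).mono fun x hx => hx.1
  · exact (contMDiffOn_symm_of_mem_maximalAtlas he).mono fun x hx => hx.1

theorem IsPKE.isPKEOn (hg : IsPKE g K) (he : e ∈ IsManifold.maximalAtlas (𝓡 4) ∞ M)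
    {V : Opens E4} (hV : (V : Set E4) ⊆ e.target) :
    IsPKEOn V (localMetric g e) (localEndo K e) := by
  have h := hg _ (restr_target_mem_maximalAtlas he V)
  have h2 : (e.symm.restrOpen V V.isOpen).symm.target = V := Set.inter_eq_right.2 hV
  rw [h2] at h
  exact h

/-- A ball in the target of a chart. -/
theorem exists_ball {M : Type v} [TopologicalSpace M] {e : OpenPartialHomeomorph M E4} {p : M}
    (hp : p ∈ e.source) : ∃ U : Opens E4, (U : Set E4) ⊆ e.target ∧ e p ∈ U ∧
      Convex ℝ (U : Set E4) := by
  obtain ⟨ε, hε, h⟩ := Metric.isOpen_iff.1 e.open_target _ (e.map_source hp)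
  exact ⟨⟨Metric.ball (e p) ε, Metric.isOpen_ball⟩, h, Metric.mem_ball_self hε, convex_ball _ _⟩

/-- In the first branch, the diagonal change of the coframe with factors `J₄` and `J₂` normalizes
`J₂ = J₄ = 1`. -/
theorem hasNormalFormAt_of_generic (hg : IsPKE g K) (hS : HasNonzeroScal g)
    (he : e ∈ IsManifold.maximalAtlas (𝓡 4) ∞ M) (hp : p ∈ e.source)
    (hθ : IsReducedCoframeOn e.target (localMetric g e) (localEndo K e) θ)
    (h2 : ∀ y ∈ e.target, J2 (localMetric g e) θ y ≠ 0)
    (h4 : ∀ y ∈ e.target, J4 (localMetric g e) θ y ≠ 0) :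
    ∃ k₁ k₂ k₃ k₄ s : ℝ, k₄ ≠ 0 ∧ s ≠ 0 ∧
      HasNormalFormAt g K p domainNe (genericCoframe k₁ k₂ k₃ k₄ s) s 1 1 := by
  obtain ⟨U, hU, hpU, hUc⟩ := exists_ball hp
  have hgU := hg.isPKEOn he hU
  have hθU : IsReducedCoframeOn U _ _ θ := hθ.mono hU
  obtain ⟨hs2, hs4⟩ := hθU.contDiffOn_J
  obtain ⟨hr, hJ⟩ := hθU.changeDiag hgU hs4 hs2 (fun x hx => h4 x (hU hx)) fun x hx => h2 x (hU hx)
  obtain ⟨k₁, k₂, k₃, k₄, s, hk, hs, Y, hY⟩ := exists_pullsBack_generic hr hgU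
    (fun x hx => hS e he x (hU hx)) hUc
    (fun x hx => by rw [(hJ x hx).1, inv_mul_cancel₀ (h2 x (hU hx))])
    (fun x hx => by rw [(hJ x hx).2, inv_mul_cancel₀ (h4 x (hU hx))]) hpU
  obtain ⟨e', he', hp', -, hD, hA⟩ := exists_chart_of_pullsBack he hp hpU hr.adapted hY
  exact ⟨k₁, k₂, k₃, k₄, s, hk, hs,
    (isModel_generic k₁ k₂ k₃ k₄ s hk).hasNormalFormAt hg he' hp' hD hA⟩

/-- In the second branch, the diagonal change of the coframe with factors `1` and `J₂` normalizes
`J₂ = 1`. The conclusion is in terms of adapted coframes so that it applies to the third branch too. -/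
theorem exists_chart_special (hg : IsPKE g K) (hS : HasNonzeroScal g)
    (he : e ∈ IsManifold.maximalAtlas (𝓡 4) ∞ M) (hp : p ∈ e.source)
    (hθ : IsReducedCoframeOn e.target (localMetric g e) (localEndo K e) θ)
    (h2 : ∀ y ∈ e.target, J2 (localMetric g e) θ y ≠ 0)
    (h4 : ∀ y ∈ e.target, J4 (localMetric g e) θ y = 0) :
    ∃ k₁ k₂ s : ℝ, k₁ ≠ 0 ∧ s ≠ 0 ∧ ∃ e' ∈ IsManifold.maximalAtlas (𝓡 4) ∞ M, p ∈ e'.source ∧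
      e'.target ⊆ domainNe ∧ ∀ y ∈ e'.target,
        IsAdapted (localMetric g e' y) (localEndo K e' y) (specialCoframe k₁ k₂ s y) := by
  obtain ⟨U, hU, hpU, hUc⟩ := exists_ball hp
  have hgU := hg.isPKEOn he hU
  have hθU : IsReducedCoframeOn U _ _ θ := hθ.mono hU
  obtain ⟨hs2, -⟩ := hθU.contDiffOn_J
  obtain ⟨hr, hJ⟩ := hθU.changeDiag hgU (p := fun _ => 1) contDiffOn_const hs2
    (fun _ _ => one_ne_zero) fun x hx => h2 x (hU hx)
  obtain ⟨k₁, k₂, s, hk, hs, V, hV, hpV, θ', hA', Y, hY⟩ := exists_pullsBack_special hr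
    (fun V hV => hg.isPKEOn he (fun z hz => hU (hV hz)))
    (fun x hx => hS e he x (hU hx)) hUc
    (fun x hx => by rw [(hJ x hx).1, inv_mul_cancel₀ (h2 x (hU hx))])
    (fun x hx => by rw [(hJ x hx).2, h4 x (hU hx), mul_zero]) hpU
  obtain ⟨e', he', hp', -, hD, hA⟩ :=
    exists_chart_of_pullsBack he hp hpV hA' hY
  exact ⟨k₁, k₂, s, hk, hs, e', he', hp', hD, hA⟩

/-- In the fourth branch the coordinates of the normal form can be centred at any point. -/
theorem exists_chart_homogeneous (hg : IsPKE g K) (hS : HasNonzeroScal g)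
    (he : e ∈ IsManifold.maximalAtlas (𝓡 4) ∞ M) (hp : p ∈ e.source)
    (hθ : IsReducedCoframeOn e.target (localMetric g e) (localEndo K e) θ)
    (h2 : ∀ y ∈ e.target, J2 (localMetric g e) θ y = 0)
    (h4 : ∀ y ∈ e.target, J4 (localMetric g e) θ y = 0) :
    ∃ s : ℝ, s ≠ 0 ∧ ∃ e' ∈ IsManifold.maximalAtlas (𝓡 4) ∞ M, p ∈ e'.source ∧ e' p = 0 ∧
      e'.target ⊆ domainHom s ∧ ∀ y ∈ e'.target,
        IsAdapted (localMetric g e' y) (localEndo K e' y) (homogeneousCoframe s y) := by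
  obtain ⟨U, hU, hpU, hUc⟩ := exists_ball hp
  have hgU := hg.isPKEOn he hU
  have hθU : IsReducedCoframeOn U _ _ θ := hθ.mono hU
  obtain ⟨s, hs, V, hV, hpV, θ', hA', Y, hY, hY0⟩ := exists_pullsBack_homogeneous hθU hgU
    (fun x hx => hS e he x (hU hx)) hUc (fun x hx => h2 x (hU hx)) (fun x hx => h4 x (hU hx)) hpU
  obtain ⟨e', he', hp', hpe, hD, hA⟩ :=
    exists_chart_of_pullsBack he hp hpV hA' hY
  exact ⟨s, hs, e', he', hp', hpe.trans hY0, hD, hA⟩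

theorem exists_normalForm_branch₁ (hg : IsPKE g K) (hS : HasNonzeroScal g) (hp : p ∈ branch₁ g K) :
    ∃ k₁ k₂ k₃ k₄ s : ℝ, k₄ ≠ 0 ∧ s ≠ 0 ∧
      HasNormalFormAt g K p domainNe (genericCoframe k₁ k₂ k₃ k₄ s) s 1 1 := by
  obtain ⟨e, he, hpe, θ, hθ, hJ⟩ := hp
  exact hasNormalFormAt_of_generic hg hS he hpe hθ (fun y hy => (hJ y hy).1) fun y hy => (hJ y hy).2

theorem exists_normalForm_branch₂ (hg : IsPKE g K) (hS : HasNonzeroScal g) (hp : p ∈ branch₂ g K) :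
    ∃ k₁ k₂ s : ℝ, k₁ ≠ 0 ∧ s ≠ 0 ∧
      HasNormalFormAt g K p domainNe (specialCoframe k₁ k₂ s) s 1 0 := by
  obtain ⟨e, he, hpe, θ, hθ, hJ⟩ := hp
  obtain ⟨k₁, k₂, s, hk, hs, e', he', hp', hD, hA⟩ := exists_chart_special hg hS he hpe hθ
    (fun y hy => (hJ y hy).1) fun y hy => (hJ y hy).2
  exact ⟨k₁, k₂, s, hk, hs, (isModel_special k₁ k₂ s hk).hasNormalFormAt hg he' hp' hD hA⟩

/-- Switching `θ¹ ↔ θ²` and `θ³ ↔ θ⁴` exchanges `J₂` and `J₄`, hence the third and the second branch. -/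
theorem exists_normalForm_branch₃ (hg : IsPKE g K) (hS : HasNonzeroScal g) (hp : p ∈ branch₃ g K) :
    ∃ k₁ k₂ s : ℝ, k₁ ≠ 0 ∧ s ≠ 0 ∧
      HasNormalFormAt g K p domainNe (swapCoframe (specialCoframe k₁ k₂ s)) s 0 1 := by
  obtain ⟨e, he, hpe, θ, hθ, hJ⟩ := hp
  obtain ⟨k₁, k₂, s, hk, hs, e', he', hp', hD, hA⟩ := exists_chart_special hg hS he hpe
    (IsReducedCoframeOn.swap (U := ⟨e.target, e.open_target⟩) hθ (hg e he)) (fun y hy => by rw [J2_swap]; exact (hJ y hy).2)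
    fun y hy => by rw [J4_swap]; exact (hJ y hy).1
  exact ⟨k₁, k₂, s, hk, hs, (isModel_special k₁ k₂ s hk).swap.hasNormalFormAt hg he' hp' hD
    fun y hy => (hA y hy).swap⟩

theorem exists_normalForm_branch₄ (hg : IsPKE g K) (hS : HasNonzeroScal g) (hp : p ∈ branch₄ g K) :
    ∃ s : ℝ, s ≠ 0 ∧ HasNormalFormAt g K p (domainHom s) (homogeneousCoframe s) s 0 0 := by
  obtain ⟨e, he, hpe, θ, hθ, hJ⟩ := hp
  obtain ⟨s, hs, e', he', hp', -, hD, hA⟩ := exists_chart_homogeneous hg hS he hpe hθ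
    (fun y hy => (hJ y hy).1) fun y hy => (hJ y hy).2
  exact ⟨s, hs, (isModel_homogeneous s hs).hasNormalFormAt hg he' hp' hD hA⟩

/-- Reduced coframes exist near every point. -/
theorem exists_reduced_chart (hg : IsPKE g K) (hD : IsRealTypeD g K) (p : M) :
    ∃ e ∈ IsManifold.maximalAtlas (𝓡 4) ∞ M, p ∈ e.source ∧
      ∃ θ, IsReducedCoframeOn e.target (localMetric g e) (localEndo K e) θ := by
  have he : chartAt E4 p ∈ IsManifold.maximalAtlas (𝓡 4) ∞ M :=
    IsManifold.chart_mem_maximalAtlas p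
  have hp := mem_chart_source E4 p
  let U : Opens E4 := ⟨(chartAt E4 p).target, (chartAt E4 p).open_target⟩
  obtain ⟨V, hV, hpV, θ, hθ⟩ := exists_isReducedCoframeOn (U := U)
    (fun V hV => hg.isPKEOn he hV) (hD _ he) ((chartAt E4 p).map_source hp)
  refine ⟨_, restr_target_mem_maximalAtlas he V, ⟨hp, hpV⟩, θ, ?_⟩
  exact hθ.mono fun z hz => hz.2

end Branches

/-! ### The branches are open, and their union is dense -/

section Density

universe v

variable {M : Type v} [TopologicalSpace M] [ChartedSpace E4 M]
  {g : ∀ x : M, TangentSpace (𝓡 4) x →L[ℝ] TangentSpace (𝓡 4) x →L[ℝ] ℝ}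
  {K : ∀ x : M, TangentSpace (𝓡 4) x →L[ℝ] TangentSpace (𝓡 4) x}

theorem isOpen_branch (P : ℝ → ℝ → Prop) : IsOpen (branch g K P) :=
  isOpen_iff_mem_nhds.2 fun _ ⟨e, he, hp, θ, hθ, hJ⟩ =>
    Filter.mem_of_superset (e.open_source.mem_nhds hp) fun _ hq => ⟨e, he, hq, θ, hθ, hJ⟩

/-- A continuous function is nowhere zero, or zero, on a smaller open set. -/
theorem exists_open_dichotomy {W : Opens E4} (hW : (W : Set E4).Nonempty) {f : E4 → ℝ}
    (hf : ContinuousOn f W) : ∃ V ≤ W, (V : Set E4).Nonempty ∧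
      ((∀ z ∈ V, f z ≠ 0) ∨ ∀ z ∈ V, f z = 0) := by
  by_cases h : ∃ z ∈ W, f z ≠ 0
  · obtain ⟨z, hz, hz0⟩ := h
    exact ⟨⟨W ∩ f ⁻¹' {0}ᶜ, hf.isOpen_inter_preimage W.isOpen isOpen_compl_singleton⟩,
      fun _ h => h.1, ⟨z, hz, hz0⟩, Or.inl fun _ h => h.2⟩
  · push Not at h
    exact ⟨W, le_rfl, hW, Or.inr h⟩

variable [IsManifold (𝓡 4) ∞ M]

/-- In a reduced coframe, `J₂` and `J₄` are continuous, so each of them is nowhere zero or vanishes on a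
suitable smaller open set. -/
theorem dense_branches (hg : IsPKE g K) (hD : IsRealTypeD g K) :
    Dense (branch₁ g K ∪ branch₂ g K ∪ branch₃ g K ∪ branch₄ g K) := by
  refine dense_iff_inter_open.2 fun O hO ⟨p, hp⟩ => ?_
  obtain ⟨e, he, hpe, θ, hθ⟩ := exists_reduced_chart hg hD p
  obtain ⟨hc2, hc4⟩ := IsReducedCoframeOn.contDiffOn_J (U := ⟨e.target, e.open_target⟩) hθ
  let W : Opens E4 := ⟨e.target ∩ e.symm ⁻¹' O, e.isOpen_inter_preimage_symm hO⟩
  have hW : (W : Set E4).Nonempty := ⟨e p, e.map_source hpe, by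
    rw [Set.mem_preimage, e.left_inv hpe]; exact hp⟩
  obtain ⟨V, hV, hVn, h2⟩ := exists_open_dichotomy hW (hc2.continuousOn.mono fun _ h => h.1)
  obtain ⟨V', hV', ⟨z, hz⟩, h4⟩ := exists_open_dichotomy hVn
    (hc4.continuousOn.mono fun _ h => (hV h).1)
  have hzW := hV (hV' hz)
  have key {P : ℝ → ℝ → Prop} (hP : ∀ y ∈ V', P (J2 (localMetric g e) θ y) (J4 (localMetric g e) θ y)) :
      e.symm z ∈ branch g K P :=
    ⟨_, restr_target_mem_maximalAtlas he V', ⟨e.map_target hzW.1, by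
      change e (e.symm z) ∈ V'
      rwa [e.right_inv hzW.1]⟩, θ, hθ.mono fun _ h => h.1, fun y hy => hP y hy.2⟩
  refine ⟨e.symm z, hzW.2, ?_⟩
  rcases h2 with h2 | h2 <;> rcases h4 with h4 | h4
  · exact Or.inl (Or.inl (Or.inl (key fun y hy => ⟨h2 y (hV' hy), h4 y hy⟩)))
  · exact Or.inl (Or.inl (Or.inr (key fun y hy => ⟨h2 y (hV' hy), h4 y hy⟩)))
  · exact Or.inl (Or.inr (key fun y hy => ⟨h2 y (hV' hy), h4 y hy⟩))
  · exact Or.inr (key fun y hy => ⟨h2 y (hV' hy), h4 y hy⟩)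

end Density

/-! ### Homogeneity of the fourth branch -/

section Transition

universe v

variable {M : Type v} [TopologicalSpace M] [ChartedSpace E4 M]
  {g : ∀ x : M, TangentSpace (𝓡 4) x →L[ℝ] TangentSpace (𝓡 4) x →L[ℝ] ℝ}
  {K : ∀ x : M, TangentSpace (𝓡 4) x →L[ℝ] TangentSpace (𝓡 4) x}
  {e e' : OpenPartialHomeomorph M E4}

/-- The pull-back of a coframe. -/
def pullCoframe (h : E4 → E4) (θ : FormQuad) : FormQuad := fun z a => (θ (h z) a).comp (fderiv ℝ h z)

/-- The domain of the transition map from `e` to `e'`. -/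
def transDomain (e e' : OpenPartialHomeomorph M E4) : Opens E4 :=
  ⟨e.target ∩ e.symm ⁻¹' e'.source, e.isOpen_inter_preimage_symm e'.open_source⟩

/-- A reduced coframe, in another chart. -/
theorem pullsBack_transition (he : e ∈ IsManifold.maximalAtlas (𝓡 4) ∞ M)
    (he' : e' ∈ IsManifold.maximalAtlas (𝓡 4) ∞ M)
    (hg : IsPKEOn (transDomain e e') (localMetric g e) (localEndo K e))
    {V : Opens E4} (hV : (V : Set E4) = e'.target)
    (hg' : IsPKEOn V (localMetric g e') (localEndo K e')) {θ : FormQuad}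
    (hθ : IsReducedCoframeOn V (localMetric g e') (localEndo K e') θ) :
    IsReducedCoframeOn (transDomain e e') (localMetric g e) (localEndo K e)
        (pullCoframe (e' ∘ e.symm) θ) ∧
      PullsBack (transDomain e e') V θ (pullCoframe (e' ∘ e.symm) θ) (e' ∘ e.symm) := by
  set h := e' ∘ e.symm
  have hs : ContDiffOn ℝ ∞ h (transDomain e e') := contMDiffOn_iff_contDiffOn.1
    ((contMDiffOn_of_mem_maximalAtlas he').comp
      ((contMDiffOn_symm_of_mem_maximalAtlas he).mono fun _ hz => hz.1) fun _ hz => hz.2)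
  have hm (z) (hz : z ∈ transDomain e e') : h z ∈ (V : Set E4) := by
    rw [hV]; exact e'.map_source hz.2
  have hY : PullsBack (transDomain e e') V θ (pullCoframe h θ) h := ⟨hs, hm, fun _ _ _ _ => rfl⟩
  have hi (z) (hz : z ∈ transDomain e e') : Function.Injective (fderiv ℝ h z) := by
    intro v w hvw
    rw [fderiv_transition he he' hz.1 hz.2] at hvw
    have h1 := congrArg (dSymm e' (e' (e.symm z))) hvw
    simp only [ContinuousLinearMap.comp_apply, dSymm_dChart he' hz.2] at h1
    rw [← dChart_dSymm he hz.1 v, h1, dChart_dSymm he hz.1]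
  have hA : IsAdaptedOn (transDomain e e') (localMetric g e) (localEndo K e) (pullCoframe h θ) := by
    refine ⟨fun a => ((hθ.smooth a).comp hs hm).clm_comp
      (hs.fderiv_of_isOpen (transDomain e e').isOpen (by simp)), fun z hz => ?_⟩
    have hA' := hθ.adapted (h z) (hm z hz)
    have hG := localMetric_transition (g := g) he he' hz.1 hz.2
    have hK := localEndo_transition (K := K) he he' hz.1 hz.2
    have hsurj : Function.Surjective (fderiv ℝ h z) :=
      (LinearMap.injective_iff_surjective (f := (fderiv ℝ h z).toLinearMap)).1 (hi z hz)
    refine ⟨?_, fun v w => ?_, fun v => ?_, fun v => ?_, fun v => ?_, fun v => ?_⟩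
    · choose b hb using fun a => hsurj (dualVec (θ (h z)) a)
      refine linearIndependent_of_dual (e := b) fun a c => ?_
      change θ (h z) a (fderiv ℝ h z (b c)) = _
      rw [hb, apply_dualVec hA'.indep]
    · rw [← hG v w]
      exact hA'.metric _ _
    · exact (congrArg (θ (h z) 0) (hK v)).symm.trans (hA'.endo₀ _)
    · exact (congrArg (θ (h z) 1) (hK v)).symm.trans (hA'.endo₁ _)
    · exact (congrArg (θ (h z) 2) (hK v)).symm.trans (hA'.endo₂ _)
    · exact (congrArg (θ (h z) 3) (hK v)).symm.trans (hA'.endo₃ _)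
  exact ⟨hY.isReducedCoframeOn hA hg hθ hg', hY⟩

theorem IsAdapted.endo_eq {G G' : E4 →L[ℝ] E4 →L[ℝ] ℝ} {k k' : E4 →L[ℝ] E4}
    {η : Fin 4 → E4 →L[ℝ] ℝ} (h : IsAdapted G k η) (h' : IsAdapted G' k' η) : k = k' := by
  ext1 v
  rw [← sum_smul_dualVec h.indep (k v), ← sum_smul_dualVec h.indep (k' v)]
  simp only [h.apply_endo, h'.apply_endo]

variable [IsManifold (𝓡 4) ∞ M]

/-- The set of the points near which the structure is the member of the fourth family with
parameter `s`. -/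
def homogeneousLocus (g : ∀ x : M, TangentSpace (𝓡 4) x →L[ℝ] TangentSpace (𝓡 4) x →L[ℝ] ℝ)
    (K : ∀ x : M, TangentSpace (𝓡 4) x →L[ℝ] TangentSpace (𝓡 4) x) (s : ℝ) : Set M :=
  {p | HasNormalFormAt g K p (domainHom s) (homogeneousCoframe s) s 0 0}

/-- The parameter of the fourth family is determined by the scalar curvature. -/
theorem parameter_unique (hg : IsPKE g K) {s s' : ℝ} {p : M} (h : p ∈ homogeneousLocus g K s)
    (h' : p ∈ homogeneousLocus g K s') : s = s' := by
  obtain ⟨e, he, hp, -, hr, hs⟩ := h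
  obtain ⟨e', he', hp', -, hr', hs'⟩ := h'
  let V : Opens E4 := ⟨e'.target, e'.open_target⟩
  let W : Opens E4 := ⟨e.target, e.open_target⟩
  have hgV : IsPKEOn V (localMetric g e') (localEndo K e') := hg e' he'
  have hgW : IsPKEOn W (localMetric g e) (localEndo K e) := hg e he
  have hrV : IsReducedCoframeOn V (localMetric g e') (localEndo K e') (homogeneousCoframe s') := hr'
  have hrW : IsReducedCoframeOn W (localMetric g e) (localEndo K e) (homogeneousCoframe s) := hr
  have hgT : IsPKEOn (transDomain e e') (localMetric g e) (localEndo K e) :=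
    hg.isPKEOn he fun _ hz => hz.1
  obtain ⟨hrT, hY⟩ := pullsBack_transition he he' hgT (V := V) rfl hgV hrV
  have hz : e p ∈ transDomain e e' := ⟨e.map_source hp, by
    rw [Set.mem_preimage, e.left_inv hp]; exact hp'⟩
  have h1 := (hY.psi_eq hrT.isAdaptedOn hgT hrV.isAdaptedOn hgV ⟨e p, hz⟩).2.2.2.2.2
  have h2 := (hrW.isAdaptedOn.ev_rF_eq hgW ⟨e p, e.map_source hp⟩).2
  have hpe : (e' ∘ e.symm) (e p) = e' p := congrArg e' (e.left_inv hp)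
  have h3 := (hrV.isAdaptedOn.ev_rF_eq hgV ⟨e' p, e'.map_source hp'⟩).2
  rw [(hs _ (e.map_source hp)).1] at h2
  rw [(hs' _ (e'.map_source hp')).1] at h3
  exact h2.trans (h1.trans
    ((congrArg (fun y => -scalarCurv (localMetric g e') y / 12) hpe).trans h3.symm))

/-- Any two points of the fourth branch are the centres of charts in which the coframe of the same
member of the fourth family is adapted; the parameter is locally constant, hence constant. -/
theorem isHomogeneousPair_of_branch₄ [ConnectedSpace M] (hg : IsPKE g K) (hS : HasNonzeroScal g)
    (hB : ∀ p : M, p ∈ branch₄ g K) : IsHomogeneousPair g K := by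
  have key (p : M) : ∃ s : ℝ, s ≠ 0 ∧ ∃ e ∈ IsManifold.maximalAtlas (𝓡 4) ∞ M, p ∈ e.source ∧
      e p = 0 ∧ e.target ⊆ domainHom s ∧ ∀ y ∈ e.target,
        IsAdapted (localMetric g e y) (localEndo K e y) (homogeneousCoframe s y) := by
    obtain ⟨e, he, hpe, θ, hθ, hJ⟩ := hB p
    exact exists_chart_homogeneous hg hS he hpe hθ (fun y hy => (hJ y hy).1) fun y hy => (hJ y hy).2
  choose s hs0 e he hpe hp0 hD hA using key
  have hL (p q : M) (hq : q ∈ (e p).source) : q ∈ homogeneousLocus g K (s p) :=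
    (isModel_homogeneous _ (hs0 p)).hasNormalFormAt hg (he p) hq (hD p) (hA p)
  have hloc : IsLocallyConstant s := (IsLocallyConstant.iff_eventually_eq s).2 fun p => by
    filter_upwards [(e p).open_source.mem_nhds (hpe p)] with q hq
    exact parameter_unique hg (hL q q (hpe q)) (hL p q hq)
  intro p q
  have hsq : s p = s q := hloc.apply_eq_of_preconnectedSpace p q
  have hAq := hA q
  rw [← hsq] at hAq
  set φ := (e p).trans (e q).symm with hφ
  have hφp : φ p = q := by
    change (e q).symm (e p p) = q
    rw [hp0, ← hp0 q, (e q).left_inv (hpe q)]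
  have hq0 : e p p ∈ (e q).target := by
    rw [hp0, ← hp0 q]
    exact (e q).map_source (hpe q)
  have hd {x : M} (hx : x ∈ φ.source) (v : E4) :
      (mfderiv (𝓡 4) (𝓡 4) φ x : E4 →L[ℝ] E4) v = dSymm (e q) (e p x) (dChart (e p) x v) :=
    congrArg (fun L : E4 →L[ℝ] E4 => L v) (mfderiv_comp x
      (mdifferentiableAt_chart_symm (he q) hx.2) (mdifferentiableAt_chart (he p) hx.1))
  have hG {x : M} (hx : x ∈ φ.source) (v w : E4) :
      metricAt g (φ x) (dSymm (e q) (e p x) (dChart (e p) x v))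
        (dSymm (e q) (e p x) (dChart (e p) x w)) = metricAt g x v w := by
    have h1 := (hAq (e p x) hx.2).metric (dChart (e p) x v) (dChart (e p) x w)
    rw [← (hA p (e p x) ((e p).map_source hx.1)).metric, localMetric_apply, localMetric_apply,
      (e p).left_inv hx.1, dSymm_dChart (he p) hx.1, dSymm_dChart (he p) hx.1] at h1
    exact h1
  have hK {x : M} (hx : x ∈ φ.source) (v : E4) : dSymm (e q) (e p x) (dChart (e p) x (endoAt K x v))
      = endoAt K (φ x) (dSymm (e q) (e p x) (dChart (e p) x v)) := by
    have h1 := congrArg (fun k : E4 →L[ℝ] E4 => dSymm (e q) (e p x) (k (dChart (e p) x v)))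
      ((hAq (e p x) hx.2).endo_eq (hA p (e p x) ((e p).map_source hx.1)))
    have h2 := dSymm_dChart (he q) ((e q).map_target hx.2)
    rw [(e q).right_inv hx.2] at h2
    simp only [localEndo_apply] at h1
    rw [(e p).left_inv hx.1, dSymm_dChart (he p) hx.1] at h1
    exact h1.symm.trans (h2 _)
  refine ⟨φ, ⟨hpe p, hq0⟩, hφp, ⟨?_, ?_, fun x hx v w => ?_⟩, fun x hx v => ?_⟩
  · exact (contMDiffOn_symm_of_mem_maximalAtlas (he q)).comp
      ((contMDiffOn_of_mem_maximalAtlas (he p)).mono fun x hx => hx.1) fun x hx => hx.2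
  · exact (contMDiffOn_symm_of_mem_maximalAtlas (he p)).comp
      ((contMDiffOn_of_mem_maximalAtlas (he q)).mono fun x hx => hx.1) fun x hx => hx.2
  · exact (congrArg₂ (fun a b => metricAt g (φ x) a b) (hd hx v) (hd hx w)).trans (hG hx v w)
  · exact ((hd hx _).trans (hK hx v)).trans (congrArg (endoAt K (φ x)) (hd hx v)).symm

end Transition

/-! ### The square of the curvature tensor -/

section Square

/-- The 4-tensor with components `r`. -/
def tensorEval (r : Fin 4 → Fin 4 → Fin 4 → Fin 4 → ℝ) (X Y Z W : E4) : ℝ :=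
  ∑ a, ∑ b, ∑ c, ∑ d, r a b c d * X a * Y b * Z c * W d

/-- The full contraction of a 4-tensor with itself, where each index has its own null frame. -/
def tensorSq (r : Fin 4 → Fin 4 → Fin 4 → Fin 4 → ℝ) (E₁ E₂ E₃ E₄ : Fin 4 → E4) : ℝ :=
  ∑ a, ∑ b, ∑ c, ∑ d, tensorEval r (E₁ a) (E₂ b) (E₃ c) (E₄ d)
    * tensorEval r (E₁ (a + 2)) (E₂ (b + 2)) (E₃ (c + 2)) (E₄ (d + 2))

variable {r : Fin 4 → Fin 4 → Fin 4 → Fin 4 → ℝ}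

theorem tensorEval_rotate (X Y Z W : E4) :
    tensorEval r X Y Z W = tensorEval (fun b c d a => r a b c d) Y Z W X := by
  rw [tensorEval, sum_rotate]
  exact Finset.sum_congr rfl fun b _ => Finset.sum_congr rfl fun c _ =>
    Finset.sum_congr rfl fun d _ => Finset.sum_congr rfl fun a _ => by ring

theorem tensorEval_linear (Y Z W : E4) : ∃ k : Fin 4 → ℝ, ∀ X, tensorEval r X Y Z W = ∑ i, X i * k i :=
  ⟨fun a => ∑ b, ∑ c, ∑ d, r a b c d * Y b * Z c * W d, fun X => by
    simp only [tensorEval, Finset.mul_sum]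
    exact Finset.sum_congr rfl fun a _ => Finset.sum_congr rfl fun b _ =>
      Finset.sum_congr rfl fun c _ => Finset.sum_congr rfl fun d _ => by ring⟩

/-- Two frames that are null for the same metric have the same contraction. -/
theorem sum_mul_eq_of_contraction {E E' : Fin 4 → E4}
    (hE : ∀ i j, ∑ a, E a i * E (a + 2) j = ∑ a, E' a i * E' (a + 2) j) (k l : Fin 4 → ℝ) :
    ∑ a, (∑ i, E a i * k i) * ∑ j, E (a + 2) j * l j
      = ∑ a, (∑ i, E' a i * k i) * ∑ j, E' (a + 2) j * l j := by
  have key (F : Fin 4 → E4) : ∑ a, (∑ i, F a i * k i) * ∑ j, F (a + 2) j * l j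
      = ∑ i, ∑ j, k i * l j * ∑ a, F a i * F (a + 2) j := by
    simp only [Finset.sum_mul, Finset.mul_sum]
    rw [sum_rotate3, Finset.sum_comm]
    refine Finset.sum_congr rfl fun i _ => Finset.sum_congr rfl fun j _ =>
      Finset.sum_congr rfl fun a _ => by ring
  simp only [key, hE]

/-- The frame in the first slot is exchanged, and the slots are permuted cyclically; four applications
exchange all frames. -/
theorem tensorSq_rotate {E₁ E₁' : Fin 4 → E4}
    (hE : ∀ i j, ∑ a, E₁ a i * E₁ (a + 2) j = ∑ a, E₁' a i * E₁' (a + 2) j)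
    (E₂ E₃ E₄ : Fin 4 → E4) :
    tensorSq r E₁ E₂ E₃ E₄ = tensorSq (fun b c d a => r a b c d) E₂ E₃ E₄ E₁' := by
  rw [tensorSq, sum_rotate]
  refine Finset.sum_congr rfl fun b _ => Finset.sum_congr rfl fun c _ =>
    Finset.sum_congr rfl fun d _ => ?_
  obtain ⟨k, hk⟩ := tensorEval_linear (r := r) (E₂ b) (E₃ c) (E₄ d)
  obtain ⟨l, hl⟩ := tensorEval_linear (r := r) (E₂ (b + 2)) (E₃ (c + 2)) (E₄ (d + 2))
  simp only [← tensorEval_rotate, hk, hl]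
  exact sum_mul_eq_of_contraction hE k l

/-- The square of a tensor does not depend on the null frame. -/
theorem tensorSq_eq {E E' : Fin 4 → E4}
    (hE : ∀ i j, ∑ a, E a i * E (a + 2) j = ∑ a, E' a i * E' (a + 2) j) :
    tensorSq r E E E E = tensorSq r E' E' E' E' := by
  rw [tensorSq_rotate hE, tensorSq_rotate hE, tensorSq_rotate hE, tensorSq_rotate hE]

variable {U : Opens E4} {g : BilinField} {K : EndoField} {θ : FormQuad}

/-- The contraction in a null frame is the inverse metric. -/
theorem IsNullCoframeOn.sum_dual_mul_dual (h : IsNullCoframeOn U g θ) {x : E4} (hx : x ∈ U)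
    (i j : Fin 4) : ∑ a, dualVec (θ x) a i * dualVec (θ x) (a + 2) j = (gram g x)⁻¹ i j := by
  have hN : (nullMat ℝ)⁻¹ = nullMat ℝ := Matrix.inv_eq_left_inv (nullMat_mul_self ℝ)
  rw [h.gram_eq hx, Matrix.mul_inv_rev, Matrix.mul_inv_rev, hN, ← Matrix.transpose_nonsing_inv]
  simp only [dualVec_apply, Matrix.mul_apply, Matrix.transpose_apply, nullMat, Matrix.of_apply,
    Fin.sum_univ_four]
  simp

/-- The square of the curvature tensor of a reduced frame. -/
theorem curvTable_sq (ψ s : ℝ) : ∑ a, ∑ b, ∑ c, ∑ d, curvTable 0 0 ψ 0 0 s (a + 2) b c d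
    * curvTable 0 0 ψ 0 0 s (a + 2 + 2) (b + 2) (c + 2) (d + 2) = 24 * ψ ^ 2 + 48 * s ^ 2 := by
  simp only [Fin.sum_univ_four]
  simp [curvTable, glBlock, skewBlock]
  ring

theorem IsNullCoframeOn.tensorSq_eq (h : IsNullCoframeOn U g θ) (x : U) {ψ s : ℝ}
    (hr : ∀ a b c e, Sm.ev x (rF U g θ a b c e) = curvTable 0 0 ψ 0 0 s a b c e) :
    tensorSq (fun a b c d => riemannLow g a b c d x) (dualVec (θ x)) (dualVec (θ x))
      (dualVec (θ x)) (dualVec (θ x)) = 24 * ψ ^ 2 + 48 * s ^ 2 := by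
  have h1 (a b c e : Fin 4) : tensorEval (fun a b c d => riemannLow g a b c d x) (dualVec (θ x) a)
      (dualVec (θ x) b) (dualVec (θ x) c) (dualVec (θ x) e) = curvTable 0 0 ψ 0 0 s (a + 2) b c e :=
    (h.riemEval_dual x a b c e).trans (hr _ _ _ _)
  rw [tensorSq]
  simp only [h1]
  exact curvTable_sq ψ s

theorem IsReducedCoframeOn.ev_rF (h : IsReducedCoframeOn U g K θ) (hg : IsPKEOn U g K) (x : U)
    (a b c e : Fin 4) : Sm.ev x (IsNullCoframeOn.rF U g θ a b c e)
      = curvTable 0 0 (psi2 g θ x) 0 0 (-scalarCurv g x / 12) a b c e := by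
  rw [(h.isAdaptedOn.ev_rF_eq hg x).1, h.psi0_eq x x.2, h.psi1_eq x x.2, h.psi3_eq x x.2,
    h.psi4_eq x x.2]

end Square

/-! ### Homogeneous metrics -/

section Homogeneous

universe v

variable {M : Type v} [TopologicalSpace M] [ChartedSpace E4 M]
  {g : ∀ x : M, TangentSpace (𝓡 4) x →L[ℝ] TangentSpace (𝓡 4) x →L[ℝ] ℝ}
  {K : ∀ x : M, TangentSpace (𝓡 4) x →L[ℝ] TangentSpace (𝓡 4) x}
  {e : OpenPartialHomeomorph M E4} {φ : OpenPartialHomeomorph M M}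

/-- A local isometry followed by a chart is a chart with the same coordinate expression of the
metric. -/
theorem IsLocalIsometry.localMetric_eq (hφ : IsLocalIsometry g φ)
    (he : e ∈ IsManifold.maximalAtlas (𝓡 4) ∞ M) {y : E4} (hy : y ∈ (φ.trans e).target) :
    localMetric g (φ.trans e) y = localMetric g e y := by
  have hy1 : y ∈ e.target := hy.1
  have hy2 : e.symm y ∈ φ.target := hy.2
  have hds : MDifferentiableAt (𝓡 4) (𝓡 4) φ.symm (e.symm y) :=
    ((hφ.2.1 _ hy2).contMDiffAt (φ.open_target.mem_nhds hy2)).mdifferentiableAt (by simp)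
  have hx : φ.symm (e.symm y) ∈ φ.source := φ.map_target hy2
  have hd : MDifferentiableAt (𝓡 4) (𝓡 4) φ (φ.symm (e.symm y)) :=
    ((hφ.1 _ hx).contMDiffAt (φ.open_source.mem_nhds hx)).mdifferentiableAt (by simp)
  let A : E4 →L[ℝ] E4 := mfderiv (𝓡 4) (𝓡 4) φ.symm (e.symm y)
  let B : E4 →L[ℝ] E4 := mfderiv (𝓡 4) (𝓡 4) φ (φ.symm (e.symm y))
  have h1 : dSymm (φ.trans e) y = A.comp (dSymm e y) :=
    mfderiv_comp y hds (mdifferentiableAt_chart_symm he hy1)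
  have h2 (v : E4) : B (A v) = v := by
    have h3 : mfderiv (𝓡 4) (𝓡 4) (φ ∘ φ.symm) (e.symm y) = B.comp A := mfderiv_comp _ hd hds
    have h4 : φ ∘ φ.symm =ᶠ[nhds (e.symm y)] id := by
      filter_upwards [φ.open_target.mem_nhds hy2] with z hz using φ.right_inv hz
    rw [h4.mfderiv_eq, mfderiv_id] at h3
    exact (congrArg (fun L : E4 →L[ℝ] E4 => L v) h3).symm
  have h5 (v w : E4) : metricAt g (φ (φ.symm (e.symm y))) (B v) (B w)
      = metricAt g (φ.symm (e.symm y)) v w := hφ.2.2 _ hx v w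
  rw [φ.right_inv hy2] at h5
  ext v w
  rw [localMetric_apply, localMetric_apply, h1, ContinuousLinearMap.comp_apply,
    ContinuousLinearMap.comp_apply]
  change metricAt g (φ.symm (e.symm y)) _ _ = _
  rw [← h5, h2, h2]

variable [IsManifold (𝓡 4) ∞ M]

theorem IsLocalIsometry.trans_mem_maximalAtlas (hφ : IsLocalIsometry g φ)
    (he : e ∈ IsManifold.maximalAtlas (𝓡 4) ∞ M) :
    φ.trans e ∈ IsManifold.maximalAtlas (𝓡 4) ∞ M := by
  refine OpenPartialHomeomorph.mem_maximalAtlas_of_contMDiffOn _ ?_ ?_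
  · exact (contMDiffOn_of_mem_maximalAtlas he).comp (hφ.1.mono fun x hx => hx.1) fun x hx => hx.2
  · exact hφ.2.1.comp ((contMDiffOn_symm_of_mem_maximalAtlas he).mono fun x hx => hx.1)
      fun x hx => hx.2

/-- If local isometries act transitively, then `Ψ₂²` is constant, because it is determined by the
square of the curvature tensor. -/
theorem IsHomogeneousMetric.psi2_sq_eq (hH : IsHomogeneousMetric g) (hg : IsPKE g K)
    (he : e ∈ IsManifold.maximalAtlas (𝓡 4) ∞ M) {p : M} (hp : p ∈ e.source) {θ : FormQuad}
    (hθ : IsReducedCoframeOn e.target (localMetric g e) (localEndo K e) θ) {U : Opens E4}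
    (hU : (U : Set E4) ⊆ e.target) (hpU : e p ∈ U) {s : ℝ}
    (hs : ∀ z ∈ U, -scalarCurv (localMetric g e) z / 12 = s) {z : E4} (hz : z ∈ U) :
    psi2 (localMetric g e) θ z ^ 2 = psi2 (localMetric g e) θ (e p) ^ 2 := by
  obtain ⟨φ, hpφ, hφp, hφ⟩ := hH p (e.symm z)
  have he2 := hφ.trans_mem_maximalAtlas he
  have hφz : φ.symm (e.symm z) = p := by rw [← hφp, φ.left_inv hpφ]
  have hzT : z ∈ transDomain (φ.trans e) e := ⟨⟨hU hz, by
    change e.symm z ∈ φ.target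
    rw [← hφp]; exact φ.map_source hpφ⟩, by
    change φ.symm (e.symm z) ∈ e.source
    rwa [hφz]⟩
  let V : Opens E4 := ⟨e.target, e.open_target⟩
  have hgV : IsPKEOn V (localMetric g e) (localEndo K e) := hg e he
  have hθV : IsReducedCoframeOn V (localMetric g e) (localEndo K e) θ := hθ
  have hgU : IsPKEOn U (localMetric g e) (localEndo K e) := hg.isPKEOn he hU
  have hθU : IsReducedCoframeOn U (localMetric g e) (localEndo K e) θ := hθ.mono hU
  have hgT : IsPKEOn (transDomain (φ.trans e) e) (localMetric g (φ.trans e))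
      (localEndo K (φ.trans e)) := hg.isPKEOn he2 fun _ h => h.1
  obtain ⟨hT, hY⟩ := pullsBack_transition he2 he hgT (V := V) rfl hgV hθV
  have hYz : (e ∘ (φ.trans e).symm) z = e p := congrArg e hφz
  obtain ⟨-, -, h1, -, -, h2⟩ := hY.psi_eq hT.isAdaptedOn hgT hθV.isAdaptedOn hgV ⟨z, hzT⟩
  rw [show (e ∘ (φ.trans e).symm) (⟨z, hzT⟩ : transDomain (φ.trans e) e) = e p from hYz] at h1 h2
  rw [hs _ hpU] at h2
  let W : Opens E4 := transDomain (φ.trans e) e ⊓ U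
  have hn := hθU.isAdaptedOn.null
  have hnW : IsNullCoframeOn W (localMetric g (φ.trans e)) θ :=
    ⟨fun a => (hn.smooth a).mono fun _ h => h.2, fun x hx => hn.indep x hx.2, fun x hx => by
      rw [hφ.localMetric_eq he hx.1.1]; exact hn.metric x hx.2⟩
  have hid : PullsBack W U θ θ id := ⟨contDiffOn_id, fun _ h => h.2, fun _ _ _ _ => by simp⟩
  have hrW (w : W) (a b c d : Fin 4) :
      Sm.ev w (IsNullCoframeOn.rF W (localMetric g (φ.trans e)) θ a b c d)
        = curvTable 0 0 (psi2 (localMetric g e) θ w) 0 0 s a b c d := by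
    have h4 := congrArg (Sm.ev w) (hid.rF_comp hnW hn a b c d)
    have h6 := hθU.ev_rF hgU ⟨w, w.2.2⟩ a b c d
    have hw : (⟨id w, hid.maps w w.2⟩ : U) = ⟨w, w.2.2⟩ := rfl
    rw [Sm.ev_comp, hw] at h4
    rw [hs _ w.2.2] at h6
    exact h4.trans h6
  have h3 := hnW.tensorSq_eq ⟨z, hzT, hz⟩ (hrW ⟨z, hzT, hz⟩)
  have h5 := hT.isAdaptedOn.null.tensorSq_eq ⟨z, hzT⟩ (ψ := psi2 (localMetric g e) θ (e p)) (s := s)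
    fun a b c d => by
      rw [hT.ev_rF hgT, h1, h2]
  rw [tensorSq_eq (E' := dualVec (pullCoframe (e ∘ (φ.trans e).symm) θ z)) fun i j => by
    rw [hnW.sum_dual_mul_dual ⟨hzT, hz⟩, hT.isAdaptedOn.null.sum_dual_mul_dual hzT], h5] at h3
  linarith

/-- A homogeneous metric belongs to the fourth branch: since `Ψ₂` is constant, the Bianchi identity
`dΨ₂ = 3 Ψ₂ (-J₁ θ¹ + J₃ θ² + J₄ θ³ + J₂ θ⁴)` shows that `J₂ = J₄ = 0`. -/
theorem mem_branch₄_of_isHomogeneousMetric (hg : IsPKE g K) (hD : IsRealTypeD g K)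
    (hH : IsHomogeneousMetric g) (p : M) : p ∈ branch₄ g K := by
  obtain ⟨e, he, hp, θ, hθ⟩ := exists_reduced_chart hg hD p
  obtain ⟨U, hU, hpU, hUc⟩ := exists_ball hp
  have hgU := hg.isPKEOn he hU
  have hθU : IsReducedCoframeOn U (localMetric g e) (localEndo K e) θ := hθ.mono hU
  have hT := hθU.typeDFrame hgU
  have hn := hθU.isAdaptedOn.null
  obtain ⟨s, hs⟩ := hn.exists_eq_algebraMap hUc hT.der_scal
  have hs' (z) (hz : z ∈ U) : -scalarCurv (localMetric g e) z / 12 = s := by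
    rw [← hθU.isAdaptedOn.ev_scalSm hgU ⟨z, hz⟩, hs, ev_algebraMap]
  have hc : psiSm U (localMetric g e) θ ^ 2
      = algebraMap ℝ _ (psi2 (localMetric g e) θ (e p) ^ 2) := Sm.ext fun z => by
    rw [map_pow, hθU.isAdaptedOn.ev_psiSm hgU, ev_algebraMap]
    exact hH.psi2_sq_eq hg he hp hθ hU hpU hs' z.2
  obtain ⟨m, hm⟩ := hT.unit.exists_right_inv
  have hφ (i : Fin 4) : dF U θ i (psiSm U (localMetric g e) θ) = 0 := by
    have h0 : dF U θ i (psiSm U (localMetric g e) θ ^ 2) = 0 := by rw [hc, der_algebraMap]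
    rw [Derivation.leibniz_pow] at h0
    refine eq_zero_of_natCast_mul 2 hT.unit ?_
    simpa [mul_assoc] using h0
  have h2 : cG U (localMetric g e) θ 1 0 2 = 0 := by
    have h1 : 0 = 3 * psiSm U (localMetric g e) θ * cG U (localMetric g e) θ 1 0 2 :=
      (hφ 3).symm.trans (hT.der_psi 3)
    exact eq_zero_of_natCast_mul 3 hT.unit (by push_cast; linear_combination -h1)
  have h4 : cG U (localMetric g e) θ 0 1 3 = 0 := by
    have h1 : 0 = 3 * psiSm U (localMetric g e) θ * cG U (localMetric g e) θ 0 1 3 :=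
      (hφ 2).symm.trans (hT.der_psi 2)
    exact eq_zero_of_natCast_mul 3 hT.unit (by push_cast; linear_combination -h1)
  refine ⟨_, restr_target_mem_maximalAtlas he U, ⟨hp, hpU⟩, θ, hθ.mono fun _ h => h.1,
    fun y hy => ⟨?_, ?_⟩⟩
  · exact (hn.ev_cG ⟨y, hy.2⟩ 1 0 2).symm.trans (by rw [h2, map_zero])
  · exact (hn.ev_cG ⟨y, hy.2⟩ 0 1 3).symm.trans (by rw [h4, map_zero])

end Homogeneous

end ParaKaehler

end

open ParaKaehler in
theorem mainTheorem3 :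
    (∀ (M : Type*) [TopologicalSpace M] [ChartedSpace E4 M] [IsManifold (𝓡 4) ∞ M]
      (g : ∀ x : M, TangentSpace (𝓡 4) x →L[ℝ] TangentSpace (𝓡 4) x →L[ℝ] ℝ)
      (K : ∀ x : M, TangentSpace (𝓡 4) x →L[ℝ] TangentSpace (𝓡 4) x),
      IsPKE g K → HasNonzeroScal g → IsRealTypeD g K →
      -- reduced coframes exist near every point
      (∀ p : M, ∃ e ∈ IsManifold.maximalAtlas (𝓡 4) ∞ M, p ∈ e.source ∧
        ∃ θ : FormQuad, IsReducedCoframeOn e.target (localMetric g e) (localEndo K e) θ) ∧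
      -- in every reduced coframe, `Γ²₁ = J₁ θ² + J₂ θ³` and `Γ¹₂ = - J₃ θ¹ + J₄ θ⁴`
      (∀ e ∈ IsManifold.maximalAtlas (𝓡 4) ∞ M, ∀ θ : FormQuad,
        IsReducedCoframeOn e.target (localMetric g e) (localEndo K e) θ →
        ∀ y ∈ e.target, ∀ X : E4,
          connForm (localMetric g e) θ 1 0 y X
            = J1 (localMetric g e) θ y * θ y 1 X + J2 (localMetric g e) θ y * θ y 2 X ∧
          connForm (localMetric g e) θ 0 1 y X
            = - J3 (localMetric g e) θ y * θ y 0 X + J4 (localMetric g e) θ y * θ y 3 X) ∧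
      -- `J₂` and `J₄` are independent of the reduced coframe up to non-zero factors and order
      (∀ e ∈ IsManifold.maximalAtlas (𝓡 4) ∞ M, ∀ θ θ' : FormQuad,
        IsReducedCoframeOn e.target (localMetric g e) (localEndo K e) θ →
        IsReducedCoframeOn e.target (localMetric g e) (localEndo K e) θ' →
        ∀ y ∈ e.target, ∃ a b : ℝ, a ≠ 0 ∧ b ≠ 0 ∧
          ((J2 (localMetric g e) θ' y = a * J2 (localMetric g e) θ y ∧
              J4 (localMetric g e) θ' y = b * J4 (localMetric g e) θ y) ∨
            (J2 (localMetric g e) θ' y = a * J4 (localMetric g e) θ y ∧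
              J4 (localMetric g e) θ' y = b * J2 (localMetric g e) θ y))) ∧
      -- every open set contains smaller ones that belong to one of the four branches
      IsOpen (branch₁ g K ∪ branch₂ g K ∪ branch₃ g K ∪ branch₄ g K) ∧
      Dense (branch₁ g K ∪ branch₂ g K ∪ branch₃ g K ∪ branch₄ g K) ∧
      -- the normal form of each branch
      (∀ p ∈ branch₁ g K, ∃ k₁ k₂ k₃ k₄ s : ℝ, k₄ ≠ 0 ∧ s ≠ 0 ∧
        HasNormalFormAt g K p domainNe (genericCoframe k₁ k₂ k₃ k₄ s) s 1 1) ∧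
      (∀ p ∈ branch₂ g K, ∃ k₁ k₂ s : ℝ, k₁ ≠ 0 ∧ s ≠ 0 ∧
        HasNormalFormAt g K p domainNe (specialCoframe k₁ k₂ s) s 1 0) ∧
      (∀ p ∈ branch₃ g K, ∃ k₁ k₂ s : ℝ, k₁ ≠ 0 ∧ s ≠ 0 ∧
        HasNormalFormAt g K p domainNe (swapCoframe (specialCoframe k₁ k₂ s)) s 0 1) ∧
      (∀ p ∈ branch₄ g K, ∃ s : ℝ, s ≠ 0 ∧
        HasNormalFormAt g K p (domainHom s) (homogeneousCoframe s) s 0 0) ∧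
      -- the fourth branch consists of the homogeneous metrics, and there are no others
      (ConnectedSpace M → (∀ p : M, p ∈ branch₄ g K) → IsHomogeneousPair g K) ∧
      (IsHomogeneousMetric g → ∀ p : M, p ∈ branch₄ g K)) ∧
    -- conversely, all members of the four families occur
    (∀ k₁ k₂ k₃ k₄ s : ℝ, k₄ ≠ 0 → s ≠ 0 →
      IsModel domainNe (genericCoframe k₁ k₂ k₃ k₄ s) s 1 1) ∧
    (∀ k₁ k₂ s : ℝ, k₁ ≠ 0 → s ≠ 0 → IsModel domainNe (specialCoframe k₁ k₂ s) s 1 0) ∧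
    (∀ k₁ k₂ s : ℝ, k₁ ≠ 0 → s ≠ 0 →
      IsModel domainNe (swapCoframe (specialCoframe k₁ k₂ s)) s 0 1) ∧
    (∀ s : ℝ, s ≠ 0 → IsModel (domainHom s) (homogeneousCoframe s) s 0 0) := by
  refine ⟨fun M _ _ _ g K hg hS hD => ⟨exists_reduced_chart hg hD,
    fun e he θ hθ y hy X => IsReducedCoframeOn.connForm_offdiag (U := ⟨e.target, e.open_target⟩) hθ (hg e he) ⟨y, hy⟩ X,
    fun e he θ θ' hθ hθ' y hy => IsReducedCoframeOn.J_eq (U := ⟨e.target, e.open_target⟩) hθ hθ' (hg e he) hy,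
    (((isOpen_branch _).union (isOpen_branch _)).union (isOpen_branch _)).union (isOpen_branch _),
    dense_branches hg hD, fun p hp => exists_normalForm_branch₁ hg hS hp,
    fun p hp => exists_normalForm_branch₂ hg hS hp, fun p hp => exists_normalForm_branch₃ hg hS hp,
    fun p hp => exists_normalForm_branch₄ hg hS hp,
    fun _ hB => isHomogeneousPair_of_branch₄ hg hS hB,
    fun hH p => mem_branch₄_of_isHomogeneousMetric hg hD hH p⟩,
    fun k₁ k₂ k₃ k₄ s hk _ => isModel_generic k₁ k₂ k₃ k₄ s hk,
    fun k₁ k₂ s hk _ => isModel_special k₁ k₂ s hk,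
    fun k₁ k₂ s hk _ => (isModel_special k₁ k₂ s hk).swap, fun s hs => isModel_homogeneous s hs⟩
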